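/- A Sasakian structure on a smooth manifold $S$ of odd dimension is a Riemannian metric $g$ on $S$ together with a Kähler structure $(J,\Omega)$ on the cone $C(S)=S\times\mathbb R_{>0}$ with metric $dt\otimes dt+t^2g$, such that the homotheties $h_\lambda(x,t)=(x,\lambda t)$ are holomorphic and $h_\lambda^*\Omega=\lambda^2\Omega$. Its Euler field is $R=t\,d/dt$; its Reeb field $\xi$ and its contact form $\eta$ are the restrictions to $S=S\times\{1\}$ of $JR$ and of $t^{-1}J\,dt$ (where $(J\,dt)(v)=-dt(Jv)$, so that $\eta(\xi)=1$). Let $S_1,S_2$ be compact Sasakian manifolds with Reeb fields $\xi_1,\xi_2$ and contact forms $\eta_1,\eta_2$, and let $\alpha\in\mathbb C$ with $\operatorname{Im}\alpha\neq0$. Let $z=x+iy\in\mathbb C$ act on each cone $C(S_i)$ by the flow at time one of $xR_i+yJ_iR_i$, and let $G_\alpha=\{(z,\alpha z):z\in\mathbb C\}$ act on $C(S_1)\times C(S_2)$. Every $G_\alpha$-orbit meets $\{t_1=t_2=1\}$ in exactly one point, which identifies the quotient with $M=S_1\times S_2$; endow $M$ with the complex structure for which the projection $\pi:C(S_1)\times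 C(S_2)\to M$ is a holomorphic submersion. Put $\eta=\eta_1+\eta_2$ (pulled back to $M$), let $\eta^{0,1}$ be its $(0,1)$-part, and let $\omega_0=d\eta$. Let $(\Lambda^{p,q}(M))^{\mathrm{inv}}$ be the space of smooth complex $(p,q)$-forms $\beta$ on $M$ with $\mathcal L_{\xi_1}\beta=\mathcal L_{\xi_2}\beta=0$, let $\Lambda^{p,q}_{\mathrm{bas}}$ be the space of smooth $(p,q)$-forms with $i_X\beta=0$ and $\mathcal L_X\beta=0$ for every smooth vector field $X$ tangent to the foliation spanned by $\xi_1,\xi_2$, and let $$\Lambda^{p,q}_{B,\eta^{0,1}}=\Lambda^{p,q}_{\mathrm{bas}}\oplus\left(\eta^{0,1}\wedge\Lambda^{p,q-1}_{\mathrm{bas}}\right);$$ all these spaces are $0$ if $p<0$ or $q<0$. Then, for every integer $p\ge0$, $((\Lambda^{p,*}(M))^{\mathrm{inv}},\bar\partial)$, $(\Lambda^{p-1,*}_{B,\eta^{0,1}},\bar\partial)$ and $(\Lambda^{p,*+1}_{B,\eta^{0,1}},\bar\partial)$ are cochain complexes of complex vector spaces, the wedge product with $\omega_0$ is a morphism of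 complexes $$L_{\omega_0}:(\Lambda^{p-1,*}_{B,\eta^{0,1}},\bar\partial)\longrightarrow(\Lambda^{p,*+1}_{B,\eta^{0,1}},\bar\partial),$$ and the complex $((\Lambda^{p,*}(M))^{\mathrm{inv}},\bar\partial)$ is isomorphic to the shifted cone $C(L_{\omega_0})[-1]$. Here the cone of a morphism $f:C\to D$ of cochain complexes is $C(f)^i=C^{i+1}\oplus D^i$ with differential $(c,d)\mapsto(d_Cc,\;f(c)-d_Dd)$. -/

import Mathlib

open scoped Manifold ContDiff Bundle
open CategoryTheory

noncomputable section

namespace SasakiProduct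

/-! ### Differential forms on a manifold -/

section Forms

variable {E : Type*} [NormedAddCommGroup E] [NormedSpace ℝ E]
  {H : Type*} [TopologicalSpace H] (I : ModelWithCorners ℝ E H)
  (M : Type*) [TopologicalSpace M] [ChartedSpace H M]
  (F : Type*) [NormedAddCommGroup F] [NormedSpace ℝ F]

/-- `F`-valued exterior forms on `M` of mixed degree: a form has a component in each degree `k`,
which assigns to each `x` an alternating `k`-linear map on `T_x M`. No regularity is imposed here;
see `IsSmooth`. -/
abbrev ExtForm : Type _ := ∀ (k : ℕ) (x : M), TangentSpace I x [⋀^Fin k]→L[ℝ] F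

/-- Vector fields on `M`, without regularity; see `IsSmoothField`. -/
abbrev VField : Type _ := ∀ x : M, TangentSpace I x

variable {I M F}

/-- Smoothness of a vector field, as a section of the tangent bundle. -/
def IsSmoothField [IsManifold I ∞ M] (X : VField I M) : Prop :=
  ContMDiff I I.tangent ∞ (fun x => (⟨x, X x⟩ : TangentBundle I M))

/-- The expression of a `k`-form in the preferred chart at `x₀`: its pullback under the inverse of
the chart. -/
def inChart {k : ℕ} (β : ∀ x : M, TangentSpace I x [⋀^Fin k]→L[ℝ] F) (x₀ : M) :
    E → E [⋀^Fin k]→L[ℝ] F :=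
  fun y => (β ((extChartAt I x₀).symm y)).compContinuousLinearMap
    (mfderivWithin 𝓘(ℝ, E) I (extChartAt I x₀).symm (Set.range I) y)

/-- A form is smooth if its expressions in the charts are smooth. -/
def IsSmooth (β : ExtForm I M F) : Prop :=
  ∀ (k : ℕ) (x₀ : M), ContDiffOn ℝ ∞ (inChart (β k) x₀) (extChartAt I x₀).target

/-- The exterior derivative, computed at `x` in the preferred chart at `x`. -/
def extD (β : ExtForm I M F) : ExtForm I M F
  | 0 => 0
  | k + 1 => fun x =>
      (extDerivWithin (inChart (β k) x) (Set.range I) (extChartAt I x x)).compContinuousLinearMap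
        (mfderiv I 𝓘(ℝ, E) (extChartAt I x) x)

/-- The contraction `i_X β = β(X, ·, …, ·)`. -/
def contract (X : VField I M) (β : ExtForm I M F) : ExtForm I M F :=
  fun k x => ContinuousAlternatingMap.curryLeft (E := E) (β (k + 1) x) (X x)

/-- The Lie derivative `L_X = d i_X + i_X d`. -/
def lieD (X : VField I M) (β : ExtForm I M F) : ExtForm I M F :=
  extD (contract X β) + contract X (extD β)

/-- The form of pure degree one given by a field of linear functionals. -/
def oneForm (θ : ∀ x : M, TangentSpace I x →L[ℝ] F) : ExtForm I M F
  | 1 => fun x => ContinuousAlternatingMap.ofSubsingleton ℝ (TangentSpace I x) F (0 : Fin 1) (θ x)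
  | _ => 0

/-- The form of pure degree two given by a field of alternating bilinear maps. -/
def twoForm (θ : ∀ x : M, TangentSpace I x [⋀^Fin 2]→L[ℝ] F) : ExtForm I M F
  | 2 => θ
  | _ => 0

end Forms

/-! ### The wedge product -/

section Wedge

variable {V : Type*} [AddCommGroup V] [Module ℝ V] [TopologicalSpace V]

/-- The multilinear map `v ↦ a(v_1, …, v_k) b(v_{k+1}, …, v_{k+l})`. -/
def altMul {k l : ℕ} (a : V [⋀^Fin k]→L[ℝ] ℂ) (b : V [⋀^Fin l]→L[ℝ] ℂ) :
    ContinuousMultilinearMap ℝ (fun _ : Fin (k + l) => V) ℂ where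
  toFun v := a (v ∘ Fin.castAdd l) * b (v ∘ Fin.natAdd k)
  map_update_add' v i x y := by
    have h : ‹DecidableEq (Fin (k + l))› = instDecidableEqFin _ := Subsingleton.elim _ _
    subst h
    refine Fin.addCases (fun i => ?_) (fun i => ?_) i
    · have h (x : V) : Function.update v (Fin.castAdd l i) x ∘ Fin.castAdd l =
          Function.update (v ∘ Fin.castAdd l) i x :=
        Function.update_comp_eq_of_injective _ (Fin.castAdd_injective k l) _ _
      have h' (x : V) : Function.update v (Fin.castAdd l i) x ∘ Fin.natAdd k = v ∘ Fin.natAdd k :=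
        Function.update_comp_eq_of_forall_ne _ _ fun j hj => by
          have := congrArg Fin.val hj; simp at this; omega
      simp only [h, h', a.map_update_add, add_mul]
    · have h (x : V) : Function.update v (Fin.natAdd k i) x ∘ Fin.natAdd k =
          Function.update (v ∘ Fin.natAdd k) i x :=
        Function.update_comp_eq_of_injective _ (Fin.natAdd_injective l k) _ _
      have h' (x : V) : Function.update v (Fin.natAdd k i) x ∘ Fin.castAdd l = v ∘ Fin.castAdd l :=
        Function.update_comp_eq_of_forall_ne _ _ fun j hj => by
          have := congrArg Fin.val hj; simp at this; omega
      simp only [h, h', b.map_update_add, mul_add]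
  map_update_smul' v i c x := by
    have h : ‹DecidableEq (Fin (k + l))› = instDecidableEqFin _ := Subsingleton.elim _ _
    subst h
    refine Fin.addCases (fun i => ?_) (fun i => ?_) i
    · have h (x : V) : Function.update v (Fin.castAdd l i) x ∘ Fin.castAdd l =
          Function.update (v ∘ Fin.castAdd l) i x :=
        Function.update_comp_eq_of_injective _ (Fin.castAdd_injective k l) _ _
      have h' (x : V) : Function.update v (Fin.castAdd l i) x ∘ Fin.natAdd k = v ∘ Fin.natAdd k :=
        Function.update_comp_eq_of_forall_ne _ _ fun j hj => by
          have := congrArg Fin.val hj; simp at this; omega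
      simp only [h, h', a.map_update_smul, smul_mul_assoc]
    · have h (x : V) : Function.update v (Fin.natAdd k i) x ∘ Fin.natAdd k =
          Function.update (v ∘ Fin.natAdd k) i x :=
        Function.update_comp_eq_of_injective _ (Fin.natAdd_injective l k) _ _
      have h' (x : V) : Function.update v (Fin.natAdd k i) x ∘ Fin.castAdd l = v ∘ Fin.castAdd l :=
        Function.update_comp_eq_of_forall_ne _ _ fun j hj => by
          have := congrArg Fin.val hj; simp at this; omega
      simp only [h, h', b.map_update_smul, mul_smul_comm]
  cont := (a.cont.comp (by fun_prop)).mul (b.cont.comp (by fun_prop))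

/-- The wedge product of complex valued alternating maps, where `n = k + l`:
`(a ∧ b)(v) = 1 / (k! l!) ∑_σ sign(σ) a(v_{σ 1}, …, v_{σ k}) b(v_{σ (k+1)}, …, v_{σ n})`,
the sum being over all permutations `σ` of the `n` indices. -/
def altWedge {k l n : ℕ} (h : k + l = n) (a : V [⋀^Fin k]→L[ℝ] ℂ) (b : V [⋀^Fin l]→L[ℝ] ℂ) :
    V [⋀^Fin n]→L[ℝ] ℂ :=
  ((k.factorial * l.factorial : ℂ)⁻¹) • ((altMul a b).domDomCongr (finCongr h)).alternatization

end Wedge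
section ComplexForms

variable {E : Type*} [NormedAddCommGroup E] [NormedSpace ℝ E]
  {H : Type*} [TopologicalSpace H] {I : ModelWithCorners ℝ E H}
  {M : Type*} [TopologicalSpace M] [ChartedSpace H M]

/-- The wedge product of forms of mixed degree. -/
def wedge (α β : ExtForm I M ℂ) : ExtForm I M ℂ :=
  fun k x => ∑ i : Fin (k + 1),
    altWedge (Nat.add_sub_of_le (Nat.le_of_lt_succ i.isLt)) (α i x) (β (k - i) x)

/-! ### Bidegrees and the Dolbeault operator of an almost complex structure -/

/-- A field of endomorphisms of the tangent spaces. -/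
abbrev EndField (I : ModelWithCorners ℝ E H) (M : Type*) [TopologicalSpace M]
    [ChartedSpace H M] : Type _ := ∀ x : M, TangentSpace I x →L[ℝ] TangentSpace I x

/-- Multiplication of tangent vectors at `x` by the complex number `z = a + b i`, i.e. `a + b J`. -/
def cmul (J : EndField I M) (z : ℂ) (x : M) : TangentSpace I x →L[ℝ] TangentSpace I x :=
  z.re • ContinuousLinearMap.id ℝ (TangentSpace I x) + z.im • J x

/-- The pullback of a form under multiplication by `z`: `v ↦ β(z v_1, …, z v_k)`. -/
def cpull (J : EndField I M) (z : ℂ) (β : ExtForm I M ℂ) : ExtForm I M ℂ :=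
  fun k x => (β k x).compContinuousLinearMap (cmul J z x)

/-- `β` is of type `(p, q)` with respect to `J`: it is of pure degree `p + q` and
`β(z v_1, …, z v_{p+q}) = z ^ p * conj z ^ q * β(v_1, …, v_{p+q})` for all complex `z`.
There are no nonzero forms of type `(p, q)` if `p` or `q` is negative. -/
structure IsType (J : EndField I M) (p q : ℤ) (β : ExtForm I M ℂ) : Prop where
  eq_zero_of_neg : p < 0 ∨ q < 0 → β = 0
  degree : ∀ k : ℕ, (k : ℤ) ≠ p + q → β k = 0
  weight : ∀ z : ℂ, cpull J z β = (z ^ p * (starRingEnd ℂ z) ^ q) • β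

/-- The space `Λ^{p,q}` of smooth complex forms of type `(p, q)`. -/
def pqForms (J : EndField I M) (p q : ℤ) : Set (ExtForm I M ℂ) :=
  {β | IsSmooth β ∧ IsType J p q β}

/-- The projection to the component of type `(p, q)`. On the forms of degree `k`, the roots of unity
`z` of order `2 k + 1` act on the component of type `(r, s)` through the character
`z ^ (r - s)`, and these characters are distinct for distinct `(r, s)` with `r + s = k`; so the
component is found by averaging. -/
def typeProj (J : EndField I M) (p q : ℤ) (β : ExtForm I M ℂ) : ExtForm I M ℂ :=
  fun k x => if 0 ≤ p ∧ 0 ≤ q ∧ (k : ℤ) = p + q then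
    ((2 * k + 1 : ℕ) : ℂ)⁻¹ • ∑ j ∈ Finset.range (2 * k + 1),
      (Complex.exp (2 * Real.pi * Complex.I / (2 * k + 1 : ℕ)) ^ j) ^ (q - p) •
        cpull J (Complex.exp (2 * Real.pi * Complex.I / (2 * k + 1 : ℕ)) ^ j) β k x
    else 0

/-- `typeProj` is the identity on forms of type `(p, q)` and kills the forms of any other type. -/
theorem typeProj_of_isType {J : EndField I M} {r s p q : ℤ} {β : ExtForm I M ℂ}
    (h : IsType J r s β) : typeProj J p q β = if p = r ∧ q = s then β else 0 := by
  by_cases hβ : β = 0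
  · subst hβ
    funext k x
    have : (if p = r ∧ q = s then (0 : ExtForm I M ℂ) else 0) = 0 := by simp
    rw [this]
    unfold typeProj
    split_ifs with hc
    · ext v
      simp [cpull]
    · rfl
  have hr : 0 ≤ r := by
    by_contra h'
    exact hβ (h.eq_zero_of_neg (Or.inl (by omega)))
  have hs : 0 ≤ s := by
    by_contra h'
    exact hβ (h.eq_zero_of_neg (Or.inr (by omega)))
  funext k x
  by_cases hk : (k : ℤ) = r + s
  swap
  · have h0 : β k = 0 := h.degree k hk
    have h1 : (if p = r ∧ q = s then β else 0) k x = 0 := by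
      split_ifs
      · rw [h0]; rfl
      · rfl
    rw [h1]
    unfold typeProj
    split_ifs with hc
    · ext v
      simp [cpull, h0]
    · rfl
  by_cases hc : 0 ≤ p ∧ 0 ≤ q ∧ (k : ℤ) = p + q
  swap
  · have h1 : ¬ (p = r ∧ q = s) := fun h' => hc ⟨by omega, by omega, by omega⟩
    rw [if_neg h1]
    unfold typeProj
    rw [if_neg hc]
    rfl
  unfold typeProj
  rw [if_pos hc]
  have hN : (2 * k + 1 : ℕ) ≠ 0 := by omega
  have hζ := Complex.isPrimitiveRoot_exp (2 * k + 1) hN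
  set ζ := Complex.exp (2 * Real.pi * Complex.I / (2 * k + 1 : ℕ)) with hζ'
  have hζ0 : ζ ≠ 0 := Complex.exp_ne_zero _
  have hconj : starRingEnd ℂ ζ = ζ⁻¹ := by
    rw [Complex.inv_def, Complex.normSq_eq_norm_sq,
      hζ.norm'_eq_one hN]
    simp
  have hsum : (∑ j ∈ Finset.range (2 * k + 1), (ζ ^ j) ^ (q - p) • cpull J (ζ ^ j) β k x) =
      (∑ j ∈ Finset.range (2 * k + 1), (ζ ^ (2 * (r - p))) ^ j) • β k x := by
    rw [Finset.sum_smul]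
    refine Finset.sum_congr rfl fun j _ => ?_
    rw [h.weight (ζ ^ j), Pi.smul_apply, Pi.smul_apply, smul_smul, map_pow, hconj]
    congr 1
    rw [← zpow_natCast ζ j, ← zpow_natCast ζ⁻¹ j, inv_zpow, ← zpow_neg, ← zpow_natCast, ← zpow_mul,
      ← zpow_mul, ← zpow_mul, ← zpow_mul, ← zpow_add₀ hζ0, ← zpow_add₀ hζ0]
    congr 1
    have : s = p + q - r := by omega
    subst this
    ring
  rw [hsum]
  by_cases hpr : p = r
  · have : q = s := by omega
    rw [if_pos ⟨hpr, this⟩]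
    subst hpr
    rw [sub_self, mul_zero, zpow_zero]
    simp only [one_pow, Finset.sum_const, Finset.card_range, nsmul_eq_mul, mul_one, smul_smul]
    rw [inv_mul_cancel₀ (by exact_mod_cast hN), one_smul]
  · rw [if_neg fun h' => hpr h'.1]
    have h1 : ζ ^ (2 * (r - p)) ≠ 1 := by
      intro h1
      obtain ⟨c, hc'⟩ := (hζ.zpow_eq_one_iff_dvd _).1 h1
      push_cast at hc'
      have hlt : |2 * (r - p)| < 2 * k + 1 := by
        rw [abs_lt]; constructor <;> omega
      have : 2 * (r - p) = 0 := Int.eq_zero_of_abs_lt_dvd ⟨c, hc'⟩ hlt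
      omega
    have h2 : (ζ ^ (2 * (r - p))) ^ (2 * k + 1) = 1 := by
      rw [← zpow_natCast, ← zpow_mul, mul_comm, zpow_mul, zpow_natCast, hζ.pow_eq_one, one_zpow]
    rw [geom_sum_eq h1, h2]
    simp

/-- The operator `∂̄` on forms of type `(p, q)`: the component of type `(p, q + 1)` of the exterior
derivative. -/
def dbar (J : EndField I M) (p q : ℤ) (β : ExtForm I M ℂ) : ExtForm I M ℂ :=
  typeProj J p (q + 1) (extD β)

end ComplexForms

/-! ### Sasakian manifolds -/

section Sasakian

/-- The positive real numbers, as an open submanifold of `ℝ`. -/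
abbrev PosReal : Type := (⟨Set.Ioi (0 : ℝ), isOpen_Ioi⟩ : TopologicalSpace.Opens ℝ)

/-- The positive real number `1`. -/
def posOne : PosReal := ⟨1, Set.mem_Ioi.2 one_pos⟩

/-- The underlying manifold `S × ℝ_{>0}` of the Riemannian cone. -/
abbrev Cone (S : Type*) : Type _ := S × PosReal

/-- The homothety `(p, t) ↦ (p, c t)` of the cone. -/
def homothety {S : Type*} (c : PosReal) (x : Cone S) : Cone S :=
  (x.1, ⟨c.1 * x.2.1, Set.mem_Ioi.2 (mul_pos (Set.mem_Ioi.1 c.2) (Set.mem_Ioi.1 x.2.2))⟩)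

variable {E : Type*} [NormedAddCommGroup E] [NormedSpace ℝ E]

/-- The model with corners of the cone over a manifold modelled on `E`. -/
abbrev coneModel (E : Type*) [NormedAddCommGroup E] [NormedSpace ℝ E] :
    ModelWithCorners ℝ (E × ℝ) (ModelProd E ℝ) := 𝓘(ℝ, E).prod 𝓘(ℝ, ℝ)

variable {S : Type*} [TopologicalSpace S] [ChartedSpace E S]

/-- The tangent vector `X + c d/dt` at the point `x` of the cone. -/
def coneVec (x : Cone S) (X : TangentSpace 𝓘(ℝ, E) x.1) (c : ℝ) :
    TangentSpace (coneModel E) x := ((X, c) : E × ℝ)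

/-- The component in `T_p S` of a tangent vector of the cone at `(p, t)`. -/
def tangPart (x : Cone S) (v : TangentSpace (coneModel E) x) : TangentSpace 𝓘(ℝ, E) x.1 :=
  (show E × ℝ from v).1

/-- The coefficient `dt(v)` of `d/dt` in a tangent vector of the cone at `(p, t)`. -/
def radPart (x : Cone S) (v : TangentSpace (coneModel E) x) : ℝ := (show E × ℝ from v).2

variable [IsManifold 𝓘(ℝ, E) ∞ S]

/-- The cone metric `dt ⊗ dt + t² g`. -/
def coneMetric
    (g : Bundle.ContMDiffRiemannianMetric 𝓘(ℝ, E) ∞ E (fun p : S => TangentSpace 𝓘(ℝ, E) p))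
    (x : Cone S) (v w : TangentSpace (coneModel E) x) : ℝ :=
  radPart x v * radPart x w + (x.2 : ℝ) ^ 2 * g.inner x.1 (tangPart x v) (tangPart x w)

variable (E S) in
/-- A Sasakian structure on `S`: a Riemannian metric `g` on `S` and a Kähler structure `(J, Ω)` on
the cone, with respect to the cone metric, such that the homotheties `h` are holomorphic and
`h^* Ω = c² Ω` for the homothety of ratio `c`. -/
structure SasakianStructure where
  /-- The Riemannian metric on `S`. -/
  g : Bundle.ContMDiffRiemannianMetric 𝓘(ℝ, E) ∞ E (fun p : S => TangentSpace 𝓘(ℝ, E) p)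
  /-- The complex structure on the cone. -/
  J : EndField (coneModel E) (Cone S)
  /-- The Kähler form on the cone. -/
  Ω : ∀ x : Cone S, TangentSpace (coneModel E) x [⋀^Fin 2]→L[ℝ] ℝ
  smooth_J : ContMDiff (coneModel E) ((coneModel E).prod 𝓘(ℝ, (E × ℝ) →L[ℝ] (E × ℝ))) ∞
    (fun x => Bundle.TotalSpace.mk' ((E × ℝ) →L[ℝ] (E × ℝ))
      (E := fun x : Cone S =>
        TangentSpace (coneModel E) x →L[ℝ] TangentSpace (coneModel E) x) x (J x))
  J_J : ∀ x v, J x (J x v) = -v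
  /-- The Nijenhuis tensor of `J` vanishes. -/
  integrable : ∀ X Y : VField (coneModel E) (Cone S), IsSmoothField X → IsSmoothField Y → ∀ x,
    VectorField.mlieBracket (coneModel E) (fun x => J x (X x)) (fun x => J x (Y x)) x
      - J x (VectorField.mlieBracket (coneModel E) (fun x => J x (X x)) Y x)
      - J x (VectorField.mlieBracket (coneModel E) X (fun x => J x (Y x)) x)
      - VectorField.mlieBracket (coneModel E) X Y x = 0
  hermitian : ∀ x v w, coneMetric g x (J x v) (J x w) = coneMetric g x v w
  Ω_apply : ∀ x v w, Ω x ![v, w] = coneMetric g x (J x v) w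
  closed : extD (twoForm Ω) = 0
  homothety_holomorphic : ∀ (c : PosReal) (x : Cone S) (v : TangentSpace (coneModel E) x),
    mfderiv (coneModel E) (coneModel E) (homothety c) x (J x v) =
      J (homothety c x) (mfderiv (coneModel E) (coneModel E) (homothety c) x v)
  homothety_Ω : ∀ (c : PosReal) (x : Cone S),
    (Ω (homothety c x)).compContinuousLinearMap
      (mfderiv (coneModel E) (coneModel E) (homothety c) x) = (c : ℝ) ^ 2 • Ω x

namespace SasakianStructure

variable (𝒮 : SasakianStructure E S)

/-- The Euler field `R = t d/dt` on the cone. -/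
def euler (x : Cone S) : TangentSpace (coneModel E) x := coneVec x 0 (x.2 : ℝ)

/-- The Reeb field `ξ` on `S`: the restriction of `J R` to `S = S × {1}`, to which it is tangent. -/
def reeb : VField 𝓘(ℝ, E) S :=
  fun p => tangPart (p, posOne) (𝒮.J (p, posOne) (euler (p, posOne)))

/-- The contact form `η` on `S`: the restriction of `t⁻¹ J dt` to `S = S × {1}`, where
`(J dt)(v) = - dt(J v)`, so that `η(ξ) = 1`. -/
def contact (p : S) : TangentSpace 𝓘(ℝ, E) p →L[ℝ] ℝ :=
  -((ContinuousLinearMap.snd ℝ E ℝ).comp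
    ((show (E × ℝ) →L[ℝ] (E × ℝ) from 𝒮.J (p, posOne)).comp (ContinuousLinearMap.inl ℝ E ℝ)))

end SasakianStructure

end Sasakian

/-! ### The product of two Sasakian manifolds -/

section Product

/-- The flow at time `s` of a vector field: `flow X s p = γ s` for the integral curve `γ` of `X`,
defined on all of `ℝ`, with `γ 0 = p`. (The value is `p` if there is no such curve.) -/
def flow {E : Type*} [NormedAddCommGroup E] [NormedSpace ℝ E] {H : Type*} [TopologicalSpace H]
    {I : ModelWithCorners ℝ E H} {M : Type*} [TopologicalSpace M] [ChartedSpace H M]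
    (X : VField I M) (s : ℝ) (p : M) : M :=
  open Classical in
  if h : ∃ γ : ℝ → M, γ 0 = p ∧ IsMIntegralCurve γ X then h.choose s else p

variable {E₁ : Type*} [NormedAddCommGroup E₁] [NormedSpace ℝ E₁]
  {S₁ : Type*} [TopologicalSpace S₁] [ChartedSpace E₁ S₁] [IsManifold 𝓘(ℝ, E₁) ∞ S₁]
  {E₂ : Type*} [NormedAddCommGroup E₂] [NormedSpace ℝ E₂]
  {S₂ : Type*} [TopologicalSpace S₂] [ChartedSpace E₂ S₂] [IsManifold 𝓘(ℝ, E₂) ∞ S₂]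

/-- The model with corners of `S₁ × S₂`. -/
abbrev prodModel (E₁ E₂ : Type*) [NormedAddCommGroup E₁] [NormedSpace ℝ E₁]
    [NormedAddCommGroup E₂] [NormedSpace ℝ E₂] :
    ModelWithCorners ℝ (E₁ × E₂) (ModelProd E₁ E₂) := 𝓘(ℝ, E₁).prod 𝓘(ℝ, E₂)

/-- The complex number `v(t₁, t₂)` for which `(v, a v)`, acting on `C(S₁) × C(S₂)`, moves a point
with radial coordinates `t₁, t₂` to a point with radial coordinates `1, 1`. -/
def orbitTime (a : ℂ) (t₁ t₂ : ℝ) : ℂ :=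
  -(Real.log t₁ : ℂ) + Complex.I / (a.im : ℂ) * (-(a.re : ℂ) * Real.log t₁ + Real.log t₂)

/-- The projection `π` of `C(S₁) × C(S₂)` to its quotient by the group `G_a = {(v, a v) : v ∈ ℂ}`,
identified with `S₁ × S₂`. Here `v = x + i y` acts on a cone by the flow at time one of
`x R + y ξ`, and every orbit is represented by its point with radial coordinates `1, 1`. -/
def quotProj (𝒮₁ : SasakianStructure E₁ S₁) (𝒮₂ : SasakianStructure E₂ S₂) (a : ℂ)
    (x : Cone S₁ × Cone S₂) : S₁ × S₂ :=
  (flow 𝒮₁.reeb (orbitTime a x.1.2 x.2.2).im x.1.1,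
    flow 𝒮₂.reeb (a * orbitTime a x.1.2 x.2.2).im x.2.1)

/-- The section `(p₁, p₂) ↦ ((p₁, 1), (p₂, 1))` of `quotProj`. -/
def slice (m : S₁ × S₂) : Cone S₁ × Cone S₂ := ((m.1, posOne), (m.2, posOne))

/-- The complex structure on `C(S₁) × C(S₂)`. -/
def prodJ (𝒮₁ : SasakianStructure E₁ S₁) (𝒮₂ : SasakianStructure E₂ S₂) :
    EndField ((coneModel E₁).prod (coneModel E₂)) (Cone S₁ × Cone S₂) :=
  fun x => (show (E₁ × ℝ) →L[ℝ] (E₁ × ℝ) from 𝒮₁.J x.1).prodMap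
    (show (E₂ × ℝ) →L[ℝ] (E₂ × ℝ) from 𝒮₂.J x.2)

/-- The complex structure on `S₁ × S₂` for which the projection `π = quotProj` is a holomorphic
submersion. Since `σ = slice` is a section of `π`, it is `dπ ∘ J ∘ dσ`. -/
def quotJ (𝒮₁ : SasakianStructure E₁ S₁) (𝒮₂ : SasakianStructure E₂ S₂) (a : ℂ) :
    EndField (prodModel E₁ E₂) (S₁ × S₂) :=
  fun m => ((show (E₁ × ℝ) × (E₂ × ℝ) →L[ℝ] E₁ × E₂ from
      mfderiv ((coneModel E₁).prod (coneModel E₂)) (prodModel E₁ E₂) (quotProj 𝒮₁ 𝒮₂ a)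
        (slice m)).comp (prodJ 𝒮₁ 𝒮₂ (slice m))).comp
    (mfderiv (prodModel E₁ E₂) ((coneModel E₁).prod (coneModel E₂)) slice m)

/-- The Reeb field of `S₁`, as a vector field on `S₁ × S₂`. -/
def reebLeft (𝒮₁ : SasakianStructure E₁ S₁) : VField (prodModel E₁ E₂) (S₁ × S₂) :=
  fun m => ((𝒮₁.reeb m.1, 0) : E₁ × E₂)

/-- The Reeb field of `S₂`, as a vector field on `S₁ × S₂`. -/
def reebRight (𝒮₂ : SasakianStructure E₂ S₂) : VField (prodModel E₁ E₂) (S₁ × S₂) :=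
  fun m => ((0, 𝒮₂.reeb m.2) : E₁ × E₂)

variable (𝒮₁ : SasakianStructure E₁ S₁) (𝒮₂ : SasakianStructure E₂ S₂)

/-- The form `η = η₁ + η₂` on `S₁ × S₂`, regarded as a complex valued form. -/
def sumContact : ExtForm (prodModel E₁ E₂) (S₁ × S₂) ℂ :=
  oneForm fun m => Complex.ofRealCLM.comp
    ((show E₁ →L[ℝ] ℝ from 𝒮₁.contact m.1).coprod (show E₂ →L[ℝ] ℝ from 𝒮₂.contact m.2))

/-- The form `ω₀ = dη`. -/
def omegaZero : ExtForm (prodModel E₁ E₂) (S₁ × S₂) ℂ := extD (sumContact 𝒮₁ 𝒮₂)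

/-- The Lefschetz operator `β ↦ ω₀ ∧ β`. -/
def lefschetz (β : ExtForm (prodModel E₁ E₂) (S₁ × S₂) ℂ) :
    ExtForm (prodModel E₁ E₂) (S₁ × S₂) ℂ := wedge (omegaZero 𝒮₁ 𝒮₂) β

/-- The forms invariant under the flows of the two Reeb fields, i.e. those with vanishing
Lie derivatives along these fields. -/
def IsInvariant (β : ExtForm (prodModel E₁ E₂) (S₁ × S₂) ℂ) : Prop :=
  lieD (reebLeft 𝒮₁) β = 0 ∧ lieD (reebRight 𝒮₂) β = 0

/-- The basic forms with respect to the foliation spanned by the two Reeb fields: `i_X β = 0` and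
`L_X β = 0` for all smooth vector fields `X` tangent to the foliation. -/
def IsBasic (β : ExtForm (prodModel E₁ E₂) (S₁ × S₂) ℂ) : Prop :=
  ∀ X : VField (prodModel E₁ E₂) (S₁ × S₂), IsSmoothField X →
    (∀ m, X m ∈ Submodule.span ℝ {reebLeft 𝒮₁ m, reebRight 𝒮₂ m}) →
    contract X β = 0 ∧ lieD X β = 0

/-- The space of invariant forms of type `(p, q)`. -/
def invForms (a : ℂ) (p q : ℤ) : Set (ExtForm (prodModel E₁ E₂) (S₁ × S₂) ℂ) :=
  {β | β ∈ pqForms (quotJ 𝒮₁ 𝒮₂ a) p q ∧ IsInvariant 𝒮₁ 𝒮₂ β}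

/-- The space of basic forms of type `(p, q)`. -/
def basForms (a : ℂ) (p q : ℤ) : Set (ExtForm (prodModel E₁ E₂) (S₁ × S₂) ℂ) :=
  {β | β ∈ pqForms (quotJ 𝒮₁ 𝒮₂ a) p q ∧ IsBasic 𝒮₁ 𝒮₂ β}

/-- The part `η^{0,1}` of type `(0, 1)` of `η`. -/
def etaZeroOne (a : ℂ) : ExtForm (prodModel E₁ E₂) (S₁ × S₂) ℂ :=
  typeProj (quotJ 𝒮₁ 𝒮₂ a) 0 1 (sumContact 𝒮₁ 𝒮₂)

/-- The space `Λ_{B, η^{0,1}}^{p,q} = Λ_bas^{p,q} ⊕ η^{0,1} ∧ Λ_bas^{p,q-1}`. -/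
def basEtaForms (a : ℂ) (p q : ℤ) : Set (ExtForm (prodModel E₁ E₂) (S₁ × S₂) ℂ) :=
  {β | ∃ β₀ ∈ basForms 𝒮₁ 𝒮₂ a p q, ∃ β₁ ∈ basForms 𝒮₁ 𝒮₂ a p (q - 1),
    β = β₀ + wedge (etaZeroOne 𝒮₁ 𝒮₂ a) β₁}

end Product

/-! ### Complexes and mapping cones -/

section Complexes

universe u

variable {V : Type u} [AddCommGroup V] [Module ℂ V]

/-- The subsets `C i` of `V`, with the maps `d i`, form a cochain complex: the `C i` are subspaces,
`d i` restricts to a linear map from `C i` to `C (i + 1)`, and the composites vanish. -/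
structure IsComplex (C : ℤ → Set V) (d : ℤ → V → V) : Prop where
  zero_mem : ∀ i, (0 : V) ∈ C i
  add_mem : ∀ i, ∀ x ∈ C i, ∀ y ∈ C i, x + y ∈ C i
  smul_mem : ∀ i, ∀ z : ℂ, ∀ x ∈ C i, z • x ∈ C i
  map_mem : ∀ i, ∀ x ∈ C i, d i x ∈ C (i + 1)
  map_add : ∀ i, ∀ x ∈ C i, ∀ y ∈ C i, d i (x + y) = d i x + d i y
  map_smul : ∀ i, ∀ z : ℂ, ∀ x ∈ C i, d i (z • x) = z • d i x
  map_map : ∀ i, ∀ x ∈ C i, d (i + 1) (d i x) = 0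

namespace IsComplex

variable {C : ℤ → Set V} {d : ℤ → V → V}

/-- The subspace in degree `i`. -/
def space (h : IsComplex C d) (i : ℤ) : Submodule ℂ V where
  carrier := C i
  zero_mem' := h.zero_mem i
  add_mem' hx hy := h.add_mem i _ hx _ hy
  smul_mem' z _ hx := h.smul_mem i z _ hx

/-- The differential in degree `i`. -/
def diff (h : IsComplex C d) (i : ℤ) : h.space i →ₗ[ℂ] h.space (i + 1) where
  toFun x := ⟨d i x, h.map_mem i x x.2⟩
  map_add' x y := Subtype.ext (h.map_add i x x.2 y y.2)
  map_smul' z x := Subtype.ext (h.map_smul i z x x.2)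

/-- The associated cochain complex of complex vector spaces. -/
def complex (h : IsComplex C d) : CochainComplex (ModuleCat.{u} ℂ) ℤ :=
  CochainComplex.of (fun i => ModuleCat.of ℂ (h.space i)) (fun i => ModuleCat.ofHom (h.diff i))
    (fun i => by
      ext x
      exact h.map_map i x x.2)

end IsComplex

/-- The map `f` restricts to a morphism between two complexes of subspaces of `V`. -/
structure IsComplexMap (C : ℤ → Set V) (d : ℤ → V → V) (C' : ℤ → Set V) (d' : ℤ → V → V)
    (f : V → V) : Prop where
  map_mem : ∀ i, ∀ x ∈ C i, f x ∈ C' i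
  map_add : ∀ i, ∀ x ∈ C i, ∀ y ∈ C i, f (x + y) = f x + f y
  map_smul : ∀ i, ∀ z : ℂ, ∀ x ∈ C i, f (z • x) = z • f x
  comm : ∀ i, ∀ x ∈ C i, d' i (f x) = f (d i x)

/-- The associated morphism of cochain complexes. -/
def IsComplexMap.hom {C C' : ℤ → Set V} {d d' : ℤ → V → V} {f : V → V}
    (hf : IsComplexMap C d C' d' f) (h : IsComplex C d) (h' : IsComplex C' d') :
    h.complex ⟶ h'.complex :=
  CochainComplex.ofHom
    (fun i => ModuleCat.ofHom
      { toFun := fun x : h.space i => (⟨f x, hf.map_mem i x x.2⟩ : h'.space i)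
        map_add' := fun x y => Subtype.ext (hf.map_add i x x.2 y y.2)
        map_smul' := fun z x => Subtype.ext (hf.map_smul i z x x.2) })
    (fun i => by
      simp only [IsComplex.complex, CochainComplex.of_d]
      ext x
      exact hf.comm i x x.2)

/-- The cone of a morphism `f` from `C` to `D`: it is `C^{i+1} ⊕ D^i` in degree `i`, with the
differential `(c, d) ↦ (d_C c, f c - d_D d)`. -/
def coneOf {C D : CochainComplex (ModuleCat.{u} ℂ) ℤ} (f : C ⟶ D) :
    CochainComplex (ModuleCat.{u} ℂ) ℤ :=
  CochainComplex.of (fun i => ModuleCat.of ℂ (C.X (i + 1) × D.X i))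
    (fun i => ModuleCat.ofHom
      (LinearMap.prod ((C.d (i + 1) (i + 1 + 1)).hom ∘ₗ LinearMap.fst ℂ _ _)
        ((f.f (i + 1)).hom ∘ₗ LinearMap.fst ℂ _ _ - (D.d i (i + 1)).hom ∘ₗ LinearMap.snd ℂ _ _)))
    (fun i => by
      have hC : C.d (i + 1) (i + 1 + 1) ≫ C.d (i + 1 + 1) (i + 1 + 1 + 1) = 0 := C.d_comp_d _ _ _
      have hD : D.d i (i + 1) ≫ D.d (i + 1) (i + 1 + 1) = 0 := D.d_comp_d _ _ _
      have hf := f.comm (i + 1) (i + 1 + 1)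
      apply ModuleCat.hom_ext
      refine LinearMap.ext fun x => ?_
      have h₁ := congrArg (fun g => g.hom x.1) hC
      have h₂ := congrArg (fun g => g.hom x.2) hD
      have h₃ := congrArg (fun g => g.hom x.1) hf
      refine Prod.ext h₁ ?_
      simp only [ModuleCat.hom_comp, LinearMap.comp_apply, ModuleCat.hom_zero,
        LinearMap.zero_apply] at h₂ h₃
      change (f.f (i + 1 + 1)).hom ((C.d (i + 1) (i + 1 + 1)).hom x.1) -
        (D.d (i + 1) (i + 1 + 1)).hom
          ((f.f (i + 1)).hom x.1 - (D.d i (i + 1)).hom x.2) = 0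
      rw [map_sub, h₂, h₃, sub_zero, sub_self])

end Complexes

end SasakiProduct

end

open SasakiProduct

/-!
Let `φ₁`, `φ₂` be the transverse complex structures of the two factors, extended by zero, and let
`a` be the parameter of the action. Differentiating the projection `π` along the slice
`t₁ = t₂ = 1` gives the complex structure of `M` (`endAt_quotJ`): it is `φ₁ + φ₂` on the contact
distributions, and on the span of `ξ₁`, `ξ₂` it is the constant complex structure for which
`θ = a η₁ - η₂` has type `(1, 0)`. Up to a constant `η^{0,1}` is the conjugate of `θ`
(`etaZeroOne_eq`). The integrability of the cones, read at `t = 1`, says that `φⱼ` and `ηⱼ` are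
invariant under the Reeb flow, that `dηⱼ` is horizontal of type `(1, 1)`, and that `φⱼ` is
integrable modulo `ξⱼ` (`frolicher_phi`).

Write a smooth invariant form with the help of the contractions dual to `θ` and `η^{0,1}`: it is
`d + θ ∧ c` for unique `c`, `d` in `Λ_{B, η^{0,1}}`. Because `dηⱼ` has type `(1, 1)`, one has
`∂̄η^{0,1} = 0` and `∂̄θ = a dη₁ - dη₂`. So invariant forms are the shifted cone of the product with
`a dη₁ - dη₂`, up to signs, and it remains to replace this form by `ω₀ = dη₁ + dη₂`. Let `Q` count
the factors of type `(1, 0)` in the contact distribution of the first factor. It is diagonalizable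
with natural eigenvalues, so that `Φ = (-a) ^ Q` makes sense (`twist`). The operator `Q` commutes
with `θ`, `η^{0,1}` and `dη₂`, it is raised by one by `dη₁`, and it commutes with `∂̄` on basic forms
(`bas_Q_del`), since the basic forms locally are the forms on a product of two complex manifolds,
the leaf spaces, and `∂̄` raises the antiholomorphic degree only. Hence
`(c, d) ↦ Φ (d + θ ∧ c)` is bijective (`Ψ_injective`, `Ψ_surjective`), and it carries the
differential of the shifted cone of `ω₀ ∧` to `∂̄` (`del_Ψ`).

The leaf spaces need not exist globally, and no local model of them is used. All of the above is
instead deduced from commutation relations between linear operators on smooth forms of mixed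
degree: `d`, contractions, products with `ηⱼ`, and insertions of fields of endomorphisms. They are
collected in `SasakiOps` and verified in `SasakiPair.ops`. Being of type `(p, q)` is the condition to
be a joint eigenvector of two operators `A` and `B` of this algebra (`isType_quotJ_iff`), and `∂̄` is
`[B, d]` on invariant forms (`dbar_quotJ`). The local integrability enters through the relations
between `d` and two insertions (`frolicher_op`), which is the vanishing of the Frölicher–Nijenhuis
brackets of the `φⱼ` modulo contractions with the Reeb fields. Identities between forms at a point
are proved by induction on the degree, since a form of positive degree is determined by its
contractions (`eq_succ_of_ctr`, `ctr_wedge`, `ctr_alt`).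
-/


noncomputable section

set_option linter.unusedSectionVars false

namespace SasakiProduct

/-! ### Alternating forms of mixed degree on a vector space -/

section MixedForms

open ContinuousAlternatingMap

variable {E : Type*} [NormedAddCommGroup E] [NormedSpace ℝ E]

/-- Complex valued alternating forms of mixed degree on a real vector space: the value at a point
of an `ExtForm`. -/
abbrev MixAlt (E : Type*) [NormedAddCommGroup E] [NormedSpace ℝ E] : Type _ :=
  ∀ k : ℕ, E [⋀^Fin k]→L[ℝ] ℂ

namespace MixAlt

/-- The contraction with a vector. -/
def ctr (v : E) (b : MixAlt E) : MixAlt E := fun k => (b (k + 1)).curryLeft v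

/-- The alternatization `∑ (-1)^i T(v_i)(…, v̂_i, …)` of a linear family `T` of forms. The exterior
derivative is the case where `T` is the derivative of a form. -/
def alt (T : ∀ k : ℕ, E →L[ℝ] E [⋀^Fin k]→L[ℝ] ℂ) : MixAlt E
  | 0 => 0
  | k + 1 => alternatizeUncurryFin (T k)

/-- The derivation `b ↦ ∑ b(…, A v_i, …)` of degree zero defined by an endomorphism `A`. -/
def ins (A : E →L[ℝ] E) (b : MixAlt E) : MixAlt E :=
  alt fun k => (b (k + 1)).curryLeft ∘L A

theorem ctr_add (v : E) (b c : MixAlt E) : ctr v (b + c) = ctr v b + ctr v c := rfl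

theorem ctr_sub (v : E) (b c : MixAlt E) : ctr v (b - c) = ctr v b - ctr v c := by
  funext k; ext w; simp [ctr]

theorem ctr_smul (v : E) (z : ℂ) (b : MixAlt E) : ctr v (z • b) = z • ctr v b := by
  funext k; ext w; simp [ctr]

theorem ctr_zero (v : E) : ctr v (0 : MixAlt E) = 0 := rfl

theorem ctr_add_left (v w : E) (b : MixAlt E) : ctr (v + w) b = ctr v b + ctr w b := by
  funext k; simp [ctr]

theorem ctr_smul_left (r : ℝ) (v : E) (b : MixAlt E) : ctr (r • v) b = (r : ℂ) • ctr v b := by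
  funext k; ext w; simp [ctr]

theorem ctr_zero_left (b : MixAlt E) : ctr 0 b = 0 := by
  funext k; simp [ctr]

theorem ctr_neg_left (v : E) (b : MixAlt E) : ctr (-v) b = -ctr v b := by
  funext k; simp [ctr]

theorem ctr_ctr_swap (v w : E) (b : MixAlt E) : ctr v (ctr w b) = -ctr w (ctr v b) := by
  funext k; ext u
  simp only [ctr, curryLeft_apply_apply, Pi.neg_apply, ContinuousAlternatingMap.neg_apply]
  have h : b (k + 1 + 1) (Matrix.vecCons w (Matrix.vecCons v u) ∘ Equiv.swap 0 1) =
      -b (k + 1 + 1) (Matrix.vecCons w (Matrix.vecCons v u)) :=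
    (b (k + 1 + 1)).map_swap (Matrix.vecCons w (Matrix.vecCons v u)) (i := 0) (j := 1) (by simp)
  rw [← neg_eq_iff_eq_neg, ← h]
  congr 1
  funext i
  refine Fin.cases ?_ (fun i => Fin.cases ?_ (fun i => ?_) i) i
  · simp
  · simp
  · rw [Function.comp_apply, Equiv.swap_apply_of_ne_of_ne (by simp [Fin.ext_iff])
      (by simp [Fin.ext_iff])]
    simp

theorem ctr_self (v : E) (b : MixAlt E) : ctr v (ctr v b) = 0 := by
  funext k
  exact curryLeft_same _ _

/-- A form of positive degree is determined by its contractions. -/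
theorem eq_succ_of_ctr {b c : MixAlt E} {k : ℕ} (h : ∀ v, ctr v b k = ctr v c k) :
    b (k + 1) = c (k + 1) := by
  ext v
  have := congrArg (fun f => f (fun i => v i.succ)) (h (v 0))
  simp only [ctr, curryLeft_apply_apply] at this
  have hv : Matrix.vecCons (v 0) (fun i => v i.succ) = v := by
    funext i; refine Fin.cases ?_ (fun i => ?_) i <;> simp
  rwa [hv] at this

/-- The recursion that determines an alternatization `alt T` through its contractions: contracting
either fills the slot of `T k` or passes to the alternating argument. Identities for the exterior
derivative and for insertions are deduced from it by induction on the degree. -/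
theorem ctr_alt (T : ∀ k : ℕ, E →L[ℝ] E [⋀^Fin k]→L[ℝ] ℂ) (v : E) :
    ctr v (alt T) = (fun k => T k v) -
      alt (fun k => ((curryLeftLI (𝕜 := ℝ) (E := E) (F := ℂ) (n := k)).toContinuousLinearMap.flip v)
        ∘L T (k + 1)) := by
  funext k
  ext u
  cases k with
  | zero =>
    simp [ctr, alt, alternatizeUncurryFin_apply]
  | succ k =>
    simp only [ctr, alt, curryLeft_apply_apply, alternatizeUncurryFin_apply, Pi.sub_apply,
      ContinuousAlternatingMap.sub_apply]
    rw [Fin.sum_univ_succ, sub_eq_add_neg, ← Finset.sum_neg_distrib]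
    congr 1
    · simp
    · refine Finset.sum_congr rfl fun i _ => ?_
      simp only [Fin.val_succ, pow_succ]
      have : (i.succ).removeNth (Matrix.vecCons v u) = Matrix.vecCons v (i.removeNth u) := by
        funext j
        refine Fin.cases ?_ (fun j => ?_) j
        · simp [Fin.removeNth]
        · simp [Fin.removeNth]
      rw [this]
      simp

theorem ctr_ins (A : E →L[ℝ] E) (v : E) (b : MixAlt E) :
    ctr v (ins A b) = ctr (A v) b + ins A (ctr v b) := by
  rw [ins, ctr_alt, sub_eq_add_neg]
  congr 1
  funext k
  cases k with
  | zero => simp [alt, ins]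
  | succ k =>
    simp only [alt, ins, Pi.neg_apply]
    rw [← neg_one_smul ℝ, ← alternatizeUncurryFin_smul]
    congr 1
    ext w u
    have := congrArg (fun f : MixAlt E => f k u) (ctr_ctr_swap (A w) v b)
    simp [ctr] at this ⊢
    rw [this]

theorem ins_zero_apply (A : E →L[ℝ] E) (b : MixAlt E) : ins A b 0 = 0 := rfl

theorem alt_add (S T : ∀ k : ℕ, E →L[ℝ] E [⋀^Fin k]→L[ℝ] ℂ) :
    alt (fun k => S k + T k) = alt S + alt T := by
  funext k; cases k <;> simp [alt]

theorem alt_smul (z : ℂ) (T : ∀ k : ℕ, E →L[ℝ] E [⋀^Fin k]→L[ℝ] ℂ) :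
    alt (fun k => z • T k) = z • alt T := by
  funext k
  cases k with
  | zero => exact (smul_zero (M := ℂ) (A := E [⋀^Fin 0]→L[ℝ] ℂ) z).symm
  | succ k => exact alternatizeUncurryFin_smul z (T k)

theorem ins_add (A : E →L[ℝ] E) (b c : MixAlt E) : ins A (b + c) = ins A b + ins A c := by
  rw [ins, ins, ins, ← alt_add]; rfl

theorem ins_smul (A : E →L[ℝ] E) (z : ℂ) (b : MixAlt E) : ins A (z • b) = z • ins A b := by
  rw [ins, ins, ← alt_smul]; rfl

theorem ins_add_left (A B : E →L[ℝ] E) (b : MixAlt E) :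
    ins (A + B) b = ins A b + ins B b := by
  rw [ins, ins, ins, ← alt_add]
  congr 1; funext k; simp

theorem ins_eq_zero {A : E →L[ℝ] E} {b : MixAlt E} (h : ∀ v, ctr (A v) b = 0) : ins A b = 0 := by
  have : (fun k => (b (k + 1)).curryLeft ∘L A) = fun k => 0 := by
    funext k; ext v u
    exact congrArg (fun f : MixAlt E => f k u) (h v)
  rw [ins, this]
  funext k
  cases k with
  | zero => rfl
  | succ k => ext u; simp [alt, alternatizeUncurryFin_apply]

theorem ins_apply (A : E →L[ℝ] E) (b : MixAlt E) (k : ℕ) (v : Fin k → E) :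
    ins A b k v = ∑ i, b k (Function.update v i (A (v i))) := by
  cases k with
  | zero => simp [ins, alt]
  | succ k =>
    simp only [ins, alt, alternatizeUncurryFin_apply]
    refine Finset.sum_congr rfl fun i _ => ?_
    simp only [ContinuousLinearMap.comp_apply, curryLeft_apply_apply]
    rw [← map_insertNth, Fin.insertNth_removeNth]

/-- The commutator of the derivations given by `A` and `B` is the one given by the reversed commutator
`B ∘L A - A ∘L B`. -/
theorem ins_comm (A B : E →L[ℝ] E) (b : MixAlt E) :
    ins A (ins B b) + ins (A ∘L B) b = ins B (ins A b) + ins (B ∘L A) b := by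
  funext k
  induction k generalizing b with
  | zero => simp [ins_zero_apply]
  | succ k ih =>
    refine eq_succ_of_ctr fun v => ?_
    have := ih (ctr v b)
    simp only [ctr_add, ctr_ins, ins_add, ContinuousLinearMap.comp_apply, Pi.add_apply] at this ⊢
    linear_combination (norm := module) this

end MixAlt

end MixedForms

/-! ### The wedge product is a graded derivation for contractions -/

section WedgeAlgebra

open ContinuousAlternatingMap Equiv

variable {E : Type*} [NormedAddCommGroup E] [NormedSpace ℝ E]

/-- A sum over the permutations `σ` of `n + 1` indices, organized by `p = σ⁻¹ 0`. -/
theorem sum_perm_fin_succ {A : Type*} [AddCommMonoid A] {n : ℕ} (f : Perm (Fin (n + 1)) → A) :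
    ∑ σ, f σ = ∑ p : Fin (n + 1), ∑ e : Perm (Fin n),
      f (Perm.decomposeFin.symm (0, e) * p.cycleRange) := by
  rw [← Fintype.sum_prod_type' (f := fun (p : Fin (n + 1)) (e : Perm (Fin n)) =>
    f (Perm.decomposeFin.symm (0, e) * p.cycleRange))]
  symm
  refine Fintype.sum_bijective _ ?_ _ _ fun _ => rfl
  rw [Fintype.bijective_iff_injective_and_card]
  constructor
  · rintro ⟨p, e⟩ ⟨q, e'⟩ h
    simp only at h
    have hp : p = q := by
      have h1 := congrArg (fun g : Perm (Fin (n + 1)) => g⁻¹ 0) h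
      have key (e : Perm (Fin n)) :
          (Perm.decomposeFin.symm ((0 : Fin (n + 1)), e)).symm 0 = 0 := by
        rw [Equiv.symm_apply_eq, Perm.decomposeFin_symm_apply_zero]
      simpa [mul_inv_rev, key] using h1
    subst hp
    have := Perm.decomposeFin.symm.injective (mul_right_cancel h)
    rw [(Prod.mk.inj this).2]
  · simp [Fintype.card_perm, Nat.factorial_succ]

theorem cons_comp_decomposeFin_mul_cycleRange {A : Type*} {n : ℕ} (x : A) (u : Fin n → A)
    (p : Fin (n + 1)) (e : Perm (Fin n)) (j : Fin (n + 1)) :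
    (Matrix.vecCons x u : Fin (n + 1) → A)
      ((Perm.decomposeFin.symm (0, e) * p.cycleRange) j) = p.insertNth (α := fun _ => A) x (u ∘ e) j := by
  rcases Fin.eq_self_or_eq_succAbove p j with rfl | ⟨j, rfl⟩
  · simp
  · simp

/-- The wedge product without its normalizing factor. -/
def rawWedge {k l n : ℕ} (h : k + l = n) (a : E [⋀^Fin k]→L[ℝ] ℂ) (b : E [⋀^Fin l]→L[ℝ] ℂ)
    (v : Fin n → E) : ℂ :=
  ∑ σ : Perm (Fin n), ((Perm.sign σ : ℤ) : ℂ) * (a (fun i => v (σ ⟨i, by omega⟩)) *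
    b (fun i => v (σ ⟨k + i, by omega⟩)))

theorem altWedge_apply {k l n : ℕ} (h : k + l = n) (a : E [⋀^Fin k]→L[ℝ] ℂ)
    (b : E [⋀^Fin l]→L[ℝ] ℂ) (v : Fin n → E) :
    altWedge h a b v = (k.factorial * l.factorial : ℂ)⁻¹ * rawWedge h a b v := by
  subst h
  simp only [altWedge, rawWedge, ContinuousAlternatingMap.smul_apply, smul_eq_mul]
  congr 1
  rw [ContinuousMultilinearMap.alternatization_apply_apply]
  refine Finset.sum_congr rfl fun σ _ => ?_
  rw [Units.smul_def, zsmul_eq_mul]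
  rfl

theorem rawWedge_cons {k l n : ℕ} (h : k + l = n + 1) (a : E [⋀^Fin k]→L[ℝ] ℂ)
    (b : E [⋀^Fin l]→L[ℝ] ℂ) (x : E) (u : Fin n → E) :
    rawWedge h a b (Matrix.vecCons x u) = ∑ p : Fin (n + 1), (-1) ^ (p : ℕ) *
      ∑ e : Perm (Fin n), ((Perm.sign e : ℤ) : ℂ) *
        (a (fun i => p.insertNth (α := fun _ => E) x (u ∘ e) ⟨i, by omega⟩) *
          b (fun i => p.insertNth (α := fun _ => E) x (u ∘ e) ⟨k + i, by omega⟩)) := by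
  rw [rawWedge, sum_perm_fin_succ]
  refine Finset.sum_congr rfl fun p _ => ?_
  rw [Finset.mul_sum]
  refine Finset.sum_congr rfl fun e _ => ?_
  simp only [cons_comp_decomposeFin_mul_cycleRange]
  rw [map_mul, Fin.sign_cycleRange, Perm.decomposeFin.symm_sign]
  simp
  ring

theorem insertNth_of_lt {A : Type*} {n : ℕ} (p : Fin (n + 1)) (x : A) (u : Fin n → A) {j : ℕ}
    (hj : j < n) (h : j < p) :
    p.insertNth (α := fun _ => A) x u ⟨j, by omega⟩ = u ⟨j, hj⟩ := by
  have : (⟨j, by omega⟩ : Fin (n + 1)) = p.succAbove ⟨j, hj⟩ := by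
    rw [Fin.succAbove_of_castSucc_lt _ _ (by simpa [Fin.lt_def] using h)]; rfl
  rw [this, Fin.insertNth_apply_succAbove]

theorem insertNth_of_gt {A : Type*} {n : ℕ} (p : Fin (n + 1)) (x : A) (u : Fin n → A) {j : ℕ}
    (hj : j < n) (h : (p : ℕ) ≤ j) :
    p.insertNth (α := fun _ => A) x u ⟨j + 1, by omega⟩ = u ⟨j, hj⟩ := by
  have : (⟨j + 1, by omega⟩ : Fin (n + 1)) = p.succAbove ⟨j, hj⟩ := by
    rw [Fin.succAbove_of_le_castSucc _ _ (by simpa [Fin.le_def] using h)]; rfl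
  rw [this, Fin.insertNth_apply_succAbove]

theorem insertNth_self {A : Type*} {n : ℕ} (p : Fin (n + 1)) (x : A) (u : Fin n → A) {j : ℕ}
    (hj : j < n + 1) (h : (p : ℕ) = j) :
    p.insertNth (α := fun _ => A) x u ⟨j, hj⟩ = x := by
  have : (⟨j, hj⟩ : Fin (n + 1)) = p := Fin.ext h.symm
  rw [this, Fin.insertNth_apply_same]

theorem ext_insertNth {A : Type*} {n : ℕ} (p : Fin (n + 1)) (x : A) (u : Fin n → A)
    {f : Fin (n + 1) → A} (h0 : f p = x)
    (h1 : ∀ (j : ℕ) (hj : j < n), j < p → f ⟨j, by omega⟩ = u ⟨j, hj⟩)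
    (h2 : ∀ (j : ℕ) (hj : j < n), (p : ℕ) ≤ j → f ⟨j + 1, by omega⟩ = u ⟨j, hj⟩) :
    f = p.insertNth (α := fun _ => A) x u := by
  funext i
  rcases Fin.eq_self_or_eq_succAbove p i with rfl | ⟨j, rfl⟩
  · simpa using h0
  · rw [Fin.insertNth_apply_succAbove]
    rcases lt_or_ge (j : ℕ) p with h | h
    · rw [Fin.succAbove_of_castSucc_lt _ _ (by simpa [Fin.lt_def] using h)]
      exact h1 j j.2 h
    · rw [Fin.succAbove_of_le_castSucc _ _ (by simpa [Fin.le_def] using h)]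
      exact h2 j j.2 h

theorem rawWedge_cons_term_left {k l n : ℕ} (h : k + 1 + l = n + 1)
    (a : E [⋀^Fin (k + 1)]→L[ℝ] ℂ) (b : E [⋀^Fin l]→L[ℝ] ℂ) (x : E) (u : Fin n → E)
    (i : Fin (k + 1)) (p : Fin (n + 1)) (hp : (p : ℕ) = i) :
    (-1) ^ (p : ℕ) * ∑ e : Perm (Fin n), ((Perm.sign e : ℤ) : ℂ) *
        (a (fun i => p.insertNth (α := fun _ => E) x (u ∘ e) ⟨i, by omega⟩) *
          b (fun i => p.insertNth (α := fun _ => E) x (u ∘ e) ⟨k + 1 + i, by omega⟩)) =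
      rawWedge (by omega : k + l = n) (a.curryLeft x) b u := by
  rw [rawWedge, Finset.mul_sum]
  refine Finset.sum_congr rfl fun e _ => ?_
  have h1 : (fun j : Fin (k + 1) => p.insertNth (α := fun _ => E) x (u ∘ e) ⟨j, by omega⟩) =
      i.insertNth (α := fun _ => E) x (fun j : Fin k => u (e ⟨j, by omega⟩)) := by
    refine ext_insertNth _ _ _ ?_ ?_ ?_
    · exact insertNth_self _ _ _ _ hp
    · intro j hj hlt
      exact insertNth_of_lt p x (u ∘ e) (j := j) (by omega) (by omega)
    · intro j hj hle
      exact insertNth_of_gt p x (u ∘ e) (j := j) (by omega) (by omega)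
  have h2 : (fun j : Fin l => p.insertNth (α := fun _ => E) x (u ∘ e) ⟨k + 1 + j, by omega⟩) =
      fun j : Fin l => u (e ⟨k + j, by omega⟩) := by
    funext j
    have := insertNth_of_gt p x (u ∘ e) (j := k + j) (by omega) (by omega)
    rw [← Function.comp_apply (f := u), ← this]
    congr 2
    omega
  rw [h1, h2, map_insertNth, hp, curryLeft_apply_apply]
  have : ((-1 : ℂ)) ^ (i : ℕ) * (-1) ^ (i : ℕ) = 1 := by rw [← mul_pow]; simp
  rw [zsmul_eq_mul]
  push_cast
  linear_combination (((Perm.sign e : ℤ) : ℂ) * a (Matrix.vecCons x fun j : Fin k =>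
    u (e ⟨j, by omega⟩)) * b (fun j => u (e ⟨k + j, by omega⟩))) * this

theorem rawWedge_cons_term_right {k l n : ℕ} (h : k + (l + 1) = n + 1)
    (a : E [⋀^Fin k]→L[ℝ] ℂ) (b : E [⋀^Fin (l + 1)]→L[ℝ] ℂ) (x : E) (u : Fin n → E)
    (i : Fin (l + 1)) (p : Fin (n + 1)) (hp : (p : ℕ) = k + i) :
    (-1) ^ (p : ℕ) * ∑ e : Perm (Fin n), ((Perm.sign e : ℤ) : ℂ) *
        (a (fun i => p.insertNth (α := fun _ => E) x (u ∘ e) ⟨i, by omega⟩) *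
          b (fun i => p.insertNth (α := fun _ => E) x (u ∘ e) ⟨k + i, by omega⟩)) =
      (-1) ^ k * rawWedge (by omega : k + l = n) a (b.curryLeft x) u := by
  rw [rawWedge, Finset.mul_sum, Finset.mul_sum]
  refine Finset.sum_congr rfl fun e _ => ?_
  have h1 : (fun j : Fin k => p.insertNth (α := fun _ => E) x (u ∘ e) ⟨j, by omega⟩) =
      fun j : Fin k => u (e ⟨j, by omega⟩) := by
    funext j
    exact insertNth_of_lt p x (u ∘ e) (j := j) (by omega) (by omega)
  have h2 : (fun j : Fin (l + 1) =>
        p.insertNth (α := fun _ => E) x (u ∘ e) ⟨k + j, by omega⟩) =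
      i.insertNth (α := fun _ => E) x (fun j : Fin l => u (e ⟨k + j, by omega⟩)) := by
    refine ext_insertNth _ _ _ ?_ ?_ ?_
    · exact insertNth_self _ _ _ _ hp
    · intro j hj hlt
      exact insertNth_of_lt p x (u ∘ e) (j := k + j) (by omega) (by omega)
    · intro j hj hle
      exact insertNth_of_gt p x (u ∘ e) (j := k + j) (by omega) (by omega)
  rw [h1, h2, map_insertNth, hp, curryLeft_apply_apply, zsmul_eq_mul, pow_add]
  have : ((-1 : ℂ)) ^ (i : ℕ) * (-1) ^ (i : ℕ) = 1 := by rw [← mul_pow]; simp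
  push_cast
  linear_combination ((-1) ^ k * ((Perm.sign e : ℤ) : ℂ) * a (fun j : Fin k =>
    u (e ⟨j, by omega⟩)) * b (Matrix.vecCons x fun j => u (e ⟨k + j, by omega⟩))) * this

namespace MixAlt

/-- The term `a_k ∧ b_l` in degree `n`, which is `0` unless `n = k + l`. -/
def wedgeTerm (a b : MixAlt E) (n k l : ℕ) : E [⋀^Fin n]→L[ℝ] ℂ :=
  if h : k + l = n then altWedge h (a k) (b l) else 0

/-- The wedge product of forms of mixed degree. -/
def wedge (a b : MixAlt E) : MixAlt E :=
  fun k => ∑ i : Fin (k + 1),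
    altWedge (Nat.add_sub_of_le (Nat.le_of_lt_succ i.isLt)) (a i) (b (k - i))

/-- The involution `(-1)^k` in degree `k`. -/
def sgn (a : MixAlt E) : MixAlt E := fun k => (-1 : ℂ) ^ k • a k

theorem wedge_eq_sum (a b : MixAlt E) (n : ℕ) :
    wedge a b n = ∑ p ∈ Finset.HasAntidiagonal.antidiagonal n, wedgeTerm a b n p.1 p.2 := by
  rw [Finset.Nat.sum_antidiagonal_eq_sum_range_succ (fun i j => wedgeTerm a b n i j),
    ← Fin.sum_univ_eq_sum_range (fun i => wedgeTerm a b n i (n - i))]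
  refine Finset.sum_congr rfl fun i _ => ?_
  rw [wedgeTerm, dif_pos]

/-- The contraction of `a_k ∧ b_l` that hits the first factor. -/
def ctrLeftTerm (x : E) (a b : MixAlt E) (n : ℕ) : ℕ → ℕ → E [⋀^Fin n]→L[ℝ] ℂ
  | 0, _ => 0
  | k + 1, l => wedgeTerm (ctr x a) b n k l

/-- The contraction of `a_k ∧ b_l` that hits the second factor. -/
def ctrRightTerm (x : E) (a b : MixAlt E) (n : ℕ) : ℕ → ℕ → E [⋀^Fin n]→L[ℝ] ℂ
  | _, 0 => 0
  | k, l + 1 => wedgeTerm (sgn a) (ctr x b) n k l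

theorem altWedge_smul_left {k l n : ℕ} (h : k + l = n) (z : ℂ) (a : E [⋀^Fin k]→L[ℝ] ℂ)
    (b : E [⋀^Fin l]→L[ℝ] ℂ) : altWedge h (z • a) b = z • altWedge h a b := by
  ext v
  simp only [altWedge_apply, rawWedge, ContinuousAlternatingMap.smul_apply, smul_eq_mul,
    Finset.mul_sum]
  refine Finset.sum_congr rfl fun σ _ => ?_
  ring

theorem curryLeft_wedgeTerm (x : E) (a b : MixAlt E) {n k l : ℕ} (h : k + l = n + 1) :
    (wedgeTerm a b (n + 1) k l).curryLeft x =
      ctrLeftTerm x a b n k l + ctrRightTerm x a b n k l := by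
  ext u
  rw [wedgeTerm, dif_pos h, curryLeft_apply_apply, altWedge_apply, rawWedge_cons,
    ← (finCongr h).sum_comp, Fin.sum_univ_add, mul_add, ContinuousAlternatingMap.add_apply]
  congr 1
  · cases k with
    | zero => simp [ctrLeftTerm]
    | succ k =>
      rw [Finset.sum_congr (g := fun _ => rawWedge (by omega : k + l = n)
        ((a (k + 1)).curryLeft x) (b l) u) rfl fun i _ => rawWedge_cons_term_left h (a (k + 1))
          (b l) x u i (finCongr h (Fin.castAdd l i)) (by simp)]
      rw [ctrLeftTerm, wedgeTerm, dif_pos (by omega), altWedge_apply, Finset.sum_const,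
        Finset.card_univ, Fintype.card_fin, nsmul_eq_mul, ← mul_assoc, Nat.factorial_succ]
      congr 1
      have := Nat.factorial_ne_zero k
      have := Nat.factorial_ne_zero l
      have : (k : ℂ) + 1 ≠ 0 := by exact_mod_cast k.succ_ne_zero
      push_cast
      field_simp
  · cases l with
    | zero => simp [ctrRightTerm]
    | succ l =>
      rw [Finset.sum_congr (g := fun _ => (-1) ^ k * rawWedge (by omega : k + l = n) (a k)
        ((b (l + 1)).curryLeft x) u) rfl fun i _ => rawWedge_cons_term_right h (a k) (b (l + 1))
          x u i (finCongr h (Fin.natAdd k i)) (by simp)]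
      rw [ctrRightTerm, wedgeTerm, dif_pos (by omega), sgn, altWedge_smul_left,
        ContinuousAlternatingMap.smul_apply, altWedge_apply, Finset.sum_const,
        Finset.card_univ, Fintype.card_fin, nsmul_eq_mul, Nat.factorial_succ, smul_eq_mul, ctr]
      have := Nat.factorial_ne_zero k
      have := Nat.factorial_ne_zero l
      have : (l : ℂ) + 1 ≠ 0 := by exact_mod_cast l.succ_ne_zero
      push_cast
      field_simp

/-- Contractions are antiderivations of the wedge product. -/
theorem ctr_wedge (x : E) (a b : MixAlt E) :
    ctr x (wedge a b) = wedge (ctr x a) b + wedge (sgn a) (ctr x b) := by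
  funext n
  rw [ctr, wedge_eq_sum, Pi.add_apply, wedge_eq_sum, wedge_eq_sum]
  have h1 : (∑ p ∈ Finset.HasAntidiagonal.antidiagonal (n + 1), wedgeTerm a b (n + 1) p.1 p.2).curryLeft x =
      ∑ p ∈ Finset.HasAntidiagonal.antidiagonal (n + 1), (wedgeTerm a b (n + 1) p.1 p.2).curryLeft x := by
    ext u
    simp [ContinuousAlternatingMap.sum_apply]
  rw [h1, Finset.sum_congr rfl fun p hp => curryLeft_wedgeTerm x a b
    (Finset.HasAntidiagonal.mem_antidiagonal.1 hp), Finset.sum_add_distrib]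
  congr 1
  · rw [Finset.Nat.sum_antidiagonal_succ]
    simp [ctrLeftTerm]
  · rw [Finset.Nat.sum_antidiagonal_succ']
    simp [ctrRightTerm]

end MixAlt

end WedgeAlgebra

section WedgeBilinear

open ContinuousAlternatingMap Equiv

variable {E : Type*} [NormedAddCommGroup E] [NormedSpace ℝ E]

theorem norm_altWedge_le {k l n : ℕ} (h : k + l = n) (a : E [⋀^Fin k]→L[ℝ] ℂ)
    (b : E [⋀^Fin l]→L[ℝ] ℂ) : ‖altWedge h a b‖ ≤ n.factorial * ‖a‖ * ‖b‖ := by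
  refine ContinuousAlternatingMap.opNorm_le_bound _ (by positivity) fun v => ?_
  have hprod (σ : Perm (Fin n)) : (∏ i : Fin k, ‖v (σ ⟨i, by omega⟩)‖) *
      ∏ i : Fin l, ‖v (σ ⟨k + i, by omega⟩)‖ = ∏ i, ‖v i‖ := by
    rw [← Equiv.prod_comp σ (fun i => ‖v i‖), ← (finCongr h).prod_comp, Fin.prod_univ_add]
    rfl
  rw [altWedge_apply, norm_mul]
  have h1 : ‖((k.factorial * l.factorial : ℂ)⁻¹)‖ ≤ 1 := by
    rw [norm_inv]
    refine inv_le_one_of_one_le₀ ?_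
    rw [norm_mul, Complex.norm_natCast, Complex.norm_natCast]
    exact_mod_cast Nat.mul_pos k.factorial_pos l.factorial_pos
  have h2 : ‖rawWedge h a b v‖ ≤ n.factorial * ‖a‖ * ‖b‖ * ∏ i, ‖v i‖ := by
    refine (norm_sum_le _ _).trans ?_
    have : ∀ σ ∈ (Finset.univ : Finset (Perm (Fin n))), ‖((Perm.sign σ : ℤ) : ℂ) *
        (a (fun i => v (σ ⟨i, by omega⟩)) * b (fun i => v (σ ⟨k + i, by omega⟩)))‖ ≤
        ‖a‖ * ‖b‖ * ∏ i, ‖v i‖ := by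
      intro σ _
      have hs : ‖((Perm.sign σ : ℤ) : ℂ)‖ = 1 := by
        rcases Int.units_eq_one_or (Perm.sign σ) with h | h <;> simp [h]
      rw [norm_mul, hs, one_mul, norm_mul, ← hprod σ]
      refine (mul_le_mul (a.le_opNorm _) (b.le_opNorm _) (norm_nonneg _)
        (mul_nonneg (norm_nonneg _) (Finset.prod_nonneg fun _ _ => norm_nonneg _))).trans_eq ?_
      ring
    refine (Finset.sum_le_sum this).trans_eq ?_
    rw [Finset.sum_const, Finset.card_univ, Fintype.card_perm, Fintype.card_fin, nsmul_eq_mul]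
    ring
  calc _ ≤ 1 * ‖rawWedge h a b v‖ := by gcongr
    _ ≤ _ := by rw [one_mul]; exact h2

theorem altWedge_add_left {k l n : ℕ} (h : k + l = n) (a a' : E [⋀^Fin k]→L[ℝ] ℂ)
    (b : E [⋀^Fin l]→L[ℝ] ℂ) : altWedge h (a + a') b = altWedge h a b + altWedge h a' b := by
  ext v
  simp only [altWedge_apply, rawWedge, ContinuousAlternatingMap.add_apply]
  rw [← mul_add, ← Finset.sum_add_distrib]
  congr 1
  refine Finset.sum_congr rfl fun σ _ => ?_
  ring

theorem altWedge_add_right {k l n : ℕ} (h : k + l = n) (a : E [⋀^Fin k]→L[ℝ] ℂ)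
    (b b' : E [⋀^Fin l]→L[ℝ] ℂ) : altWedge h a (b + b') = altWedge h a b + altWedge h a b' := by
  ext v
  simp only [altWedge_apply, rawWedge, ContinuousAlternatingMap.add_apply]
  rw [← mul_add, ← Finset.sum_add_distrib]
  congr 1
  refine Finset.sum_congr rfl fun σ _ => ?_
  ring

theorem altWedge_smul_right {k l n : ℕ} (h : k + l = n) (z : ℂ) (a : E [⋀^Fin k]→L[ℝ] ℂ)
    (b : E [⋀^Fin l]→L[ℝ] ℂ) : altWedge h a (z • b) = z • altWedge h a b := by
  ext v
  simp only [altWedge_apply, rawWedge, ContinuousAlternatingMap.smul_apply, smul_eq_mul,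
    Finset.mul_sum]
  refine Finset.sum_congr rfl fun σ _ => ?_
  ring

/-- The wedge product as a continuous bilinear map. -/
def altWedgeCLM {k l n : ℕ} (h : k + l = n) :
    (E [⋀^Fin k]→L[ℝ] ℂ) →L[ℝ] (E [⋀^Fin l]→L[ℝ] ℂ) →L[ℝ] (E [⋀^Fin n]→L[ℝ] ℂ) :=
  LinearMap.mkContinuous₂
    (LinearMap.mk₂ ℝ (altWedge h) (altWedge_add_left h)
      (fun c a b => by
        exact MixAlt.altWedge_smul_left h (c : ℂ) a b)
      (altWedge_add_right h)
      (fun c a b => by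
        exact altWedge_smul_right h (c : ℂ) a b))
    n.factorial (norm_altWedge_le h)

@[simp]
theorem altWedgeCLM_apply {k l n : ℕ} (h : k + l = n) (a : E [⋀^Fin k]→L[ℝ] ℂ)
    (b : E [⋀^Fin l]→L[ℝ] ℂ) : altWedgeCLM h a b = altWedge h a b := rfl

namespace MixAlt

theorem wedge_add_left (a a' b : MixAlt E) : wedge (a + a') b = wedge a b + wedge a' b := by
  funext k
  simp only [wedge, Pi.add_apply, altWedge_add_left, Finset.sum_add_distrib]

theorem wedge_add_right (a b b' : MixAlt E) : wedge a (b + b') = wedge a b + wedge a b' := by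
  funext k
  simp only [wedge, Pi.add_apply, altWedge_add_right, Finset.sum_add_distrib]

theorem wedge_smul_left (z : ℂ) (a b : MixAlt E) : wedge (z • a) b = z • wedge a b := by
  funext k
  simp only [wedge, Pi.smul_apply, altWedge_smul_left, Finset.smul_sum]

theorem wedge_smul_right (z : ℂ) (a b : MixAlt E) : wedge a (z • b) = z • wedge a b := by
  funext k
  simp only [wedge, Pi.smul_apply, altWedge_smul_right, Finset.smul_sum]

theorem wedge_neg_left (a b : MixAlt E) : wedge (-a) b = -wedge a b :=
  (AddMonoidHom.mk' (fun a => wedge a b) fun a a' => wedge_add_left a a' b).map_neg a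

theorem wedge_neg_right (a b : MixAlt E) : wedge a (-b) = -wedge a b :=
  (AddMonoidHom.mk' (fun b => wedge a b) fun b b' => wedge_add_right a b b').map_neg b

theorem wedge_sub_left (a a' b : MixAlt E) : wedge (a - a') b = wedge a b - wedge a' b :=
  (AddMonoidHom.mk' (fun a => wedge a b) fun a a' => wedge_add_left a a' b).map_sub a a'

theorem wedge_sub_right (a b b' : MixAlt E) : wedge a (b - b') = wedge a b - wedge a b' :=
  (AddMonoidHom.mk' (fun b => wedge a b) fun b b' => wedge_add_right a b b').map_sub b b'

theorem wedge_zero_left (b : MixAlt E) : wedge 0 b = 0 :=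
  (AddMonoidHom.mk' (fun a => wedge a b) fun a a' => wedge_add_left a a' b).map_zero

theorem wedge_degree_zero (a b : MixAlt E) (v : Fin 0 → E) :
    wedge a b 0 v = a 0 v * b 0 v := by
  simp only [wedge, Fin.sum_univ_succ, Finset.univ_eq_empty, Finset.sum_empty, add_zero]
  rw [altWedge_apply, rawWedge]
  simp

theorem sgn_sgn (a : MixAlt E) : sgn (sgn a) = a := by
  funext k
  rw [sgn, sgn, smul_smul, ← mul_pow]
  simp

theorem ctr_sgn (x : E) (a : MixAlt E) : ctr x (sgn a) = -sgn (ctr x a) := by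
  funext k
  ext v
  simp [ctr, sgn, pow_succ]

theorem ins_sgn (A : E →L[ℝ] E) (a : MixAlt E) : ins A (sgn a) = sgn (ins A a) := by
  funext k
  ext v
  simp only [ins_apply, sgn, ContinuousAlternatingMap.smul_apply, smul_eq_mul, Finset.mul_sum]

/-- Insertions are derivations of the wedge product. -/
theorem ins_wedge (A : E →L[ℝ] E) (a b : MixAlt E) :
    ins A (wedge a b) = wedge (ins A a) b + wedge a (ins A b) := by
  funext k
  induction k generalizing a b with
  | zero =>
    ext v
    simp [wedge_degree_zero, ins_zero_apply]
  | succ k ih =>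
    refine eq_succ_of_ctr fun v => ?_
    have h1 := ih (ctr v a) b
    have h2 := ih (sgn a) (ctr v b)
    simp only [ctr_add, ctr_ins, ctr_wedge, ins_add, ins_sgn, wedge_add_left, wedge_add_right,
      Pi.add_apply] at h1 h2 ⊢
    linear_combination (norm := module) h1 + h2

/-- The family `v ↦ T(v) ∧ b`. -/
def wedgeL (T : ∀ k : ℕ, E →L[ℝ] E [⋀^Fin k]→L[ℝ] ℂ) (b : MixAlt E) (k : ℕ) :
    E →L[ℝ] E [⋀^Fin k]→L[ℝ] ℂ :=
  ∑ i : Fin (k + 1), ((altWedgeCLM (Nat.add_sub_of_le (Nat.le_of_lt_succ i.isLt))).flip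
    (b (k - i))) ∘L T i

/-- The family `v ↦ a ∧ T(v)`. -/
def wedgeR (a : MixAlt E) (T : ∀ k : ℕ, E →L[ℝ] E [⋀^Fin k]→L[ℝ] ℂ) (k : ℕ) :
    E →L[ℝ] E [⋀^Fin k]→L[ℝ] ℂ :=
  ∑ i : Fin (k + 1), (altWedgeCLM (Nat.add_sub_of_le (Nat.le_of_lt_succ i.isLt)) (a i)) ∘L
    T (k - i)

theorem wedgeL_apply (T : ∀ k : ℕ, E →L[ℝ] E [⋀^Fin k]→L[ℝ] ℂ) (b : MixAlt E) (k : ℕ) (v : E) :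
    wedgeL T b k v = wedge (fun k => T k v) b k := by
  simp [wedgeL, wedge]

theorem wedgeR_apply (a : MixAlt E) (T : ∀ k : ℕ, E →L[ℝ] E [⋀^Fin k]→L[ℝ] ℂ) (k : ℕ) (v : E) :
    wedgeR a T k v = wedge a (fun k => T k v) k := by
  simp [wedgeR, wedge]

/-- The contraction of the values of a family. -/
def ctrFam (x : E) (T : ∀ k : ℕ, E →L[ℝ] E [⋀^Fin k]→L[ℝ] ℂ) (k : ℕ) :
    E →L[ℝ] E [⋀^Fin k]→L[ℝ] ℂ :=
  ((curryLeftLI (𝕜 := ℝ) (E := E) (F := ℂ) (n := k)).toContinuousLinearMap.flip x) ∘L T (k + 1)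

theorem ctrFam_apply (x : E) (T : ∀ k : ℕ, E →L[ℝ] E [⋀^Fin k]→L[ℝ] ℂ) (k : ℕ) (v : E) :
    ctrFam x T k v = ctr x (fun k => T k v) k := rfl

theorem ctr_alt' (T : ∀ k : ℕ, E →L[ℝ] E [⋀^Fin k]→L[ℝ] ℂ) (x : E) :
    ctr x (alt T) = (fun k => T k x) - alt (ctrFam x T) := ctr_alt T x

theorem alt_sgn (T : ∀ k : ℕ, E →L[ℝ] E [⋀^Fin k]→L[ℝ] ℂ) :
    alt (fun k => (-1 : ℂ) ^ k • T k) = -sgn (alt T) := by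
  funext k
  cases k with
  | zero => ext v; simp [alt, sgn]
  | succ k => ext v; simp [alt, sgn, alternatizeUncurryFin_smul, pow_succ]

theorem alt_wedgeL (T : ∀ k : ℕ, E →L[ℝ] E [⋀^Fin k]→L[ℝ] ℂ) (b : MixAlt E) :
    alt (wedgeL T b) = wedge (alt T) b := by
  funext k
  induction k generalizing T b with
  | zero => ext v; simp [wedge_degree_zero, alt]
  | succ k ih =>
    refine eq_succ_of_ctr fun x => ?_
    have h : ctrFam x (wedgeL T b) = fun k => wedgeL (ctrFam x T) b k +
        wedgeL (fun k => (-1 : ℂ) ^ k • T k) (ctr x b) k := by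
      funext k; ext1 v
      rw [ctrFam_apply, _root_.add_apply, wedgeL_apply, wedgeL_apply]
      simp only [wedgeL_apply]
      exact congrFun (ctr_wedge x (fun k => T k v) b) k
    have h1 := ih (ctrFam x T) b
    have h2 := ih (fun k => (-1 : ℂ) ^ k • T k) (ctr x b)
    rw [ctr_alt', h, alt_add, ctr_wedge, ctr_alt']
    rw [alt_sgn] at h2
    simp only [wedge_sub_left, wedge_neg_left, Pi.add_apply, Pi.sub_apply, wedgeL_apply,
      Pi.neg_apply] at h1 h2 ⊢
    linear_combination (norm := module) -h1 - h2

theorem alt_wedgeR (a : MixAlt E) (T : ∀ k : ℕ, E →L[ℝ] E [⋀^Fin k]→L[ℝ] ℂ) :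
    alt (wedgeR a T) = wedge (sgn a) (alt T) := by
  funext k
  induction k generalizing T a with
  | zero => ext v; simp [wedge_degree_zero, alt]
  | succ k ih =>
    refine eq_succ_of_ctr fun x => ?_
    have h : ctrFam x (wedgeR a T) = fun k => wedgeR (ctr x a) T k +
        wedgeR (sgn a) (ctrFam x T) k := by
      funext k; ext1 v
      rw [ctrFam_apply, _root_.add_apply, wedgeR_apply, wedgeR_apply]
      simp only [wedgeR_apply]
      exact congrFun (ctr_wedge x a (fun k => T k v)) k
    have h1 := ih (ctr x a) T
    have h2 := ih (sgn a) (ctrFam x T)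
    rw [ctr_alt', h, alt_add, ctr_wedge, ctr_alt', ctr_sgn, sgn_sgn]
    rw [sgn_sgn] at h2
    simp only [wedge_sub_right, wedge_neg_left, Pi.add_apply, Pi.sub_apply, wedgeR_apply,
      Pi.neg_apply] at h1 h2 ⊢
    linear_combination (norm := module) -h1 - h2

theorem wedge_compContinuousLinearMap {E' : Type*} [NormedAddCommGroup E'] [NormedSpace ℝ E']
    (f : E' →L[ℝ] E) (a b : MixAlt E) :
    wedge (fun k => (a k).compContinuousLinearMap f) (fun k => (b k).compContinuousLinearMap f) =
      fun k => (wedge a b k).compContinuousLinearMap f := by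
  funext k; ext v
  simp only [wedge, ContinuousAlternatingMap.sum_apply, altWedge_apply,
    ContinuousAlternatingMap.compContinuousLinearMap_apply]
  rfl

end MixAlt

end WedgeBilinear

/-! ### Forms, fields and endomorphisms in charts -/

section Charts

open ContinuousAlternatingMap Set

variable {E : Type*} [NormedAddCommGroup E] [NormedSpace ℝ E]
  {H : Type*} [TopologicalSpace H] {I : ModelWithCorners ℝ E H}
  {M : Type*} [TopologicalSpace M] [ChartedSpace H M]

/-- The value of a form at a point, with the tangent space replaced by the model space. -/
def formAt (β : ExtForm I M ℂ) (x : M) : MixAlt E := fun k => β k x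

/-- The value of a vector field at a point, as a vector of the model space. -/
def fieldAt (X : VField I M) (x : M) : E := X x

/-- The value of a field of endomorphisms at a point, as an endomorphism of the model space. -/
def endAt (A : EndField I M) (x : M) : E →L[ℝ] E := A x

theorem ext_formAt {β γ : ExtForm I M ℂ} (h : ∀ x, formAt β x = formAt γ x) : β = γ := by
  funext k x
  exact congrFun (h x) k

/-- The derivation of forms defined by a field of endomorphisms. -/
def insForm (A : EndField I M) (β : ExtForm I M ℂ) : ExtForm I M ℂ :=
  fun k x => MixAlt.ins (endAt A x) (formAt β x) k

/-- The involution `(-1)^k` on forms of degree `k`. -/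
def sgnForm (β : ExtForm I M ℂ) : ExtForm I M ℂ := fun k x => MixAlt.sgn (formAt β x) k

theorem formAt_contract (X : VField I M) (β : ExtForm I M ℂ) (x : M) :
    formAt (contract X β) x = MixAlt.ctr (fieldAt X x) (formAt β x) := rfl

theorem formAt_insForm (A : EndField I M) (β : ExtForm I M ℂ) (x : M) :
    formAt (insForm A β) x = MixAlt.ins (endAt A x) (formAt β x) := rfl

theorem formAt_sgnForm (β : ExtForm I M ℂ) (x : M) :
    formAt (sgnForm β) x = MixAlt.sgn (formAt β x) := rfl

theorem formAt_wedge (α β : ExtForm I M ℂ) (x : M) :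
    formAt (wedge α β) x = MixAlt.wedge (formAt α x) (formAt β x) := rfl

theorem formAt_add (α β : ExtForm I M ℂ) (x : M) :
    formAt (α + β) x = formAt α x + formAt β x := rfl

theorem formAt_smul (z : ℂ) (β : ExtForm I M ℂ) (x : M) :
    formAt (z • β) x = z • formAt β x := rfl

theorem formAt_zero (x : M) : formAt (0 : ExtForm I M ℂ) x = 0 := rfl

/-- The derivative of the inverse of the chart at `x₀`. -/
def symmD (I : ModelWithCorners ℝ E H) (x₀ : M) (y : E) : E →L[ℝ] E :=
  mfderivWithin 𝓘(ℝ, E) I (extChartAt I x₀).symm (range I) y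

/-- The derivative of the chart at `x₀`. -/
def chartD (I : ModelWithCorners ℝ E H) (x₀ x : M) : E →L[ℝ] E :=
  mfderiv I 𝓘(ℝ, E) (extChartAt I x₀) x

/-- A form in the chart at `x₀`. -/
def chartForm (β : ExtForm I M ℂ) (x₀ : M) (y : E) : MixAlt E := fun k => inChart (β k) x₀ y

/-- A vector field in the chart at `x₀`. -/
def chartField (X : VField I M) (x₀ : M) (y : E) : E :=
  chartD I x₀ ((extChartAt I x₀).symm y) (fieldAt X ((extChartAt I x₀).symm y))

/-- A field of endomorphisms in the chart at `x₀`. -/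
def chartEnd (A : EndField I M) (x₀ : M) (y : E) : E →L[ℝ] E :=
  chartD I x₀ ((extChartAt I x₀).symm y) ∘L endAt A ((extChartAt I x₀).symm y) ∘L symmD I x₀ y

/-- The pullback of a form of mixed degree under a linear map. -/
def MixAlt.pull (f : E →L[ℝ] E) (b : MixAlt E) : MixAlt E :=
  fun k => (b k).compContinuousLinearMap f

theorem chartForm_eq (β : ExtForm I M ℂ) (x₀ : M) (y : E) :
    chartForm β x₀ y = MixAlt.pull (symmD I x₀ y) (formAt β ((extChartAt I x₀).symm y)) := rfl

theorem MixAlt.ctr_pull (f : E →L[ℝ] E) (b : MixAlt E) (v : E) :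
    ctr v (pull f b) = pull f (ctr (f v) b) := by
  funext k
  exact curryLeft_compContinuousLinearMap _ _ _

theorem MixAlt.ins_pull {f A A' : E →L[ℝ] E} (h : f ∘L A' = A ∘L f) (b : MixAlt E) :
    ins A' (pull f b) = pull f (ins A b) := by
  funext k; ext v
  simp only [ins_apply, pull, compContinuousLinearMap_apply]
  refine Finset.sum_congr rfl fun i _ => ?_
  congr 1
  funext j
  by_cases hj : j = i
  · subst hj
    simpa using congrArg (fun g : E →L[ℝ] E => g (v j)) h
  · simp [hj]

theorem MixAlt.pull_add (f : E →L[ℝ] E) (b c : MixAlt E) :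
    pull f (b + c) = pull f b + pull f c := rfl

theorem MixAlt.pull_smul (f : E →L[ℝ] E) (z : ℂ) (b : MixAlt E) :
    pull f (z • b) = z • pull f b := rfl

theorem MixAlt.pull_pull (f g : E →L[ℝ] E) (b : MixAlt E) :
    pull f (pull g b) = pull (g ∘L f) b := rfl

theorem MixAlt.pull_id (b : MixAlt E) : pull (.id ℝ E) b = b := rfl

theorem chartForm_wedge (α β : ExtForm I M ℂ) (x₀ : M) (y : E) :
    chartForm (wedge α β) x₀ y = MixAlt.wedge (chartForm α x₀ y) (chartForm β x₀ y) := by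
  rw [chartForm_eq, formAt_wedge]
  exact (MixAlt.wedge_compContinuousLinearMap _ _ _).symm

theorem chartForm_differentiableAt [I.Boundaryless] {β : ExtForm I M ℂ} (hβ : IsSmooth β) {x₀ : M}
    (k : ℕ) {y : E} (hy : y ∈ (extChartAt I x₀).target) :
    DifferentiableAt ℝ (fun y => chartForm β x₀ y k) y :=
  ((hβ k x₀).contDiffAt (extChartAt_target_mem_nhds' hy)).differentiableAt (by simp)

variable [IsManifold I ∞ M]

theorem isManifold_one_of_infty (I : ModelWithCorners ℝ E H) (M : Type*) [TopologicalSpace M]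
    [ChartedSpace H M] [IsManifold I ∞ M] : IsManifold I 1 M :=
  IsManifold.of_le (n := ∞) (by exact_mod_cast le_top)

theorem chartD_comp_symmD {x₀ : M} {y : E} (hy : y ∈ (extChartAt I x₀).target) :
    chartD I x₀ ((extChartAt I x₀).symm y) ∘L symmD I x₀ y = .id ℝ E :=
  have := isManifold_one_of_infty I M
  mfderiv_extChartAt_comp_mfderivWithin_extChartAt_symm hy

theorem symmD_comp_chartD {x₀ : M} {y : E} (hy : y ∈ (extChartAt I x₀).target) :
    symmD I x₀ y ∘L chartD I x₀ ((extChartAt I x₀).symm y) = .id ℝ E :=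
  have := isManifold_one_of_infty I M
  mfderivWithin_extChartAt_symm_comp_mfderiv_extChartAt hy

theorem symmD_comp_chartD' {x₀ x : M} (hx : x ∈ (extChartAt I x₀).source) :
    symmD I x₀ (extChartAt I x₀ x) ∘L chartD I x₀ x = .id ℝ E :=
  have := isManifold_one_of_infty I M
  mfderivWithin_extChartAt_symm_comp_mfderiv_extChartAt' hx

theorem chartD_self (x : M) : chartD I x x = .id ℝ E :=
  have := isManifold_one_of_infty I M
  mfderiv_extChartAt_self

theorem symmD_self (x : M) : symmD I x (extChartAt I x x) = .id ℝ E :=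
  have := isManifold_one_of_infty I M
  mfderivWithin_range_extChartAt_symm

theorem symmD_chartField (X : VField I M) {x₀ : M} {y : E} (hy : y ∈ (extChartAt I x₀).target) :
    symmD I x₀ y (chartField X x₀ y) = fieldAt X ((extChartAt I x₀).symm y) :=
  congrArg (fun f : E →L[ℝ] E => f (fieldAt X ((extChartAt I x₀).symm y))) (symmD_comp_chartD hy)

theorem chartForm_contract (X : VField I M) (β : ExtForm I M ℂ) {x₀ : M} {y : E}
    (hy : y ∈ (extChartAt I x₀).target) :
    chartForm (contract X β) x₀ y = MixAlt.ctr (chartField X x₀ y) (chartForm β x₀ y) := by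
  rw [chartForm_eq, chartForm_eq, MixAlt.ctr_pull, symmD_chartField X hy, formAt_contract]

theorem chartForm_insForm (A : EndField I M) (β : ExtForm I M ℂ) {x₀ : M} {y : E}
    (hy : y ∈ (extChartAt I x₀).target) :
    chartForm (insForm A β) x₀ y = MixAlt.ins (chartEnd A x₀ y) (chartForm β x₀ y) := by
  rw [chartForm_eq, chartForm_eq, formAt_insForm]
  refine (MixAlt.ins_pull ?_ _).symm
  rw [chartEnd, ← ContinuousLinearMap.comp_assoc, symmD_comp_chartD hy,
    ContinuousLinearMap.id_comp]

theorem formAt_eq_chartForm (β : ExtForm I M ℂ) (x : M) :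
    formAt β x = chartForm β x (extChartAt I x x) := by
  rw [chartForm_eq, symmD_self, MixAlt.pull_id, extChartAt_to_inv]

theorem fieldAt_eq_chartField (X : VField I M) (x : M) :
    fieldAt X x = chartField X x (extChartAt I x x) := by
  rw [chartField, extChartAt_to_inv, chartD_self]
  rfl

theorem endAt_eq_chartEnd (A : EndField I M) (x : M) :
    endAt A x = chartEnd A x (extChartAt I x x) := by
  rw [chartEnd, extChartAt_to_inv, chartD_self, symmD_self]
  rfl

variable [I.Boundaryless]

theorem contDiffAt_chart_transition (x₀ x₁ : M) {y : E} (hy : y ∈ (extChartAt I x₀).target)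
    (hy' : (extChartAt I x₀).symm y ∈ (extChartAt I x₁).source) :
    ContDiffAt ℝ ∞ (extChartAt I x₁ ∘ (extChartAt I x₀).symm) y := by
  rw [← contMDiffAt_iff_contDiffAt]
  refine ContMDiffAt.comp y (I' := I) ?_ ?_
  · exact contMDiffAt_extChartAt' (by rwa [extChartAt_source] at hy')
  · exact (contMDiffOn_extChartAt_symm x₀ y hy).contMDiffAt (extChartAt_target_mem_nhds' hy)

theorem fderiv_chart_transition (x₀ x₁ : M) {y : E} (hy : y ∈ (extChartAt I x₀).target)
    (hy' : (extChartAt I x₀).symm y ∈ (extChartAt I x₁).source) :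
    fderiv ℝ (extChartAt I x₁ ∘ (extChartAt I x₀).symm) y =
      chartD I x₁ ((extChartAt I x₀).symm y) ∘L symmD I x₀ y := by
  have := isManifold_one_of_infty I M
  rw [symmD, I.range_eq_univ, mfderivWithin_univ, ← mfderiv_eq_fderiv]
  refine mfderiv_comp y (I' := I) ?_ ?_
  · exact mdifferentiableAt_extChartAt (by rwa [extChartAt_source] at hy')
  · have := mdifferentiableWithinAt_extChartAt_symm (I := I) hy
    rwa [I.range_eq_univ, mdifferentiableWithinAt_univ] at this

theorem chartForm_transition (β : ExtForm I M ℂ) (x₀ x₁ : M) {y : E}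
    (hy : y ∈ (extChartAt I x₀).target)
    (hy' : (extChartAt I x₀).symm y ∈ (extChartAt I x₁).source) :
    chartForm β x₀ y = MixAlt.pull (fderiv ℝ (extChartAt I x₁ ∘ (extChartAt I x₀).symm) y)
      (chartForm β x₁ ((extChartAt I x₁ ∘ (extChartAt I x₀).symm) y)) := by
  rw [fderiv_chart_transition x₀ x₁ hy hy', chartForm_eq, chartForm_eq, MixAlt.pull_pull,
    Function.comp_apply, ← ContinuousLinearMap.comp_assoc, symmD_comp_chartD' hy',
    ContinuousLinearMap.id_comp, (extChartAt I x₁).left_inv hy']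

/-- The exterior derivative may be computed in any chart. -/
theorem chartForm_extD {β : ExtForm I M ℂ} (hβ : IsSmooth β) {x₀ : M} {y : E}
    (hy : y ∈ (extChartAt I x₀).target) :
    chartForm (extD β) x₀ y = MixAlt.alt fun k => fderiv ℝ (fun y => chartForm β x₀ y k) y := by
  funext k
  cases k with
  | zero =>
    rfl
  | succ k =>
    set z := (extChartAt I x₀).symm y with hz
    have hzs : (extChartAt I x₀).symm y ∈ (extChartAt I z).source := mem_extChartAt_source z
    set τ := extChartAt I z ∘ (extChartAt I x₀).symm with hτ
    have hτy : τ y = extChartAt I z z := rfl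
    have hev : (fun y => chartForm β x₀ y k) =ᶠ[nhds y]
        fun y' => (inChart (β k) z (τ y')).compContinuousLinearMap (fderiv ℝ τ y') := by
      have hc : ContinuousAt (extChartAt I x₀).symm y :=
        (contMDiffOn_extChartAt_symm (n := ∞) x₀ y hy).continuousWithinAt.continuousAt
          (extChartAt_target_mem_nhds' hy)
      filter_upwards [extChartAt_target_mem_nhds' hy,
        hc.preimage_mem_nhds (extChartAt_source_mem_nhds (I := I) z)] with y' h1 h2
      exact congrFun (chartForm_transition β x₀ z h1 h2) k
    have h1 : extDeriv (fun y => chartForm β x₀ y k) y =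
        (extDeriv (inChart (β k) z) (τ y)).compContinuousLinearMap (fderiv ℝ τ y) := by
      rw [hev.extDeriv_eq]
      refine extDeriv_pullback (r := ∞) ?_ (contDiffAt_chart_transition x₀ z hy hzs) ?_
      · exact chartForm_differentiableAt hβ k (mem_extChartAt_target z)
      · rw [minSmoothness_of_isRCLikeNormedField]; exact WithTop.coe_le_coe.2 (le_top : (2 : ℕ∞) ≤ ⊤)
    change _ = extDeriv (fun y => chartForm β x₀ y k) y
    rw [h1, fderiv_chart_transition x₀ z hy hzs, hτy, ← extDerivWithin_univ, ← I.range_eq_univ]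
    rfl

theorem formAt_extD {β : ExtForm I M ℂ} (hβ : IsSmooth β) (x : M) :
    formAt (extD β) x = MixAlt.alt fun k =>
      fderiv ℝ (fun y => chartForm β x y k) (extChartAt I x x) := by
  rw [formAt_eq_chartForm, chartForm_extD hβ (mem_extChartAt_target x)]

/-- Smoothness of a field of endomorphisms, in charts. -/
def IsSmoothEnd (A : EndField I M) : Prop :=
  ∀ x₀ : M, ContDiffOn ℝ ∞ (chartEnd A x₀) (extChartAt I x₀).target

/-- Smoothness of a vector field on the domain of a chart. -/
theorem contMDiffOn_field_iff {X : VField I M} (x₀ : M) :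
    ContMDiffOn I I.tangent ∞ (fun x => (⟨x, X x⟩ : TangentBundle I M)) (chartAt H x₀).source ↔
      ContDiffOn ℝ ∞ (chartField X x₀) (extChartAt I x₀).target := by
  have := isManifold_one_of_infty I M
  have h1 := (trivializationAt E (TangentSpace I : M → Type _) x₀).contMDiffOn_section_baseSet_iff
    (IB := I) (n := ∞) (s := X)
  have hb : (trivializationAt E (TangentSpace I : M → Type _) x₀).baseSet =
      (chartAt H x₀).source := rfl
  rw [hb] at h1
  refine h1.trans ?_
  have h2 : ∀ x ∈ (chartAt H x₀).source,
      ((trivializationAt E (TangentSpace I : M → Type _) x₀) ⟨x, X x⟩).2 =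
        chartD I x₀ x (fieldAt X x) := by
    intro x hx
    have := TangentBundle.continuousLinearMapAt_trivializationAt (I := I) hx
    have h3 := Bundle.Trivialization.continuousLinearMapAt_apply_of_mem (R := ℝ)
      (trivializationAt E (TangentSpace I : M → Type _) x₀) (b := x) hx (X x)
    exact h3.symm.trans (congrArg (fun f : TangentSpace I x →L[ℝ] E => f (X x)) this)
  rw [contMDiffOn_congr h2]
  constructor
  · intro h
    rw [← contMDiffOn_iff_contDiffOn]
    exact h.comp (contMDiffOn_extChartAt_symm x₀) fun y hy => by
      have := (extChartAt I x₀).map_target hy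
      rwa [extChartAt_source] at this
  · intro h
    rw [← contMDiffOn_iff_contDiffOn] at h
    have := h.comp (contMDiffOn_extChartAt (I := I) (x := x₀)) fun y hy =>
      (extChartAt I x₀).map_source (by rwa [extChartAt_source])
    refine this.congr fun x hx => ?_
    simp only [Function.comp_apply, chartField]
    rw [(extChartAt I x₀).left_inv (by rwa [extChartAt_source])]

theorem isSmoothField_iff {X : VField I M} :
    IsSmoothField X ↔ ∀ x₀ : M, ContDiffOn ℝ ∞ (chartField X x₀) (extChartAt I x₀).target := by
  constructor
  · intro h x₀
    exact (contMDiffOn_field_iff x₀).1 h.contMDiffOn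
  · intro h x₀
    exact ((contMDiffOn_field_iff x₀).2 (h x₀)).contMDiffAt
      ((chartAt H x₀).open_source.mem_nhds (mem_chart_source H x₀))

end Charts

/-! ### Linear families of alternating forms -/

section Families

open ContinuousAlternatingMap

variable {E : Type*} [NormedAddCommGroup E] [NormedSpace ℝ E]

/-- Linear families of forms of mixed degree, parametrized by vectors. The derivative of a form on
an open subset of a vector space is of this kind. -/
abbrev MixFam (E : Type*) [NormedAddCommGroup E] [NormedSpace ℝ E] : Type _ :=
  ∀ k : ℕ, E →L[ℝ] E [⋀^Fin k]→L[ℝ] ℂ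

/-- The insertion of an endomorphism in one degree, as a continuous bilinear map. -/
def insCLM : ∀ k : ℕ,
    (E →L[ℝ] E) →L[ℝ] (E [⋀^Fin k]→L[ℝ] ℂ) →L[ℝ] (E [⋀^Fin k]→L[ℝ] ℂ)
  | 0 => 0
  | k + 1 => ((ContinuousLinearMap.compL ℝ (E →L[ℝ] E) (E →L[ℝ] E [⋀^Fin k]→L[ℝ] ℂ)
      (E [⋀^Fin (k + 1)]→L[ℝ] ℂ) (alternatizeUncurryFinCLM ℝ E ℂ)) ∘L
      (ContinuousLinearMap.compL ℝ E E (E [⋀^Fin k]→L[ℝ] ℂ)) ∘L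
      (curryLeftLI (𝕜 := ℝ) (E := E) (F := ℂ) (n := k)).toContinuousLinearMap).flip

/-- The contraction with a vector in one degree, as a continuous bilinear map. -/
def ctrCLM (k : ℕ) : E →L[ℝ] (E [⋀^Fin (k + 1)]→L[ℝ] ℂ) →L[ℝ] (E [⋀^Fin k]→L[ℝ] ℂ) :=
  (curryLeftLI (𝕜 := ℝ) (E := E) (F := ℂ) (n := k)).toContinuousLinearMap.flip

namespace MixAlt

theorem insCLM_apply (A : E →L[ℝ] E) (b : MixAlt E) (k : ℕ) : insCLM k A (b k) = ins A b k := by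
  cases k <;> rfl

/-- The value of a family at a vector. -/
def famApp (T : MixFam E) (v : E) : MixAlt E := fun k => T k v

theorem ext_famApp {S T : MixFam E} (h : ∀ v, famApp S v = famApp T v) : S = T := by
  funext k; ext1 v; exact congrFun (h v) k

/-- The family `v ↦ T(A v)`. -/
def compFam (T : MixFam E) (A : E →L[ℝ] E) : MixFam E := fun k => T k ∘L A

/-- The family `v ↦ N_A T(v)` for the insertion operator `N_A`. -/
def insFam (A : E →L[ℝ] E) (T : MixFam E) : MixFam E := fun k => insCLM k A ∘L T k

/-- The family `v ↦ N_{S(v)} b`. -/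
def insFamL (S : E →L[ℝ] E →L[ℝ] E) (b : MixAlt E) : MixFam E :=
  fun k => ((insCLM k).flip (b k)) ∘L S

/-- The family `v ↦ i_{A v} b`. -/
def ctrFamL (A : E →L[ℝ] E) (b : MixAlt E) : MixFam E := fun k => (b (k + 1)).curryLeft ∘L A

@[simp] theorem famApp_add (S T : MixFam E) (v : E) :
    famApp (S + T) v = famApp S v + famApp T v := rfl
@[simp] theorem famApp_sub (S T : MixFam E) (v : E) :
    famApp (S - T) v = famApp S v - famApp T v := rfl
@[simp] theorem famApp_zero (v : E) : famApp (0 : MixFam E) v = 0 := rfl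
@[simp] theorem famApp_compFam (T : MixFam E) (A : E →L[ℝ] E) (v : E) :
    famApp (compFam T A) v = famApp T (A v) := rfl
@[simp] theorem famApp_ctrFamL (A : E →L[ℝ] E) (b : MixAlt E) (v : E) :
    famApp (ctrFamL A b) v = ctr (A v) b := rfl
@[simp] theorem famApp_ctrFam (x : E) (T : MixFam E) (v : E) :
    famApp (ctrFam x T) v = ctr x (famApp T v) := rfl
@[simp] theorem famApp_insFam (A : E →L[ℝ] E) (T : MixFam E) (v : E) :
    famApp (insFam A T) v = ins A (famApp T v) := by
  funext k; exact insCLM_apply A (famApp T v) k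
@[simp] theorem famApp_insFamL (S : E →L[ℝ] E →L[ℝ] E) (b : MixAlt E) (v : E) :
    famApp (insFamL S b) v = ins (S v) b := by
  funext k; exact insCLM_apply (S v) b k
@[simp] theorem famApp_wedgeL (T : MixFam E) (b : MixAlt E) (v : E) :
    famApp (wedgeL T b) v = wedge (famApp T v) b := funext fun k => wedgeL_apply T b k v
@[simp] theorem famApp_wedgeR (a : MixAlt E) (T : MixFam E) (v : E) :
    famApp (wedgeR a T) v = wedge a (famApp T v) := funext fun k => wedgeR_apply a T k v

/-- Alternatization as a linear map. -/
def altHom : MixFam E →ₗ[ℂ] MixAlt E where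
  toFun := alt
  map_add' := alt_add
  map_smul' := alt_smul

theorem altHom_apply (T : MixFam E) : altHom T = alt T := rfl

theorem ins_eq_altHom (A : E →L[ℝ] E) (b : MixAlt E) : ins A b = altHom (ctrFamL A b) := rfl

theorem ctr_altHom (T : MixFam E) (x : E) :
    ctr x (altHom T) = famApp T x - altHom (ctrFam x T) := ctr_alt' T x

/-- Insertions as linear maps. -/
def insHom (A : E →L[ℝ] E) : MixAlt E →ₗ[ℂ] MixAlt E where
  toFun := ins A
  map_add' := ins_add A
  map_smul' z b := ins_smul A z b

theorem ins_sub (A : E →L[ℝ] E) (b c : MixAlt E) : ins A (b - c) = ins A b - ins A c :=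
  (insHom A).map_sub b c

theorem ins_zero (A : E →L[ℝ] E) : ins A (0 : MixAlt E) = 0 := (insHom A).map_zero

theorem ins_neg_left (A : E →L[ℝ] E) (b : MixAlt E) : ins (-A) b = -ins A b := by
  refine (AddMonoidHom.mk' (fun A => ins A b) fun A A' => ?_).map_neg A
  exact ins_add_left A A' b

theorem ins_sub_left (A B : E →L[ℝ] E) (b : MixAlt E) : ins (A - B) b = ins A b - ins B b := by
  rw [sub_eq_add_neg, ins_add_left, ins_neg_left, sub_eq_add_neg]

theorem ins_altHom (A : E →L[ℝ] E) (T : MixFam E) :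
    ins A (altHom T) = altHom (compFam T A + insFam A T) := by
  funext k
  induction k generalizing T with
  | zero => rfl
  | succ k ih =>
    refine eq_succ_of_ctr fun x => ?_
    have h1 := ih (ctrFam x T)
    have h2 : ctrFam x (compFam T A + insFam A T) =
        compFam (ctrFam x T) A + insFam A (ctrFam x T) + ctrFam (A x) T := by
      refine ext_famApp fun v => ?_
      simp only [famApp_ctrFam, famApp_add, famApp_compFam, famApp_insFam, ctr_add, ctr_ins]
      abel
    rw [ctr_ins, ctr_altHom, ctr_altHom, ctr_altHom, h2, map_add, ins_sub]
    simp only [famApp_add, famApp_compFam, famApp_insFam, Pi.add_apply, Pi.sub_apply] at h1 ⊢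
    rw [h1]
    abel

/-- The alternatization of `v ↦ N_{S(v)} b` only depends on the antisymmetrization of `S`, so it
vanishes if `S(v) w - S(w) v` contracts `b` to zero. -/
theorem altHom_insFamL_eq_zero {S : E →L[ℝ] E →L[ℝ] E} {b : MixAlt E}
    (h : ∀ v w, ctr (S v w - S w v) b = 0) : altHom (insFamL S b) = 0 := by
  funext k
  induction k generalizing b with
  | zero => rfl
  | succ k ih =>
    refine eq_succ_of_ctr fun x => ?_
    have h1 : ctrFam x (insFamL S b) = ctrFamL (S x) b + insFamL S (ctr x b) := by
      refine ext_famApp fun v => ?_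
      simp only [famApp_ctrFam, famApp_insFamL, famApp_add, famApp_ctrFamL, ctr_ins]
      have := h v x
      rw [sub_eq_add_neg, ctr_add_left, ctr_neg_left, ← sub_eq_add_neg, sub_eq_zero] at this
      rw [this]
    have h2 := ih (b := ctr x b) fun v w => by
      rw [ctr_ctr_swap, h, ctr_zero, neg_zero]
    rw [ctr_altHom, h1, map_add, ← ins_eq_altHom, famApp_insFamL, ctr_zero]
    simp only [Pi.sub_apply, Pi.add_apply, h2]
    rw [Pi.zero_apply, add_zero, sub_self]

end MixAlt

/-- `T` is the derivative at `y` of the form of mixed degree `b` on a vector space. -/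
def HasFormDerivAt (b : E → MixAlt E) (T : MixFam E) (y : E) : Prop :=
  ∀ k, HasFDerivAt (fun y => b y k) (T k) y

namespace HasFormDerivAt

open MixAlt

variable {b c : E → MixAlt E} {S T : MixFam E} {y : E}

theorem congr (h : HasFormDerivAt b T y) (hc : c =ᶠ[nhds y] b) : HasFormDerivAt c T y :=
  fun k => (h k).congr_of_eventuallyEq (hc.mono fun _ hz => congrFun hz k)

theorem add (hb : HasFormDerivAt b S y) (hc : HasFormDerivAt c T y) :
    HasFormDerivAt (fun z => b z + c z) (S + T) y := fun k => (hb k).add (hc k)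

theorem const_smul (hb : HasFormDerivAt b S y) (r : ℂ) :
    HasFormDerivAt (fun z => r • b z) (r • S) y := fun k => (hb k).const_smul r

theorem ctr {X : E → E} {X' : E →L[ℝ] E} (hX : HasFDerivAt X X' y) (hb : HasFormDerivAt b T y) :
    HasFormDerivAt (fun z => MixAlt.ctr (X z) (b z)) (ctrFamL X' (b y) + ctrFam (X y) T) y := by
  intro k
  have h1 := (ctrCLM (E := E) k).hasFDerivAt_of_bilinear hX (hb (k + 1))
  refine h1.congr_fderiv ?_
  rw [add_comm]
  rfl

theorem ins {A : E → E →L[ℝ] E} {A' : E →L[ℝ] E →L[ℝ] E} (hA : HasFDerivAt A A' y)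
    (hb : HasFormDerivAt b T y) :
    HasFormDerivAt (fun z => MixAlt.ins (A z) (b z)) (insFamL A' (b y) + insFam (A y) T) y := by
  intro k
  have h1 := (insCLM (E := E) k).hasFDerivAt_of_bilinear hA (hb k)
  rw [show (fun z => MixAlt.ins (A z) (b z) k) = fun z => insCLM k (A z) (b z k) from
    funext fun z => (insCLM_apply _ _ _).symm]
  refine h1.congr_fderiv ?_
  rw [add_comm]
  rfl

theorem wedge (hb : HasFormDerivAt b S y) (hc : HasFormDerivAt c T y) :
    HasFormDerivAt (fun z => MixAlt.wedge (b z) (c z)) (wedgeL S (c y) + wedgeR (b y) T) y := by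
  intro k
  have h1 := HasFDerivAt.fun_sum (u := Finset.univ) fun (i : Fin (k + 1)) _ =>
    (altWedgeCLM (E := E) (Nat.add_sub_of_le (Nat.le_of_lt_succ i.isLt))).hasFDerivAt_of_bilinear
      (hb i) (hc (k - i))
  refine h1.congr_fderiv ?_
  rw [Finset.sum_add_distrib, add_comm]
  rfl

end HasFormDerivAt

end Families

/-! ### Calculus of differential forms -/

section Calculus

open ContinuousAlternatingMap Set MixAlt

variable {E : Type*} [NormedAddCommGroup E] [NormedSpace ℝ E]
  {H : Type*} [TopologicalSpace H] {I : ModelWithCorners ℝ E H}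
  {M : Type*} [TopologicalSpace M] [ChartedSpace H M]

theorem contDiffOn_bilinear {V F G K : Type*} [NormedAddCommGroup V] [NormedSpace ℝ V]
    [NormedAddCommGroup F] [NormedSpace ℝ F] [NormedAddCommGroup G] [NormedSpace ℝ G]
    [NormedAddCommGroup K] [NormedSpace ℝ K] (L : F →L[ℝ] G →L[ℝ] K) {f : V → F} {g : V → G}
    {s : Set V} (hf : ContDiffOn ℝ ∞ f s) (hg : ContDiffOn ℝ ∞ g s) :
    ContDiffOn ℝ ∞ (fun y => L (f y) (g y)) s :=
  L.isBoundedBilinearMap.contDiff.comp_contDiffOn (hf.prodMk hg)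

theorem contDiffOn_clm_fderiv {V F K : Type*} [NormedAddCommGroup V] [NormedSpace ℝ V]
    [NormedAddCommGroup F] [NormedSpace ℝ F] [NormedAddCommGroup K] [NormedSpace ℝ K]
    (L : (V →L[ℝ] F) →L[ℝ] K) {f : V → F} {s : Set V} (hf : ContDiffOn ℝ ∞ f s) (hs : IsOpen s) :
    ContDiffOn ℝ ∞ (fun y => L (fderiv ℝ f y)) s :=
  L.contDiff.comp_contDiffOn (hf.fderiv_of_isOpen hs (by simp))

theorem IsSmooth.add {α β : ExtForm I M ℂ} (hα : IsSmooth α) (hβ : IsSmooth β) :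
    IsSmooth (α + β) := fun k x₀ => (hα k x₀).add (hβ k x₀)

theorem IsSmooth.const_smul {β : ExtForm I M ℂ} (hβ : IsSmooth β) (z : ℂ) :
    IsSmooth (z • β) := fun k x₀ => (hβ k x₀).const_smul z

theorem isSmooth_zero : IsSmooth (0 : ExtForm I M ℂ) := fun _ _ => contDiffOn_const (c := 0)

variable (I M) in
/-- The complex vector space of smooth forms of mixed degree. -/
def smoothForms : Submodule ℂ (ExtForm I M ℂ) where
  carrier := {β | IsSmooth β}
  add_mem' := IsSmooth.add
  zero_mem' := isSmooth_zero
  smul_mem' z _ h := h.const_smul z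

theorem IsSmooth.wedge {α β : ExtForm I M ℂ} (hα : IsSmooth α) (hβ : IsSmooth β) :
    IsSmooth (wedge α β) := by
  intro k x₀
  have h : ContDiffOn ℝ ∞ (fun y => ∑ i : Fin (k + 1),
      altWedgeCLM (Nat.add_sub_of_le (Nat.le_of_lt_succ i.isLt)) (inChart (α i) x₀ y)
        (inChart (β (k - i)) x₀ y)) (extChartAt I x₀).target := by
    refine ContDiffOn.sum fun i _ => ?_
    exact contDiffOn_bilinear _ (hα i x₀) (hβ (k - i) x₀)
  refine h.congr fun y _ => ?_
  exact congrFun (chartForm_wedge α β x₀ y) k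

/-- Composition of fields of endomorphisms. -/
def compEnd (A B : EndField I M) : EndField I M := fun x => (A x).comp (B x)

theorem endAt_compEnd (A B : EndField I M) (x : M) :
    endAt (compEnd A B) x = endAt A x ∘L endAt B x := rfl

/-- The derivative of a field of endomorphisms at `x` in the chart at `x`. -/
def endD (A : EndField I M) (x : M) : E →L[ℝ] E →L[ℝ] E :=
  fderiv ℝ (chartEnd A x) (extChartAt I x x)

/-- The derivative of a vector field at `x` in the chart at `x`. -/
def fieldD (X : VField I M) (x : M) : E →L[ℝ] E :=
  fderiv ℝ (chartField X x) (extChartAt I x x)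

/-- The derivative of a form at `x` in the chart at `x`. -/
def formD (β : ExtForm I M ℂ) (x : M) : MixFam E :=
  fun k => fderiv ℝ (fun y => chartForm β x y k) (extChartAt I x x)

variable [IsManifold I ∞ M]

theorem chartEnd_compEnd (A B : EndField I M) {x₀ : M} {y : E} (hy : y ∈ (extChartAt I x₀).target) :
    chartEnd (compEnd A B) x₀ y = chartEnd A x₀ y ∘L chartEnd B x₀ y := by
  ext v
  have h (w : E) : symmD I x₀ y (chartD I x₀ ((extChartAt I x₀).symm y) w) = w :=
    congrArg (fun f : E →L[ℝ] E => f w) (symmD_comp_chartD hy)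
  simp only [chartEnd, endAt_compEnd, ContinuousLinearMap.comp_apply, h]

theorem IsSmooth.contract {X : VField I M} {β : ExtForm I M ℂ}
    (hX : ∀ x₀, ContDiffOn ℝ ∞ (chartField X x₀) (extChartAt I x₀).target) (hβ : IsSmooth β) :
    IsSmooth (contract X β) := by
  intro k x₀
  have h := contDiffOn_bilinear (ctrCLM k) (hX x₀) (hβ (k + 1) x₀)
  exact h.congr fun y hy => congrFun (chartForm_contract X β hy) k

theorem IsSmooth.insForm {A : EndField I M} {β : ExtForm I M ℂ} (hA : IsSmoothEnd A)
    (hβ : IsSmooth β) : IsSmooth (insForm A β) := by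
  intro k x₀
  have h := contDiffOn_bilinear (insCLM k) (hA x₀) (hβ k x₀)
  exact h.congr fun y hy => (congrFun (chartForm_insForm A β hy) k).trans
    (insCLM_apply _ (chartForm β x₀ y) k).symm

theorem IsSmoothEnd.compEnd {A B : EndField I M} (hA : IsSmoothEnd A) (hB : IsSmoothEnd B) :
    IsSmoothEnd (compEnd A B) := by
  intro x₀
  have h : ContDiffOn ℝ ∞ (fun y => chartEnd A x₀ y ∘L chartEnd B x₀ y) (extChartAt I x₀).target :=
    (hA x₀).clm_comp (hB x₀)
  exact h.congr fun y hy => chartEnd_compEnd A B hy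

variable [I.Boundaryless]

theorem IsSmooth.extD {β : ExtForm I M ℂ} (hβ : IsSmooth β) : IsSmooth (extD β) := by
  intro k x₀
  cases k with
  | zero => exact contDiffOn_const (c := 0)
  | succ k =>
    have h1 := contDiffOn_clm_fderiv (alternatizeUncurryFinCLM ℝ E ℂ (n := k)) (hβ k x₀)
      (isOpen_extChartAt_target x₀)
    exact h1.congr fun y hy => congrFun (chartForm_extD hβ hy) (k + 1)

theorem IsSmooth.hasFormDerivAt {β : ExtForm I M ℂ} (hβ : IsSmooth β) (x : M) :
    HasFormDerivAt (chartForm β x) (formD β x) (extChartAt I x x) :=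
  fun k => (chartForm_differentiableAt hβ k (mem_extChartAt_target x)).hasFDerivAt

theorem formAt_extD_of_hasFormDerivAt {β : ExtForm I M ℂ} (hβ : IsSmooth β) {x : M} {T : MixFam E}
    (h : HasFormDerivAt (chartForm β x) T (extChartAt I x x)) : formAt (extD β) x = altHom T := by
  rw [formAt_extD hβ, altHom_apply]
  congr 1
  funext k
  exact (h k).fderiv

theorem formAt_extD' {β : ExtForm I M ℂ} (hβ : IsSmooth β) (x : M) :
    formAt (extD β) x = altHom (formD β x) :=
  formAt_extD_of_hasFormDerivAt hβ (hβ.hasFormDerivAt x)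

theorem IsSmoothEnd.hasFDerivAt {A : EndField I M} (hA : IsSmoothEnd A) (x : M) :
    HasFDerivAt (chartEnd A x) (endD A x) (extChartAt I x x) :=
  (((hA x).contDiffAt (extChartAt_target_mem_nhds x)).differentiableAt (by simp)).hasFDerivAt

theorem chartField_hasFDerivAt {X : VField I M}
    (hX : ∀ x₀, ContDiffOn ℝ ∞ (chartField X x₀) (extChartAt I x₀).target) (x : M) :
    HasFDerivAt (chartField X x) (fieldD X x) (extChartAt I x x) :=
  (((hX x).contDiffAt (extChartAt_target_mem_nhds x)).differentiableAt (by simp)).hasFDerivAt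

theorem hasFormDerivAt_insForm {A : EndField I M} (hA : IsSmoothEnd A) {β : ExtForm I M ℂ} {x : M}
    {T : MixFam E} (h : HasFormDerivAt (chartForm β x) T (extChartAt I x x)) :
    HasFormDerivAt (chartForm (insForm A β) x)
      (insFamL (endD A x) (formAt β x) + insFam (endAt A x) T) (extChartAt I x x) := by
  rw [formAt_eq_chartForm, endAt_eq_chartEnd]
  refine ((h.ins (hA.hasFDerivAt x))).congr ?_
  filter_upwards [extChartAt_target_mem_nhds (I := I) x] with y hy using chartForm_insForm A β hy

theorem hasFormDerivAt_contract {X : VField I M}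
    (hX : ∀ x₀, ContDiffOn ℝ ∞ (chartField X x₀) (extChartAt I x₀).target) {β : ExtForm I M ℂ}
    {x : M} {T : MixFam E} (h : HasFormDerivAt (chartForm β x) T (extChartAt I x x)) :
    HasFormDerivAt (chartForm (contract X β) x)
      (ctrFamL (fieldD X x) (formAt β x) + ctrFam (fieldAt X x) T) (extChartAt I x x) := by
  rw [formAt_eq_chartForm, fieldAt_eq_chartField]
  refine (h.ctr (chartField_hasFDerivAt hX x)).congr ?_
  filter_upwards [extChartAt_target_mem_nhds (I := I) x] with y hy using chartForm_contract X β hy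

theorem hasFormDerivAt_wedge {α β : ExtForm I M ℂ} {x : M} {S T : MixFam E}
    (hα : HasFormDerivAt (chartForm α x) S (extChartAt I x x))
    (hβ : HasFormDerivAt (chartForm β x) T (extChartAt I x x)) :
    HasFormDerivAt (chartForm (wedge α β) x)
      (wedgeL S (formAt β x) + wedgeR (formAt α x) T) (extChartAt I x x) := by
  rw [formAt_eq_chartForm, formAt_eq_chartForm]
  exact (hα.wedge hβ).congr (Filter.Eventually.of_forall fun y => chartForm_wedge α β x y)

theorem hasFDerivAt_chartEnd_compEnd {A B : EndField I M} (hA : IsSmoothEnd A)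
    (hB : IsSmoothEnd B) (x : M) (v : E) :
    endD (compEnd A B) x v = endD A x v ∘L endAt B x + endAt A x ∘L endD B x v := by
  have h1 := (hA.hasFDerivAt x).clm_comp (hB.hasFDerivAt x)
  have h2 := h1.congr_of_eventuallyEq (f₁ := chartEnd (compEnd A B) x) (by
    filter_upwards [extChartAt_target_mem_nhds (I := I) x] with y hy using chartEnd_compEnd A B hy)
  rw [endD, h2.fderiv, endAt_eq_chartEnd, endAt_eq_chartEnd]
  ext w
  simp [add_comm]

theorem extD_add {α β : ExtForm I M ℂ} (hα : IsSmooth α) (hβ : IsSmooth β) :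
    extD (α + β) = extD α + extD β := by
  refine ext_formAt fun x => ?_
  rw [formAt_extD_of_hasFormDerivAt (hα.add hβ) ((hα.hasFormDerivAt x).add (hβ.hasFormDerivAt x)),
    map_add, formAt_add, formAt_extD' hα, formAt_extD' hβ]

theorem extD_smul (z : ℂ) {β : ExtForm I M ℂ} (hβ : IsSmooth β) :
    extD (z • β) = z • extD β := by
  refine ext_formAt fun x => ?_
  rw [formAt_extD_of_hasFormDerivAt (hβ.const_smul z) ((hβ.hasFormDerivAt x).const_smul z),
    map_smul, formAt_smul, formAt_extD' hβ]

theorem extD_extD {β : ExtForm I M ℂ} (hβ : IsSmooth β) : extD (extD β) = 0 := by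
  refine ext_formAt fun x => ?_
  rw [formAt_extD hβ.extD, formAt_zero]
  funext k
  match k with
  | 0 => rfl
  | 1 =>
    have h : (fun y => chartForm (extD β) x y 0) = fun _ => 0 := by
      funext y
      rw [chartForm_eq]
      rfl
    change alternatizeUncurryFin (fderiv ℝ (fun y => chartForm (extD β) x y 0) _) = 0
    rw [h, fderiv_fun_const]
    exact (alternatizeUncurryFinCLM ℝ E ℂ (n := 0)).map_zero
  | k + 2 =>
    have h : (fun y => chartForm (extD β) x y (k + 1)) =ᶠ[nhds (extChartAt I x x)]
        extDeriv (fun y => chartForm β x y k) := by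
      filter_upwards [extChartAt_target_mem_nhds (I := I) x] with y hy
      exact congrFun (chartForm_extD hβ hy) (k + 1)
    change extDeriv (fun y => chartForm (extD β) x y (k + 1)) _ = 0
    rw [h.extDeriv_eq]
    refine extDeriv_extDeriv_apply (r := ∞)
      ((hβ k x).contDiffAt (extChartAt_target_mem_nhds x)) ?_
    rw [minSmoothness_of_isRCLikeNormedField]
    exact WithTop.coe_le_coe.2 (le_top : (2 : ℕ∞) ≤ ⊤)

/-- The Leibniz rule. -/
theorem extD_wedge {α β : ExtForm I M ℂ} (hα : IsSmooth α) (hβ : IsSmooth β) :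
    extD (wedge α β) = wedge (extD α) β + wedge (sgnForm α) (extD β) := by
  refine ext_formAt fun x => ?_
  rw [formAt_extD_of_hasFormDerivAt (hα.wedge hβ)
    (hasFormDerivAt_wedge (hα.hasFormDerivAt x) (hβ.hasFormDerivAt x)), map_add, formAt_add,
    formAt_wedge, formAt_wedge, formAt_sgnForm, formAt_extD' hα, formAt_extD' hβ]
  exact congrArg₂ _ (alt_wedgeL _ _) (alt_wedgeR _ _)

/-- The Lie derivative in a chart. -/
theorem formAt_lieD {X : VField I M}
    (hX : ∀ x₀, ContDiffOn ℝ ∞ (chartField X x₀) (extChartAt I x₀).target) {β : ExtForm I M ℂ}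
    (hβ : IsSmooth β) {x : M} {T : MixFam E}
    (hT : HasFormDerivAt (chartForm β x) T (extChartAt I x x)) :
    formAt (lieD X β) x = famApp T (fieldAt X x) + ins (fieldD X x) (formAt β x) := by
  rw [lieD, formAt_add, formAt_contract, formAt_extD_of_hasFormDerivAt hβ hT, ctr_altHom,
    formAt_extD_of_hasFormDerivAt (hβ.contract hX) (hasFormDerivAt_contract hX hT), map_add,
    ← ins_eq_altHom]
  abel

/-- Two vector fields commute if their chart expressions do; then so do the Lie derivative along one
and the contraction with the other. -/
theorem lieD_contract {X Y : VField I M}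
    (hX : ∀ x₀, ContDiffOn ℝ ∞ (chartField X x₀) (extChartAt I x₀).target)
    (hY : ∀ x₀, ContDiffOn ℝ ∞ (chartField Y x₀) (extChartAt I x₀).target)
    (h : ∀ x, fieldD Y x (fieldAt X x) = fieldD X x (fieldAt Y x))
    {β : ExtForm I M ℂ} (hβ : IsSmooth β) :
    lieD X (contract Y β) = contract Y (lieD X β) := by
  refine ext_formAt fun x => ?_
  have hT := hβ.hasFormDerivAt x
  rw [formAt_contract, formAt_lieD hX (hβ.contract hY) (hasFormDerivAt_contract hY hT),
    formAt_contract, formAt_lieD hX hβ hT]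
  simp only [famApp_add, famApp_ctrFamL, famApp_ctrFam, ctr_add, ctr_ins, h x]
  abel

theorem lieD_wedge {X : VField I M}
    (hX : ∀ x₀, ContDiffOn ℝ ∞ (chartField X x₀) (extChartAt I x₀).target)
    {α β : ExtForm I M ℂ} (hα : IsSmooth α) (hβ : IsSmooth β) :
    lieD X (wedge α β) = wedge (lieD X α) β + wedge α (lieD X β) := by
  refine ext_formAt fun x => ?_
  have hS := hα.hasFormDerivAt x
  have hT := hβ.hasFormDerivAt x
  rw [formAt_lieD hX (hα.wedge hβ) (hasFormDerivAt_wedge hS hT), formAt_add, formAt_wedge,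
    formAt_wedge, formAt_wedge, formAt_lieD hX hβ hT, formAt_lieD hX hα hS]
  simp only [famApp_add, famApp_wedgeL, famApp_wedgeR, ins_wedge, wedge_add_left, wedge_add_right]
  abel

/-- The Lie derivative along `X` commutes with the insertion of `A` if `L_X A = 0`. -/
theorem lieD_insForm {X : VField I M}
    (hX : ∀ x₀, ContDiffOn ℝ ∞ (chartField X x₀) (extChartAt I x₀).target)
    {A : EndField I M} (hA : IsSmoothEnd A)
    (h : ∀ x, endD A x (fieldAt X x) = fieldD X x ∘L endAt A x - endAt A x ∘L fieldD X x)
    {β : ExtForm I M ℂ} (hβ : IsSmooth β) :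
    lieD X (insForm A β) = insForm A (lieD X β) := by
  refine ext_formAt fun x => ?_
  have hT := hβ.hasFormDerivAt x
  rw [formAt_lieD hX (hβ.insForm hA) (hasFormDerivAt_insForm hA hT), formAt_insForm,
    formAt_insForm, formAt_lieD hX hβ hT]
  simp only [famApp_add, famApp_insFamL, famApp_insFam, ins_add, h x, ins_sub_left]
  linear_combination (norm := module) -ins_comm (endAt A x) (fieldD X x) (formAt β x)

/-- The Frölicher–Nijenhuis bracket of two fields of endomorphisms, in a chart. -/
def frolicher (A B : EndField I M) (x : M) (v w : E) : E :=
  (-endD B x (endAt A x v) w - endD A x (endAt B x v) w + endAt A x (endD B x v w)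
    + endAt B x (endD A x v w)) -
  (-endD B x (endAt A x w) v - endD A x (endAt B x w) v + endAt A x (endD B x w v)
    + endAt B x (endD A x w v))

/-- If the Frölicher–Nijenhuis bracket of `A` and `B` contracts `β` to zero, then
`[N_A, [N_B, d]] = [N_{BA}, d]` on `β`, where `N` denotes insertion. -/
theorem insForm_insForm_extD {A B : EndField I M} (hA : IsSmoothEnd A) (hB : IsSmoothEnd B)
    {β : ExtForm I M ℂ} (hβ : IsSmooth β)
    (h : ∀ x v w, ctr (frolicher A B x v w) (formAt β x) = 0) :
    insForm A (insForm B (extD β)) - insForm A (extD (insForm B β)) -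
      insForm B (extD (insForm A β)) + extD (insForm B (insForm A β)) =
    insForm (compEnd B A) (extD β) - extD (insForm (compEnd B A) β) := by
  rw [← sub_eq_zero]
  refine ext_formAt fun x => ?_
  have hT := hβ.hasFormDerivAt x
  set T := formD β x with hTdef
  have hBA := hB.compEnd hA
  have e1 := formAt_extD_of_hasFormDerivAt hβ hT
  have e2 := formAt_extD_of_hasFormDerivAt (hβ.insForm hB) (hasFormDerivAt_insForm hB hT)
  have e3 := formAt_extD_of_hasFormDerivAt (hβ.insForm hA) (hasFormDerivAt_insForm hA hT)
  have e4 := formAt_extD_of_hasFormDerivAt ((hβ.insForm hA).insForm hB)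
    (hasFormDerivAt_insForm hB (hasFormDerivAt_insForm hA hT))
  have e5 := formAt_extD_of_hasFormDerivAt (hβ.insForm hBA) (hasFormDerivAt_insForm hBA hT)
  let S : E →L[ℝ] E →L[ℝ] E :=
    -endD B x ∘L endAt A x - endD A x ∘L endAt B x
      + ContinuousLinearMap.compL ℝ E E E (endAt A x) ∘L endD B x
      + ContinuousLinearMap.compL ℝ E E E (endAt B x) ∘L endD A x
  have hS : altHom (insFamL S (formAt β x)) = 0 := altHom_insFamL_eq_zero fun v w => h x v w
  change ins (endAt A x) (ins (endAt B x) (formAt (extD β) x)) -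
    ins (endAt A x) (formAt (extD (insForm B β)) x) -
    ins (endAt B x) (formAt (extD (insForm A β)) x) + formAt (extD (insForm B (insForm A β))) x -
    (ins (endAt B x ∘L endAt A x) (formAt (extD β) x) -
      formAt (extD (insForm (compEnd B A) β)) x) = 0
  rw [e1, e2, e3, e4, e5, ← hS]
  simp only [ins_altHom, ← map_add, ← map_sub]
  congr 1
  refine ext_famApp fun v => ?_
  have hSv : S v = -endD B x (endAt A x v) - endD A x (endAt B x v) + endAt A x ∘L endD B x v
    + endAt B x ∘L endD A x v := rfl
  simp only [famApp_add, famApp_sub, famApp_compFam, famApp_insFam, famApp_insFamL, ins_add, hSv,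
    formAt_insForm, hasFDerivAt_chartEnd_compEnd hB hA, ins_add_left, ins_sub_left, ins_neg_left,
    endAt_compEnd, ContinuousLinearMap.comp_apply]
  linear_combination (norm := module) -ins_comm (endAt A x) (endD B x v) (formAt β x)

end Calculus

/-! ### Functions of a diagonalizable operator with natural eigenvalues -/

section Twist

open Polynomial

variable {V : Type*} [AddCommGroup V] [Module ℂ V]

/-- The spectral projection of `T` to the eigenvalue `m`, if the eigenvalues are `0, …, n`. -/
def eigenProj (T : Module.End ℂ V) (n m : ℕ) : Module.End ℂ V :=
  aeval T (Lagrange.basis (Finset.range (n + 1)) (fun j : ℕ => (j : ℂ)) m)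

/-- The operator `c ^ T`, for an operator `T` which is diagonalizable with eigenvalues
`0, …, n`. -/
def twist (T : Module.End ℂ V) (n : ℕ) (c : ℂ) : Module.End ℂ V :=
  ∑ m ∈ Finset.range (n + 1), c ^ m • eigenProj T n m

variable {T : Module.End ℂ V} {n : ℕ}

theorem sum_eigenProj (x : V) : ∑ m ∈ Finset.range (n + 1), eigenProj T n m x = x := by
  have h := Lagrange.sum_basis (s := Finset.range (n + 1)) (v := fun j : ℕ => (j : ℂ))
    (fun i _ j _ h => Nat.cast_injective h) ⟨0, by simp⟩
  have := congrArg (fun P => aeval T P x) h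
  simpa [eigenProj, map_sum] using this

/-- The Lagrange basis polynomial of `m`, multiplied by `X - m`, is a multiple of the polynomial
that annihilates `T`. -/
theorem apply_eigenProj (hT : aeval T (∏ j ∈ Finset.range (n + 1), (X - C (j : ℂ))) = 0) {m : ℕ}
    (hm : m ∈ Finset.range (n + 1)) (x : V) : T (eigenProj T n m x) = (m : ℂ) • eigenProj T n m x := by
  have h : (X - C (m : ℂ)) * Lagrange.basis (Finset.range (n + 1)) (fun j : ℕ => (j : ℂ)) m =
      C (∏ j ∈ (Finset.range (n + 1)).erase m, ((m : ℂ) - j)⁻¹) *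
        ∏ j ∈ Finset.range (n + 1), (X - C (j : ℂ)) := by
    rw [Lagrange.basis, ← Finset.mul_prod_erase _ _ hm, map_prod]
    simp only [Lagrange.basisDivisor, Finset.prod_mul_distrib]
    ring
  have h2 := congrArg (fun P => aeval T P x) h
  simp only [map_mul, hT, mul_zero, Module.End.mul_apply, map_sub, aeval_X, aeval_C,
    LinearMap.zero_apply, LinearMap.sub_apply, Module.algebraMap_end_apply] at h2
  exact sub_eq_zero.1 h2

theorem eigenProj_eigen {m : ℕ} (hm : m ∈ Finset.range (n + 1)) {k : ℕ} {x : V}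
    (hx : T x = (k : ℂ) • x) (hk : k ∈ Finset.range (n + 1)) :
    eigenProj T n m x = if k = m then x else 0 := by
  have h1 (P : ℂ[X]) : aeval T P x = P.eval (k : ℂ) • x := by
    induction P using Polynomial.induction_on' with
    | add P Q hP hQ => simp [hP, hQ, add_smul]
    | monomial r z =>
      have : (T ^ r) x = (k : ℂ) ^ r • x := by
        induction r with
        | zero => simp
        | succ r ih => rw [pow_succ, Module.End.mul_apply, hx, map_smul, ih, smul_smul, pow_succ,
            mul_comm]
      simp [aeval_monomial, this, smul_smul, mul_comm]
  rw [eigenProj, h1]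
  split_ifs with h
  · subst h
    rw [Lagrange.eval_basis_self (fun i _ j _ h => by exact_mod_cast h) hk, one_smul]
  · rw [Lagrange.eval_basis_of_ne (fun h' => h h'.symm) hk, zero_smul]

theorem eigen_eq_zero (hT : aeval T (∏ j ∈ Finset.range (n + 1), (X - C (j : ℂ))) = 0) {k : ℕ}
    {x : V} (hx : T x = (k : ℂ) • x) (hk : k ∉ Finset.range (n + 1)) : x = 0 := by
  rw [← sum_eigenProj (T := T) (n := n) x]
  refine Finset.sum_eq_zero fun m hm => ?_
  have h1 : eigenProj T n m (T x) = T (eigenProj T n m x) := by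
    have : Commute (aeval T (Lagrange.basis (Finset.range (n + 1)) (fun j : ℕ => (j : ℂ)) m)) T := by
      conv_rhs => rw [← aeval_X (R := ℂ) T]
      rw [Commute, SemiconjBy, ← map_mul, ← map_mul, mul_comm]
    exact congrArg (fun f : Module.End ℂ V => f x) this.eq
  rw [hx, map_smul, apply_eigenProj hT hm, ← sub_eq_zero, ← sub_smul, smul_eq_zero] at h1
  refine h1.resolve_left fun h => hk ?_
  rw [sub_eq_zero] at h
  have : k = m := by exact_mod_cast h
  rwa [this]

theorem twist_eigen (hT : aeval T (∏ j ∈ Finset.range (n + 1), (X - C (j : ℂ))) = 0) (c : ℂ) {k : ℕ}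
    {x : V} (hx : T x = (k : ℂ) • x) : twist T n c x = c ^ k • x := by
  by_cases hk : k ∈ Finset.range (n + 1)
  · rw [twist, LinearMap.sum_apply, Finset.sum_eq_single k]
    · rw [LinearMap.smul_apply, eigenProj_eigen hk hx hk, if_pos rfl]
    · intro m hm hmk
      rw [LinearMap.smul_apply, eigenProj_eigen hm hx hk, if_neg (Ne.symm hmk), smul_zero]
    · exact fun h => absurd hk h
  · rw [eigen_eq_zero hT hx hk, map_zero, smul_zero]

theorem eigenProj_mem {W : Submodule ℂ V} (hW : ∀ x ∈ W, T x ∈ W) {x : V} (hx : x ∈ W) (m : ℕ) :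
    eigenProj T n m x ∈ W := by
  have h1 (P : ℂ[X]) : aeval T P x ∈ W := by
    induction P using Polynomial.induction_on' with
    | add P Q hP hQ => rw [map_add]; exact W.add_mem hP hQ
    | monomial r z =>
      have : (T ^ r) x ∈ W := by
        induction r with
        | zero => simpa
        | succ r ih => rw [pow_succ', Module.End.mul_apply]; exact hW _ ih
      simpa [aeval_monomial] using W.smul_mem z this
  exact h1 _

theorem twist_mem {W : Submodule ℂ V} (hW : ∀ x ∈ W, T x ∈ W) (c : ℂ) {x : V} (hx : x ∈ W) :
    twist T n c x ∈ W := by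
  rw [twist, LinearMap.sum_apply]
  exact W.sum_mem fun m _ => W.smul_mem _ (eigenProj_mem hW hx m)

/-- If `g` raises eigenvalues of `T` by `s`, then `c ^ T g = c ^ s g c ^ T`. -/
theorem twist_comm (hT : aeval T (∏ j ∈ Finset.range (n + 1), (X - C (j : ℂ))) = 0) (c : ℂ)
    {W : Submodule ℂ V} (hW : ∀ x ∈ W, T x ∈ W) (g : V →ₗ[ℂ] V) (s : ℕ)
    (hg : ∀ x ∈ W, T (g x) = g (T x) + (s : ℂ) • g x) {x : V} (hx : x ∈ W) :
    twist T n c (g x) = c ^ s • g (twist T n c x) := by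
  have h : ∀ m ∈ Finset.range (n + 1), twist T n c (g (eigenProj T n m x)) =
      c ^ s • g (twist T n c (eigenProj T n m x)) := by
    intro m hm
    have h1 := apply_eigenProj hT hm x
    have h2 := hg _ (eigenProj_mem (n := n) hW hx m)
    rw [h1, map_smul, ← add_smul] at h2
    rw [twist_eigen hT c h1, twist_eigen hT c (k := m + s) (by rw [h2]; push_cast; rfl), map_smul,
      smul_smul, pow_add, mul_comm]
  have h' := Finset.sum_congr rfl h
  simp only [← map_sum, ← Finset.smul_sum] at h'
  rwa [sum_eigenProj] at h'

theorem twist_twist_inv (hT : aeval T (∏ j ∈ Finset.range (n + 1), (X - C (j : ℂ))) = 0) {c : ℂ}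
    (hc : c ≠ 0) (x : V) : twist T n c (twist T n c⁻¹ x) = x := by
  have h : ∀ m ∈ Finset.range (n + 1), twist T n c (twist T n c⁻¹ (eigenProj T n m x)) =
      eigenProj T n m x := by
    intro m hm
    have h1 := apply_eigenProj hT hm x
    rw [twist_eigen hT _ h1, map_smul, twist_eigen hT _ h1, smul_smul, ← mul_pow,
      inv_mul_cancel₀ hc, one_pow, one_smul]
  have h' := Finset.sum_congr rfl h
  simp only [← map_sum] at h'
  rwa [sum_eigenProj] at h'

end Twist

/-! ### The algebra of operators on the forms of a product of two Sasakian manifolds -/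

section Operators

open Polynomial

/-- The operators on the smooth forms of a product of two Sasakian manifolds, with the relations
that the argument uses: the exterior derivative `d`, the contractions `i₁`, `i₂` with the Reeb
fields, the products `e₁`, `e₂` with the contact forms, the insertions `N₁`, `N₂` of the transverse
complex structures and `P` of the projection to the contact distribution of the first factor, and
the degree `D`. -/
structure SasakiOps (V : Type*) [AddCommGroup V] [Module ℂ V] where
  d : V →ₗ[ℂ] V
  i₁ : V →ₗ[ℂ] V
  i₂ : V →ₗ[ℂ] V
  e₁ : V →ₗ[ℂ] V
  e₂ : V →ₗ[ℂ] V
  N₁ : V →ₗ[ℂ] V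
  N₂ : V →ₗ[ℂ] V
  P : V →ₗ[ℂ] V
  D : V →ₗ[ℂ] V
  d_d : ∀ x, d (d x) = 0
  i₁_i₁ : ∀ x, i₁ (i₁ x) = 0
  i₂_i₂ : ∀ x, i₂ (i₂ x) = 0
  i₂_i₁ : ∀ x, i₂ (i₁ x) = -i₁ (i₂ x)
  e₁_e₁ : ∀ x, e₁ (e₁ x) = 0
  e₂_e₂ : ∀ x, e₂ (e₂ x) = 0
  e₂_e₁ : ∀ x, e₂ (e₁ x) = -e₁ (e₂ x)
  i₁_e₁ : ∀ x, i₁ (e₁ x) = x - e₁ (i₁ x)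
  i₂_e₂ : ∀ x, i₂ (e₂ x) = x - e₂ (i₂ x)
  i₁_e₂ : ∀ x, i₁ (e₂ x) = -e₂ (i₁ x)
  i₂_e₁ : ∀ x, i₂ (e₁ x) = -e₁ (i₂ x)
  L₁_i₂ : ∀ x, d (i₁ (i₂ x)) + i₁ (d (i₂ x)) = i₂ (d (i₁ x)) + i₂ (i₁ (d x))
  L₂_i₁ : ∀ x, d (i₂ (i₁ x)) + i₂ (d (i₁ x)) = i₁ (d (i₂ x)) + i₁ (i₂ (d x))
  L₁_e₁ : ∀ x, d (i₁ (e₁ x)) + i₁ (d (e₁ x)) = e₁ (d (i₁ x)) + e₁ (i₁ (d x))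
  L₁_e₂ : ∀ x, d (i₁ (e₂ x)) + i₁ (d (e₂ x)) = e₂ (d (i₁ x)) + e₂ (i₁ (d x))
  L₂_e₁ : ∀ x, d (i₂ (e₁ x)) + i₂ (d (e₁ x)) = e₁ (d (i₂ x)) + e₁ (i₂ (d x))
  L₂_e₂ : ∀ x, d (i₂ (e₂ x)) + i₂ (d (e₂ x)) = e₂ (d (i₂ x)) + e₂ (i₂ (d x))
  L₁_N₁ : ∀ x, d (i₁ (N₁ x)) + i₁ (d (N₁ x)) = N₁ (d (i₁ x)) + N₁ (i₁ (d x))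
  L₁_N₂ : ∀ x, d (i₁ (N₂ x)) + i₁ (d (N₂ x)) = N₂ (d (i₁ x)) + N₂ (i₁ (d x))
  L₂_N₁ : ∀ x, d (i₂ (N₁ x)) + i₂ (d (N₁ x)) = N₁ (d (i₂ x)) + N₁ (i₂ (d x))
  L₂_N₂ : ∀ x, d (i₂ (N₂ x)) + i₂ (d (N₂ x)) = N₂ (d (i₂ x)) + N₂ (i₂ (d x))
  L₁_P : ∀ x, d (i₁ (P x)) + i₁ (d (P x)) = P (d (i₁ x)) + P (i₁ (d x))
  L₂_P : ∀ x, d (i₂ (P x)) + i₂ (d (P x)) = P (d (i₂ x)) + P (i₂ (d x))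
  N₂_N₁ : ∀ x, N₂ (N₁ x) = N₁ (N₂ x)
  P_N₁ : ∀ x, P (N₁ x) = N₁ (P x)
  P_N₂ : ∀ x, P (N₂ x) = N₂ (P x)
  N₁_e₁ : ∀ x, N₁ (e₁ x) = e₁ (N₁ x)
  N₁_e₂ : ∀ x, N₁ (e₂ x) = e₂ (N₁ x)
  N₂_e₁ : ∀ x, N₂ (e₁ x) = e₁ (N₂ x)
  N₂_e₂ : ∀ x, N₂ (e₂ x) = e₂ (N₂ x)
  P_e₁ : ∀ x, P (e₁ x) = e₁ (P x)
  P_e₂ : ∀ x, P (e₂ x) = e₂ (P x)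
  i₁_N₁ : ∀ x, i₁ (N₁ x) = N₁ (i₁ x)
  i₁_N₂ : ∀ x, i₁ (N₂ x) = N₂ (i₁ x)
  i₂_N₁ : ∀ x, i₂ (N₁ x) = N₁ (i₂ x)
  i₂_N₂ : ∀ x, i₂ (N₂ x) = N₂ (i₂ x)
  i₁_P : ∀ x, i₁ (P x) = P (i₁ x)
  i₂_P : ∀ x, i₂ (P x) = P (i₂ x)
  D_d : ∀ x, D (d x) = d (D x) + d x
  D_e₁ : ∀ x, D (e₁ x) = e₁ (D x) + e₁ x
  D_e₂ : ∀ x, D (e₂ x) = e₂ (D x) + e₂ x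
  i₁_D : ∀ x, i₁ (D x) = D (i₁ x) + i₁ x
  i₂_D : ∀ x, i₂ (D x) = D (i₂ x) + i₂ x
  D_N₁ : ∀ x, D (N₁ x) = N₁ (D x)
  D_N₂ : ∀ x, D (N₂ x) = N₂ (D x)
  D_P : ∀ x, D (P x) = P (D x)
  N₁_w₁ : ∀ x, N₁ (d (e₁ x) + e₁ (d x)) = d (e₁ (N₁ x)) + e₁ (d (N₁ x))
  N₁_w₂ : ∀ x, N₁ (d (e₂ x) + e₂ (d x)) = d (e₂ (N₁ x)) + e₂ (d (N₁ x))
  N₂_w₁ : ∀ x, N₂ (d (e₁ x) + e₁ (d x)) = d (e₁ (N₂ x)) + e₁ (d (N₂ x))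
  N₂_w₂ : ∀ x, N₂ (d (e₂ x) + e₂ (d x)) = d (e₂ (N₂ x)) + e₂ (d (N₂ x))
  P_w₁ : ∀ x, P (d (e₁ x) + e₁ (d x)) =
    d (e₁ (P x)) + e₁ (d (P x)) + (2 : ℂ) • (d (e₁ x) + e₁ (d x))
  P_w₂ : ∀ x, P (d (e₂ x) + e₂ (d x)) = d (e₂ (P x)) + e₂ (d (P x))
  e₁_w₂ : ∀ x, e₁ (d (e₂ x) + e₂ (d x)) = d (e₂ (e₁ x)) + e₂ (d (e₁ x))
  e₂_w₁ : ∀ x, e₂ (d (e₁ x) + e₁ (d x)) = d (e₁ (e₂ x)) + e₁ (d (e₂ x))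
  FN₁₁ : ∀ x, i₁ x = 0 → i₂ x = 0 →
    N₁ (N₁ (d x)) - N₁ (d (N₁ x)) - N₁ (d (N₁ x)) + d (N₁ (N₁ x)) = d (P x) - P (d x)
  FN₁₂ : ∀ x, i₁ x = 0 → i₂ x = 0 →
    N₁ (N₂ (d x)) - N₁ (d (N₂ x)) - N₂ (d (N₁ x)) + d (N₁ (N₂ x)) = 0
  FN₂₂ : ∀ x, i₁ x = 0 → i₂ x = 0 →
    N₂ (N₂ (d x)) - N₂ (d (N₂ x)) - N₂ (d (N₂ x)) + d (N₂ (N₂ x)) =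
      d (D x) - D (d x) + e₁ (i₁ (d x)) + e₂ (i₂ (d x)) + P (d x) - d (P x)
  FNP₁ : ∀ x, i₁ x = 0 → i₂ x = 0 →
    P (N₁ (d x)) + e₁ (i₁ (N₁ (d x))) - P (d (N₁ x)) - e₁ (i₁ (d (N₁ x))) - N₁ (d (P x))
      + d (N₁ (P x)) = N₁ (d x) - d (N₁ x)
  FNP₂ : ∀ x, i₁ x = 0 → i₂ x = 0 →
    P (N₂ (d x)) + e₁ (i₁ (N₂ (d x))) - P (d (N₂ x)) - e₁ (i₁ (d (N₂ x))) - N₂ (d (P x))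
      + d (N₂ (P x)) = 0
  n : ℕ
  annihilated : aeval ((1 / 2 : ℂ) • (P - Complex.I • N₁) : Module.End ℂ V)
    (∏ j ∈ Finset.range (n + 1), (X - C (j : ℂ))) = 0

namespace SasakiOps

variable {V : Type*} [AddCommGroup V] [Module ℂ V] (O : SasakiOps V) (a : ℂ)

/-- The product with the `(1, 0)`-form `a η₁ - η₂`. -/
def θ : V →ₗ[ℂ] V := a • O.e₁ - O.e₂

/-- The product with `η^{0,1}`. -/
def τ : V →ₗ[ℂ] V :=
  ((1 + a) / (starRingEnd ℂ a - a)) • (starRingEnd ℂ a • O.e₁ - O.e₂)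

/-- The contraction with the complex vector field dual to `a η₁ - η₂`. -/
def ι : V →ₗ[ℂ] V := (a - starRingEnd ℂ a)⁻¹ • (O.i₁ + starRingEnd ℂ a • O.i₂)

/-- The contraction with the complex vector field dual to `η^{0,1}`. -/
def ι' : V →ₗ[ℂ] V := (1 + a)⁻¹ • (O.i₁ + a • O.i₂)

/-- The sum of the insertions of the two transverse complex structures. -/
def N : V →ₗ[ℂ] V := O.N₁ + O.N₂

/-- The product with `d η₁`. -/
def w₁ : V →ₗ[ℂ] V := O.d ∘ₗ O.e₁ + O.e₁ ∘ₗ O.d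

/-- The product with `d η₂`. -/
def w₂ : V →ₗ[ℂ] V := O.d ∘ₗ O.e₂ + O.e₂ ∘ₗ O.d

/-- The operator which is `p` on forms of type `(p, q)`. -/
def A : V →ₗ[ℂ] V :=
  (1 / 2 : ℂ) • (O.D - Complex.I • O.N + O.θ a ∘ₗ O.ι a - O.τ a ∘ₗ O.ι' a)

/-- The operator which is `q` on forms of type `(p, q)`. -/
def B : V →ₗ[ℂ] V :=
  (1 / 2 : ℂ) • (O.D + Complex.I • O.N - O.θ a ∘ₗ O.ι a + O.τ a ∘ₗ O.ι' a)

/-- The operator which counts the factors of type `(1, 0)` from the contact distribution of the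
first manifold. -/
def Q : Module.End ℂ V := (1 / 2 : ℂ) • (O.P - Complex.I • O.N₁)

/-- The commutator `[B, d]`, which is the Dolbeault operator on invariant forms. -/
def del : V →ₗ[ℂ] V := O.B a ∘ₗ O.d - O.d ∘ₗ O.B a

theorem N_apply (x : V) : O.N x = O.N₁ x + O.N₂ x := rfl
theorem w₁_apply (x : V) : O.w₁ x = O.d (O.e₁ x) + O.e₁ (O.d x) := rfl
theorem w₂_apply (x : V) : O.w₂ x = O.d (O.e₂ x) + O.e₂ (O.d x) := rfl
theorem θ_apply (x : V) : O.θ a x = a • O.e₁ x - O.e₂ x := rfl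
theorem τ_apply (x : V) : O.τ a x = ((1 + a) / (starRingEnd ℂ a - a)) •
  (starRingEnd ℂ a • O.e₁ x - O.e₂ x) := rfl
theorem ι_apply (x : V) : O.ι a x = (a - starRingEnd ℂ a)⁻¹ •
  (O.i₁ x + starRingEnd ℂ a • O.i₂ x) := rfl
theorem ι'_apply (x : V) : O.ι' a x = (1 + a)⁻¹ • (O.i₁ x + a • O.i₂ x) := rfl
theorem A_apply (x : V) : O.A a x =
  (1 / 2 : ℂ) • (O.D x - Complex.I • O.N x + O.θ a (O.ι a x) - O.τ a (O.ι' a x)) := rfl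
theorem B_apply (x : V) : O.B a x =
  (1 / 2 : ℂ) • (O.D x + Complex.I • O.N x - O.θ a (O.ι a x) + O.τ a (O.ι' a x)) := rfl
theorem Q_apply (x : V) : O.Q x = (1 / 2 : ℂ) • (O.P x - Complex.I • O.N₁ x) := rfl
theorem del_apply (x : V) : O.del a x = O.B a (O.d x) - O.d (O.B a x) := rfl

theorem i₁_w₁ (x : V) : O.i₁ (O.w₁ x) = O.w₁ (O.i₁ x) := by
  have := O.L₁_e₁ x
  simp only [w₁_apply, map_add, map_sub, O.i₁_e₁] at *
  linear_combination (norm := module) this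

theorem i₁_w₂ (x : V) : O.i₁ (O.w₂ x) = O.w₂ (O.i₁ x) := by
  have := O.L₁_e₂ x
  simp only [w₂_apply, map_add, map_neg, O.i₁_e₂] at *
  linear_combination (norm := module) this

theorem i₂_w₁ (x : V) : O.i₂ (O.w₁ x) = O.w₁ (O.i₂ x) := by
  have := O.L₂_e₁ x
  simp only [w₁_apply, map_add, map_neg, O.i₂_e₁] at *
  linear_combination (norm := module) this

theorem i₂_w₂ (x : V) : O.i₂ (O.w₂ x) = O.w₂ (O.i₂ x) := by
  have := O.L₂_e₂ x
  simp only [w₂_apply, map_add, map_sub, O.i₂_e₂] at *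
  linear_combination (norm := module) this

theorem e₁_w₁ (x : V) : O.e₁ (O.w₁ x) = O.w₁ (O.e₁ x) := by
  simp [w₁_apply, O.e₁_e₁]

theorem e₂_w₂ (x : V) : O.e₂ (O.w₂ x) = O.w₂ (O.e₂ x) := by
  simp [w₂_apply, O.e₂_e₂]

theorem e₁_w₂' (x : V) : O.e₁ (O.w₂ x) = O.w₂ (O.e₁ x) := O.e₁_w₂ x
theorem e₂_w₁' (x : V) : O.e₂ (O.w₁ x) = O.w₁ (O.e₂ x) := O.e₂_w₁ x
theorem N_w₁ (x : V) : O.N (O.w₁ x) = O.w₁ (O.N x) := by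
  have h1 := O.N₁_w₁ x
  have h2 := O.N₂_w₁ x
  simp only [w₁_apply, N_apply, map_add] at *
  linear_combination (norm := module) h1 + h2
theorem N_w₂ (x : V) : O.N (O.w₂ x) = O.w₂ (O.N x) := by
  have h1 := O.N₁_w₂ x
  have h2 := O.N₂_w₂ x
  simp only [w₂_apply, N_apply, map_add] at *
  linear_combination (norm := module) h1 + h2
theorem D_w₁ (x : V) : O.D (O.w₁ x) = O.w₁ (O.D x) + (2 : ℂ) • O.w₁ x := by
  simp only [w₁_apply, map_add, O.D_d, O.D_e₁]
  module
theorem D_w₂ (x : V) : O.D (O.w₂ x) = O.w₂ (O.D x) + (2 : ℂ) • O.w₂ x := by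
  simp only [w₂_apply, map_add, O.D_d, O.D_e₂]
  module
theorem d_w₁ (x : V) : O.d (O.w₁ x) = O.w₁ (O.d x) := by
  simp [w₁_apply, O.d_d]
theorem d_w₂ (x : V) : O.d (O.w₂ x) = O.w₂ (O.d x) := by
  simp [w₂_apply, O.d_d]

section Relations

theorem ι_ι (x : V) : O.ι a (O.ι a x) = 0 := by
  simp only [ι_apply, map_add, map_smul, O.i₁_i₁, O.i₂_i₂, O.i₂_i₁]; module
theorem ι'_ι' (x : V) : O.ι' a (O.ι' a x) = 0 := by
  simp only [ι'_apply, map_add, map_smul, O.i₁_i₁, O.i₂_i₂, O.i₂_i₁]; module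
theorem ι'_ι (x : V) : O.ι' a (O.ι a x) = -O.ι a (O.ι' a x) := by
  simp only [ι_apply, ι'_apply, map_add, map_smul, O.i₁_i₁, O.i₂_i₂, O.i₂_i₁]; module
theorem θ_θ (x : V) : O.θ a (O.θ a x) = 0 := by
  simp only [θ_apply, map_sub, map_smul, O.e₁_e₁, O.e₂_e₂, O.e₂_e₁]; module
theorem τ_τ (x : V) : O.τ a (O.τ a x) = 0 := by
  simp only [τ_apply, map_sub, map_smul, O.e₁_e₁, O.e₂_e₂, O.e₂_e₁]; module
theorem τ_θ (x : V) : O.τ a (O.θ a x) = -O.θ a (O.τ a x) := by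
  simp only [θ_apply, τ_apply, map_sub, map_smul, O.e₁_e₁, O.e₂_e₂, O.e₂_e₁]; module
theorem ι'_θ (x : V) : O.ι' a (O.θ a x) = -O.θ a (O.ι' a x) := by
  simp only [θ_apply, ι'_apply, map_add, map_sub, map_smul, O.i₁_e₁, O.i₂_e₂, O.i₁_e₂, O.i₂_e₁]
  module
theorem ι_τ (x : V) : O.ι a (O.τ a x) = -O.τ a (O.ι a x) := by
  simp only [τ_apply, ι_apply, map_add, map_sub, map_smul, O.i₁_e₁, O.i₂_e₂, O.i₁_e₂, O.i₂_e₁]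
  module

variable {a}

theorem conj_sub_ne_zero (ha : a.im ≠ 0) : starRingEnd ℂ a - a ≠ 0 := by
  intro h
  have := congrArg Complex.im h
  simp at this
  exact ha (by linarith)

theorem one_add_ne_zero (ha : a.im ≠ 0) : 1 + a ≠ 0 := by
  intro h
  have := congrArg Complex.im h
  simp at this
  exact ha this

theorem ι_θ (ha : a.im ≠ 0) (x : V) : O.ι a (O.θ a x) = x - O.θ a (O.ι a x) := by
  have h : (a - starRingEnd ℂ a)⁻¹ * (a - starRingEnd ℂ a) = 1 :=
    inv_mul_cancel₀ (by rw [← neg_sub]; exact neg_ne_zero.2 (conj_sub_ne_zero ha))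
  simp only [θ_apply, ι_apply, map_add, map_sub, map_smul, O.i₁_e₁, O.i₂_e₂, O.i₁_e₂, O.i₂_e₁]
  linear_combination (norm := module) congrArg (· • x) h

theorem ι'_τ (ha : a.im ≠ 0) (x : V) : O.ι' a (O.τ a x) = x - O.τ a (O.ι' a x) := by
  have h : (1 + a)⁻¹ * ((1 + a) / (starRingEnd ℂ a - a)) * (starRingEnd ℂ a - a) = 1 := by
    have h1 := conj_sub_ne_zero ha
    have h2 := one_add_ne_zero ha
    field_simp
  simp only [τ_apply, ι'_apply, map_add, map_sub, map_smul, O.i₁_e₁, O.i₂_e₂, O.i₁_e₂, O.i₂_e₁]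
  linear_combination (norm := module) congrArg (· • x) h

end Relations

theorem D_θ (x : V) : O.D (O.θ a x) = O.θ a (O.D x) + O.θ a x := by
  simp only [θ_apply, map_sub, map_smul, O.D_e₁, O.D_e₂]; module
theorem D_τ (x : V) : O.D (O.τ a x) = O.τ a (O.D x) + O.τ a x := by
  simp only [τ_apply, map_sub, map_smul, O.D_e₁, O.D_e₂]; module
theorem ι_D (x : V) : O.ι a (O.D x) = O.D (O.ι a x) + O.ι a x := by
  simp only [ι_apply, map_add, map_smul, O.i₁_D, O.i₂_D]; module
theorem ι'_D (x : V) : O.ι' a (O.D x) = O.D (O.ι' a x) + O.ι' a x := by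
  simp only [ι'_apply, map_add, map_smul, O.i₁_D, O.i₂_D]; module
theorem N_θ (x : V) : O.N (O.θ a x) = O.θ a (O.N x) := by
  simp only [θ_apply, N_apply, map_sub, map_add, map_smul, O.N₁_e₁, O.N₁_e₂, O.N₂_e₁, O.N₂_e₂]
  module
theorem N_τ (x : V) : O.N (O.τ a x) = O.τ a (O.N x) := by
  simp only [τ_apply, N_apply, map_sub, map_add, map_smul, O.N₁_e₁, O.N₁_e₂, O.N₂_e₁, O.N₂_e₂]
  module
theorem ι_N (x : V) : O.ι a (O.N x) = O.N (O.ι a x) := by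
  simp only [ι_apply, N_apply, map_add, map_smul, O.i₁_N₁, O.i₁_N₂, O.i₂_N₁, O.i₂_N₂]; module
theorem ι'_N (x : V) : O.ι' a (O.N x) = O.N (O.ι' a x) := by
  simp only [ι'_apply, N_apply, map_add, map_smul, O.i₁_N₁, O.i₁_N₂, O.i₂_N₁, O.i₂_N₂]; module
theorem Q_θ (x : V) : O.Q (O.θ a x) = O.θ a (O.Q x) := by
  simp only [θ_apply, Q_apply, map_sub, map_smul, O.N₁_e₁, O.N₁_e₂, O.P_e₁, O.P_e₂]; module
theorem Q_τ (x : V) : O.Q (O.τ a x) = O.τ a (O.Q x) := by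
  simp only [τ_apply, Q_apply, map_sub, map_smul, O.N₁_e₁, O.N₁_e₂, O.P_e₁, O.P_e₂]; module
theorem ι_Q (x : V) : O.ι a (O.Q x) = O.Q (O.ι a x) := by
  simp only [ι_apply, Q_apply, map_sub, map_add, map_smul, O.i₁_N₁, O.i₂_N₁, O.i₁_P, O.i₂_P]
  module
theorem ι'_Q (x : V) : O.ι' a (O.Q x) = O.Q (O.ι' a x) := by
  simp only [ι'_apply, Q_apply, map_sub, map_add, map_smul, O.i₁_N₁, O.i₂_N₁, O.i₁_P, O.i₂_P]
  module
theorem Q_N (x : V) : O.Q (O.N x) = O.N (O.Q x) := by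
  simp only [N_apply, Q_apply, map_sub, map_add, map_smul, O.P_N₁, O.P_N₂, O.N₂_N₁]
  module
theorem Q_D (x : V) : O.Q (O.D x) = O.D (O.Q x) := by
  simp only [Q_apply, map_sub, map_smul, O.D_N₁, O.D_P]
theorem Q_w₁ (x : V) : O.Q (O.w₁ x) = O.w₁ (O.Q x) + O.w₁ x := by
  have h1 := O.N₁_w₁ x
  have h2 := O.P_w₁ x
  simp only [← w₁_apply] at h1 h2
  simp only [Q_apply, map_sub, map_smul, h1, h2]
  module
theorem Q_w₂ (x : V) : O.Q (O.w₂ x) = O.w₂ (O.Q x) := by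
  have h1 := O.N₁_w₂ x
  have h2 := O.P_w₂ x
  simp only [← w₂_apply] at h1 h2
  simp only [Q_apply, map_sub, map_smul, h1, h2]

section Dolbeault

/-- The submodule of basic elements. -/
def bas : Submodule ℂ V :=
  (O.i₁.ker ⊓ O.i₂.ker) ⊓ ((O.i₁ ∘ₗ O.d).ker ⊓ (O.i₂ ∘ₗ O.d).ker)

/-- The submodule of invariant elements. -/
def inv : Submodule ℂ V :=
  (O.d ∘ₗ O.i₁ + O.i₁ ∘ₗ O.d).ker ⊓ (O.d ∘ₗ O.i₂ + O.i₂ ∘ₗ O.d).ker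

theorem mem_bas {x : V} : x ∈ O.bas ↔
    (O.i₁ x = 0 ∧ O.i₂ x = 0) ∧ O.i₁ (O.d x) = 0 ∧ O.i₂ (O.d x) = 0 := Iff.rfl

theorem mem_inv {x : V} : x ∈ O.inv ↔
    O.d (O.i₁ x) + O.i₁ (O.d x) = 0 ∧ O.d (O.i₂ x) + O.i₂ (O.d x) = 0 := Iff.rfl

theorem bas_le_inv : O.bas ≤ O.inv := by
  rintro x ⟨⟨h1, h2⟩, h3, h4⟩
  refine ⟨?_, ?_⟩
  · change O.d (O.i₁ x) + O.i₁ (O.d x) = 0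
    rw [show O.i₁ x = 0 from h1, show O.i₁ (O.d x) = 0 from h3, map_zero, add_zero]
  · change O.d (O.i₂ x) + O.i₂ (O.d x) = 0
    rw [show O.i₂ x = 0 from h2, show O.i₂ (O.d x) = 0 from h4, map_zero, add_zero]

theorem mem_bas_iff {x : V} : x ∈ O.bas ↔ x ∈ O.inv ∧ O.i₁ x = 0 ∧ O.i₂ x = 0 := by
  rw [mem_bas, mem_inv]
  constructor
  · rintro ⟨⟨h1, h2⟩, h3, h4⟩
    simp [h1, h2, h3, h4]
  · rintro ⟨⟨h3, h4⟩, h1, h2⟩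
    rw [h1, map_zero, zero_add] at h3
    rw [h2, map_zero, zero_add] at h4
    exact ⟨⟨h1, h2⟩, h3, h4⟩

theorem inv_d {x : V} (hx : x ∈ O.inv) : O.d x ∈ O.inv := by
  rw [mem_inv] at hx ⊢
  have h1 := congrArg O.d hx.1
  have h2 := congrArg O.d hx.2
  simpa [O.d_d] using And.intro h1 h2

theorem inv_i₁ {x : V} (hx : x ∈ O.inv) : O.i₁ x ∈ O.inv := by
  rw [mem_inv] at hx ⊢
  have h1 := congrArg O.i₁ hx.1
  have h2 := congrArg O.i₁ hx.2
  have h3 := O.L₂_i₁ x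
  simp only [map_add, map_zero, O.i₁_i₁, O.i₂_i₁, map_neg, add_zero, zero_add] at h1 h2 h3 ⊢
  exact ⟨h1, h3.trans h2⟩

theorem inv_i₂ {x : V} (hx : x ∈ O.inv) : O.i₂ x ∈ O.inv := by
  rw [mem_inv] at hx ⊢
  have h1 := congrArg O.i₂ hx.1
  have h2 := congrArg O.i₂ hx.2
  have h3 := O.L₁_i₂ x
  simp only [map_add, map_zero, O.i₂_i₂, O.i₂_i₁, add_zero, zero_add] at h1 h2 h3 ⊢
  exact ⟨h3.trans h1, h2⟩

/-- An operator which commutes with both Lie derivatives preserves the invariant elements. -/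
theorem inv_of_comm {g : V → V}
    (h1 : ∀ x, O.d (O.i₁ (g x)) + O.i₁ (O.d (g x)) = g (O.d (O.i₁ x) + O.i₁ (O.d x)))
    (h2 : ∀ x, O.d (O.i₂ (g x)) + O.i₂ (O.d (g x)) = g (O.d (O.i₂ x) + O.i₂ (O.d x)))
    (h0 : g 0 = 0) {x : V} (hx : x ∈ O.inv) : g x ∈ O.inv := by
  rw [mem_inv] at hx ⊢
  rw [h1, h2, hx.1, hx.2, h0]
  exact ⟨rfl, rfl⟩

theorem inv_e₁ {x : V} (hx : x ∈ O.inv) : O.e₁ x ∈ O.inv :=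
  O.inv_of_comm (fun x => by rw [map_add]; exact O.L₁_e₁ x)
    (fun x => by rw [map_add]; exact O.L₂_e₁ x) (map_zero _) hx
theorem inv_e₂ {x : V} (hx : x ∈ O.inv) : O.e₂ x ∈ O.inv :=
  O.inv_of_comm (fun x => by rw [map_add]; exact O.L₁_e₂ x)
    (fun x => by rw [map_add]; exact O.L₂_e₂ x) (map_zero _) hx
theorem inv_N₁ {x : V} (hx : x ∈ O.inv) : O.N₁ x ∈ O.inv :=
  O.inv_of_comm (fun x => by rw [map_add]; exact O.L₁_N₁ x)
    (fun x => by rw [map_add]; exact O.L₂_N₁ x) (map_zero _) hx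
theorem inv_N₂ {x : V} (hx : x ∈ O.inv) : O.N₂ x ∈ O.inv :=
  O.inv_of_comm (fun x => by rw [map_add]; exact O.L₁_N₂ x)
    (fun x => by rw [map_add]; exact O.L₂_N₂ x) (map_zero _) hx
theorem inv_P {x : V} (hx : x ∈ O.inv) : O.P x ∈ O.inv :=
  O.inv_of_comm (fun x => by rw [map_add]; exact O.L₁_P x)
    (fun x => by rw [map_add]; exact O.L₂_P x) (map_zero _) hx
theorem d_D (x : V) : O.d (O.D x) = O.D (O.d x) - O.d x := by
  rw [O.D_d]; abel
theorem inv_D {x : V} (hx : x ∈ O.inv) : O.D x ∈ O.inv :=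
  O.inv_of_comm
    (fun x => by simp only [map_add, map_sub, O.i₁_D, d_D]; abel)
    (fun x => by simp only [map_add, map_sub, O.i₂_D, d_D]; abel) (map_zero _) hx

variable {a}

theorem inv_θ {x : V} (hx : x ∈ O.inv) : O.θ a x ∈ O.inv :=
  O.inv.sub_mem (O.inv.smul_mem _ (O.inv_e₁ hx)) (O.inv_e₂ hx)
theorem inv_τ {x : V} (hx : x ∈ O.inv) : O.τ a x ∈ O.inv :=
  O.inv.smul_mem _ (O.inv.sub_mem (O.inv.smul_mem _ (O.inv_e₁ hx)) (O.inv_e₂ hx))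
theorem inv_ι {x : V} (hx : x ∈ O.inv) : O.ι a x ∈ O.inv :=
  O.inv.smul_mem _ (O.inv.add_mem (O.inv_i₁ hx) (O.inv.smul_mem _ (O.inv_i₂ hx)))
theorem inv_ι' {x : V} (hx : x ∈ O.inv) : O.ι' a x ∈ O.inv :=
  O.inv.smul_mem _ (O.inv.add_mem (O.inv_i₁ hx) (O.inv.smul_mem _ (O.inv_i₂ hx)))
theorem inv_N {x : V} (hx : x ∈ O.inv) : O.N x ∈ O.inv := O.inv.add_mem (O.inv_N₁ hx) (O.inv_N₂ hx)
theorem inv_B {x : V} (hx : x ∈ O.inv) : O.B a x ∈ O.inv :=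
  O.inv.smul_mem _ (O.inv.add_mem (O.inv.sub_mem (O.inv.add_mem (O.inv_D hx)
    (O.inv.smul_mem _ (O.inv_N hx))) (O.inv_θ (O.inv_ι hx))) (O.inv_τ (O.inv_ι' hx)))
theorem inv_Q {x : V} (hx : x ∈ O.inv) : O.Q x ∈ O.inv :=
  O.inv.smul_mem _ (O.inv.sub_mem (O.inv_P hx) (O.inv.smul_mem _ (O.inv_N₁ hx)))
theorem inv_del {x : V} (hx : x ∈ O.inv) : O.del a x ∈ O.inv :=
  O.inv.sub_mem (O.inv_B (O.inv_d hx)) (O.inv_d (O.inv_B hx))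

/-- Basic elements are the invariant ones killed by the two complex contractions. -/
theorem mem_bas_iff' (ha : a.im ≠ 0) {x : V} :
    x ∈ O.bas ↔ x ∈ O.inv ∧ O.ι a x = 0 ∧ O.ι' a x = 0 := by
  rw [mem_bas_iff]
  refine and_congr_right fun _ => ⟨fun h => ?_, fun h => ?_⟩
  · simp [ι_apply, ι'_apply, h.1, h.2]
  · have h0 := conj_sub_ne_zero ha
    have h1 := h.1
    have h2 := h.2
    rw [ι_apply, smul_eq_zero] at h1
    rw [ι'_apply, smul_eq_zero] at h2
    have h1 := h1.resolve_left (inv_ne_zero (by rw [← neg_sub]; exact neg_ne_zero.2 h0))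
    have h2 := h2.resolve_left (inv_ne_zero (one_add_ne_zero ha))
    have h3 : (starRingEnd ℂ a - a) • O.i₂ x = 0 := by
      linear_combination (norm := module) h1 - h2
    have h4 := (smul_eq_zero.1 h3).resolve_left h0
    rw [h4, smul_zero, add_zero] at h1
    exact ⟨h1, h4⟩

theorem A_θ (ha : a.im ≠ 0) (x : V) : O.A a (O.θ a x) = O.θ a (O.A a x) + O.θ a x := by
  simp only [A_apply, map_add, map_sub, map_smul, map_neg, D_θ, N_θ, O.ι_θ ha, θ_θ, ι'_θ, τ_θ]
  module
theorem B_θ (ha : a.im ≠ 0) (x : V) : O.B a (O.θ a x) = O.θ a (O.B a x) := by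
  simp only [B_apply, map_add, map_sub, map_smul, map_neg, D_θ, N_θ, O.ι_θ ha, θ_θ, ι'_θ, τ_θ]
  module
theorem A_τ (ha : a.im ≠ 0) (x : V) : O.A a (O.τ a x) = O.τ a (O.A a x) := by
  simp only [A_apply, map_add, map_sub, map_smul, map_neg, D_τ, N_τ, O.ι'_τ ha, τ_τ, ι_τ, τ_θ]
  module
theorem B_τ (ha : a.im ≠ 0) (x : V) : O.B a (O.τ a x) = O.τ a (O.B a x) + O.τ a x := by
  simp only [B_apply, map_add, map_sub, map_smul, map_neg, D_τ, N_τ, O.ι'_τ ha, τ_τ, ι_τ, τ_θ]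
  module
theorem ι_A (ha : a.im ≠ 0) (x : V) : O.ι a (O.A a x) = O.A a (O.ι a x) + O.ι a x := by
  simp only [A_apply, map_add, map_sub, map_smul, ι_D, ι_N, O.ι_θ ha, ι_τ, ι_ι, ι'_ι,
    map_neg, map_zero]
  module
theorem ι_B (ha : a.im ≠ 0) (x : V) : O.ι a (O.B a x) = O.B a (O.ι a x) := by
  simp only [B_apply, map_add, map_sub, map_smul, ι_D, ι_N, O.ι_θ ha, ι_τ, ι_ι, ι'_ι,
    map_neg, map_zero]
  module
theorem ι'_A (ha : a.im ≠ 0) (x : V) : O.ι' a (O.A a x) = O.A a (O.ι' a x) := by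
  simp only [A_apply, map_add, map_sub, map_smul, ι'_D, ι'_N, O.ι'_τ ha, ι'_θ, ι'_ι', ι'_ι,
    map_neg, map_zero]
  module
theorem ι'_B (ha : a.im ≠ 0) (x : V) : O.ι' a (O.B a x) = O.B a (O.ι' a x) + O.ι' a x := by
  simp only [B_apply, map_add, map_sub, map_smul, ι'_D, ι'_N, O.ι'_τ ha, ι'_θ, ι'_ι', ι'_ι,
    map_neg, map_zero]
  module

theorem A_add_B (x : V) : O.A a x + O.B a x = O.D x := by
  rw [A_apply, B_apply]; module
theorem Q_A (x : V) : O.Q (O.A a x) = O.A a (O.Q x) := by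
  simp only [A_apply, map_add, map_sub, map_smul, Q_D, Q_N, Q_θ, Q_τ, ← ι_Q, ← ι'_Q]
theorem Q_B (x : V) : O.Q (O.B a x) = O.B a (O.Q x) := by
  simp only [B_apply, map_add, map_sub, map_smul, Q_D, Q_N, Q_θ, Q_τ, ← ι_Q, ← ι'_Q]
theorem B_w₁ (x : V) : O.B a (O.w₁ x) = O.w₁ (O.B a x) + O.w₁ x := by
  simp only [B_apply, θ_apply, τ_apply, ι_apply, ι'_apply, map_add, map_sub, map_smul, D_w₁, N_w₁,
    i₁_w₁, i₂_w₁, e₁_w₁, e₂_w₁']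
  module
theorem B_w₂ (x : V) : O.B a (O.w₂ x) = O.w₂ (O.B a x) + O.w₂ x := by
  simp only [B_apply, θ_apply, τ_apply, ι_apply, ι'_apply, map_add, map_sub, map_smul, D_w₂, N_w₂,
    i₁_w₂, i₂_w₂, e₁_w₂', e₂_w₂]
  module
theorem A_w₁ (x : V) : O.A a (O.w₁ x) = O.w₁ (O.A a x) + O.w₁ x := by
  simp only [A_apply, θ_apply, τ_apply, ι_apply, ι'_apply, map_add, map_sub, map_smul, D_w₁, N_w₁,
    i₁_w₁, i₂_w₁, e₁_w₁, e₂_w₁']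
  module
theorem A_w₂ (x : V) : O.A a (O.w₂ x) = O.w₂ (O.A a x) + O.w₂ x := by
  simp only [A_apply, θ_apply, τ_apply, ι_apply, ι'_apply, map_add, map_sub, map_smul, D_w₂, N_w₂,
    i₁_w₂, i₂_w₂, e₁_w₂', e₂_w₂]
  module

theorem del_w₁ (x : V) : O.del a (O.w₁ x) = O.w₁ (O.del a x) := by
  simp only [del_apply, d_w₁, B_w₁, map_add, map_sub]
  abel
theorem del_w₂ (x : V) : O.del a (O.w₂ x) = O.w₂ (O.del a x) := by
  simp only [del_apply, d_w₂, B_w₂, map_add, map_sub]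
  abel

theorem d_θ (x : V) : O.d (O.θ a x) = a • O.w₁ x - O.w₂ x - O.θ a (O.d x) := by
  simp only [θ_apply, w₁_apply, w₂_apply, map_sub, map_smul]; module
theorem d_τ (x : V) : O.d (O.τ a x) = ((1 + a) / (starRingEnd ℂ a - a)) •
    (starRingEnd ℂ a • O.w₁ x - O.w₂ x) - O.τ a (O.d x) := by
  simp only [τ_apply, w₁_apply, w₂_apply, map_sub, map_smul]; module

/-- The forms `dη₁` and `dη₂` have type `(1, 1)`, so that `∂̄θ` is all of `dθ`. -/
theorem del_θ (ha : a.im ≠ 0) (x : V) :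
    O.del a (O.θ a x) = a • O.w₁ x - O.w₂ x - O.θ a (O.del a x) := by
  simp only [del_apply, d_θ, B_θ O ha, B_w₁, B_w₂, map_sub, map_smul]
  module

/-- The differential of `η^{0,1}` has type `(1, 1)`, so that `∂̄η^{0,1} = 0`. -/
theorem del_τ (ha : a.im ≠ 0) (x : V) : O.del a (O.τ a x) = -O.τ a (O.del a x) := by
  simp only [del_apply, d_τ, B_τ O ha, B_w₁, B_w₂, map_sub, map_smul, map_add]
  module

/-- The Frölicher–Nijenhuis relations on basic elements. -/
theorem bas_N_N_d {x : V} (hx : x ∈ O.bas) :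
    O.N (O.N (O.d x)) - (2 : ℂ) • O.N (O.d (O.N x)) + O.d (O.N (O.N x)) = -O.d x := by
  obtain ⟨⟨h1, h2⟩, h3, h4⟩ := O.mem_bas.1 hx
  have f1 := O.FN₁₁ x h1 h2
  have f2 := O.FN₁₂ x h1 h2
  have f3 := O.FN₂₂ x h1 h2
  rw [h3, h4, map_zero, map_zero, O.D_d] at f3
  simp only [N_apply, map_add, O.N₂_N₁] at *
  linear_combination (norm := module) f1 + (2 : ℂ) • f2 + f3

theorem B_of_hor {x : V} (h1 : O.i₁ x = 0) (h2 : O.i₂ x = 0) :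
    O.B a x = (1 / 2 : ℂ) • (O.D x + Complex.I • O.N x) := by
  simp [B_apply, ι_apply, ι'_apply, h1, h2]

theorem del_of_bas {x : V} (hx : x ∈ O.bas) :
    O.del a x = (1 / 2 : ℂ) • (O.d x + Complex.I • (O.N (O.d x) - O.d (O.N x))) := by
  obtain ⟨⟨h1, h2⟩, h3, h4⟩ := O.mem_bas.1 hx
  rw [del_apply, B_of_hor O h1 h2, B_of_hor O h3 h4, O.D_d]
  simp only [map_add, map_smul]
  module

theorem bas_B_mem (ha : a.im ≠ 0) {x : V} (hx : x ∈ O.bas) : O.B a x ∈ O.bas := by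
  rw [O.mem_bas_iff' ha] at hx ⊢
  exact ⟨O.inv_B hx.1, by rw [O.ι_B ha, hx.2.1, map_zero],
    by rw [O.ι'_B ha, hx.2.2, map_zero, add_zero]⟩

theorem bas_Q_mem {x : V} (hx : x ∈ O.bas) : O.Q x ∈ O.bas := by
  obtain ⟨h, h1, h2⟩ := O.mem_bas_iff.1 hx
  exact O.mem_bas_iff.2 ⟨O.inv_Q h, by simp [Q_apply, O.i₁_P, O.i₁_N₁, h1],
    by simp [Q_apply, O.i₂_P, O.i₂_N₁, h2]⟩

theorem bas_d_mem {x : V} (hx : x ∈ O.bas) : O.d x ∈ O.bas := by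
  obtain ⟨⟨h1, h2⟩, h3, h4⟩ := O.mem_bas.1 hx
  exact O.mem_bas.2 ⟨⟨h3, h4⟩, by simp [O.d_d], by simp [O.d_d]⟩

theorem bas_del_mem (ha : a.im ≠ 0) {x : V} (hx : x ∈ O.bas) : O.del a x ∈ O.bas :=
  O.bas.sub_mem (O.bas_B_mem ha (O.bas_d_mem hx)) (O.bas_d_mem (O.bas_B_mem ha hx))

theorem D_N (x : V) : O.D (O.N x) = O.N (O.D x) := by
  simp only [N_apply, map_add, O.D_N₁, O.D_N₂]

/-- On basic elements `del` raises the second degree by one. -/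
theorem bas_B_del (ha : a.im ≠ 0) {x : V} (hx : x ∈ O.bas) :
    O.B a (O.del a x) = O.del a (O.B a x) + O.del a x := by
  obtain ⟨⟨h1, h2⟩, h3, h4⟩ := O.mem_bas.1 hx
  obtain ⟨⟨h5, h6⟩, -⟩ := O.mem_bas.1 (O.bas_del_mem ha hx)
  rw [B_of_hor O h5 h6, O.del_of_bas (O.bas_B_mem ha hx), O.del_of_bas hx, B_of_hor O h1 h2]
  have h := O.bas_N_N_d hx
  have hI : Complex.I * Complex.I = -1 := Complex.I_mul_I
  simp only [map_add, map_sub, map_smul, O.D_d, D_N, smul_add, smul_sub, smul_smul]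
  have h' := congrArg (fun y => ((1 / 4 : ℂ) * (Complex.I * Complex.I)) • y) h
  simp only [smul_add, smul_sub, smul_smul, smul_neg] at h'
  rw [hI] at h'
  linear_combination (norm := skip) h'
  match_scalars <;> ring_nf <;> simp [Complex.I_sq]

theorem bas_A_del (ha : a.im ≠ 0) {x : V} (hx : x ∈ O.bas) :
    O.A a (O.del a x) = O.del a (O.A a x) := by
  have h1 := O.bas_B_del ha hx
  have hA (y : V) : O.A a y = O.D y - O.B a y := eq_sub_of_add_eq (O.A_add_B y)
  have h2 : O.D (O.del a x) = O.del a (O.D x) + O.del a x := by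
    have hB (y : V) : O.D (O.B a y) = O.B a (O.D y) := by
      simp only [B_apply, map_add, map_sub, map_smul, D_N, D_θ, D_τ, ι_D, ι'_D]
    simp only [del_apply, map_sub, map_add, hB, O.D_d]
    abel
  rw [hA, hA, map_sub, h1, h2]
  abel

/-- On basic elements, `del` commutes with the operator that defines the twist. -/
theorem bas_Q_del {x : V} (hx : x ∈ O.bas) :
    O.Q (O.del a x) = O.del a (O.Q x) := by
  obtain ⟨⟨h1, h2⟩, h3, h4⟩ := O.mem_bas.1 hx
  rw [O.del_of_bas hx, O.del_of_bas (O.bas_Q_mem hx)]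
  have f1 := O.FN₁₁ x h1 h2
  have f2 := O.FN₁₂ x h1 h2
  have f4 := O.FNP₁ x h1 h2
  have f5 := O.FNP₂ x h1 h2
  have g (y : V) (h : y ∈ O.bas) : O.i₁ y = 0 := (O.mem_bas.1 h).1.1
  have hN1 {y : V} (hy : y ∈ O.bas) : O.N₁ y ∈ O.bas := by
    obtain ⟨h, h1, h2⟩ := O.mem_bas_iff.1 hy
    exact O.mem_bas_iff.2 ⟨O.inv_N₁ h, by simp [O.i₁_N₁, h1], by simp [O.i₂_N₁, h2]⟩
  have hN2 {y : V} (hy : y ∈ O.bas) : O.N₂ y ∈ O.bas := by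
    obtain ⟨h, h1, h2⟩ := O.mem_bas_iff.1 hy
    exact O.mem_bas_iff.2 ⟨O.inv_N₂ h, by simp [O.i₁_N₂, h1], by simp [O.i₂_N₂, h2]⟩
  rw [g _ (hN1 (O.bas_d_mem hx)), g _ (O.bas_d_mem (hN1 hx)), map_zero] at f4
  rw [g _ (hN2 (O.bas_d_mem hx)), g _ (O.bas_d_mem (hN2 hx)), map_zero] at f5
  simp only [Q_apply, N_apply, map_add, map_sub, map_smul, O.P_N₁, O.P_N₂, O.N₂_N₁,
    smul_add, smul_sub, smul_smul, add_zero, sub_zero] at *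
  linear_combination (norm := skip) (1 / 4 : ℂ) • f1 + (1 / 4 : ℂ) • f2 +
    (Complex.I / 4 : ℂ) • f4 + (Complex.I / 4 : ℂ) • f5
  match_scalars <;> ring_nf <;> simp [Complex.I_sq]

end Dolbeault

end SasakiOps

end Operators

/-! ### Invariant elements and the twisted decomposition -/

section Decomposition

open Polynomial

namespace SasakiOps

variable {V : Type*} [AddCommGroup V] [Module ℂ V] (O : SasakiOps V) {a : ℂ}

/-- The invariant elements of type `(p, q)`. -/
def invT (a : ℂ) (p q : ℤ) : Submodule ℂ V where
  carrier := {x | x ∈ O.inv ∧ O.A a x = (p : ℂ) • x ∧ O.B a x = (q : ℂ) • x}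
  add_mem' := fun {x y} hx hy => ⟨O.inv.add_mem hx.1 hy.1,
    by rw [map_add, hx.2.1, hy.2.1, smul_add], by rw [map_add, hx.2.2, hy.2.2, smul_add]⟩
  zero_mem' := ⟨O.inv.zero_mem, by simp, by simp⟩
  smul_mem' := fun z x hx => ⟨O.inv.smul_mem z hx.1,
    by rw [map_smul, hx.2.1, smul_comm], by rw [map_smul, hx.2.2, smul_comm]⟩

/-- The basic elements of type `(p, q)`. -/
def basT (a : ℂ) (p q : ℤ) : Submodule ℂ V := O.bas ⊓ O.invT a p q

/-- The space `Λ_{B, η^{0,1}}^{p,q}`. -/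
def basET (a : ℂ) (p q : ℤ) : Submodule ℂ V := O.basT a p q ⊔ (O.basT a p (q - 1)).map (O.τ a)

theorem mem_basT {p q : ℤ} {x : V} : x ∈ O.basT a p q ↔
    x ∈ O.bas ∧ O.A a x = (p : ℂ) • x ∧ O.B a x = (q : ℂ) • x :=
  ⟨fun h => ⟨h.1, h.2.2⟩, fun h => ⟨h.1, O.bas_le_inv h.1, h.2⟩⟩

theorem mem_basET {p q : ℤ} {x : V} : x ∈ O.basET a p q ↔
    ∃ y ∈ O.basT a p q, ∃ z ∈ O.basT a p (q - 1), y + O.τ a z = x := by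
  simp [basET, Submodule.mem_sup]

/-- The invariant elements are generated by the basic ones under the products with `η^{0,1}` and
`θ`. This reduces commutation relations of `del` to basic elements, on which the Frölicher–Nijenhuis
relations apply. -/
theorem inv_induction (ha : a.im ≠ 0) {W : Submodule ℂ V} (hb : O.bas ≤ W)
    (hτ : ∀ x ∈ O.inv, x ∈ W → O.τ a x ∈ W) (hθ : ∀ x ∈ O.inv, x ∈ W → O.θ a x ∈ W) :
    O.inv ≤ W := by
  -- An element killed by `ι` is `y + τ z` with `y`, `z` basic; a general one is `y + θ z` with `y`, `z`
  -- killed by `ι`.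
  have h1 (x : V) (hx : x ∈ O.inv) (hι : O.ι a x = 0) : x ∈ W := by
    have h2 : O.ι' a x ∈ O.bas := (O.mem_bas_iff' ha).2 ⟨O.inv_ι' hx, by
      have := O.ι'_ι a x; rw [hι, map_zero] at this; exact neg_eq_zero.1 this.symm, O.ι'_ι' a x⟩
    have h3 : x - O.τ a (O.ι' a x) ∈ O.bas :=
      (O.mem_bas_iff' ha).2 ⟨O.inv.sub_mem hx (O.inv_τ (O.inv_ι' hx)),
        by rw [map_sub, hι, ι_τ, ((O.mem_bas_iff' ha).1 h2).2.1, map_zero, neg_zero, sub_zero],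
        by rw [map_sub, O.ι'_τ ha, ι'_ι', map_zero, sub_zero, sub_self]⟩
    have := W.add_mem (hb h3) (hτ _ (O.bas_le_inv h2) (hb h2))
    rwa [sub_add_cancel] at this
  intro x hx
  have h2 : O.ι a x ∈ W := h1 _ (O.inv_ι hx) (O.ι_ι a x)
  have h3 : x - O.θ a (O.ι a x) ∈ W := h1 _ (O.inv.sub_mem hx (O.inv_θ (O.inv_ι hx)))
    (by rw [map_sub, O.ι_θ ha, ι_ι, map_zero, sub_zero, sub_self])
  have := W.add_mem h3 (hθ _ (O.inv_ι hx) h2)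
  rwa [sub_add_cancel] at this

theorem inv_B_del (ha : a.im ≠ 0) {x : V} (hx : x ∈ O.inv) :
    O.B a (O.del a x) = O.del a (O.B a x) + O.del a x := by
  have h := O.inv_induction ha
    (W := (O.B a ∘ₗ O.del a - O.del a ∘ₗ O.B a - O.del a).ker) ?_ ?_ ?_ hx
  · rw [LinearMap.mem_ker, LinearMap.sub_apply, LinearMap.sub_apply] at h
    linear_combination (norm := module) h
  · intro x hx
    rw [LinearMap.mem_ker, LinearMap.sub_apply, LinearMap.sub_apply, LinearMap.comp_apply,
      O.bas_B_del ha hx, LinearMap.comp_apply]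
    abel
  · intro x _ h
    rw [LinearMap.mem_ker, LinearMap.sub_apply, LinearMap.sub_apply, LinearMap.comp_apply,
      LinearMap.comp_apply] at h ⊢
    have := congrArg (O.τ a) h
    simp only [O.del_τ ha, O.B_τ ha, map_neg, map_add, map_sub, map_zero] at this ⊢
    linear_combination (norm := module) -this
  · intro x _ h
    rw [LinearMap.mem_ker, LinearMap.sub_apply, LinearMap.sub_apply, LinearMap.comp_apply,
      LinearMap.comp_apply] at h ⊢
    have := congrArg (O.θ a) h
    simp only [O.del_θ ha, O.B_θ ha, B_w₁, B_w₂, map_smul, map_sub, map_zero] at this ⊢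
    linear_combination (norm := module) -this

theorem inv_A_del (ha : a.im ≠ 0) {x : V} (hx : x ∈ O.inv) :
    O.A a (O.del a x) = O.del a (O.A a x) := by
  have h := O.inv_induction ha (W := (O.A a ∘ₗ O.del a - O.del a ∘ₗ O.A a).ker) ?_ ?_ ?_ hx
  · exact sub_eq_zero.1 h
  · intro x hx
    exact sub_eq_zero.2 (O.bas_A_del ha hx)
  · intro x _ h
    rw [LinearMap.mem_ker, LinearMap.sub_apply, LinearMap.comp_apply, LinearMap.comp_apply] at h ⊢
    have := congrArg (O.τ a) h
    simp only [O.del_τ ha, O.A_τ ha, map_neg, map_sub, map_zero] at this ⊢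
    linear_combination (norm := module) -this
  · intro x _ h
    rw [LinearMap.mem_ker, LinearMap.sub_apply, LinearMap.comp_apply, LinearMap.comp_apply] at h ⊢
    have := congrArg (O.θ a) h
    simp only [O.del_θ ha, O.A_θ ha, A_w₁, A_w₂, map_smul, map_sub, map_zero, map_add] at this ⊢
    linear_combination (norm := module) -this

theorem del_d (x : V) : O.del a (O.d x) = -O.d (O.del a x) := by
  simp [del_apply, O.d_d]

/-- The square of `del` is zero: this is the component of degree two in `B` of `d ^ 2 = 0`, because
`del` is the component of `d` which raises `B` by one. -/
theorem inv_del_del (ha : a.im ≠ 0) {x : V} (hx : x ∈ O.inv) : O.del a (O.del a x) = 0 := by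
  have h1 : O.del a (O.del a x) = O.B a (O.d (O.del a x)) - O.d (O.B a (O.del a x)) := rfl
  have h2 := O.inv_B_del ha hx
  have h3 := O.inv_B_del ha (O.inv_d hx)
  have h4 : O.del a (O.del a x) = O.del a (O.B a (O.d x)) - O.del a (O.d (O.B a x)) := by
    rw [← map_sub, ← del_apply]
  rw [h2, map_add] at h1
  simp only [del_d, map_neg] at h3 h4
  have : (2 : ℂ) • O.del a (O.del a x) = 0 := by
    linear_combination (norm := module) h1 - h3 + h4
  exact (smul_eq_zero.1 this).resolve_left two_ne_zero

theorem invT_del (ha : a.im ≠ 0) {p q : ℤ} {x : V} (hx : x ∈ O.invT a p q) :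
    O.del a x ∈ O.invT a p (q + 1) := by
  obtain ⟨h, h1, h2⟩ := hx
  refine ⟨O.inv_del h, ?_, ?_⟩
  · rw [O.inv_A_del ha h, h1, map_smul]
  · rw [O.inv_B_del ha h, h2, map_smul]
    push_cast
    module

/-- On invariant elements of type `(p, q)`, the difference `d - del` has type `(p + 1, q)`. -/
theorem invT_d_sub_del (ha : a.im ≠ 0) {p q : ℤ} {x : V} (hx : x ∈ O.invT a p q) :
    O.d x - O.del a x ∈ O.invT a (p + 1) q := by
  have hd := O.invT_del ha hx
  obtain ⟨h, h1, h2⟩ := hx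
  refine ⟨O.inv.sub_mem (O.inv_d h) (O.inv_del h), ?_, ?_⟩
  · have h3 : O.B a (O.d x) = O.del a x + O.d (O.B a x) := by rw [del_apply]; abel
    have h4 : O.A a (O.d x) = O.D (O.d x) - O.B a (O.d x) := eq_sub_of_add_eq (O.A_add_B _)
    have h5 : O.D x = ((p : ℂ) + q) • x := by rw [← O.A_add_B (a := a), h1, h2, add_smul]
    rw [map_sub, hd.2.1, h4, h3, h2, O.D_d, h5, map_smul, map_smul]
    push_cast
    module
  · have h3 : O.B a (O.d x) = O.del a x + O.d (O.B a x) := by rw [del_apply]; abel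
    rw [map_sub, hd.2.2, h3, h2, map_smul]
    push_cast
    module

theorem basT_τ (ha : a.im ≠ 0) {p q : ℤ} {x : V} (hx : x ∈ O.invT a p (q - 1)) :
    O.τ a x ∈ O.invT a p q := by
  obtain ⟨h, h1, h2⟩ := hx
  refine ⟨O.inv_τ h, by rw [O.A_τ ha, h1, map_smul], ?_⟩
  rw [O.B_τ ha, h2, map_smul]
  push_cast
  module

theorem invT_θ (ha : a.im ≠ 0) {p q : ℤ} {x : V} (hx : x ∈ O.invT a (p - 1) q) :
    O.θ a x ∈ O.invT a p q := by
  obtain ⟨h, h1, h2⟩ := hx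
  refine ⟨O.inv_θ h, ?_, by rw [O.B_θ ha, h2, map_smul]⟩
  rw [O.A_θ ha, h1, map_smul]
  push_cast
  module

theorem basET_le_invT (ha : a.im ≠ 0) (p q : ℤ) : O.basET a p q ≤ O.invT a p q := by
  refine sup_le inf_le_right ?_
  rintro _ ⟨x, hx, rfl⟩
  exact O.basT_τ ha hx.2

theorem basET_del (ha : a.im ≠ 0) {p q : ℤ} {x : V} (hx : x ∈ O.basET a p q) :
    O.del a x ∈ O.basET a p (q + 1) := by
  obtain ⟨y, hy, z, hz, rfl⟩ := O.mem_basET.1 hx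
  refine O.mem_basET.2 ⟨O.del a y, ⟨O.bas_del_mem ha hy.1, O.invT_del ha hy.2⟩, -O.del a z,
    Submodule.neg_mem _ ⟨O.bas_del_mem ha hz.1, ?_⟩, ?_⟩
  · have := O.invT_del ha hz.2
    rwa [show q - 1 + 1 = q + 1 - 1 by ring] at this
  · rw [map_add, O.del_τ ha, map_neg]

/-- The Lefschetz operator. -/
def lef : V →ₗ[ℂ] V := O.w₁ + O.w₂

theorem lef_apply (x : V) : O.lef x = O.w₁ x + O.w₂ x := rfl

theorem lef_del (x : V) : O.del a (O.lef x) = O.lef (O.del a x) := by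
  simp only [lef_apply, map_add, del_w₁, del_w₂]

theorem inv_w₁ {x : V} (hx : x ∈ O.inv) : O.w₁ x ∈ O.inv :=
  O.inv.add_mem (O.inv_d (O.inv_e₁ hx)) (O.inv_e₁ (O.inv_d hx))

theorem inv_w₂ {x : V} (hx : x ∈ O.inv) : O.w₂ x ∈ O.inv :=
  O.inv.add_mem (O.inv_d (O.inv_e₂ hx)) (O.inv_e₂ (O.inv_d hx))

theorem basT_lef {p q : ℤ} {x : V} (hx : x ∈ O.basT a (p - 1) q) :
    O.lef x ∈ O.basT a p (q + 1) := by
  obtain ⟨h, h1, h2⟩ := O.mem_basT.1 hx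
  obtain ⟨h3, h4, h5⟩ := O.mem_bas_iff.1 h
  refine O.mem_basT.2 ⟨O.mem_bas_iff.2 ⟨O.inv.add_mem (O.inv_w₁ h3) (O.inv_w₂ h3), ?_, ?_⟩, ?_, ?_⟩
  · rw [lef_apply, map_add, i₁_w₁, i₁_w₂, h4, map_zero, map_zero, add_zero]
  · rw [lef_apply, map_add, i₂_w₁, i₂_w₂, h5, map_zero, map_zero, add_zero]
  · rw [lef_apply, map_add, A_w₁, A_w₂, h1, map_smul, map_smul]
    push_cast
    module
  · rw [lef_apply, map_add, B_w₁, B_w₂, h2, map_smul, map_smul]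
    push_cast
    module

theorem lef_τ (x : V) : O.lef (O.τ a x) = O.τ a (O.lef x) := by
  simp only [lef_apply, τ_apply, map_add, map_sub, map_smul, e₁_w₁, e₁_w₂', e₂_w₁', e₂_w₂]
  module

theorem basET_lef {p q : ℤ} {x : V} (hx : x ∈ O.basET a (p - 1) q) :
    O.lef x ∈ O.basET a p (q + 1) := by
  obtain ⟨y, hy, z, hz, rfl⟩ := O.mem_basET.1 hx
  refine O.mem_basET.2 ⟨O.lef y, O.basT_lef hy, O.lef z, ?_, ?_⟩
  · have := O.basT_lef hz
    rwa [show q - 1 + 1 = q + 1 - 1 by ring] at this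
  · rw [map_add, lef_τ]

/-- The space `Λ_{B, η^{0,1}}` consists of the invariant elements killed by the contraction dual to
`θ`; the converse is `ι_of_mem_basET`. -/
theorem mem_basET_of_ι (ha : a.im ≠ 0) {p q : ℤ} {x : V} (hx : x ∈ O.invT a p q)
    (h : O.ι a x = 0) : x ∈ O.basET a p q := by
  obtain ⟨h0, h1, h2⟩ := hx
  have h3 : O.ι' a x ∈ O.basT a p (q - 1) := by
    refine O.mem_basT.2 ⟨(O.mem_bas_iff' ha).2 ⟨O.inv_ι' h0, ?_, O.ι'_ι' a x⟩, ?_, ?_⟩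
    · have := O.ι'_ι a x; rw [h, map_zero] at this; exact neg_eq_zero.1 this.symm
    · rw [← O.ι'_A ha, h1, map_smul]
    · have := O.ι'_B ha x
      rw [h2, map_smul] at this
      push_cast
      linear_combination (norm := module) -this
  refine O.mem_basET.2 ⟨x - O.τ a (O.ι' a x), ⟨(O.mem_bas_iff' ha).2 ⟨?_, ?_, ?_⟩, ?_⟩, _, h3,
    sub_add_cancel _ _⟩
  · exact O.inv.sub_mem h0 (O.inv_τ (O.inv_ι' h0))
  · rw [map_sub, h, ι_τ, ((O.mem_bas_iff' ha).1 h3.1).2.1, map_zero, neg_zero, sub_zero]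
  · rw [map_sub, O.ι'_τ ha, ι'_ι', map_zero, sub_zero, sub_self]
  · exact Submodule.sub_mem _ ⟨h0, h1, h2⟩ (O.basT_τ ha h3.2)

theorem ι_of_mem_basET (ha : a.im ≠ 0) {p q : ℤ} {x : V} (hx : x ∈ O.basET a p q) :
    O.ι a x = 0 := by
  obtain ⟨y, hy, z, hz, rfl⟩ := O.mem_basET.1 hx
  rw [map_add, ι_τ, ((O.mem_bas_iff' ha).1 hy.1).2.1, ((O.mem_bas_iff' ha).1 hz.1).2.1, map_zero,
    neg_zero, add_zero]

/-- The twist `(-a) ^ Q`. -/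
def Φ (a : ℂ) : Module.End ℂ V := twist O.Q O.n (-a)

theorem Φ_comm (g : V →ₗ[ℂ] V) (hg : ∀ x, O.Q (g x) = g (O.Q x)) (x : V) :
    O.Φ a (g x) = g (O.Φ a x) := by
  have := twist_comm O.annihilated (-a) (W := ⊤) (fun _ _ => trivial) g 0
    (fun x _ => by rw [Nat.cast_zero, zero_smul, add_zero]; exact hg x) (x := x) trivial
  rwa [pow_zero, one_smul] at this

/-- The form `dη₁` has one factor of type `(1, 0)` in the contact distribution of the first factor.
-/
theorem Φ_w₁ (x : V) : O.Φ a (O.w₁ x) = -a • O.w₁ (O.Φ a x) := by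
  have := twist_comm O.annihilated (-a) (W := ⊤) (fun _ _ => trivial) O.w₁ 1
    (fun x _ => by rw [Nat.cast_one, one_smul]; exact O.Q_w₁ x) (x := x) trivial
  rwa [pow_one] at this

theorem Φ_del (ha : a.im ≠ 0) {p q : ℤ} {x : V} (hx : x ∈ O.basET a p q) :
    O.Φ a (O.del a x) = O.del a (O.Φ a x) := by
  have h (x : V) (hx : x ∈ O.bas) : O.Φ a (O.del a x) = O.del a (O.Φ a x) := by
    have := twist_comm O.annihilated (-a) (W := O.bas) (fun _ h => O.bas_Q_mem h) (O.del a) 0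
      (fun x h => by rw [Nat.cast_zero, zero_smul, add_zero]; exact O.bas_Q_del h) hx
    rwa [pow_zero, one_smul] at this
  obtain ⟨y, hy, z, hz, rfl⟩ := O.mem_basET.1 hx
  have hτ := O.Φ_comm (a := a) (O.τ a) (O.Q_τ a)
  rw [map_add, map_add, map_add, map_add, h y hy.1, O.del_τ ha, map_neg, hτ, h z hz.1, hτ,
    O.del_τ ha]

theorem Φ_invT {p q : ℤ} (b : ℂ) {x : V} (hx : x ∈ O.invT a p q) : O.Φ b x ∈ O.invT a p q := by
  refine ⟨twist_mem (fun _ h => O.inv_Q h) _ hx.1, ?_, ?_⟩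
  · rw [← O.Φ_comm (O.A a) (O.Q_A), hx.2.1, map_smul]
  · rw [← O.Φ_comm (O.B a) (O.Q_B), hx.2.2, map_smul]

/-- The map from the mapping cone to the invariant elements. -/
def Ψ (a : ℂ) (c d : V) : V := O.Φ a (d + O.θ a c)

theorem Ψ_mem (ha : a.im ≠ 0) {p q : ℤ} {c d : V} (hc : c ∈ O.basET a (p - 1) q)
    (hd : d ∈ O.basET a p q) : O.Ψ a c d ∈ O.invT a p q :=
  O.Φ_invT a (Submodule.add_mem _ (O.basET_le_invT ha _ _ hd)
    (O.invT_θ ha (O.basET_le_invT ha _ _ hc)))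

theorem ne_zero_of_im (ha : a.im ≠ 0) : a ≠ 0 := fun h => ha (by simp [h])

theorem Ψ_injective (ha : a.im ≠ 0) {p q : ℤ} {c d : V} (hc : c ∈ O.basET a (p - 1) q)
    (hd : d ∈ O.basET a p q) (h : O.Ψ a c d = 0) : c = 0 ∧ d = 0 := by
  have h1 : d + O.θ a c = 0 := by
    have := twist_twist_inv O.annihilated (inv_ne_zero (neg_ne_zero.2 (ne_zero_of_im ha)))
      (d + O.θ a c)
    rw [inv_inv] at this
    rw [← this]
    exact (congrArg _ h).trans (map_zero _)
  have h2 : c = 0 := by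
    have := congrArg (O.ι a) h1
    rwa [map_add, O.ι_θ ha, O.ι_of_mem_basET ha hc, O.ι_of_mem_basET ha hd, map_zero, sub_zero,
      zero_add, map_zero] at this
  rw [h2, map_zero, add_zero] at h1
  exact ⟨h2, h1⟩

theorem Ψ_surjective (ha : a.im ≠ 0) {p q : ℤ} {x : V} (hx : x ∈ O.invT a p q) :
    ∃ c ∈ O.basET a (p - 1) q, ∃ d ∈ O.basET a p q, O.Ψ a c d = x := by
  set y := twist O.Q O.n (-a)⁻¹ x with hy
  have hxy : O.Φ a y = x := twist_twist_inv O.annihilated (neg_ne_zero.2 (ne_zero_of_im ha)) x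
  have hyT : y ∈ O.invT a p q := by
    have := O.Φ_invT (-(-a)⁻¹) hx
    rwa [Φ, neg_neg] at this
  have hc : O.ι a y ∈ O.invT a (p - 1) q := by
    refine ⟨O.inv_ι hyT.1, ?_, ?_⟩
    · have := O.ι_A ha y
      rw [hyT.2.1, map_smul] at this
      push_cast
      linear_combination (norm := module) -this
    · rw [← O.ι_B ha, hyT.2.2, map_smul]
  refine ⟨O.ι a y, O.mem_basET_of_ι ha hc (O.ι_ι a y), y - O.θ a (O.ι a y),
    O.mem_basET_of_ι ha (Submodule.sub_mem _ hyT (O.invT_θ ha hc)) ?_, ?_⟩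
  · rw [map_sub, O.ι_θ ha, ι_ι, map_zero, sub_zero, sub_self]
  · rw [Ψ, sub_add_cancel, hxy]

/-- The isomorphism is compatible with the differentials. Here the twist is used: `del θ` is the
product with `a dη₁ - dη₂`, and `Φ` carries the product with `-(dη₁ + dη₂)` to it. -/
theorem del_Ψ (ha : a.im ≠ 0) {p q : ℤ} {c d : V} (hc : c ∈ O.basET a (p - 1) q)
    (hd : d ∈ O.basET a p q) :
    O.del a (O.Ψ a c d) = O.Ψ a (-O.del a c) (-(O.lef c - O.del a d)) := by
  have hθ := O.Φ_comm (a := a) (O.θ a) (O.Q_θ a)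
  have hw := O.Φ_comm (a := a) O.w₂ O.Q_w₂
  rw [Ψ, Ψ, map_add, map_add, hθ, O.del_θ ha, ← O.Φ_del ha hc, ← O.Φ_del ha hd, lef_apply,
    map_add, map_neg, map_neg, map_neg, map_sub, map_add, hθ, Φ_w₁, hw]
  module

end SasakiOps

end Decomposition

/-! ### Bidegrees -/

section Bidegree

open ContinuousAlternatingMap MixAlt

variable {E : Type*} [NormedAddCommGroup E] [NormedSpace ℝ E]

theorem csmul_zero (z : ℂ) (k : ℕ) : z • (0 : E [⋀^Fin k]→L[ℝ] ℂ) = 0 :=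
  smul_zero (M := ℂ) (A := E [⋀^Fin k]→L[ℝ] ℂ) z

theorem mixAlt_zero_smul (b : MixAlt E) : (0 : ℂ) • b = 0 := zero_smul ℂ b

/-- A form on a vector space with complex structure `J` has bidegree `(p, q)`. The condition is the
infinitesimal version of the one in `IsType`. -/
def HasBideg (J : E →L[ℝ] E) (p q : ℤ) (b : MixAlt E) : Prop :=
  (∀ k : ℕ, (k : ℤ) ≠ p + q → b k = 0) ∧ ins J b = (Complex.I * (p - q)) • b

variable {J : E →L[ℝ] E}

/-- The contraction with a vector of type `(1, 0)` lowers the first degree. -/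
theorem HasBideg.ctr_left (hJ : J ∘L J = -.id ℝ E) {p q : ℤ} {b : MixAlt E} (hb : HasBideg J p q b)
    (v : E) : HasBideg J (p - 1) q (ctr v b - Complex.I • ctr (J v) b) := by
  have hJv : J (J v) = -v := congrArg (fun f : E →L[ℝ] E => f v) hJ
  refine ⟨fun k hk => ?_, ?_⟩
  · have h0 : b (k + 1) = 0 := hb.1 (k + 1) (by push_cast; omega)
    simp [ctr, h0, csmul_zero]
  · have h1 := congrArg (ctr v) hb.2
    have h2 := congrArg (ctr (J v)) hb.2
    simp only [ctr_ins, ctr_smul, hJv, ctr_neg_left] at h1 h2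
    rw [ins_sub, ins_smul]
    push_cast
    linear_combination (norm := skip) h1 - Complex.I • h2
    match_scalars <;> ring_nf <;> simp [Complex.I_sq]

/-- The contraction with a vector of type `(0, 1)` lowers the second degree. -/
theorem HasBideg.ctr_right (hJ : J ∘L J = -.id ℝ E) {p q : ℤ} {b : MixAlt E}
    (hb : HasBideg J p q b) (v : E) :
    HasBideg J p (q - 1) (ctr v b + Complex.I • ctr (J v) b) := by
  have hJv : J (J v) = -v := congrArg (fun f : E →L[ℝ] E => f v) hJ
  refine ⟨fun k hk => ?_, ?_⟩
  · have h0 : b (k + 1) = 0 := hb.1 (k + 1) (by push_cast; omega)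
    simp [ctr, h0, csmul_zero]
  · have h1 := congrArg (ctr v) hb.2
    have h2 := congrArg (ctr (J v)) hb.2
    simp only [ctr_ins, ctr_smul, hJv, ctr_neg_left] at h1 h2
    rw [ins_add, ins_smul]
    push_cast
    linear_combination (norm := skip) h1 + Complex.I • h2
    match_scalars <;> ring_nf <;> simp [Complex.I_sq]

theorem HasBideg.eq_zero (hJ : J ∘L J = -.id ℝ E) {p q : ℤ} {b : MixAlt E} (hb : HasBideg J p q b)
    (h : p < 0 ∨ q < 0) : b = 0 := by
  funext k
  induction k generalizing p q b with
  | zero =>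
    by_cases h0 : p + q = 0
    · have h1 := congrFun hb.2 0
      have h2 : Complex.I * ((p : ℂ) - q) ≠ 0 := by
        refine mul_ne_zero Complex.I_ne_zero (sub_ne_zero.2 fun h2 => ?_)
        have : p = q := by exact_mod_cast h2
        omega
      ext v
      have h3 := congrArg (fun f : E [⋀^Fin 0]→L[ℝ] ℂ => f v) h1
      rw [ins_zero_apply, Pi.smul_apply] at h3
      exact (mul_eq_zero.1 (h3.symm : Complex.I * ((p : ℂ) - q) * b 0 v = 0)).resolve_left h2
    · exact hb.1 0 (by push_cast; omega)
  | succ k ih =>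
    refine eq_succ_of_ctr fun v => ?_
    have h1 := ih (hb.ctr_left hJ v) (by omega)
    have h2 := ih (hb.ctr_right hJ v) (by omega)
    simp only [Pi.sub_apply, Pi.add_apply, Pi.zero_apply, Pi.smul_apply, ctr_zero] at h1 h2 ⊢
    linear_combination (norm := module) (1 / 2 : ℂ) • h1 + (1 / 2 : ℂ) • h2

theorem mul_zpow_sub_one (z : ℂ) {p : ℤ} (hp : 0 < p) : z * z ^ (p - 1) = z ^ p := by
  obtain ⟨n, rfl⟩ : ∃ n : ℕ, p = n + 1 := ⟨(p - 1).toNat, by omega⟩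
  rw [add_sub_cancel_right, zpow_natCast, ← Nat.cast_succ, zpow_natCast, pow_succ, mul_comm]

/-- Multiplication by the complex number `z`. -/
def cmulAt (J : E →L[ℝ] E) (z : ℂ) : E →L[ℝ] E := z.re • .id ℝ E + z.im • J

/-- From the infinitesimal condition to the action of all complex numbers; the proof is an induction
on the degree through the contractions of type `(1, 0)` and `(0, 1)`. -/
theorem HasBideg.pull_cmulAt (hJ : J ∘L J = -.id ℝ E) {p q : ℤ} {b : MixAlt E}
    (hb : HasBideg J p q b) (z : ℂ) :
    pull (cmulAt J z) b = (z ^ p * (starRingEnd ℂ z) ^ q) • b := by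
  funext k
  induction k generalizing p q b with
  | zero =>
    by_cases h0 : p = 0 ∧ q = 0
    · obtain ⟨rfl, rfl⟩ := h0
      ext v
      simp only [pull, compContinuousLinearMap_apply, zpow_zero, mul_one, one_smul]
      congr 1
      exact Subsingleton.elim _ _
    · have : b 0 = 0 := by
        by_cases h1 : (0 : ℤ) = p + q
        · rw [hb.eq_zero hJ (by omega)]; rfl
        · exact hb.1 0 (by simpa using h1)
      rw [pull, Pi.smul_apply, this]
      ext v
      simp
  | succ k ih =>
    refine eq_succ_of_ctr fun v => ?_
    have hl := hb.ctr_left hJ v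
    have hr := hb.ctr_right hJ v
    have h1 := ih hl
    have h2 := ih hr
    have hz : ctr (cmulAt J z v) b = (1 / 2 : ℂ) • (z • (ctr v b - Complex.I • ctr (J v) b) +
        starRingEnd ℂ z • (ctr v b + Complex.I • ctr (J v) b)) := by
      have hv : cmulAt J z v = z.re • v + z.im • J v := rfl
      rw [hv, ctr_add_left, ctr_smul_left, ctr_smul_left, Complex.re_eq_add_conj,
        Complex.im_eq_sub_conj]
      match_scalars
      · ring
      · have := Complex.I_ne_zero
        field_simp
        ring_nf
        simp [Complex.I_sq]
        ring
    have hp : (z * (z ^ (p - 1) * (starRingEnd ℂ z) ^ q)) •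
        (ctr v b - Complex.I • ctr (J v) b) k =
        (z ^ p * (starRingEnd ℂ z) ^ q) • (ctr v b - Complex.I • ctr (J v) b) k := by
      by_cases hp : 0 < p
      · rw [← mul_assoc, mul_zpow_sub_one z hp]
      · rw [hl.eq_zero hJ (by omega), Pi.zero_apply, csmul_zero, csmul_zero]
    have hq : (starRingEnd ℂ z * (z ^ p * (starRingEnd ℂ z) ^ (q - 1))) •
        (ctr v b + Complex.I • ctr (J v) b) k =
        (z ^ p * (starRingEnd ℂ z) ^ q) • (ctr v b + Complex.I • ctr (J v) b) k := by
      by_cases hq : 0 < q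
      · rw [mul_left_comm, mul_zpow_sub_one _ hq]
      · rw [hr.eq_zero hJ (by omega), Pi.zero_apply, csmul_zero, csmul_zero]
    rw [ctr_pull, hz, pull_smul, pull_add, pull_smul, pull_smul, ctr_smul, Pi.smul_apply,
      Pi.add_apply, Pi.smul_apply, Pi.smul_apply, h1, h2, Pi.smul_apply, Pi.smul_apply, smul_smul,
      smul_smul, hp, hq, Pi.smul_apply, Pi.sub_apply, Pi.add_apply, Pi.smul_apply]
    module

/-- The differential of `y ↦ pull (1 + y J) b` at zero is the insertion of `J`. -/
theorem ins_of_pull_cmulAt {p q : ℕ} {b : MixAlt E}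
    (h : ∀ z : ℂ, pull (cmulAt J z) b = (z ^ p * (starRingEnd ℂ z) ^ q) • b) :
    ins J b = (Complex.I * (p - q)) • b := by
  funext k
  ext v
  have h1 : HasDerivAt (fun y : ℝ => b k (fun i => v i + y • J (v i))) (ins J b k v) 0 := by
    have hf := (b k).toContinuousMultilinearMap.hasFDerivAt (fun i => v i + (0 : ℝ) • J (v i))
    have hg : HasDerivAt (fun y : ℝ => fun i => v i + y • J (v i)) (fun i => J (v i)) 0 := by
      rw [hasDerivAt_pi]
      intro i
      simpa using ((hasDerivAt_id (0 : ℝ)).smul_const (J (v i))).const_add (v i)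
    have := hf.comp_hasDerivAt (0 : ℝ) hg
    refine this.congr_deriv ?_
    rw [ins_apply, ContinuousMultilinearMap.linearDeriv_apply]
    simp
  have h2 : HasDerivAt (fun y : ℝ => ((1 + y * Complex.I) ^ p * (1 - y * Complex.I) ^ q) * b k v)
      ((Complex.I * (p - q)) * b k v) 0 := by
    have hy : HasDerivAt (fun y : ℝ => (y : ℂ) * Complex.I) Complex.I 0 := by
      simpa using (Complex.ofRealCLM.hasDerivAt (x := (0 : ℝ))).mul_const Complex.I
    have := (((hy.const_add 1).pow p).mul ((hy.const_sub 1).pow q)).mul_const (b k v)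
    refine this.congr_deriv ?_
    simp
    left
    ring
  refine h1.unique (h2.congr_of_eventuallyEq (Filter.Eventually.of_forall fun y => ?_))
  have h3 := congrArg (fun f => f v) (congrFun (h (1 + y * Complex.I)) k)
  have h4 : starRingEnd ℂ (1 + y * Complex.I) = 1 - y * Complex.I := by
    simp [sub_eq_add_neg]
  rw [h4] at h3
  refine Eq.trans ?_ h3
  simp only [pull, compContinuousLinearMap_apply]
  congr 1
  funext i
  simp [cmulAt]

end Bidegree

/-! ### The eigenvalues of the twist -/

section Counting

open MixAlt Polynomial

variable {E : Type*} [NormedAddCommGroup E] [NormedSpace ℝ E]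

/-- The operator which counts the factors of type `(1, 0)` in the image of `F`. -/
def countOp (F : E →L[ℝ] E) : Module.End ℂ (MixAlt E) :=
  (1 / 2 : ℂ) • (insHom (-(F ∘L F)) - Complex.I • insHom F)

/-- The contraction with the part of type `(1, 0)` of `v` in the image of `F`. -/
def ctrHol (F : E →L[ℝ] E) (v : E) (b : MixAlt E) : MixAlt E :=
  (1 / 2 : ℂ) • (ctr (-(F (F v))) b - Complex.I • ctr (F v) b)

variable {F : E →L[ℝ] E}

theorem countOp_apply (b : MixAlt E) : countOp F b =
    (1 / 2 : ℂ) • (ins (-(F ∘L F)) b - Complex.I • ins F b) := rfl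

theorem ctrHol_sub (v : E) (b c : MixAlt E) :
    ctrHol F v (b - c) = ctrHol F v b - ctrHol F v c := by
  simp only [ctrHol, ctr_sub]
  module

theorem ctrHol_smul (v : E) (z : ℂ) (b : MixAlt E) : ctrHol F v (z • b) = z • ctrHol F v b := by
  simp only [ctrHol, ctr_smul]
  module

theorem ctr_countOp (v : E) (b : MixAlt E) :
    ctr v (countOp F b) = countOp F (ctr v b) + ctrHol F v b := by
  simp only [countOp_apply, ctrHol, ctr_smul, ctr_sub, ctr_ins, neg_apply,
    ContinuousLinearMap.comp_apply]
  module

theorem ctrHol_countOp (hF : F ∘L F ∘L F = -F) (v : E) (b : MixAlt E) :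
    ctrHol F v (countOp F b) = countOp F (ctrHol F v b) + ctrHol F v b := by
  have h3 : F (F (F v)) = -F v := congrArg (fun f : E →L[ℝ] E => f v) hF
  have hc : countOp F (ctrHol F v b) = (1 / 2 : ℂ) • (countOp F (ctr (-(F (F v))) b) -
      Complex.I • countOp F (ctr (F v) b)) := by
    rw [ctrHol, map_smul, map_sub, map_smul]
  rw [hc, ctrHol, ctr_countOp, ctr_countOp, ctrHol, ctrHol, ctrHol]
  simp only [map_neg, h3, neg_neg, ctr_neg_left]
  match_scalars <;> ring_nf <;> simp [Complex.I_sq] <;> norm_num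

theorem countOp_degree {b : MixAlt E} {k : ℕ} (h : b k = 0) : countOp F b k = 0 := by
  have hi (A : E →L[ℝ] E) : ins A b k = 0 := by
    ext v
    simp [ins_apply, h]
  simp [countOp_apply, hi, csmul_zero]

theorem prod_countOp_succ (k : ℕ) (b : MixAlt E) :
    aeval (countOp F) (∏ j ∈ Finset.range (k + 1), (X - C (j : ℂ))) b =
      countOp F (aeval (countOp F) (∏ j ∈ Finset.range k, (X - C (j : ℂ))) b) -
        (k : ℂ) • aeval (countOp F) (∏ j ∈ Finset.range k, (X - C (j : ℂ))) b := by
  rw [Finset.prod_range_succ, mul_comm, map_mul, Module.End.mul_apply, map_sub, aeval_X, aeval_C,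
    LinearMap.sub_apply, Module.algebraMap_end_apply]

theorem ctr_prod_countOp (hF : F ∘L F ∘L F = -F) (v : E) (k : ℕ) (b : MixAlt E) :
    ctr v (aeval (countOp F) (∏ j ∈ Finset.range k, (X - C (j : ℂ))) b) -
        ctrHol F v (aeval (countOp F) (∏ j ∈ Finset.range k, (X - C (j : ℂ))) b) =
      aeval (countOp F) (∏ j ∈ Finset.range k, (X - C (j : ℂ))) (ctr v b - ctrHol F v b) := by
  induction k with
  | zero => simp
  | succ k ih =>
    rw [prod_countOp_succ, prod_countOp_succ, ← ih, ctr_sub, ctrHol_sub, ctr_smul, ctrHol_smul,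
      ctr_countOp, ctrHol_countOp hF, map_sub]
    module

theorem ctrHol_prod_countOp (hF : F ∘L F ∘L F = -F) (v : E) (k : ℕ) (b : MixAlt E) :
    ctrHol F v (aeval (countOp F) (∏ j ∈ Finset.range (k + 1), (X - C (j : ℂ))) b) =
      countOp F (aeval (countOp F) (∏ j ∈ Finset.range k, (X - C (j : ℂ))) (ctrHol F v b)) +
        aeval (countOp F) (∏ j ∈ Finset.range k, (X - C (j : ℂ))) (ctrHol F v b) := by
  induction k with
  | zero =>
    rw [prod_countOp_succ, Nat.cast_zero, mixAlt_zero_smul, sub_zero]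
    simp only [Finset.range_zero, Finset.prod_empty, map_one, Module.End.one_apply]
    exact ctrHol_countOp hF v b
  | succ k ih =>
    rw [prod_countOp_succ, ctrHol_sub, ctrHol_smul, ctrHol_countOp hF, ih, prod_countOp_succ k]
    simp only [map_add, map_sub, map_smul]
    push_cast
    module

/-- In degree `k` the eigenvalues of the counting operator are among `0, …, k`. -/
theorem prod_countOp_eq_zero (hF : F ∘L F ∘L F = -F) (k : ℕ) (b : MixAlt E) :
    aeval (countOp F) (∏ j ∈ Finset.range (k + 1), (X - C (j : ℂ))) b k = 0 := by
  induction k generalizing b with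
  | zero =>
    rw [prod_countOp_succ, Nat.cast_zero, mixAlt_zero_smul, sub_zero, countOp_apply, Pi.smul_apply,
      Pi.sub_apply, Pi.smul_apply, ins_zero_apply, ins_zero_apply, csmul_zero, sub_zero, csmul_zero]
  | succ k ih =>
    refine eq_succ_of_ctr (c := 0) fun v => ?_
    have h1 := ih (ctr v b - ctrHol F v b)
    have h2 := ih (ctrHol F v b)
    have h3 := congrFun (ctr_prod_countOp hF v (k + 2) b) k
    have h4 := congrFun (ctrHol_prod_countOp hF v (k + 1) b) k
    rw [prod_countOp_succ (k + 1) (ctr v b - ctrHol F v b), Pi.sub_apply, Pi.sub_apply,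
      countOp_degree h1, Pi.smul_apply, h1, csmul_zero, sub_zero] at h3
    rw [Pi.add_apply, countOp_degree h2, h2, add_zero] at h4
    rw [h4, sub_zero] at h3
    exact h3

theorem prod_countOp_eq_zero_of_le (hF : F ∘L F ∘L F = -F) {k n : ℕ} (h : k ≤ n) (b : MixAlt E) :
    aeval (countOp F) (∏ j ∈ Finset.range (n + 1), (X - C (j : ℂ))) b k = 0 := by
  induction n, h using Nat.le_induction with
  | base => exact prod_countOp_eq_zero hF k b
  | succ n _ ih =>
    rw [prod_countOp_succ, Pi.sub_apply, countOp_degree ih, Pi.smul_apply, ih, csmul_zero, sub_zero]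

theorem mixAlt_eq_zero_of_finrank_lt [FiniteDimensional ℝ E] {k : ℕ}
    (hk : Module.finrank ℝ E < k) (b : E [⋀^Fin k]→L[ℝ] ℂ) : b = 0 := by
  ext v
  exact b.toAlternatingMap.map_linearDependent v fun h => by
    have := h.fintype_card_le_finrank
    simp at this
    omega

theorem prod_countOp_finrank [FiniteDimensional ℝ E] (hF : F ∘L F ∘L F = -F) (b : MixAlt E) :
    aeval (countOp F) (∏ j ∈ Finset.range (Module.finrank ℝ E + 1), (X - C (j : ℂ))) b = 0 := by
  funext k
  by_cases h : k ≤ Module.finrank ℝ E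
  · exact prod_countOp_eq_zero_of_le hF h b
  · exact mixAlt_eq_zero_of_finrank_lt (by omega) _

end Counting

/-! ### One-forms -/

section OneForms

open ContinuousAlternatingMap MixAlt

variable {E : Type*} [NormedAddCommGroup E] [NormedSpace ℝ E]

namespace MixAlt

/-- A linear functional as a form of degree one. -/
def one (θ : E →L[ℝ] ℝ) : MixAlt E
  | 1 => ofSubsingleton ℝ E ℂ (0 : Fin 1) (Complex.ofRealCLM.comp θ)
  | _ => 0

/-- A number as a form of degree zero. -/
def const (z : ℂ) : MixAlt E
  | 0 => constOfIsEmpty ℝ E (Fin 0) z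
  | _ + 1 => 0

theorem ctr_const (z : ℂ) (v : E) : ctr v (const z) = 0 := by
  funext k; ext u; simp [ctr, const]

theorem ctr_one (θ : E →L[ℝ] ℝ) (v : E) : ctr v (one θ) = const (θ v) := by
  funext k
  match k with
  | 0 => ext u; simp [ctr, const, one]
  | k + 1 => ext u; simp [ctr, const, one]

theorem sgn_const (z : ℂ) : sgn (const z : MixAlt E) = const z := by
  funext k
  match k with
  | 0 => ext u; simp [sgn, const]
  | k + 1 => ext u; simp [sgn, const]

theorem sgn_one (θ : E →L[ℝ] ℝ) : sgn (one θ) = -one θ := by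
  funext k
  match k with
  | 0 => ext u; simp [sgn, one]
  | 1 => ext u; simp [sgn, one]
  | k + 2 => ext u; simp [sgn, one]

theorem wedge_const (z : ℂ) (b : MixAlt E) : wedge (const z) b = z • b := by
  funext k
  induction k generalizing b with
  | zero => ext v; simp [wedge_degree_zero, const]
  | succ k ih =>
    refine eq_succ_of_ctr fun v => ?_
    rw [ctr_wedge, ctr_const, wedge_zero_left, sgn_const, zero_add, ih, ctr_smul]

theorem ctr_one_wedge (θ : E →L[ℝ] ℝ) (v : E) (b : MixAlt E) :
    ctr v (wedge (one θ) b) = (θ v : ℂ) • b - wedge (one θ) (ctr v b) := by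
  rw [ctr_wedge, ctr_one, wedge_const, sgn_one, wedge_neg_left, sub_eq_add_neg]

theorem one_wedge_zero (θ : E →L[ℝ] ℝ) (b : MixAlt E) : wedge (one θ) b 0 = 0 := by
  ext v; simp [wedge_degree_zero, one]

theorem wedge_one_wedge (c : MixAlt E) (θ : E →L[ℝ] ℝ) (b : MixAlt E) :
    wedge c (wedge (one θ) b) = wedge (one θ) (wedge (sgn c) b) := by
  funext k
  induction k generalizing b c with
  | zero => ext v; simp [wedge_degree_zero, one_wedge_zero]
  | succ k ih =>
    refine eq_succ_of_ctr fun v => ?_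
    have h1 := ih (ctr v c) b
    have h2 := ih (sgn c) (ctr v b)
    rw [sgn_sgn] at h2
    simp only [ctr_wedge v c, ctr_one_wedge, ctr_wedge v (sgn c), ctr_sgn, sgn_sgn, wedge_add_right,
      wedge_sub_right, wedge_neg_left, wedge_neg_right, wedge_smul_right, Pi.add_apply,
      Pi.sub_apply, Pi.neg_apply, h1, h2]
    module

theorem one_wedge_one_wedge (θ θ' : E →L[ℝ] ℝ) (b : MixAlt E) :
    wedge (one θ) (wedge (one θ') b) = -wedge (one θ') (wedge (one θ) b) := by
  rw [wedge_one_wedge, sgn_one, wedge_neg_left, wedge_neg_right]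

theorem one_wedge_self (θ : E →L[ℝ] ℝ) (b : MixAlt E) : wedge (one θ) (wedge (one θ) b) = 0 := by
  have h := one_wedge_one_wedge θ θ b
  funext k
  ext v
  have := congrArg (fun c : MixAlt E => c k v) h
  simp only [Pi.neg_apply, ContinuousAlternatingMap.neg_apply] at this
  simpa using self_eq_neg.1 this

theorem ins_one (A : E →L[ℝ] E) (θ : E →L[ℝ] ℝ) : ins A (one θ) = one (θ ∘L A) := by
  funext k
  ext v
  match k with
  | 0 => simp [ins_apply, one]
  | 1 => simp [ins_apply, one]
  | k + 2 => simp [ins_apply, one]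

theorem one_zero : one (0 : E →L[ℝ] ℝ) = 0 := by
  funext k
  match k with
  | 0 => rfl
  | 1 => ext v; simp [one]
  | k + 2 => rfl

/-- The insertion of an endomorphism of rank one. -/
theorem ins_smulRight (θ : E →L[ℝ] ℝ) (X : E) (b : MixAlt E) :
    ins (θ.smulRight X) b = wedge (one θ) (ctr X b) := by
  funext k
  induction k generalizing b with
  | zero => rw [ins_zero_apply, one_wedge_zero]
  | succ k ih =>
    refine eq_succ_of_ctr fun v => ?_
    rw [ctr_ins, ctr_one_wedge, ctr_ctr_swap v X, wedge_neg_right, sub_neg_eq_add, Pi.add_apply, ih,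
      ContinuousLinearMap.smulRight_apply, ctr_smul_left]
    rfl

theorem one_add (θ θ' : E →L[ℝ] ℝ) : one (θ + θ') = one θ + one θ' := by
  refine funext fun k => ?_
  match k with
  | 0 => ext v; simp [one]
  | 1 => ext v; simp [one]
  | k + 2 => ext v; simp [one]

theorem one_sub (θ θ' : E →L[ℝ] ℝ) : one (θ - θ') = one θ - one θ' := by
  refine funext fun k => ?_
  match k with
  | 0 => ext v; simp [one]
  | 1 => ext v; simp [one]
  | k + 2 => ext v; simp [one]

/-- Linear functionals as forms of degree one, as a continuous linear map. -/
def oneCLM : (E →L[ℝ] ℝ) →L[ℝ] (E [⋀^Fin 1]→L[ℝ] ℂ) :=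
  (ofSubsingletonLIE (𝕜 := ℝ) (E := E) (F := ℂ) (0 : Fin 1)).toContinuousLinearEquiv.toContinuousLinearMap ∘L
      (ContinuousLinearMap.compL ℝ E ℝ ℂ Complex.ofRealCLM)

/-- A family of linear functionals as a linear family of forms. -/
def oneFam (S : E →L[ℝ] E →L[ℝ] ℝ) : MixFam E
  | 1 => oneCLM ∘L S
  | _ => 0

@[simp] theorem famApp_oneFam (S : E →L[ℝ] E →L[ℝ] ℝ) (v : E) : famApp (oneFam S) v = one (S v) := by
  funext k
  match k with
  | 0 => rfl
  | 1 => rfl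
  | k + 2 => rfl

/-- A two-form obtained from a family of linear functionals. -/
theorem ctr_altHom_oneFam (S : E →L[ℝ] E →L[ℝ] ℝ) (v : E) :
    ctr v (altHom (oneFam S)) = one (S v - S.flip v) := by
  have h0 (w : E) : ctrFam w (ctrFam v (oneFam S)) = 0 := by
    refine ext_famApp fun u => ?_
    rw [famApp_ctrFam, famApp_ctrFam, famApp_oneFam, ctr_one, ctr_const, famApp_zero]
  have h1 : altHom (ctrFam v (oneFam S)) = one (S.flip v) := by
    funext k
    cases k with
    | zero => rfl
    | succ k =>
      refine eq_succ_of_ctr fun w => ?_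
      rw [ctr_altHom, h0, LinearMap.map_zero, sub_zero, ctr_one, famApp_ctrFam, famApp_oneFam, ctr_one]
      rfl
  rw [ctr_altHom, famApp_oneFam, h1, one_sub]

end MixAlt

end OneForms

/-! ### One-forms on a manifold and the operators on its smooth forms -/

section Covectors

open ContinuousAlternatingMap Set MixAlt

variable {E : Type*} [NormedAddCommGroup E] [NormedSpace ℝ E]
  {H : Type*} [TopologicalSpace H] {I : ModelWithCorners ℝ E H}
  {M : Type*} [TopologicalSpace M] [ChartedSpace H M]

variable (I M) in
/-- Fields of real linear functionals on the tangent spaces. -/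
abbrev CovField : Type _ := ∀ x : M, TangentSpace I x →L[ℝ] ℝ

/-- The value of a field of functionals at a point, as a functional on the model space. -/
def covAt (η : CovField I M) (x : M) : E →L[ℝ] ℝ := η x

/-- A field of functionals as a complex valued one-form. -/
def covForm (η : CovField I M) : ExtForm I M ℂ := oneForm fun x => Complex.ofRealCLM.comp (η x)

/-- A field of functionals in the chart at `x₀`. -/
def chartCov (η : CovField I M) (x₀ : M) (y : E) : E →L[ℝ] ℝ :=
  covAt η ((extChartAt I x₀).symm y) ∘L symmD I x₀ y

/-- The derivative of a field of functionals at `x` in the chart at `x`. -/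
def covD (η : CovField I M) (x : M) : E →L[ℝ] E →L[ℝ] ℝ :=
  fderiv ℝ (chartCov η x) (extChartAt I x x)

/-- Smoothness of a field of functionals, in charts. -/
def IsSmoothCov (η : CovField I M) : Prop :=
  ∀ x₀ : M, ContDiffOn ℝ ∞ (chartCov η x₀) (extChartAt I x₀).target

/-- Smoothness of a vector field, in charts. -/
def IsSmoothVec (X : VField I M) : Prop :=
  ∀ x₀ : M, ContDiffOn ℝ ∞ (chartField X x₀) (extChartAt I x₀).target

theorem formAt_covForm (η : CovField I M) (x : M) : formAt (covForm η) x = one (covAt η x) := by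
  funext k
  match k with
  | 0 => rfl
  | 1 => rfl
  | k + 2 => rfl

theorem chartForm_covForm (η : CovField I M) (x₀ : M) (y : E) :
    chartForm (covForm η) x₀ y = one (chartCov η x₀ y) := by
  rw [chartForm_eq, formAt_covForm]
  refine funext fun k => ?_
  match k with
  | 0 => rfl
  | 1 => rfl
  | k + 2 => rfl

theorem isSmooth_covForm {η : CovField I M} (hη : IsSmoothCov η) : IsSmooth (covForm η) := by
  intro k x₀
  have h (y : E) : inChart (covForm η k) x₀ y = one (chartCov η x₀ y) k :=
    congrFun (chartForm_covForm η x₀ y) k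
  refine ContDiffOn.congr ?_ fun y _ => h y
  match k with
  | 0 => exact contDiffOn_const (c := 0)
  | 1 => exact oneCLM.contDiff.comp_contDiffOn (hη x₀)
  | k + 2 => exact contDiffOn_const (c := 0)

theorem formAt_sub (α β : ExtForm I M ℂ) (x : M) :
    formAt (α - β) x = formAt α x - formAt β x := rfl

theorem formAt_neg (α : ExtForm I M ℂ) (x : M) : formAt (-α) x = -formAt α x := rfl

theorem form_wedge_add (α β γ : ExtForm I M ℂ) : wedge α (β + γ) = wedge α β + wedge α γ :=
  ext_formAt fun x => wedge_add_right (formAt α x) (formAt β x) (formAt γ x)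

theorem form_wedge_smul (α : ExtForm I M ℂ) (z : ℂ) (β : ExtForm I M ℂ) :
    wedge α (z • β) = z • wedge α β :=
  ext_formAt fun x => wedge_smul_right z (formAt α x) (formAt β x)

theorem insForm_add (A : EndField I M) (α β : ExtForm I M ℂ) :
    insForm A (α + β) = insForm A α + insForm A β :=
  ext_formAt fun x => ins_add (endAt A x) (formAt α x) (formAt β x)

theorem insForm_smul (A : EndField I M) (z : ℂ) (β : ExtForm I M ℂ) :
    insForm A (z • β) = z • insForm A β :=
  ext_formAt fun x => ins_smul (endAt A x) z (formAt β x)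

theorem ext_smoothForms {α β : smoothForms I M}
    (h : ∀ x, formAt (α : ExtForm I M ℂ) x = formAt (β : ExtForm I M ℂ) x) : α = β :=
  Subtype.ext (ext_formAt h)

variable [IsManifold I ∞ M]

theorem covAt_eq_chartCov (η : CovField I M) (x : M) :
    covAt η x = chartCov η x (extChartAt I x x) := by
  rw [chartCov, extChartAt_to_inv, symmD_self]
  rfl

variable [I.Boundaryless]

theorem hasFDerivAt_chartCov {η : CovField I M} (hη : IsSmoothCov η) (x : M) :
    HasFDerivAt (chartCov η x) (covD η x) (extChartAt I x x) :=
  (((hη x).contDiffAt (extChartAt_target_mem_nhds x)).differentiableAt (by simp)).hasFDerivAt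

theorem hasFormDerivAt_covForm {η : CovField I M} (hη : IsSmoothCov η) (x : M) :
    HasFormDerivAt (chartForm (covForm η) x) (oneFam (covD η x)) (extChartAt I x x) := by
  intro k
  have h : (fun y => chartForm (covForm η) x y k) = fun y => one (chartCov η x y) k :=
    funext fun y => congrFun (chartForm_covForm η x y) k
  rw [h]
  match k with
  | 0 => exact hasFDerivAt_const 0 _
  | 1 => exact oneCLM.hasFDerivAt.comp _ (hasFDerivAt_chartCov hη x)
  | k + 2 => exact hasFDerivAt_const 0 _

theorem formAt_extD_covForm {η : CovField I M} (hη : IsSmoothCov η) (x : M) :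
    formAt (extD (covForm η)) x = altHom (oneFam (covD η x)) :=
  formAt_extD_of_hasFormDerivAt (isSmooth_covForm hη) (hasFormDerivAt_covForm hη x)

theorem lieD_covForm {X : VField I M} (hX : IsSmoothVec X) {η : CovField I M} (hη : IsSmoothCov η)
    (h : ∀ x w, covD η x (fieldAt X x) w + covAt η x (fieldD X x w) = 0) :
    lieD X (covForm η) = 0 := by
  refine ext_formAt fun x => ?_
  rw [formAt_lieD hX (isSmooth_covForm hη) (hasFormDerivAt_covForm hη x), famApp_oneFam,
    formAt_covForm, ins_one, ← one_add, formAt_zero, ← one_zero]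
  congr 1
  ext w
  exact h x w

/-- The two-form defined by `S` is multiplied by `r` by the insertion of `A` if the bilinear form
defined by `S` is. -/
theorem ins_altHom_oneFam {S : E →L[ℝ] E →L[ℝ] ℝ} {A : E →L[ℝ] E} (r : ℝ)
    (h : ∀ v w, (S (A v) w - S w (A v)) + (S v (A w) - S (A w) v) = r * (S v w - S w v)) :
    ins A (altHom (oneFam S)) = (r : ℂ) • altHom (oneFam S) := by
  funext k
  cases k with
  | zero => ext v; simp [ins_zero_apply]; exact Or.inr rfl
  | succ k =>
    refine eq_succ_of_ctr fun v => ?_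
    have hr : (r : ℂ) • one (S v - S.flip v) = one (r • (S v - S.flip v)) := by
      refine funext fun k => ?_
      match k with
      | 0 => ext v; simp [one]
      | 1 => ext v; simp [one]
      | k + 2 => ext v; simp [one]
    rw [ctr_ins, ctr_altHom_oneFam, ctr_altHom_oneFam, ins_one, ctr_smul, ctr_altHom_oneFam, hr,
      ← one_add]
    congr 2
    ext w
    exact h v w

theorem sgn_altHom_oneFam (S : E →L[ℝ] E →L[ℝ] ℝ) :
    sgn (altHom (oneFam S)) = altHom (oneFam S) := by
  funext k
  cases k with
  | zero => ext v; simp [sgn]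
  | succ k =>
    refine eq_succ_of_ctr fun v => ?_
    rw [ctr_sgn, ctr_altHom_oneFam, sgn_one, neg_neg]

/-- The exterior derivative on smooth forms. -/
def dOp : smoothForms I M →ₗ[ℂ] smoothForms I M where
  toFun β := ⟨extD β, IsSmooth.extD β.2⟩
  map_add' α β := Subtype.ext (extD_add α.2 β.2)
  map_smul' z β := Subtype.ext (extD_smul z β.2)

/-- The contraction with a smooth vector field, on smooth forms. -/
def ctrOp (X : VField I M) (hX : IsSmoothVec X) : smoothForms I M →ₗ[ℂ] smoothForms I M where
  toFun β := ⟨contract X β, IsSmooth.contract hX β.2⟩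
  map_add' _ _ := rfl
  map_smul' _ _ := rfl

/-- The product with a smooth one-form, on smooth forms. -/
def covOp (η : CovField I M) (hη : IsSmoothCov η) : smoothForms I M →ₗ[ℂ] smoothForms I M where
  toFun β := ⟨SasakiProduct.wedge (covForm η) β, IsSmooth.wedge (isSmooth_covForm hη) β.2⟩
  map_add' α β := Subtype.ext (form_wedge_add (covForm η) α β)
  map_smul' z β := Subtype.ext (form_wedge_smul (covForm η) z β)

/-- The insertion of a smooth field of endomorphisms, on smooth forms. -/
def insOp (A : EndField I M) (hA : IsSmoothEnd A) : smoothForms I M →ₗ[ℂ] smoothForms I M where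
  toFun β := ⟨insForm A β, IsSmooth.insForm hA β.2⟩
  map_add' α β := Subtype.ext (insForm_add A α β)
  map_smul' z β := Subtype.ext (insForm_smul A z β)

theorem coe_ctrOp (X : VField I M) (hX : IsSmoothVec X) (β : smoothForms I M) :
    (ctrOp X hX β : ExtForm I M ℂ) = contract X β := rfl
theorem coe_covOp (η : CovField I M) (hη : IsSmoothCov η) (β : smoothForms I M) :
    (covOp η hη β : ExtForm I M ℂ) = wedge (covForm η) β := rfl
theorem coe_insOp (A : EndField I M) (hA : IsSmoothEnd A) (β : smoothForms I M) :
    (insOp A hA β : ExtForm I M ℂ) = insForm A β := rfl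

/-- The anticommutator of `d` and the product with `η` is the product with `dη`. -/
theorem extD_covForm_wedge {η : CovField I M} (hη : IsSmoothCov η) {β : ExtForm I M ℂ}
    (hβ : IsSmooth β) (x : M) :
    formAt (extD (wedge (covForm η) β)) x + formAt (wedge (covForm η) (extD β)) x =
      MixAlt.wedge (altHom (oneFam (covD η x))) (formAt β x) := by
  rw [extD_wedge (isSmooth_covForm hη) hβ, formAt_add, formAt_wedge, formAt_wedge, formAt_wedge,
    formAt_sgnForm, formAt_covForm, sgn_one, wedge_neg_left, formAt_extD_covForm hη]
  abel

variable (I M) in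
/-- The identity field of endomorphisms. Its insertion multiplies a form by its degree. -/
def idEnd : EndField I M := fun x => .id ℝ (TangentSpace I x)

theorem endAt_idEnd (x : M) : endAt (idEnd I M) x = .id ℝ E := rfl

theorem chartEnd_idEnd {x₀ : M} {y : E} (hy : y ∈ (extChartAt I x₀).target) :
    chartEnd (idEnd I M) x₀ y = .id ℝ E := by
  rw [chartEnd, endAt_idEnd, ContinuousLinearMap.id_comp, chartD_comp_symmD hy]

theorem isSmoothEnd_idEnd : IsSmoothEnd (idEnd I M) := fun _ =>
  contDiffOn_const.congr fun _ hy => chartEnd_idEnd hy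

theorem endD_idEnd (x : M) : endD (idEnd I M) x = 0 := by
  have h : chartEnd (idEnd I M) x =ᶠ[nhds (extChartAt I x x)] fun _ => .id ℝ E := by
    filter_upwards [extChartAt_target_mem_nhds (I := I) x] with y hy using chartEnd_idEnd hy
  rw [endD, h.fderiv_eq, fderiv_fun_const]
  rfl

theorem insForm_idEnd_extD {β : ExtForm I M ℂ} (hβ : IsSmooth β) :
    insForm (idEnd I M) (extD β) = extD (insForm (idEnd I M) β) + extD β := by
  refine ext_formAt fun x => ?_
  have hT := hβ.hasFormDerivAt x
  rw [formAt_insForm, formAt_add, formAt_extD_of_hasFormDerivAt hβ hT,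
    formAt_extD_of_hasFormDerivAt (hβ.insForm isSmoothEnd_idEnd)
      (hasFormDerivAt_insForm isSmoothEnd_idEnd hT), ins_altHom, ← LinearMap.map_add]
  congr 1
  refine ext_famApp fun v => ?_
  simp only [famApp_add, famApp_compFam, famApp_insFam, famApp_insFamL, endD_idEnd, endAt_idEnd,
    zero_apply, ContinuousLinearMap.id_apply]
  rw [show ins (0 : E →L[ℝ] E) (formAt β x) = 0 from ins_eq_zero fun v => by
    rw [zero_apply, ctr_zero_left]]
  abel

end Covectors

/-! ### Pairs of transverse structures -/

section Pairs

open Set MixAlt Polynomial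

variable {E : Type*} [NormedAddCommGroup E] [NormedSpace ℝ E]
  {H : Type*} [TopologicalSpace H] {I : ModelWithCorners ℝ E H}
  {M : Type*} [TopologicalSpace M] [ChartedSpace H M]

/-- The tensor fields which two Sasakian structures induce on the product of the manifolds, with the
relations between them: the Reeb fields `X₁`, `X₂`, the contact forms `η₁`, `η₂`, the complex
structures `F₁`, `F₂` of the two contact distributions, and the projection `R₁` to the tangent
bundle of the first factor. The derivatives are taken in the preferred charts. -/
structure SasakiPair (I : ModelWithCorners ℝ E H) (M : Type*) [TopologicalSpace M]
    [ChartedSpace H M] where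
  X₁ : VField I M
  X₂ : VField I M
  η₁ : CovField I M
  η₂ : CovField I M
  F₁ : EndField I M
  F₂ : EndField I M
  R₁ : EndField I M
  smooth_X₁ : IsSmoothVec X₁
  smooth_X₂ : IsSmoothVec X₂
  smooth_η₁ : IsSmoothCov η₁
  smooth_η₂ : IsSmoothCov η₂
  smooth_F₁ : IsSmoothEnd F₁
  smooth_F₂ : IsSmoothEnd F₂
  smooth_R₁ : IsSmoothEnd R₁
  η₁_X₁ : ∀ x, covAt η₁ x (fieldAt X₁ x) = 1
  η₂_X₂ : ∀ x, covAt η₂ x (fieldAt X₂ x) = 1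
  η₁_X₂ : ∀ x, covAt η₁ x (fieldAt X₂ x) = 0
  η₂_X₁ : ∀ x, covAt η₂ x (fieldAt X₁ x) = 0
  F₁_X₁ : ∀ x, endAt F₁ x (fieldAt X₁ x) = 0
  F₁_X₂ : ∀ x, endAt F₁ x (fieldAt X₂ x) = 0
  F₂_X₁ : ∀ x, endAt F₂ x (fieldAt X₁ x) = 0
  F₂_X₂ : ∀ x, endAt F₂ x (fieldAt X₂ x) = 0
  η₁_F₁ : ∀ x, covAt η₁ x ∘L endAt F₁ x = 0
  η₁_F₂ : ∀ x, covAt η₁ x ∘L endAt F₂ x = 0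
  η₂_F₁ : ∀ x, covAt η₂ x ∘L endAt F₁ x = 0
  η₂_F₂ : ∀ x, covAt η₂ x ∘L endAt F₂ x = 0
  F₁_F₂ : ∀ x, endAt F₁ x ∘L endAt F₂ x = 0
  F₂_F₁ : ∀ x, endAt F₂ x ∘L endAt F₁ x = 0
  R₁_eq : ∀ x, endAt R₁ x =
    -(endAt F₁ x ∘L endAt F₁ x) + (covAt η₁ x).smulRight (fieldAt X₁ x)
  R₂_eq : ∀ x, endAt F₂ x ∘L endAt F₂ x =
    -.id ℝ E + endAt R₁ x + (covAt η₂ x).smulRight (fieldAt X₂ x)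
  X_comm : ∀ x, fieldD X₂ x (fieldAt X₁ x) = fieldD X₁ x (fieldAt X₂ x)
  L₁_F₁ : ∀ x, endD F₁ x (fieldAt X₁ x) = fieldD X₁ x ∘L endAt F₁ x - endAt F₁ x ∘L fieldD X₁ x
  L₁_F₂ : ∀ x, endD F₂ x (fieldAt X₁ x) = fieldD X₁ x ∘L endAt F₂ x - endAt F₂ x ∘L fieldD X₁ x
  L₂_F₁ : ∀ x, endD F₁ x (fieldAt X₂ x) = fieldD X₂ x ∘L endAt F₁ x - endAt F₁ x ∘L fieldD X₂ x
  L₂_F₂ : ∀ x, endD F₂ x (fieldAt X₂ x) = fieldD X₂ x ∘L endAt F₂ x - endAt F₂ x ∘L fieldD X₂ x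
  L₁_η₁ : ∀ x w, covD η₁ x (fieldAt X₁ x) w + covAt η₁ x (fieldD X₁ x w) = 0
  L₁_η₂ : ∀ x w, covD η₂ x (fieldAt X₁ x) w + covAt η₂ x (fieldD X₁ x w) = 0
  L₂_η₁ : ∀ x w, covD η₁ x (fieldAt X₂ x) w + covAt η₁ x (fieldD X₂ x w) = 0
  L₂_η₂ : ∀ x w, covD η₂ x (fieldAt X₂ x) w + covAt η₂ x (fieldD X₂ x w) = 0
  dη₁_F₁ : ∀ x v w, (covD η₁ x (endAt F₁ x v) w - covD η₁ x w (endAt F₁ x v)) +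
    (covD η₁ x v (endAt F₁ x w) - covD η₁ x (endAt F₁ x w) v) = 0
  dη₂_F₂ : ∀ x v w, (covD η₂ x (endAt F₂ x v) w - covD η₂ x w (endAt F₂ x v)) +
    (covD η₂ x v (endAt F₂ x w) - covD η₂ x (endAt F₂ x w) v) = 0
  dη₁_F₂ : ∀ x v w, covD η₁ x (endAt F₂ x v) w - covD η₁ x w (endAt F₂ x v) = 0
  dη₂_F₁ : ∀ x v w, covD η₂ x (endAt F₁ x v) w - covD η₂ x w (endAt F₁ x v) = 0
  dη₁_sq : ∀ x v w, covD η₁ x (endAt F₁ x (endAt F₁ x v)) w -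
    covD η₁ x w (endAt F₁ x (endAt F₁ x v)) = -(covD η₁ x v w - covD η₁ x w v)
  bracket₁₁ : ∀ x v w, ∃ r : ℝ, frolicher F₁ F₁ x v w = r • fieldAt X₁ x
  bracket₂₂ : ∀ x v w, ∃ r : ℝ, frolicher F₂ F₂ x v w = r • fieldAt X₂ x
  bracket₁₂ : ∀ x v w, frolicher F₁ F₂ x v w = 0
  bracketR₁ : ∀ x v w, frolicher R₁ F₁ x v w = 0
  bracketR₂ : ∀ x v w, frolicher R₁ F₂ x v w = 0

namespace SasakiPair

variable [IsManifold I ∞ M] [I.Boundaryless] (𝒬 : SasakiPair I M)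

theorem form_zero_wedge (β : ExtForm I M ℂ) : wedge (0 : ExtForm I M ℂ) β = 0 :=
  ext_formAt fun x => wedge_zero_left (formAt β x)

theorem lieD_covForm_wedge {X : VField I M} (hX : IsSmoothVec X) {η : CovField I M}
    (hη : IsSmoothCov η) (h : ∀ x w, covD η x (fieldAt X x) w + covAt η x (fieldD X x w) = 0)
    {β : ExtForm I M ℂ} (hβ : IsSmooth β) :
    lieD X (SasakiProduct.wedge (covForm η) β) = SasakiProduct.wedge (covForm η) (lieD X β) := by
  rw [lieD_wedge hX (isSmooth_covForm hη) hβ, lieD_covForm hX hη h, form_zero_wedge, zero_add]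

theorem ctr_eq_zero_of_smul {X : VField I M} {β : ExtForm I M ℂ} (h : contract X β = 0) {x : M}
    {u : E} (hu : ∃ r : ℝ, u = r • fieldAt X x) : ctr u (formAt β x) = 0 := by
  obtain ⟨r, rfl⟩ := hu
  have h1 : ctr (fieldAt X x) (formAt β x) = 0 := congrArg (fun γ => formAt γ x) h
  rw [ctr_smul_left, h1]
  funext k
  exact csmul_zero _ k

theorem smooth_sq : IsSmoothEnd (compEnd 𝒬.F₁ 𝒬.F₁) := 𝒬.smooth_F₁.compEnd 𝒬.smooth_F₁

/-- The derivative of the square of `F₁` along a field which preserves `F₁`. -/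
theorem L_sq {X : VField I M} {x : M} (h : endD 𝒬.F₁ x (fieldAt X x) =
      fieldD X x ∘L endAt 𝒬.F₁ x - endAt 𝒬.F₁ x ∘L fieldD X x) :
    endD (compEnd 𝒬.F₁ 𝒬.F₁) x (fieldAt X x) = fieldD X x ∘L endAt (compEnd 𝒬.F₁ 𝒬.F₁) x -
      endAt (compEnd 𝒬.F₁ 𝒬.F₁) x ∘L fieldD X x := by
  rw [hasFDerivAt_chartEnd_compEnd 𝒬.smooth_F₁ 𝒬.smooth_F₁, h, endAt_compEnd]
  ext v
  simp

theorem insForm_R₁ (β : ExtForm I M ℂ) : insForm 𝒬.R₁ β =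
    -insForm (compEnd 𝒬.F₁ 𝒬.F₁) β + wedge (covForm 𝒬.η₁) (contract 𝒬.X₁ β) := by
  refine ext_formAt fun x => ?_
  rw [formAt_add, formAt_neg, formAt_insForm, formAt_insForm, formAt_wedge, formAt_covForm,
    formAt_contract, 𝒬.R₁_eq, ins_add_left, ins_neg_left, ins_smulRight, endAt_compEnd]

theorem insForm_sq₂ (β : ExtForm I M ℂ) : insForm (compEnd 𝒬.F₂ 𝒬.F₂) β =
    -insForm (idEnd I M) β + (-insForm (compEnd 𝒬.F₁ 𝒬.F₁) β +
      wedge (covForm 𝒬.η₁) (contract 𝒬.X₁ β)) + wedge (covForm 𝒬.η₂) (contract 𝒬.X₂ β) := by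
  rw [← 𝒬.insForm_R₁]
  refine ext_formAt fun x => ?_
  rw [formAt_add, formAt_add, formAt_neg, formAt_insForm, formAt_insForm, formAt_insForm,
    formAt_wedge, formAt_covForm, formAt_contract, endAt_compEnd, 𝒬.R₂_eq, ins_add_left,
    ins_add_left, ins_neg_left, ins_smulRight, endAt_idEnd]

/-- `F₁ ^ 2 = -1` on the contact distribution of the first factor, and `F₁ = 0` on its complement.
-/
theorem F₁_cube (x : M) : endAt 𝒬.F₁ x ∘L endAt 𝒬.F₁ x ∘L endAt 𝒬.F₁ x = -endAt 𝒬.F₁ x := by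
  have h1 : endAt 𝒬.F₁ x ∘L (endAt 𝒬.F₂ x ∘L endAt 𝒬.F₂ x) = 0 := by
    rw [← ContinuousLinearMap.comp_assoc, 𝒬.F₁_F₂, ContinuousLinearMap.zero_comp]
  rw [𝒬.R₂_eq, 𝒬.R₁_eq] at h1
  ext v
  have := congrArg (fun f : E →L[ℝ] E => f v) h1
  simp only [ContinuousLinearMap.comp_apply, add_apply, neg_apply, ContinuousLinearMap.id_apply,
    ContinuousLinearMap.smulRight_apply, map_add, map_neg, map_smul, 𝒬.F₁_X₁, 𝒬.F₁_X₂, smul_zero,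
    add_zero, zero_apply] at this
  simp only [ContinuousLinearMap.comp_apply, neg_apply]
  rw [← neg_add, neg_eq_zero, add_comm] at this
  exact eq_neg_of_add_eq_zero_left this

end SasakiPair

end Pairs

section PairOperators

open Set MixAlt Polynomial

variable {E : Type*} [NormedAddCommGroup E] [NormedSpace ℝ E]
  {H : Type*} [TopologicalSpace H] {I : ModelWithCorners ℝ E H}
  {M : Type*} [TopologicalSpace M] [ChartedSpace H M] [IsManifold I ∞ M] [I.Boundaryless]

namespace SasakiPair

variable (𝒬 : SasakiPair I M)

/-- The insertion of the projection to the contact distribution of the first factor. -/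
def POp : smoothForms I M →ₗ[ℂ] smoothForms I M := -insOp (compEnd 𝒬.F₁ 𝒬.F₁) 𝒬.smooth_sq

theorem ins_commute {A B : E →L[ℝ] E} (h : A ∘L B = B ∘L A) (b : MixAlt E) :
    ins A (ins B b) = ins B (ins A b) := by
  have := ins_comm A B b
  rwa [h, add_left_inj] at this

theorem lieD_insForm_op {X : VField I M} (hX : IsSmoothVec X) {A : EndField I M}
    (hA : IsSmoothEnd A)
    (h : ∀ x, endD A x (fieldAt X x) = fieldD X x ∘L endAt A x - endAt A x ∘L fieldD X x)
    (β : smoothForms I M) :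
    dOp (ctrOp X hX (insOp A hA β)) + ctrOp X hX (dOp (insOp A hA β)) =
      insOp A hA (dOp (ctrOp X hX β)) + insOp A hA (ctrOp X hX (dOp β)) := by
  rw [← map_add]
  exact Subtype.ext (lieD_insForm hX hA h β.2)

theorem lieD_covForm_op {X : VField I M} (hX : IsSmoothVec X) {η : CovField I M}
    (hη : IsSmoothCov η) (h : ∀ x w, covD η x (fieldAt X x) w + covAt η x (fieldD X x w) = 0)
    (β : smoothForms I M) :
    dOp (ctrOp X hX (covOp η hη β)) + ctrOp X hX (dOp (covOp η hη β)) =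
      covOp η hη (dOp (ctrOp X hX β)) + covOp η hη (ctrOp X hX (dOp β)) := by
  rw [← map_add]
  exact Subtype.ext (lieD_covForm_wedge hX hη h β.2)

theorem lieD_ctr_op {X Y : VField I M} (hX : IsSmoothVec X) (hY : IsSmoothVec Y)
    (h : ∀ x, fieldD Y x (fieldAt X x) = fieldD X x (fieldAt Y x)) (β : smoothForms I M) :
    dOp (ctrOp X hX (ctrOp Y hY β)) + ctrOp X hX (dOp (ctrOp Y hY β)) =
      ctrOp Y hY (dOp (ctrOp X hX β)) + ctrOp Y hY (ctrOp X hX (dOp β)) := by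
  rw [← map_add]
  exact Subtype.ext (lieD_contract hX hY h β.2)

/-- The anticommutator of `d` and the product with `η` is the product with `dη`. -/
theorem formAt_dOp_covOp {η : CovField I M} (hη : IsSmoothCov η) (β : smoothForms I M) (x : M) :
    formAt (↑(dOp (covOp η hη β) + covOp η hη (dOp β) : smoothForms I M) : ExtForm I M ℂ) x =
      MixAlt.wedge (altHom (oneFam (covD η x))) (formAt (β : ExtForm I M ℂ) x) :=
  extD_covForm_wedge hη β.2 x

/-- The value of a smooth form at a point, as a linear map. -/
def evalAt (x : M) : smoothForms I M →ₗ[ℂ] MixAlt E where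
  toFun β := formAt (β : ExtForm I M ℂ) x
  map_add' _ _ := rfl
  map_smul' _ _ := rfl

theorem evalAt_insOp {A : EndField I M} (hA : IsSmoothEnd A) (x : M) (β : smoothForms I M) :
    evalAt x (insOp A hA β) = ins (endAt A x) (evalAt x β) := rfl

theorem ext_evalAt {α β : smoothForms I M} (h : ∀ x, evalAt x α = evalAt x β) : α = β :=
  ext_smoothForms h

theorem evalAt_dOp_covOp {η : CovField I M} (hη : IsSmoothCov η) (β : smoothForms I M) (x : M) :
    evalAt x (dOp (covOp η hη β) + covOp η hη (dOp β)) =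
      MixAlt.wedge (altHom (oneFam (covD η x))) (evalAt x β) := formAt_dOp_covOp hη β x

/-- The insertion of `A` and the product with `dη` commute up to the multiple `r` of the latter, if
`A` acts on `dη` as `r`. -/
theorem ins_dη_op {A : EndField I M} (hA : IsSmoothEnd A) {η : CovField I M}
    (hη : IsSmoothCov η) (r : ℝ)
    (h : ∀ x v w, (covD η x (endAt A x v) w - covD η x w (endAt A x v)) +
      (covD η x v (endAt A x w) - covD η x (endAt A x w) v) = r * (covD η x v w - covD η x w v))
    (β : smoothForms I M) :
    insOp A hA (dOp (covOp η hη β) + covOp η hη (dOp β)) =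
      (dOp (covOp η hη (insOp A hA β)) + covOp η hη (dOp (insOp A hA β))) +
        (r : ℂ) • (dOp (covOp η hη β) + covOp η hη (dOp β)) := by
  refine ext_evalAt fun x => ?_
  rw [evalAt_insOp, evalAt_dOp_covOp, LinearMap.map_add, LinearMap.map_smul, evalAt_dOp_covOp,
    evalAt_dOp_covOp, ins_wedge, ins_altHom_oneFam r (h x), wedge_smul_left, evalAt_insOp]
  abel

theorem cov_dη_op {η η' : CovField I M} (hη : IsSmoothCov η) (hη' : IsSmoothCov η')
    (β : smoothForms I M) :
    covOp η hη (dOp (covOp η' hη' β) + covOp η' hη' (dOp β)) =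
      dOp (covOp η' hη' (covOp η hη β)) + covOp η' hη' (dOp (covOp η hη β)) := by
  refine ext_smoothForms fun x => ?_
  rw [coe_covOp, formAt_wedge, formAt_dOp_covOp, formAt_dOp_covOp, formAt_covForm, coe_covOp,
    formAt_wedge, formAt_covForm, wedge_one_wedge, sgn_altHom_oneFam]

theorem ins_cov_op {A : EndField I M} (hA : IsSmoothEnd A) {η : CovField I M}
    (hη : IsSmoothCov η) (h : ∀ x, covAt η x ∘L endAt A x = 0) (β : smoothForms I M) :
    insOp A hA (covOp η hη β) = covOp η hη (insOp A hA β) := by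
  refine ext_smoothForms fun x => ?_
  rw [coe_insOp, formAt_insForm, coe_covOp, coe_covOp, formAt_wedge, formAt_wedge, formAt_covForm,
    ins_wedge, ins_one, h, one_zero, wedge_zero_left, zero_add]
  rfl

theorem ctr_ins_op {A : EndField I M} (hA : IsSmoothEnd A) {X : VField I M}
    (hX : IsSmoothVec X) (h : ∀ x, endAt A x (fieldAt X x) = 0) (β : smoothForms I M) :
    ctrOp X hX (insOp A hA β) = insOp A hA (ctrOp X hX β) := by
  refine ext_smoothForms fun x => ?_
  rw [coe_insOp, formAt_insForm, coe_ctrOp, coe_ctrOp, formAt_contract, formAt_contract, coe_insOp,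
    formAt_insForm, ctr_ins, h, ctr_zero_left, zero_add]

theorem ins_commute_op {A B : EndField I M} (hA : IsSmoothEnd A) (hB : IsSmoothEnd B)
    (h : ∀ x, endAt A x ∘L endAt B x = endAt B x ∘L endAt A x) (β : smoothForms I M) :
    insOp A hA (insOp B hB β) = insOp B hB (insOp A hA β) :=
  ext_smoothForms fun x => ins_commute (h x) _

theorem ctr_cov_op {X : VField I M} (hX : IsSmoothVec X) {η : CovField I M}
    (hη : IsSmoothCov η) (r : ℝ) (h : ∀ x, covAt η x (fieldAt X x) = r) (β : smoothForms I M) :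
    ctrOp X hX (covOp η hη β) = (r : ℂ) • β - covOp η hη (ctrOp X hX β) := by
  refine ext_smoothForms fun x => ?_
  rw [coe_ctrOp, formAt_contract, coe_covOp, formAt_wedge, formAt_covForm, ctr_one_wedge, h,
    AddSubgroupClass.coe_sub, formAt_sub, coe_covOp, formAt_wedge, formAt_covForm]
  rfl

theorem cov_cov_op {η η' : CovField I M} (hη : IsSmoothCov η) (hη' : IsSmoothCov η')
    (β : smoothForms I M) : covOp η' hη' (covOp η hη β) = -covOp η hη (covOp η' hη' β) := by
  refine ext_smoothForms fun x => ?_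
  change MixAlt.wedge (formAt (covForm η') x) (MixAlt.wedge (formAt (covForm η) x) (formAt β.1 x)) =
    -MixAlt.wedge (formAt (covForm η) x) (MixAlt.wedge (formAt (covForm η') x) (formAt β.1 x))
  rw [formAt_covForm, formAt_covForm, one_wedge_one_wedge]

theorem ctr_ctr_op {X Y : VField I M} (hX : IsSmoothVec X) (hY : IsSmoothVec Y)
    (β : smoothForms I M) : ctrOp X hX (ctrOp Y hY β) = -ctrOp Y hY (ctrOp X hX β) := by
  refine ext_smoothForms fun x => ?_
  change ctr (fieldAt X x) (ctr (fieldAt Y x) (formAt β.1 x)) =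
    -ctr (fieldAt Y x) (ctr (fieldAt X x) (formAt β.1 x))
  exact ctr_ctr_swap _ _ _

theorem ctr_self_op {X : VField I M} (hX : IsSmoothVec X)
    (β : smoothForms I M) : ctrOp X hX (ctrOp X hX β) = 0 :=
  ext_smoothForms fun x => ctr_self (fieldAt X x) (formAt β.1 x)

theorem cov_self_op {η : CovField I M} (hη : IsSmoothCov η) (β : smoothForms I M) :
    covOp η hη (covOp η hη β) = 0 := by
  refine ext_smoothForms fun x => ?_
  rw [coe_covOp, formAt_wedge, formAt_covForm, coe_covOp, formAt_wedge, formAt_covForm,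
    one_wedge_self]
  rfl

/-- The commutation relation of the insertions of two fields of endomorphisms with `d`. -/
theorem frolicher_op {A B : EndField I M} (hA : IsSmoothEnd A) (hB : IsSmoothEnd B)
    {β : smoothForms I M}
    (h : ∀ x v w, ctr (frolicher A B x v w) (formAt (β : ExtForm I M ℂ) x) = 0) :
    insOp A hA (insOp B hB (dOp β)) - insOp A hA (dOp (insOp B hB β)) -
      insOp B hB (dOp (insOp A hA β)) + dOp (insOp B hB (insOp A hA β)) =
    insOp (compEnd B A) (hB.compEnd hA) (dOp β) - dOp (insOp (compEnd B A) (hB.compEnd hA) β) :=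
  Subtype.ext (insForm_insForm_extD hA hB β.2 h)

theorem ctr_of_zero {u : E} (h : u = 0) (b : MixAlt E) : ctr u b = 0 := by
  rw [h, ctr_zero_left]

theorem insOp_congr {A B : EndField I M} (hA : IsSmoothEnd A) (hB : IsSmoothEnd B)
    (h : ∀ x, endAt A x = endAt B x) (β : smoothForms I M) : insOp A hA β = insOp B hB β :=
  ext_evalAt fun x => by rw [evalAt_insOp, evalAt_insOp, h]

theorem insOp_eq_zero {A : EndField I M} (hA : IsSmoothEnd A) (h : ∀ x, endAt A x = 0)
    (β : smoothForms I M) : insOp A hA β = 0 := by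
  refine ext_evalAt fun x => ?_
  rw [evalAt_insOp, h, LinearMap.map_zero]
  exact ins_eq_zero fun v => by rw [zero_apply, ctr_zero_left]

theorem endAt_F₂_F₁ (x : M) : endAt (compEnd 𝒬.F₂ 𝒬.F₁) x = 0 := 𝒬.F₂_F₁ x

theorem F₁_R₁ (x : M) : endAt (compEnd 𝒬.F₁ 𝒬.R₁) x = endAt 𝒬.F₁ x := by
  have h := 𝒬.F₁_cube x
  rw [endAt_compEnd, 𝒬.R₁_eq, ContinuousLinearMap.comp_add, ContinuousLinearMap.comp_neg, h, neg_neg]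
  ext v
  simp [𝒬.F₁_X₁]

theorem F₂_R₁ (x : M) : endAt (compEnd 𝒬.F₂ 𝒬.R₁) x = 0 := by
  rw [endAt_compEnd, 𝒬.R₁_eq, ContinuousLinearMap.comp_add, ContinuousLinearMap.comp_neg,
    ← ContinuousLinearMap.comp_assoc, 𝒬.F₂_F₁, ContinuousLinearMap.zero_comp]
  ext v
  simp [𝒬.F₂_X₁]

theorem insOp_R₁ (β : smoothForms I M) : insOp 𝒬.R₁ 𝒬.smooth_R₁ β =
    𝒬.POp β + covOp 𝒬.η₁ 𝒬.smooth_η₁ (ctrOp 𝒬.X₁ 𝒬.smooth_X₁ β) := Subtype.ext (𝒬.insForm_R₁ β)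

theorem insOp_sq₂ (β : smoothForms I M) :
    insOp (compEnd 𝒬.F₂ 𝒬.F₂) (𝒬.smooth_F₂.compEnd 𝒬.smooth_F₂) β =
    -insOp (idEnd I M) isSmoothEnd_idEnd β + (𝒬.POp β +
      covOp 𝒬.η₁ 𝒬.smooth_η₁ (ctrOp 𝒬.X₁ 𝒬.smooth_X₁ β)) +
        covOp 𝒬.η₂ 𝒬.smooth_η₂ (ctrOp 𝒬.X₂ 𝒬.smooth_X₂ β) := Subtype.ext (𝒬.insForm_sq₂ β)

theorem POp_apply (β : smoothForms I M) :
    𝒬.POp β = -insOp (compEnd 𝒬.F₁ 𝒬.F₁) 𝒬.smooth_sq β := rfl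

theorem ctr_of_eq_zero {X : VField I M} {hX : IsSmoothVec X} {β : smoothForms I M}
    (h : ctrOp X hX β = 0) : contract X (β : ExtForm I M ℂ) = 0 := congrArg Subtype.val h

theorem ins_idEnd_commute (A : E →L[ℝ] E) : (.id ℝ E : E →L[ℝ] E) ∘L A = A ∘L .id ℝ E := by
  rw [ContinuousLinearMap.id_comp, ContinuousLinearMap.comp_id]

theorem idOp_dOp (β : smoothForms I M) : insOp (idEnd I M) isSmoothEnd_idEnd (dOp β) =
    dOp (insOp (idEnd I M) isSmoothEnd_idEnd β) + dOp β := Subtype.ext (insForm_idEnd_extD β.2)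

theorem idOp_covOp {η : CovField I M} (hη : IsSmoothCov η) (β : smoothForms I M) :
    insOp (idEnd I M) isSmoothEnd_idEnd (covOp η hη β) =
      covOp η hη (insOp (idEnd I M) isSmoothEnd_idEnd β) + covOp η hη β := by
  refine ext_smoothForms fun x => ?_
  rw [coe_insOp, formAt_insForm, Submodule.coe_add, formAt_add, coe_covOp, formAt_wedge,
    formAt_covForm, ins_wedge, ins_one, endAt_idEnd, ContinuousLinearMap.comp_id, coe_covOp,
    formAt_wedge, formAt_covForm, coe_insOp, formAt_insForm, endAt_idEnd]
  abel

theorem ctrOp_idOp {X : VField I M} (hX : IsSmoothVec X) (β : smoothForms I M) :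
    ctrOp X hX (insOp (idEnd I M) isSmoothEnd_idEnd β) =
      insOp (idEnd I M) isSmoothEnd_idEnd (ctrOp X hX β) + ctrOp X hX β := by
  refine ext_smoothForms fun x => ?_
  rw [coe_ctrOp, formAt_contract, coe_insOp, formAt_insForm, ctr_ins, endAt_idEnd,
    Submodule.coe_add, formAt_add, coe_insOp, formAt_insForm, coe_ctrOp, formAt_contract,
    endAt_idEnd, add_comm]
  rfl

theorem map_aeval_of_commute {V W : Type*} [AddCommGroup V] [Module ℂ V] [AddCommGroup W]
    [Module ℂ W] (φ : V →ₗ[ℂ] W) {T : Module.End ℂ V} {T' : Module.End ℂ W}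
    (h : ∀ v, φ (T v) = T' (φ v)) (f : ℂ[X]) (v : V) : φ (aeval T f v) = aeval T' f (φ v) := by
  induction f using Polynomial.induction_on generalizing v with
  | C z => simp [Module.algebraMap_end_apply]
  | add f g hf hg => simp [hf, hg]
  | monomial n z ih =>
    rw [pow_succ, ← mul_assoc, map_mul (aeval T), Module.End.mul_apply, ih, aeval_X, h,
      map_mul (aeval T') (C z * X ^ n), Module.End.mul_apply, aeval_X]

theorem evalAt_countOp (x : M) (β : smoothForms I M) :
    evalAt x (((1 / 2 : ℂ) • (𝒬.POp - Complex.I • insOp 𝒬.F₁ 𝒬.smooth_F₁) :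
      Module.End ℂ (smoothForms I M)) β) = countOp (endAt 𝒬.F₁ x) (evalAt x β) := by
  rw [countOp_apply, ins_neg_left]
  rfl

variable [FiniteDimensional ℝ E]

theorem neg_add_smul_two {V : Type*} [AddCommGroup V] [Module ℂ V] (u v w : V) :
    -(u + v + ((-2 : ℝ) : ℂ) • w) = -u + -v + (2 : ℂ) • w := by
  push_cast
  module

theorem neg_add_zero_smul {V : Type*} [AddCommGroup V] [Module ℂ V] (u v w : V) :
    -(u + v + ((0 : ℝ) : ℂ) • w) = -u + -v := by
  rw [Complex.ofReal_zero, zero_smul, add_zero, neg_add]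

set_option maxHeartbeats 2000000 in
/-- The operators of a pair of transverse structures on the smooth forms. -/
def ops : SasakiOps (smoothForms I M) where
  d := dOp
  i₁ := ctrOp 𝒬.X₁ 𝒬.smooth_X₁
  i₂ := ctrOp 𝒬.X₂ 𝒬.smooth_X₂
  e₁ := covOp 𝒬.η₁ 𝒬.smooth_η₁
  e₂ := covOp 𝒬.η₂ 𝒬.smooth_η₂
  N₁ := insOp 𝒬.F₁ 𝒬.smooth_F₁
  N₂ := insOp 𝒬.F₂ 𝒬.smooth_F₂
  P := 𝒬.POp
  D := insOp (idEnd I M) isSmoothEnd_idEnd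
  d_d β := Subtype.ext (extD_extD β.2)
  i₁_i₁ := ctr_self_op _
  i₂_i₂ := ctr_self_op _
  i₂_i₁ := ctr_ctr_op _ _
  e₁_e₁ := cov_self_op _
  e₂_e₂ := cov_self_op _
  e₂_e₁ := cov_cov_op _ _
  i₁_e₁ β := by
    rw [ctr_cov_op 𝒬.smooth_X₁ 𝒬.smooth_η₁ 1 𝒬.η₁_X₁, Complex.ofReal_one, one_smul]
  i₂_e₂ β := by
    rw [ctr_cov_op 𝒬.smooth_X₂ 𝒬.smooth_η₂ 1 𝒬.η₂_X₂, Complex.ofReal_one, one_smul]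
  i₁_e₂ β := by
    rw [ctr_cov_op 𝒬.smooth_X₁ 𝒬.smooth_η₂ 0 𝒬.η₂_X₁, Complex.ofReal_zero, zero_smul, zero_sub]
  i₂_e₁ β := by
    rw [ctr_cov_op 𝒬.smooth_X₂ 𝒬.smooth_η₁ 0 𝒬.η₁_X₂, Complex.ofReal_zero, zero_smul, zero_sub]
  L₁_i₂ := lieD_ctr_op _ _ 𝒬.X_comm
  L₂_i₁ := lieD_ctr_op _ _ fun x => (𝒬.X_comm x).symm
  L₁_e₁ := lieD_covForm_op _ _ 𝒬.L₁_η₁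
  L₁_e₂ := lieD_covForm_op _ _ 𝒬.L₁_η₂
  L₂_e₁ := lieD_covForm_op _ _ 𝒬.L₂_η₁
  L₂_e₂ := lieD_covForm_op _ _ 𝒬.L₂_η₂
  L₁_N₁ := lieD_insForm_op _ _ 𝒬.L₁_F₁
  L₁_N₂ := lieD_insForm_op _ _ 𝒬.L₁_F₂
  L₂_N₁ := lieD_insForm_op _ _ 𝒬.L₂_F₁
  L₂_N₂ := lieD_insForm_op _ _ 𝒬.L₂_F₂
  L₁_P β := by
    have := lieD_insForm_op 𝒬.smooth_X₁ 𝒬.smooth_sq (fun x => 𝒬.L_sq (𝒬.L₁_F₁ x)) β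
    simp only [POp_apply, LinearMap.map_neg, ← neg_add, this]
  L₂_P β := by
    have := lieD_insForm_op 𝒬.smooth_X₂ 𝒬.smooth_sq (fun x => 𝒬.L_sq (𝒬.L₂_F₁ x)) β
    simp only [POp_apply, LinearMap.map_neg, ← neg_add, this]
  N₂_N₁ := ins_commute_op _ _ fun x => by rw [𝒬.F₁_F₂, 𝒬.F₂_F₁]
  P_N₁ β := by
    simp only [POp_apply, LinearMap.map_neg]
    rw [ins_commute_op _ _ fun x => ?_]
    rw [endAt_compEnd, ContinuousLinearMap.comp_assoc]
  P_N₂ β := by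
    simp only [POp_apply, LinearMap.map_neg]
    rw [ins_commute_op _ _ fun x => ?_]
    rw [endAt_compEnd, ContinuousLinearMap.comp_assoc, 𝒬.F₁_F₂, ContinuousLinearMap.comp_zero,
      ← ContinuousLinearMap.comp_assoc, 𝒬.F₂_F₁, ContinuousLinearMap.zero_comp]
  N₁_e₁ := ins_cov_op _ _ 𝒬.η₁_F₁
  N₁_e₂ := ins_cov_op _ _ 𝒬.η₂_F₁
  N₂_e₁ := ins_cov_op _ _ 𝒬.η₁_F₂
  N₂_e₂ := ins_cov_op _ _ 𝒬.η₂_F₂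
  P_e₁ β := by
    simp only [POp_apply, LinearMap.map_neg]
    rw [ins_cov_op _ _ fun x => ?_]
    rw [endAt_compEnd, ← ContinuousLinearMap.comp_assoc, 𝒬.η₁_F₁, ContinuousLinearMap.zero_comp]
  P_e₂ β := by
    simp only [POp_apply, LinearMap.map_neg]
    rw [ins_cov_op _ _ fun x => ?_]
    rw [endAt_compEnd, ← ContinuousLinearMap.comp_assoc, 𝒬.η₂_F₁, ContinuousLinearMap.zero_comp]
  i₁_N₁ := ctr_ins_op _ _ 𝒬.F₁_X₁
  i₁_N₂ := ctr_ins_op _ _ 𝒬.F₂_X₁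
  i₂_N₁ := ctr_ins_op _ _ 𝒬.F₁_X₂
  i₂_N₂ := ctr_ins_op _ _ 𝒬.F₂_X₂
  i₁_P β := by
    simp only [POp_apply, LinearMap.map_neg]
    rw [ctr_ins_op _ _ fun x => ?_]
    rw [endAt_compEnd, ContinuousLinearMap.comp_apply, 𝒬.F₁_X₁, map_zero]
  i₂_P β := by
    simp only [POp_apply, LinearMap.map_neg]
    rw [ctr_ins_op _ _ fun x => ?_]
    rw [endAt_compEnd, ContinuousLinearMap.comp_apply, 𝒬.F₁_X₂, map_zero]
  D_d := idOp_dOp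
  D_e₁ := idOp_covOp _
  D_e₂ := idOp_covOp _
  i₁_D := ctrOp_idOp _
  i₂_D := ctrOp_idOp _
  D_N₁ := ins_commute_op _ _ fun x => ins_idEnd_commute _
  D_N₂ := ins_commute_op _ _ fun x => ins_idEnd_commute _
  D_P β := by
    simp only [POp_apply, LinearMap.map_neg]
    rw [ins_commute_op isSmoothEnd_idEnd 𝒬.smooth_sq fun x => ins_idEnd_commute _]
  N₁_w₁ β := by
    rw [ins_dη_op 𝒬.smooth_F₁ 𝒬.smooth_η₁ 0 (fun x v w => by rw [𝒬.dη₁_F₁, zero_mul]),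
      Complex.ofReal_zero, zero_smul, add_zero]
  N₁_w₂ β := by
    rw [ins_dη_op 𝒬.smooth_F₁ 𝒬.smooth_η₂ 0 (fun x v w => by
      rw [𝒬.dη₂_F₁, zero_mul, zero_add, ← neg_sub, 𝒬.dη₂_F₁, neg_zero]),
      Complex.ofReal_zero, zero_smul, add_zero]
  N₂_w₁ β := by
    rw [ins_dη_op 𝒬.smooth_F₂ 𝒬.smooth_η₁ 0 (fun x v w => by
      rw [𝒬.dη₁_F₂, zero_mul, zero_add, ← neg_sub, 𝒬.dη₁_F₂, neg_zero]),
      Complex.ofReal_zero, zero_smul, add_zero]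
  N₂_w₂ β := by
    rw [ins_dη_op 𝒬.smooth_F₂ 𝒬.smooth_η₂ 0 (fun x v w => by rw [𝒬.dη₂_F₂, zero_mul]),
      Complex.ofReal_zero, zero_smul, add_zero]
  P_w₁ β := by
    simp only [POp_apply]
    rw [ins_dη_op 𝒬.smooth_sq 𝒬.smooth_η₁ (-2) (fun x v w => by
      have h1 := 𝒬.dη₁_sq x v w
      have h2 := 𝒬.dη₁_sq x w v
      simp only [endAt_compEnd, ContinuousLinearMap.comp_apply]
      linarith)]
    rw [LinearMap.map_neg, LinearMap.map_neg, LinearMap.map_neg, LinearMap.map_neg]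
    exact neg_add_smul_two _ _ _
  P_w₂ β := by
    simp only [POp_apply]
    rw [ins_dη_op 𝒬.smooth_sq 𝒬.smooth_η₂ 0 (fun x v w => by
      have h1 := 𝒬.dη₂_F₁ x (endAt 𝒬.F₁ x v) w
      have h2 := 𝒬.dη₂_F₁ x (endAt 𝒬.F₁ x w) v
      simp only [endAt_compEnd, ContinuousLinearMap.comp_apply]
      linarith)]
    rw [LinearMap.map_neg, LinearMap.map_neg, LinearMap.map_neg, LinearMap.map_neg]
    exact neg_add_zero_smul _ _ _
  e₁_w₂ := cov_dη_op _ _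
  e₂_w₁ := cov_dη_op _ _
  FN₁₁ β h₁ h₂ := by
    rw [frolicher_op _ _ fun x v w => ctr_eq_zero_of_smul (ctr_of_eq_zero h₁) (𝒬.bracket₁₁ x v w)]
    simp only [POp_apply, LinearMap.map_neg]
    abel
  FN₁₂ β h₁ h₂ := by
    have h := frolicher_op 𝒬.smooth_F₁ 𝒬.smooth_F₂ (β := β) fun x v w =>
      ctr_of_zero (𝒬.bracket₁₂ x v w) _
    rw [insOp_eq_zero _ 𝒬.endAt_F₂_F₁, insOp_eq_zero _ 𝒬.endAt_F₂_F₁, LinearMap.map_zero, sub_zero,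
      ins_commute_op 𝒬.smooth_F₂ 𝒬.smooth_F₁ (fun x => by rw [𝒬.F₁_F₂, 𝒬.F₂_F₁]) β] at h
    exact h
  FN₂₂ β h₁ h₂ := by
    rw [frolicher_op _ _ fun x v w => ctr_eq_zero_of_smul (ctr_of_eq_zero h₂) (𝒬.bracket₂₂ x v w)]
    simp only [insOp_sq₂, LinearMap.map_neg, LinearMap.map_add, h₁, h₂, LinearMap.map_zero]
    abel
  FNP₁ β h₁ h₂ := by
    have h := frolicher_op 𝒬.smooth_R₁ 𝒬.smooth_F₁ (β := β) fun x v w =>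
      ctr_of_zero (𝒬.bracketR₁ x v w) _
    rw [insOp_congr _ 𝒬.smooth_F₁ 𝒬.F₁_R₁, insOp_congr _ 𝒬.smooth_F₁ 𝒬.F₁_R₁] at h
    simp only [insOp_R₁, h₁, LinearMap.map_zero, add_zero] at h
    rw [sub_add_eq_sub_sub] at h
    exact h
  FNP₂ β h₁ h₂ := by
    have h := frolicher_op 𝒬.smooth_R₁ 𝒬.smooth_F₂ (β := β) fun x v w =>
      ctr_of_zero (𝒬.bracketR₂ x v w) _
    rw [insOp_eq_zero _ 𝒬.F₂_R₁, insOp_eq_zero _ 𝒬.F₂_R₁, LinearMap.map_zero, sub_zero] at h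
    simp only [insOp_R₁, h₁, LinearMap.map_zero, add_zero] at h
    rw [sub_add_eq_sub_sub] at h
    exact h
  n := Module.finrank ℝ E
  annihilated := LinearMap.ext fun β => ext_smoothForms fun x =>
    (map_aeval_of_commute (evalAt x) (𝒬.evalAt_countOp x) _ β).trans
      (prod_countOp_finrank (𝒬.F₁_cube x) _)

end SasakiPair

end PairOperators

/-! ### Charts of products -/

section ProductCharts

open Set

variable {E : Type*} [NormedAddCommGroup E] [NormedSpace ℝ E]
  {H : Type*} [TopologicalSpace H] {I : ModelWithCorners ℝ E H}
  {M : Type*} [TopologicalSpace M] [ChartedSpace H M] [IsManifold I ∞ M]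
  {E' : Type*} [NormedAddCommGroup E'] [NormedSpace ℝ E']
  {H' : Type*} [TopologicalSpace H'] {I' : ModelWithCorners ℝ E' H'}
  {M' : Type*} [TopologicalSpace M'] [ChartedSpace H' M'] [IsManifold I' ∞ M']

theorem extChartAt_prod_target (x : M × M') : (extChartAt (I.prod I') x).target =
    (extChartAt I x.1).target ×ˢ (extChartAt I' x.2).target := by
  rw [extChartAt_prod]; rfl

theorem extChartAt_prod_symm (x : M × M') (y : E × E') : (extChartAt (I.prod I') x).symm y =
    ((extChartAt I x.1).symm y.1, (extChartAt I' x.2).symm y.2) := by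
  rw [extChartAt_prod]; rfl

theorem extChartAt_prod_apply (x z : M × M') : extChartAt (I.prod I') x z =
    (extChartAt I x.1 z.1, extChartAt I' x.2 z.2) := by
  rw [extChartAt_prod]; rfl

theorem chartD_prod {x z : M × M'} (h₁ : z.1 ∈ (extChartAt I x.1).source)
    (h₂ : z.2 ∈ (extChartAt I' x.2).source) :
    chartD (I.prod I') x z = (chartD I x.1 z.1).prodMap (chartD I' x.2 z.2) := by
  have := isManifold_one_of_infty I M
  have := isManifold_one_of_infty I' M'
  rw [extChartAt_source] at h₁ h₂
  have h : (extChartAt (I.prod I') x : M × M' → E × E') =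
      Prod.map (extChartAt I x.1) (extChartAt I' x.2) := funext fun z => extChartAt_prod_apply x z
  rw [chartD, h, modelWithCornersSelf_prod, ← chartedSpaceSelf_prod]
  exact mfderiv_prodMap (mdifferentiableAt_extChartAt h₁) (mdifferentiableAt_extChartAt h₂)

theorem symmD_prod {x : M × M'} {y : E × E'} (h₁ : y.1 ∈ (extChartAt I x.1).target)
    (h₂ : y.2 ∈ (extChartAt I' x.2).target) :
    symmD (I.prod I') x y = (symmD I x.1 y.1).prodMap (symmD I' x.2 y.2) := by
  have hy : y ∈ (extChartAt (I.prod I') x).target := by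
    rw [extChartAt_prod_target]; exact ⟨h₁, h₂⟩
  have e1 := symmD_comp_chartD hy
  rw [extChartAt_prod_symm, chartD_prod ((extChartAt I x.1).map_target h₁)
    ((extChartAt I' x.2).map_target h₂)] at e1
  refine ContinuousLinearMap.ext fun v => ?_
  have e2 : chartD I x.1 ((extChartAt I x.1).symm y.1) (symmD I x.1 y.1 v.1) = v.1 :=
    congrArg (fun f : E →L[ℝ] E => f v.1) (chartD_comp_symmD h₁)
  have e3 : chartD I' x.2 ((extChartAt I' x.2).symm y.2) (symmD I' x.2 y.2 v.2) = v.2 :=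
    congrArg (fun f : E' →L[ℝ] E' => f v.2) (chartD_comp_symmD h₂)
  have e4 := congrArg (fun f : E × E' →L[ℝ] E × E' => f (symmD I x.1 y.1 v.1, symmD I' x.2 y.2 v.2)) e1
  have e5 : (chartD I x.1 ((extChartAt I x.1).symm y.1)).prodMap
      (chartD I' x.2 ((extChartAt I' x.2).symm y.2)) (symmD I x.1 y.1 v.1, symmD I' x.2 y.2 v.2) =
      v := Prod.ext e2 e3
  simp only [ContinuousLinearMap.comp_apply, ContinuousLinearMap.id_apply] at e4
  rw [e5] at e4
  exact e4

end ProductCharts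

section PosRealCharts

open Set

theorem posReal_extChartAt_eq (t s : PosReal) : extChartAt 𝓘(ℝ, ℝ) t = extChartAt 𝓘(ℝ, ℝ) s := rfl

theorem posReal_source (t : PosReal) : (extChartAt 𝓘(ℝ, ℝ) t).source = univ := by
  rw [extChartAt_source, TopologicalSpace.Opens.chartAt_eq, OpenPartialHomeomorph.subtypeRestr_source]
  rfl

theorem posReal_target (t : PosReal) : (extChartAt 𝓘(ℝ, ℝ) t).target = Ioi 0 := by
  rw [← (extChartAt 𝓘(ℝ, ℝ) t).image_source_eq_target, posReal_source, image_univ]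
  exact Subtype.range_coe

theorem posReal_symm (t : PosReal) {s : ℝ} (hs : s ∈ Ioi (0 : ℝ)) :
    (extChartAt 𝓘(ℝ, ℝ) t).symm s = ⟨s, hs⟩ := by
  have h : s ∈ (extChartAt 𝓘(ℝ, ℝ) t).target := by rwa [posReal_target]
  exact Subtype.ext ((extChartAt 𝓘(ℝ, ℝ) t).right_inv h)

theorem posReal_chartD (t s : PosReal) : chartD 𝓘(ℝ, ℝ) t s = .id ℝ ℝ := by
  have h := chartD_self (I := 𝓘(ℝ, ℝ)) s
  rwa [chartD, posReal_extChartAt_eq s t] at h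

theorem posReal_symmD (t : PosReal) {s : ℝ} (hs : s ∈ Ioi (0 : ℝ)) :
    symmD 𝓘(ℝ, ℝ) t s = .id ℝ ℝ := by
  have h := chartD_comp_symmD (I := 𝓘(ℝ, ℝ)) (x₀ := t) (y := s) (by rwa [posReal_target])
  rwa [posReal_chartD, ContinuousLinearMap.id_comp] at h

theorem posReal_mdifferentiableAt_val (t : PosReal) :
    MDifferentiableAt 𝓘(ℝ, ℝ) 𝓘(ℝ, ℝ) (fun s : PosReal => (s : ℝ)) t :=
  mdifferentiableAt_extChartAt (I := 𝓘(ℝ, ℝ)) (mem_chart_source ℝ t)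

theorem posReal_mfderiv_val (t : PosReal) :
    (mfderiv 𝓘(ℝ, ℝ) 𝓘(ℝ, ℝ) (fun s : PosReal => (s : ℝ)) t : ℝ →L[ℝ] ℝ) = .id ℝ ℝ :=
  posReal_chartD t t

/-- Multiplication by a positive number. -/
def posMul (c t : PosReal) : PosReal :=
  ⟨c.1 * t.1, Set.mem_Ioi.2 (mul_pos (Set.mem_Ioi.1 c.2) (Set.mem_Ioi.1 t.2))⟩

theorem mdifferentiableAt_posMul (c t : PosReal) :
    MDifferentiableAt 𝓘(ℝ, ℝ) 𝓘(ℝ, ℝ) (posMul c) t := by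
  have hv : ContMDiff 𝓘(ℝ, ℝ) 𝓘(ℝ, ℝ) ∞ (fun s : PosReal => (s : ℝ)) := contMDiff_subtype_val
  have h : ContMDiffAt 𝓘(ℝ, ℝ) 𝓘(ℝ, ℝ) ∞ (posMul c) t := by
    refine contMDiffAt_iff_target.2 ⟨?_, ?_⟩
    · refine Continuous.continuousAt ?_
      exact Continuous.subtype_mk (continuous_const.mul continuous_subtype_val) _
    · have : (extChartAt 𝓘(ℝ, ℝ) (posMul c t) ∘ posMul c : PosReal → ℝ) =
          fun s : PosReal => (c : ℝ) * (s : ℝ) := rfl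
      rw [this]
      exact ContMDiffAt.mul contMDiffAt_const (hv t)
  exact h.mdifferentiableAt (by simp)

theorem mfderiv_posMul (c t : PosReal) :
    (mfderiv 𝓘(ℝ, ℝ) 𝓘(ℝ, ℝ) (posMul c) t : ℝ →L[ℝ] ℝ) = (c : ℝ) • .id ℝ ℝ := by
  have h1 := mfderiv_comp (I := 𝓘(ℝ, ℝ)) (I' := 𝓘(ℝ, ℝ)) (I'' := 𝓘(ℝ, ℝ)) t
    (posReal_mdifferentiableAt_val (posMul c t)) (mdifferentiableAt_posMul c t)
  have h2 := (posReal_mdifferentiableAt_val t).hasMFDerivAt.const_smul (c : ℝ)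
  have h3 : mfderiv 𝓘(ℝ, ℝ) 𝓘(ℝ, ℝ) ((fun s : PosReal => (s : ℝ)) ∘ posMul c) t = _ := h2.mfderiv
  rw [h1] at h3
  ext
  have h4 := congrArg (fun f : ℝ →L[ℝ] ℝ => f 1) h3
  have h5 := posReal_mfderiv_val (posMul c t)
  have h6 := posReal_mfderiv_val t
  erw [h5, h6] at h4
  exact h4

end PosRealCharts

/-! ### The Nijenhuis tensor in a chart -/

section Nijenhuis

open Set VectorField

variable {E : Type*} [NormedAddCommGroup E] [NormedSpace ℝ E]
  {H : Type*} [TopologicalSpace H] {I : ModelWithCorners ℝ E H}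
  {M : Type*} [TopologicalSpace M] [ChartedSpace H M] [IsManifold I ∞ M]

/-- A field of endomorphisms which is smooth as a section of the bundle of endomorphisms is smooth
in charts. -/
theorem isSmoothEnd_of_contMDiff {A : EndField I M}
    (hA : ContMDiff I (I.prod 𝓘(ℝ, E →L[ℝ] E)) ∞
      (fun x => Bundle.TotalSpace.mk' (E →L[ℝ] E)
        (E := fun x : M => TangentSpace I x →L[ℝ] TangentSpace I x) x (A x))) : IsSmoothEnd A := by
  intro x₀
  have := isManifold_one_of_infty I M
  have h1 := (trivializationAt (E →L[ℝ] E)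
    (fun x : M => TangentSpace I x →L[ℝ] TangentSpace I x) x₀).contMDiffOn_section_baseSet_iff
      (IB := I) (n := ∞) (s := A)
  have hb : (trivializationAt (E →L[ℝ] E)
    (fun x : M => TangentSpace I x →L[ℝ] TangentSpace I x) x₀).baseSet = (chartAt H x₀).source := by
    rw [hom_trivializationAt_baseSet]
    exact inter_self _
  rw [hb] at h1
  have h3 := h1.1 hA.contMDiffOn
  have h2 : ∀ x ∈ (chartAt H x₀).source,
      ((trivializationAt (E →L[ℝ] E)
        (fun x : M => TangentSpace I x →L[ℝ] TangentSpace I x) x₀) ⟨x, A x⟩).2 =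
        chartD I x₀ x ∘L endAt A x ∘L symmD I x₀ (extChartAt I x₀ x) := by
    intro x hx
    rw [hom_trivializationAt_apply]
    have e1 := TangentBundle.continuousLinearMapAt_trivializationAt (I := I) hx
    have e2 := TangentBundle.symmL_trivializationAt (I := I) hx
    change (Bundle.Trivialization.continuousLinearMapAt ℝ _ x).comp ((A x).comp (Bundle.Trivialization.symmL ℝ _ x)) = _
    rw [e1, e2]
    rfl
  rw [contMDiffOn_congr h2, ] at h3
  rw [← contMDiffOn_iff_contDiffOn]
  refine (h3.comp (contMDiffOn_extChartAt_symm x₀) fun y hy => ?_).congr fun y hy => ?_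
  · have := (extChartAt I x₀).map_target hy
    rwa [extChartAt_source] at this
  · simp only [Function.comp_apply, chartEnd]
    rw [(extChartAt I x₀).right_inv hy]

variable [I.Boundaryless]

theorem mlieBracket_eq_fieldD (X Y : VField I M) (x : M) :
    (mlieBracket I X Y x : E) = fieldD Y x (fieldAt X x) - fieldD X x (fieldAt Y x) := by
  have := isManifold_one_of_infty I M
  have key (Z : VField I M) : mpullbackWithin 𝓘(ℝ, E) I (extChartAt I x).symm Z (range I)
      =ᶠ[nhds (extChartAt I x x)] chartField Z x := by
    filter_upwards [extChartAt_target_mem_nhds (I := I) x] with y hy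
    rw [mpullbackWithin_apply]
    have h : (symmD I x y).inverse = chartD I x ((extChartAt I x).symm y) :=
      ContinuousLinearMap.inverse_eq (symmD_comp_chartD hy) (chartD_comp_symmD hy)
    exact congrArg (fun f : E →L[ℝ] E => f (fieldAt Z _)) h
  have h1 : (mfderiv I 𝓘(ℝ, E) (extChartAt I x) x : E →L[ℝ] E) = .id ℝ E := chartD_self x
  let X' : E → E := mpullbackWithin 𝓘(ℝ, E) I (extChartAt I x).symm X (range I)
  let Y' : E → E := mpullbackWithin 𝓘(ℝ, E) I (extChartAt I x).symm Y (range I)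
  let p : E := extChartAt I x x
  let L : E := lieBracketWithin ℝ X' Y' univ p
  let D : E →L[ℝ] E := mfderiv I 𝓘(ℝ, E) (extChartAt I x) x
  have h2 : (mlieBracket I X Y x : E) = ContinuousLinearMap.inverse D L := by
    rw [← mlieBracketWithin_univ, mlieBracketWithin_apply, preimage_univ, univ_inter]
    have : range I = univ := I.range_eq_univ
    rw [this]
    simp only [L, X', Y', this]
    rfl
  have h3 : ContinuousLinearMap.inverse (.id ℝ E : E →L[ℝ] E) = .id ℝ E :=
    ContinuousLinearMap.inverse_eq (ContinuousLinearMap.id_comp _) (ContinuousLinearMap.id_comp _)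
  have hX : X' =ᶠ[nhds (extChartAt I x x)] chartField X x := key X
  have hY : Y' =ᶠ[nhds (extChartAt I x x)] chartField Y x := key Y
  have h4 : D = .id ℝ E := h1
  have h5 : ContinuousLinearMap.inverse D L =
      fieldD Y x (fieldAt X x) - fieldD X x (fieldAt Y x) := by
    have h6 : L = fderiv ℝ Y' p (X' p) - fderiv ℝ X' p (Y' p) := by
      simp only [L, lieBracketWithin_univ, lieBracket_eq]
    rw [h4, h3, ContinuousLinearMap.id_apply, h6, hX.fderiv_eq, hY.fderiv_eq, hX.eq_of_nhds,
      hY.eq_of_nhds, fieldAt_eq_chartField, fieldAt_eq_chartField]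
    rfl
  exact h2.trans h5

/-- Every vector is the value of a smooth vector field which is constant in the chart near the
point. -/
theorem exists_isSmoothField_const [T2Space M] [FiniteDimensional ℝ E] (x : M) (u : E) :
    ∃ X : VField I M, IsSmoothField X ∧
      chartField X x =ᶠ[nhds (extChartAt I x x)] fun _ => u := by
  have := isManifold_one_of_infty I M
  let ψ : SmoothBumpFunction I x := Classical.arbitrary _
  let s : VField I M := fun z => symmD I x (extChartAt I x z) u
  have hs (y : E) (hy : y ∈ (extChartAt I x).target) : chartField s x y = u := by
    have h : chartField s x y = chartD I x ((extChartAt I x).symm y)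
      (symmD I x (extChartAt I x ((extChartAt I x).symm y)) u) := rfl
    rw [h, (extChartAt I x).right_inv hy]
    exact congrArg (fun f : E →L[ℝ] E => f u) (chartD_comp_symmD hy)
  refine ⟨fun z => (ψ z • symmD I x (extChartAt I x z) u : E), ?_, ?_⟩
  · have h1 := (contMDiffOn_field_iff (X := s) x).2 (contDiffOn_const.congr hs)
    exact ContMDiffOn.smul_section_of_tsupport (V := TangentSpace I) (F := E)
      ψ.contMDiff.contMDiffOn (chartAt H x).open_source ψ.tsupport_subset_chartAt_source h1
  · have h1 : ∀ᶠ y in nhds (extChartAt I x x), ψ ((extChartAt I x).symm y) = 1 :=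
      (continuousAt_extChartAt_symm (I := I) x).eventually (by
        rw [extChartAt_to_inv (I := I) x]; exact ψ.eventuallyEq_one)
    filter_upwards [h1, extChartAt_target_mem_nhds (I := I) x] with y h2 hy
    set z := (extChartAt I x).symm y with hz
    have h3 : chartField (I := I) (fun z => (ψ z • symmD I x (extChartAt I x z) u : E)) x y =
      chartD I x z (ψ z • symmD I x (extChartAt I x z) u) := rfl
    rw [h3, h2, one_smul]
    exact hs y hy

theorem chartField_endField (A : EndField I M) (X : VField I M) {x₀ : M} {y : E}
    (hy : y ∈ (extChartAt I x₀).target) :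
    chartField (fun x => A x (X x)) x₀ y = chartEnd A x₀ y (chartField X x₀ y) := by
  rw [chartEnd, ContinuousLinearMap.comp_apply, ContinuousLinearMap.comp_apply,
    symmD_chartField X hy]
  rfl

theorem fieldD_of_const {X : VField I M} {x : M} {u : E}
    (h : chartField X x =ᶠ[nhds (extChartAt I x x)] fun _ => u) : fieldD X x = 0 := by
  rw [fieldD, h.fderiv_eq, fderiv_fun_const]
  rfl

theorem fieldD_endField_of_const {A : EndField I M} (hA : IsSmoothEnd A) {X : VField I M} {x : M}
    {u : E} (h : chartField X x =ᶠ[nhds (extChartAt I x x)] fun _ => u) (w : E) :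
    fieldD (fun x => A x (X x)) x w = endD A x w u := by
  have h1 : chartField (fun x => A x (X x)) x =ᶠ[nhds (extChartAt I x x)]
      fun y => chartEnd A x y u := by
    filter_upwards [h, extChartAt_target_mem_nhds (I := I) x] with y h2 hy
    rw [chartField_endField A X hy, h2]
  rw [fieldD, h1.fderiv_eq, ((hA.hasFDerivAt x).clm_apply (hasFDerivAt_const u _)).fderiv]
  simp

/-- The vanishing of the Nijenhuis tensor, in a chart. -/
theorem nijenhuis_chart [T2Space M] [FiniteDimensional ℝ E] {J : EndField I M} (hJ : IsSmoothEnd J)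
    (h : ∀ X Y : VField I M, IsSmoothField X → IsSmoothField Y → ∀ x,
      mlieBracket I (fun x => J x (X x)) (fun x => J x (Y x)) x
        - J x (mlieBracket I (fun x => J x (X x)) Y x)
        - J x (mlieBracket I X (fun x => J x (Y x)) x) - mlieBracket I X Y x = 0)
    (x : M) (u v : E) :
    endD J x (endAt J x u) v - endD J x (endAt J x v) u + endAt J x (endD J x v u)
      - endAt J x (endD J x u v) = 0 := by
  obtain ⟨X, hX, hXu⟩ := exists_isSmoothField_const (I := I) x u
  obtain ⟨Y, hY, hYv⟩ := exists_isSmoothField_const (I := I) x v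
  have hX0 : fieldAt X x = u := by rw [fieldAt_eq_chartField, hXu.eq_of_nhds]
  have hY0 : fieldAt Y x = v := by rw [fieldAt_eq_chartField, hYv.eq_of_nhds]
  have hJX : fieldAt (fun x => J x (X x)) x = endAt J x u := by rw [← hX0]; rfl
  have hJY : fieldAt (fun x => J x (Y x)) x = endAt J x v := by rw [← hY0]; rfl
  have h1 := h X Y hX hY x
  have e1 := mlieBracket_eq_fieldD (fun x => J x (X x)) (fun x => J x (Y x)) x
  have e2 := mlieBracket_eq_fieldD (fun x => J x (X x)) Y x
  have e3 := mlieBracket_eq_fieldD X (fun x => J x (Y x)) x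
  have e4 := mlieBracket_eq_fieldD X Y x
  rw [hJX, hJY, fieldD_endField_of_const hJ hXu, fieldD_endField_of_const hJ hYv] at e1
  rw [hJX, hY0, fieldD_endField_of_const hJ hXu, fieldD_of_const hYv] at e2
  rw [hX0, hJY, fieldD_endField_of_const hJ hYv, fieldD_of_const hXu] at e3
  rw [fieldD_of_const hXu, fieldD_of_const hYv] at e4
  have h2 : ((endD J x (endAt J x u) v - endD J x (endAt J x v) u) -
      endAt J x ((0 : E →L[ℝ] E) (endAt J x u) - endD J x v u) -
      endAt J x (endD J x u v - (0 : E →L[ℝ] E) (endAt J x v)) -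
      ((0 : E →L[ℝ] E) (fieldAt X x) - (0 : E →L[ℝ] E) (fieldAt Y x)) : E) = 0 := by
    rw [← e1, ← e2, ← e3, ← e4]
    exact h1
  simp only [zero_apply, zero_sub, sub_zero, map_neg, sub_neg_eq_add] at h2
  exact h2

end Nijenhuis

/-! ### The transverse structure of a Sasakian manifold -/

section Contractions

variable {E : Type*} [NormedAddCommGroup E] [NormedSpace ℝ E]
  {H : Type*} [TopologicalSpace H] {I : ModelWithCorners ℝ E H} [I.Boundaryless]
  {M : Type*} [TopologicalSpace M] [ChartedSpace H M] [IsManifold I ∞ M]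

theorem covD_endD_of_comp_eq_zero {η : CovField I M} (hη : IsSmoothCov η) {A : EndField I M}
    (hA : IsSmoothEnd A) (h : ∀ x, covAt η x ∘L endAt A x = 0) (x : M) (v w : E) :
    covD η x v (endAt A x w) + covAt η x (endD A x v w) = 0 := by
  have h1 := (hasFDerivAt_chartCov hη x).clm_comp (hA.hasFDerivAt x)
  have h2 : (fun y => chartCov η x y ∘L chartEnd A x y) =ᶠ[nhds (extChartAt I x x)] fun _ => 0 := by
    filter_upwards [extChartAt_target_mem_nhds (I := I) x] with y hy
    rw [chartCov, chartEnd, ContinuousLinearMap.comp_assoc,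
      ← ContinuousLinearMap.comp_assoc (symmD I x y), symmD_comp_chartD hy, ContinuousLinearMap.id_comp,
      ← ContinuousLinearMap.comp_assoc, h, ContinuousLinearMap.zero_comp]
  have h3 := congrArg (fun L : E →L[ℝ] E →L[ℝ] ℝ => L v w)
    (h1.unique ((hasFDerivAt_const 0 _).congr_of_eventuallyEq h2))
  simp only [add_apply, ContinuousLinearMap.comp_apply, ContinuousLinearMap.compL_apply,
    ContinuousLinearMap.flip_apply, zero_apply, ← covAt_eq_chartCov, ← endAt_eq_chartEnd] at h3
  rw [add_comm]
  exact h3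

theorem covD_fieldD_of_apply_eq {η : CovField I M} (hη : IsSmoothCov η) {X : VField I M}
    (hX : IsSmoothVec X) {c : ℝ} (h : ∀ x, covAt η x (fieldAt X x) = c) (x : M) (v : E) :
    covD η x v (fieldAt X x) + covAt η x (fieldD X x v) = 0 := by
  have h1 := (hasFDerivAt_chartCov hη x).clm_apply (chartField_hasFDerivAt hX x)
  have h2 : (fun y => chartCov η x y (chartField X x y)) =ᶠ[nhds (extChartAt I x x)] fun _ => c := by
    filter_upwards [extChartAt_target_mem_nhds (I := I) x] with y hy
    rw [chartCov, ContinuousLinearMap.comp_apply, symmD_chartField X hy, h]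
  have h3 := congrArg (fun L : E →L[ℝ] ℝ => L v)
    (h1.unique ((hasFDerivAt_const c _).congr_of_eventuallyEq h2))
  simp only [add_apply, ContinuousLinearMap.comp_apply, ContinuousLinearMap.flip_apply, zero_apply,
    ← covAt_eq_chartCov, ← fieldAt_eq_chartField] at h3
  rw [add_comm]
  exact h3

end Contractions

section SasakianCone

open Set

variable {E : Type*} [NormedAddCommGroup E] [NormedSpace ℝ E]
  {S : Type*} [TopologicalSpace S] [ChartedSpace E S] [IsManifold 𝓘(ℝ, E) ∞ S]

theorem mfderiv_homothety (c : PosReal) (x : Cone S) :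
    (mfderiv (coneModel E) (coneModel E) (homothety c) x : E × ℝ →L[ℝ] E × ℝ) =
      (ContinuousLinearMap.id ℝ E).prodMap ((c : ℝ) • .id ℝ ℝ) := by
  have h : (homothety c : Cone S → Cone S) = Prod.map id (posMul c) := rfl
  have h1 := mfderiv_prodMap (I := 𝓘(ℝ, E)) (I' := 𝓘(ℝ, ℝ)) (J := 𝓘(ℝ, E)) (J' := 𝓘(ℝ, ℝ)) (p := x)
    (mdifferentiableAt_id (I := 𝓘(ℝ, E)) (x := x.1)) (mdifferentiableAt_posMul c x.2)
  have h2 := mfderiv_posMul c x.2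
  rw [mfderiv_id] at h1
  rw [h]
  exact h1.trans (congrArg (fun f : ℝ →L[ℝ] ℝ => (ContinuousLinearMap.id ℝ E).prodMap f) h2)

namespace SasakianStructure

variable (𝒮 : SasakianStructure E S)

/-- The restriction of the complex structure of the cone to `S`, followed by the projection to the
tangent spaces of `S`. It vanishes on the Reeb field and is a complex structure on the contact
distribution. -/
def phi : EndField 𝓘(ℝ, E) S := fun p =>
  (ContinuousLinearMap.fst ℝ E ℝ).comp
    ((show (E × ℝ) →L[ℝ] (E × ℝ) from 𝒮.J (p, posOne)).comp (ContinuousLinearMap.inl ℝ E ℝ))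

theorem endAt_J_one (p : S) (X : E) (f : ℝ) : endAt 𝒮.J (p, posOne) (X, f) =
    (endAt 𝒮.phi p X + f • fieldAt 𝒮.reeb p, -covAt 𝒮.contact p X) := by
  have h : endAt 𝒮.J (p, posOne) (X, f) =
      endAt 𝒮.J (p, posOne) (X, 0) + f • endAt 𝒮.J (p, posOne) ((0, 1) : E × ℝ) := by
    rw [← map_smul, ← map_add]
    simp
  have h1 : (endAt 𝒮.J (p, posOne) ((0, 1) : E × ℝ)).1 = fieldAt 𝒮.reeb p := rfl
  have h2 : (endAt 𝒮.J (p, posOne) ((0, 1) : E × ℝ)).2 = 0 := by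
    have h3 := (𝒮.Ω (p, posOne)).map_eq_zero_of_eq
      ![((0, 1) : E × ℝ), ((0, 1) : E × ℝ)] (i := 0) (j := 1) rfl (by simp)
    have h4 := 𝒮.Ω_apply (p, posOne) ((0, 1) : E × ℝ) ((0, 1) : E × ℝ)
    have h5 : coneMetric 𝒮.g (p, posOne) (𝒮.J (p, posOne) ((0, 1) : E × ℝ)) ((0, 1) : E × ℝ) =
      (endAt 𝒮.J (p, posOne) ((0, 1) : E × ℝ)).2 * 1 + ((posOne : PosReal) : ℝ) ^ 2 *
        𝒮.g.inner p (show E from (endAt 𝒮.J (p, posOne) ((0, 1) : E × ℝ)).1)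
          (0 : TangentSpace 𝓘(ℝ, E) p) := rfl
    have h6 : 𝒮.g.inner p (show E from (endAt 𝒮.J (p, posOne) ((0, 1) : E × ℝ)).1)
          (0 : TangentSpace 𝓘(ℝ, E) p) = 0 := ContinuousLinearMap.map_zero _
    rw [h5, h6, mul_zero, add_zero, mul_one] at h4
    exact h4.symm.trans h3
  rw [h]
  refine Prod.ext ?_ ?_
  · rw [Prod.fst_add, Prod.smul_fst, h1]
    rfl
  · rw [Prod.snd_add, Prod.smul_snd, h2, smul_zero, add_zero]
    exact (neg_neg _).symm

theorem endAt_J (p : S) (t : PosReal) (X : E) (f : ℝ) : endAt 𝒮.J (p, t) (X, f) =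
    (endAt 𝒮.phi p X + (f / t) • fieldAt 𝒮.reeb p, -(t * covAt 𝒮.contact p X)) := by
  have ht : (t : ℝ) ≠ 0 := (Set.mem_Ioi.1 t.2).ne'
  have h1 : homothety t (p, posOne) = (p, t) :=
    Prod.ext rfl (Subtype.ext (mul_one (t : ℝ)))
  have h2 (z : Cone S) (hz : homothety t (p, posOne) = z) :
      (ContinuousLinearMap.id ℝ E).prodMap ((t : ℝ) • .id ℝ ℝ)
        (endAt 𝒮.J (p, posOne) (X, f / t)) =
      endAt 𝒮.J z ((ContinuousLinearMap.id ℝ E).prodMap ((t : ℝ) • .id ℝ ℝ) (X, f / t)) := by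
    subst hz
    rw [← mfderiv_homothety t (p, posOne)]
    exact 𝒮.homothety_holomorphic t (p, posOne) ((X, f / t) : E × ℝ)
  have h3 := h2 _ h1
  have h4 : (ContinuousLinearMap.id ℝ E).prodMap ((t : ℝ) • .id ℝ ℝ) (X, f / t) = (X, f) :=
    Prod.ext rfl (mul_div_cancel₀ f ht)
  rw [h4, endAt_J_one] at h3
  rw [← h3]
  exact Prod.ext rfl (mul_neg _ _)

theorem algebra (p : S) :
    endAt 𝒮.phi p ∘L endAt 𝒮.phi p =
      -.id ℝ E + (covAt 𝒮.contact p).smulRight (fieldAt 𝒮.reeb p) ∧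
    endAt 𝒮.phi p (fieldAt 𝒮.reeb p) = 0 ∧ covAt 𝒮.contact p ∘L endAt 𝒮.phi p = 0 ∧
    covAt 𝒮.contact p (fieldAt 𝒮.reeb p) = 1 := by
  have h (X : E) (f : ℝ) : endAt 𝒮.J (p, posOne) (endAt 𝒮.J (p, posOne) (X, f)) = -(X, f) :=
    𝒮.J_J (p, posOne) ((X, f) : E × ℝ)
  simp only [endAt_J_one] at h
  have h0 := h 0 1
  simp only [map_zero, zero_add, one_smul, neg_zero, zero_smul, add_zero, Prod.neg_mk,
    Prod.mk.injEq, neg_inj] at h0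
  have h1 (X : E) := h X 0
  simp only [zero_smul, add_zero, Prod.neg_mk, Prod.mk.injEq, neg_zero, neg_eq_zero] at h1
  refine ⟨?_, h0.1, ?_, h0.2⟩
  · ext X
    have := (h1 X).1
    simp only [ContinuousLinearMap.comp_apply, add_apply, neg_apply, ContinuousLinearMap.id_apply,
      ContinuousLinearMap.smulRight_apply, ← this]
    module
  · ext X
    exact (h1 X).2

theorem chartEnd_J (x₀ : Cone S) {y : E} (hy : y ∈ (extChartAt 𝓘(ℝ, E) x₀.1).target) {s : ℝ}
    (hs : s ∈ Ioi (0 : ℝ)) (v : E) (f : ℝ) :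
    chartEnd 𝒮.J x₀ (y, s) (v, f) =
      (chartEnd 𝒮.phi x₀.1 y v + (f / s) • chartField 𝒮.reeb x₀.1 y,
        -(s * chartCov 𝒮.contact x₀.1 y v)) := by
  have hs' : s ∈ (extChartAt 𝓘(ℝ, ℝ) x₀.2).target := by rwa [posReal_target]
  have h1 : (extChartAt (coneModel E) x₀).symm (y, s) =
      ((extChartAt 𝓘(ℝ, E) x₀.1).symm y, ⟨s, hs⟩) := by
    rw [extChartAt_prod_symm, posReal_symm _ hs]
  have h2 := symmD_prod (x := x₀) (y := ((y, s) : E × ℝ)) hy hs'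
  have h3 := chartD_prod (x := x₀) (z := ((extChartAt 𝓘(ℝ, E) x₀.1).symm y, ⟨s, hs⟩))
    ((extChartAt 𝓘(ℝ, E) x₀.1).map_target hy) (by rw [posReal_source]; trivial)
  rw [posReal_symmD _ hs] at h2
  rw [posReal_chartD] at h3
  have h4 : chartEnd 𝒮.J x₀ (y, s) = chartD (coneModel E) x₀
      ((extChartAt 𝓘(ℝ, E) x₀.1).symm y, ⟨s, hs⟩) ∘L
      endAt 𝒮.J ((extChartAt 𝓘(ℝ, E) x₀.1).symm y, ⟨s, hs⟩) ∘L symmD (coneModel E) x₀ (y, s) := by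
    rw [chartEnd, h1]
  rw [h4, h2, h3]
  have h5 := 𝒮.endAt_J ((extChartAt 𝓘(ℝ, E) x₀.1).symm y) ⟨s, hs⟩ (symmD 𝓘(ℝ, E) x₀.1 y v) f
  change (chartD 𝓘(ℝ, E) x₀.1 ((extChartAt 𝓘(ℝ, E) x₀.1).symm y)).prodMap (.id ℝ ℝ)
    (endAt 𝒮.J ((extChartAt 𝓘(ℝ, E) x₀.1).symm y, ⟨s, hs⟩) (symmD 𝓘(ℝ, E) x₀.1 y v, f)) = _
  rw [h5]
  refine Prod.ext ?_ rfl
  change chartD 𝓘(ℝ, E) x₀.1 _ (_ + _) = _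
  rw [map_add, map_smul]
  rfl

theorem isSmoothEnd_J : IsSmoothEnd 𝒮.J := isSmoothEnd_of_contMDiff 𝒮.smooth_J

theorem contDiffOn_chartEnd_J (p : S) :
    ContDiffOn ℝ ∞ (fun y : E => chartEnd 𝒮.J (p, posOne) (y, 1)) (extChartAt 𝓘(ℝ, E) p).target := by
  have h : ContDiffOn ℝ ∞ (fun y : E => ((y, 1) : E × ℝ)) (extChartAt 𝓘(ℝ, E) p).target :=
    contDiffOn_id.prodMk contDiffOn_const
  refine (𝒮.isSmoothEnd_J (p, posOne)).comp h fun y hy => ?_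
  rw [extChartAt_prod_target, posReal_target]
  exact ⟨hy, Set.mem_Ioi.2 one_pos⟩

theorem isSmoothEnd_phi : IsSmoothEnd 𝒮.phi := by
  intro p
  have h := (contDiffOn_const (c := ContinuousLinearMap.fst ℝ E ℝ)).clm_comp
    ((𝒮.contDiffOn_chartEnd_J p).clm_comp (contDiffOn_const (c := ContinuousLinearMap.inl ℝ E ℝ)))
  refine h.congr fun y hy => ?_
  ext v
  simp [𝒮.chartEnd_J (p, posOne) hy (Set.mem_Ioi.2 one_pos)]

theorem isSmoothVec_reeb : IsSmoothVec 𝒮.reeb := by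
  intro p
  have h := (contDiffOn_const (c := ContinuousLinearMap.fst ℝ E ℝ)).clm_apply
    ((𝒮.contDiffOn_chartEnd_J p).clm_apply (contDiffOn_const (c := ((0, 1) : E × ℝ))))
  refine h.congr fun y hy => ?_
  simp [𝒮.chartEnd_J (p, posOne) hy (Set.mem_Ioi.2 one_pos)]

theorem isSmoothCov_contact : IsSmoothCov 𝒮.contact := by
  intro p
  have h := ((contDiffOn_const (c := ContinuousLinearMap.snd ℝ E ℝ)).clm_comp
    ((𝒮.contDiffOn_chartEnd_J p).clm_comp (contDiffOn_const (c := ContinuousLinearMap.inl ℝ E ℝ)))).neg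
  refine h.congr fun y hy => ?_
  ext v
  simp [𝒮.chartEnd_J (p, posOne) hy (Set.mem_Ioi.2 one_pos)]

theorem endD_J (p : S) (w v : E) (r f : ℝ) : endD 𝒮.J (p, posOne) (w, r) (v, f) =
    (endD 𝒮.phi p w v + f • fieldD 𝒮.reeb p w - (r * f) • fieldAt 𝒮.reeb p,
      -(covD 𝒮.contact p w v) - r * covAt 𝒮.contact p v) := by
  have hp : extChartAt (coneModel E) (p, posOne) (p, posOne) = (extChartAt 𝓘(ℝ, E) p p, (1 : ℝ)) :=
    extChartAt_prod_apply _ _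
  have h1 := (𝒮.isSmoothEnd_J.hasFDerivAt (p, posOne)).clm_apply
    (hasFDerivAt_const ((v, f) : E × ℝ) _)
  rw [hp] at h1
  have hfst : HasFDerivAt (fun z : E × ℝ => z.1) (ContinuousLinearMap.fst ℝ E ℝ)
    (extChartAt 𝓘(ℝ, E) p p, (1 : ℝ)) := hasFDerivAt_fst
  have hsnd : HasFDerivAt (fun z : E × ℝ => z.2) (ContinuousLinearMap.snd ℝ E ℝ)
    (extChartAt 𝓘(ℝ, E) p p, (1 : ℝ)) := hasFDerivAt_snd
  have hΦ := ((𝒮.isSmoothEnd_phi.hasFDerivAt p).comp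
    ((extChartAt 𝓘(ℝ, E) p p, (1 : ℝ)) : E × ℝ) hfst).clm_apply (hasFDerivAt_const v _)
  have hΞ := (chartField_hasFDerivAt 𝒮.isSmoothVec_reeb p).comp
    ((extChartAt 𝓘(ℝ, E) p p, (1 : ℝ)) : E × ℝ) hfst
  have hH := ((hasFDerivAt_chartCov 𝒮.isSmoothCov_contact p).comp
    ((extChartAt 𝓘(ℝ, E) p p, (1 : ℝ)) : E × ℝ) hfst).clm_apply (hasFDerivAt_const v _)
  have hone : HasDerivAt (fun y : ℝ => y⁻¹) (-((1 : ℝ) ^ 2)⁻¹) (1 : ℝ) := hasDerivAt_inv one_ne_zero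
  have hinv := (hone.comp_hasFDerivAt_of_eq (f := fun z : E × ℝ => z.2)
    (extChartAt 𝓘(ℝ, E) p p, (1 : ℝ)) hsnd rfl).const_mul f
  have h2 := (hΦ.add (hinv.smul hΞ)).prodMk ((hsnd.mul hH).neg)
  have hev : ∀ᶠ z in nhds ((extChartAt 𝓘(ℝ, E) p p, (1 : ℝ)) : E × ℝ),
      z ∈ (extChartAt 𝓘(ℝ, E) p).target ×ˢ Ioi (0 : ℝ) :=
    ((isOpen_extChartAt_target p).prod isOpen_Ioi).mem_nhds
      ⟨mem_extChartAt_target p, Set.mem_Ioi.2 one_pos⟩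
  have h3 := h1.unique (h2.congr_of_eventuallyEq ?_)
  · have h4 := congrArg (fun L : E × ℝ →L[ℝ] E × ℝ => L (w, r)) h3
    simp at h4
    rw [fieldAt_eq_chartField, covAt_eq_chartCov]
    refine h4.trans (Prod.ext ?_ ?_)
    · simp only [sub_eq_add_neg, add_assoc, mul_comm f r]
      rfl
    · change -(chartCov 𝒮.contact p (extChartAt 𝓘(ℝ, E) p p) v * r) + -covD 𝒮.contact p w v = _
      ring
  · filter_upwards [hev] with z hz
    rw [𝒮.chartEnd_J (p, posOne) hz.1 hz.2]
    rfl

section Integrability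

variable [T2Space S] [FiniteDimensional ℝ E]

theorem nijenhuis (p : S) (u v : E × ℝ) :
    endD 𝒮.J (p, posOne) (endAt 𝒮.J (p, posOne) u) v - endD 𝒮.J (p, posOne)
      (endAt 𝒮.J (p, posOne) v) u + endAt 𝒮.J (p, posOne) (endD 𝒮.J (p, posOne) v u)
      - endAt 𝒮.J (p, posOne) (endD 𝒮.J (p, posOne) u v) = 0 :=
  nijenhuis_chart 𝒮.isSmoothEnd_J 𝒮.integrable (p, posOne) u v

theorem nijenhuis_horizontal (p : S) (w v : E) :
    endD 𝒮.phi p (endAt 𝒮.phi p w) v - endD 𝒮.phi p (endAt 𝒮.phi p v) w +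
      endAt 𝒮.phi p (endD 𝒮.phi p v w) - endAt 𝒮.phi p (endD 𝒮.phi p w v) =
      (covD 𝒮.contact p v w - covD 𝒮.contact p w v) • fieldAt 𝒮.reeb p ∧
    -covD 𝒮.contact p (endAt 𝒮.phi p w) v + covD 𝒮.contact p (endAt 𝒮.phi p v) w -
      covAt 𝒮.contact p (endD 𝒮.phi p v w) + covAt 𝒮.contact p (endD 𝒮.phi p w v) = 0 := by
  have h := 𝒮.nijenhuis p (w, 0) (v, 0)
  simp only [endAt_J_one, endD_J, zero_smul, add_zero, mul_zero, sub_zero, zero_mul] at h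
  have h1 := congrArg Prod.fst h
  have h2 := congrArg Prod.snd h
  simp only [Prod.fst_add, Prod.fst_sub, Prod.snd_add, Prod.snd_sub, Prod.fst_zero,
    Prod.snd_zero] at h1 h2
  constructor
  · linear_combination (norm := module) h1
  · linear_combination h2

theorem nijenhuis_radial (p : S) (w : E) :
    fieldD 𝒮.reeb p (endAt 𝒮.phi p w) - endD 𝒮.phi p (fieldAt 𝒮.reeb p) w -
      endAt 𝒮.phi p (fieldD 𝒮.reeb p w) = 0 ∧
    covD 𝒮.contact p (fieldAt 𝒮.reeb p) w + covAt 𝒮.contact p (fieldD 𝒮.reeb p w) = 0 := by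
  have h := 𝒮.nijenhuis p (w, 0) (0, 1)
  simp only [endAt_J_one, endD_J, zero_smul, add_zero, mul_zero, sub_zero, zero_mul, map_zero,
    one_smul, mul_one, one_mul, zero_add, neg_zero, zero_sub, smul_zero, zero_apply] at h
  have h1 := congrArg Prod.fst h
  have h2 := congrArg Prod.snd h
  simp only [Prod.fst_add, Prod.fst_sub, Prod.snd_add, Prod.snd_sub, Prod.fst_zero,
    Prod.snd_zero] at h1 h2
  constructor
  · linear_combination (norm := module) h1
  · linear_combination h2

/-- The Reeb field preserves the transverse complex structure. -/
theorem endD_phi_reeb (p : S) : endD 𝒮.phi p (fieldAt 𝒮.reeb p) =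
    fieldD 𝒮.reeb p ∘L endAt 𝒮.phi p - endAt 𝒮.phi p ∘L fieldD 𝒮.reeb p := by
  ext w
  have h := (𝒮.nijenhuis_radial p w).1
  rw [sub_apply, ContinuousLinearMap.comp_apply, ContinuousLinearMap.comp_apply]
  linear_combination (norm := module) -h

/-- The Reeb field preserves the contact form. -/
theorem covD_contact_reeb (p : S) (w : E) :
    covD 𝒮.contact p (fieldAt 𝒮.reeb p) w + covAt 𝒮.contact p (fieldD 𝒮.reeb p w) = 0 :=
  (𝒮.nijenhuis_radial p w).2

/-- The differential of the contact form is of type `(1, 1)`. -/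
theorem covD_contact_phi (p : S) (v w : E) :
    (covD 𝒮.contact p (endAt 𝒮.phi p v) w - covD 𝒮.contact p w (endAt 𝒮.phi p v)) +
    (covD 𝒮.contact p v (endAt 𝒮.phi p w) - covD 𝒮.contact p (endAt 𝒮.phi p w) v) = 0 := by
  have h := (𝒮.nijenhuis_horizontal p w v).2
  have h1 := covD_endD_of_comp_eq_zero 𝒮.isSmoothCov_contact 𝒮.isSmoothEnd_phi
    (fun p => (𝒮.algebra p).2.2.1) p v w
  have h2 := covD_endD_of_comp_eq_zero 𝒮.isSmoothCov_contact 𝒮.isSmoothEnd_phi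
    (fun p => (𝒮.algebra p).2.2.1) p w v
  linear_combination h + h1 - h2

/-- The differential of the contact form is horizontal. -/
theorem covD_contact_reeb_sub (p : S) (w : E) :
    covD 𝒮.contact p (fieldAt 𝒮.reeb p) w - covD 𝒮.contact p w (fieldAt 𝒮.reeb p) = 0 := by
  have h := 𝒮.covD_contact_reeb p w
  have h1 := covD_fieldD_of_apply_eq 𝒮.isSmoothCov_contact 𝒮.isSmoothVec_reeb
    (fun p => (𝒮.algebra p).2.2.2) p w
  linear_combination h - h1

theorem phi_phi (p : S) (v : E) : endAt 𝒮.phi p (endAt 𝒮.phi p v) =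
    -v + covAt 𝒮.contact p v • fieldAt 𝒮.reeb p :=
  congrArg (fun L : E →L[ℝ] E => L v) (𝒮.algebra p).1

theorem covD_contact_phi_phi (p : S) (v w : E) :
    covD 𝒮.contact p (endAt 𝒮.phi p (endAt 𝒮.phi p v)) w -
      covD 𝒮.contact p w (endAt 𝒮.phi p (endAt 𝒮.phi p v)) =
    -(covD 𝒮.contact p v w - covD 𝒮.contact p w v) := by
  have h := 𝒮.covD_contact_reeb_sub p w
  rw [phi_phi]
  simp only [map_add, map_neg, map_smul, add_apply, neg_apply, smul_apply, smul_eq_mul]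
  linear_combination covAt 𝒮.contact p v * h

/-- The transverse complex structure is integrable modulo the Reeb field. -/
theorem frolicher_phi (p : S) (v w : E) : frolicher 𝒮.phi 𝒮.phi p v w =
    (2 * (covD 𝒮.contact p v w - covD 𝒮.contact p w v)) • fieldAt 𝒮.reeb p := by
  have h := (𝒮.nijenhuis_horizontal p w v).1
  rw [frolicher]
  linear_combination (norm := module) (2 : ℝ) • h

end Integrability

end SasakianStructure

end SasakianCone

/-! ### Tensor fields on a product -/

section ProductFields

variable {E : Type*} [NormedAddCommGroup E] [NormedSpace ℝ E]
  {E' : Type*} [NormedAddCommGroup E'] [NormedSpace ℝ E']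
  {H : Type*} [TopologicalSpace H] {I : ModelWithCorners ℝ E H}
  {H' : Type*} [TopologicalSpace H'] {I' : ModelWithCorners ℝ E' H'}
  {M : Type*} [TopologicalSpace M] [ChartedSpace H M]
  {M' : Type*} [TopologicalSpace M'] [ChartedSpace H' M']

/-- The direct sum of two fields of endomorphisms. -/
def endProd (A : EndField I M) (B : EndField I' M') : EndField (I.prod I') (M × M') :=
  fun m => (endAt A m.1).prodMap (endAt B m.2)

/-- The direct sum of two vector fields. -/
def fieldProd (X : VField I M) (Y : VField I' M') : VField (I.prod I') (M × M') :=
  fun m => ((fieldAt X m.1, fieldAt Y m.2) : E × E')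

/-- The direct sum of two fields of functionals. -/
def covProd (η : CovField I M) (θ : CovField I' M') : CovField (I.prod I') (M × M') :=
  fun m => (covAt η m.1).coprod (covAt θ m.2)

theorem endAt_endProd (A : EndField I M) (B : EndField I' M') (m : M × M') :
    endAt (endProd A B) m = (endAt A m.1).prodMap (endAt B m.2) := rfl

theorem fieldAt_fieldProd (X : VField I M) (Y : VField I' M') (m : M × M') :
    fieldAt (fieldProd X Y) m = (fieldAt X m.1, fieldAt Y m.2) := rfl

theorem covAt_covProd (η : CovField I M) (θ : CovField I' M') (m : M × M') :
    covAt (covProd η θ) m = (covAt η m.1).coprod (covAt θ m.2) := rfl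

theorem endAt_zero (x : M) : endAt (0 : EndField I M) x = 0 := rfl
theorem fieldAt_zero (x : M) : fieldAt (0 : VField I M) x = 0 := rfl
theorem covAt_zero (x : M) : covAt (0 : CovField I M) x = 0 := rfl

theorem chartEnd_zero (x : M) : chartEnd (0 : EndField I M) x = 0 := by
  ext y v
  simp [chartEnd, endAt_zero]

theorem chartField_zero (x : M) : chartField (0 : VField I M) x = 0 := by
  ext y
  simp [chartField, fieldAt_zero]

theorem chartCov_zero (x : M) : chartCov (0 : CovField I M) x = 0 := by
  ext y v
  simp [chartCov, covAt_zero]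

theorem isSmoothEnd_zero : IsSmoothEnd (0 : EndField I M) := fun x => by
  rw [chartEnd_zero]; exact contDiffOn_const

theorem isSmoothVec_zero : IsSmoothVec (0 : VField I M) := fun x => by
  rw [chartField_zero]; exact contDiffOn_const

theorem isSmoothCov_zero : IsSmoothCov (0 : CovField I M) := fun x => by
  rw [chartCov_zero]; exact contDiffOn_const

theorem endD_zero (x : M) : endD (0 : EndField I M) x = 0 := by
  rw [endD, chartEnd_zero]; exact fderiv_const_apply 0

theorem fieldD_zero (x : M) : fieldD (0 : VField I M) x = 0 := by
  rw [fieldD, chartField_zero]; exact fderiv_const_apply 0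

theorem covD_zero (x : M) : covD (0 : CovField I M) x = 0 := by
  rw [covD, chartCov_zero]; exact fderiv_const_apply 0

variable [IsManifold I ∞ M] [IsManifold I' ∞ M']

section Charts

variable {x : M × M'} {y : E × E'}

theorem chartEnd_endProd (A : EndField I M) (B : EndField I' M')
    (hy : y ∈ (extChartAt (I.prod I') x).target) : chartEnd (endProd A B) x y =
      (chartEnd A x.1 y.1).prodMap (chartEnd B x.2 y.2) := by
  rw [extChartAt_prod_target] at hy
  rw [chartEnd, extChartAt_prod_symm, symmD_prod hy.1 hy.2, chartD_prod
    ((extChartAt I x.1).map_target hy.1) ((extChartAt I' x.2).map_target hy.2)]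
  rfl

theorem chartField_fieldProd (X : VField I M) (Y : VField I' M')
    (hy : y ∈ (extChartAt (I.prod I') x).target) : chartField (fieldProd X Y) x y =
      (chartField X x.1 y.1, chartField Y x.2 y.2) := by
  rw [extChartAt_prod_target] at hy
  rw [chartField, extChartAt_prod_symm, chartD_prod
    ((extChartAt I x.1).map_target hy.1) ((extChartAt I' x.2).map_target hy.2)]
  rfl

theorem chartCov_covProd (η : CovField I M) (θ : CovField I' M')
    (hy : y ∈ (extChartAt (I.prod I') x).target) : chartCov (covProd η θ) x y =
      (chartCov η x.1 y.1).coprod (chartCov θ x.2 y.2) := by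
  rw [extChartAt_prod_target] at hy
  rw [chartCov, extChartAt_prod_symm, symmD_prod hy.1 hy.2]
  rfl

end Charts

theorem mapsTo_fst_target (x : M × M') : Set.MapsTo Prod.fst (extChartAt (I.prod I') x).target
    (extChartAt I x.1).target := fun y hy => by
  rw [extChartAt_prod_target] at hy; exact hy.1

theorem mapsTo_snd_target (x : M × M') : Set.MapsTo Prod.snd (extChartAt (I.prod I') x).target
    (extChartAt I' x.2).target := fun y hy => by
  rw [extChartAt_prod_target] at hy; exact hy.2

variable {A : EndField I M} {B : EndField I' M'} {X : VField I M} {Y : VField I' M'}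
  {η : CovField I M} {θ : CovField I' M'}

theorem IsSmoothEnd.endProd (hA : IsSmoothEnd A) (hB : IsSmoothEnd B) :
    IsSmoothEnd (endProd A B) := fun x => by
  have h1 := (hA x.1).comp contDiffOn_fst (mapsTo_fst_target (I' := I') x)
  have h2 := (hB x.2).comp contDiffOn_snd (mapsTo_snd_target (I := I) x)
  exact ((ContinuousLinearMap.prodMapL ℝ E E E' E').contDiff.comp_contDiffOn (h1.prodMk h2)).congr
    fun y hy => chartEnd_endProd A B hy

theorem IsSmoothVec.fieldProd (hX : IsSmoothVec X) (hY : IsSmoothVec Y) :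
    IsSmoothVec (fieldProd X Y) := fun x => by
  have h1 := (hX x.1).comp contDiffOn_fst (mapsTo_fst_target (I' := I') x)
  have h2 := (hY x.2).comp contDiffOn_snd (mapsTo_snd_target (I := I) x)
  exact (h1.prodMk h2).congr fun y hy => chartField_fieldProd X Y hy

theorem IsSmoothCov.covProd (hη : IsSmoothCov η) (hθ : IsSmoothCov θ) :
    IsSmoothCov (covProd η θ) := fun x => by
  have h1 := (hη x.1).comp contDiffOn_fst (mapsTo_fst_target (I' := I') x)
  have h2 := (hθ x.2).comp contDiffOn_snd (mapsTo_snd_target (I := I) x)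
  refine ((h1.clm_comp (contDiffOn_const (c := ContinuousLinearMap.fst ℝ E E'))).add
    (h2.clm_comp (contDiffOn_const (c := ContinuousLinearMap.snd ℝ E E')))).congr fun y hy => ?_
  rw [chartCov_covProd η θ hy]
  ext v <;> simp

variable [I.Boundaryless] [I'.Boundaryless]

theorem hasFDerivAt_comp_fst {G : Type*} [NormedAddCommGroup G] [NormedSpace ℝ G] {f : E → G}
    {L : E →L[ℝ] G} (x : M × M') (h : HasFDerivAt f L (extChartAt I x.1 x.1)) :
    HasFDerivAt (fun y : E × E' => f y.1) (L ∘L .fst ℝ E E') (extChartAt (I.prod I') x x) := by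
  rw [extChartAt_prod_apply]
  exact HasFDerivAt.comp (extChartAt I x.1 x.1, extChartAt I' x.2 x.2) h hasFDerivAt_fst

theorem hasFDerivAt_comp_snd {G : Type*} [NormedAddCommGroup G] [NormedSpace ℝ G] {f : E' → G}
    {L : E' →L[ℝ] G} (x : M × M') (h : HasFDerivAt f L (extChartAt I' x.2 x.2)) :
    HasFDerivAt (fun y : E × E' => f y.2) (L ∘L .snd ℝ E E') (extChartAt (I.prod I') x x) := by
  rw [extChartAt_prod_apply]
  exact HasFDerivAt.comp (extChartAt I x.1 x.1, extChartAt I' x.2 x.2) h hasFDerivAt_snd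

theorem endD_endProd (hA : IsSmoothEnd A) (hB : IsSmoothEnd B) (x : M × M') (v : E × E') :
    endD (endProd A B) x v = (endD A x.1 v.1).prodMap (endD B x.2 v.2) := by
  have h1 := (hasFDerivAt_comp_fst (I := I) (I' := I') x (hA.hasFDerivAt x.1)).prodMk
    (hasFDerivAt_comp_snd (I := I) (I' := I') x (hB.hasFDerivAt x.2))
  have h2 := (ContinuousLinearMap.prodMapL ℝ E E E' E').hasFDerivAt.comp _ h1
  have h3 := h2.congr_of_eventuallyEq (f₁ := chartEnd (SasakiProduct.endProd A B) x) (by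
    filter_upwards [extChartAt_target_mem_nhds (I := I.prod I') x] with y hy
      using chartEnd_endProd A B hy)
  rw [endD, h3.fderiv]
  rfl

theorem fieldD_fieldProd (hX : IsSmoothVec X) (hY : IsSmoothVec Y) (x : M × M') (v : E × E') :
    fieldD (fieldProd X Y) x v = (fieldD X x.1 v.1, fieldD Y x.2 v.2) := by
  have h1 := (hasFDerivAt_comp_fst (I := I) (I' := I') x (chartField_hasFDerivAt hX x.1)).prodMk
    (hasFDerivAt_comp_snd (I := I) (I' := I') x (chartField_hasFDerivAt hY x.2))
  have h3 := h1.congr_of_eventuallyEq (f₁ := chartField (SasakiProduct.fieldProd X Y) x) (by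
    filter_upwards [extChartAt_target_mem_nhds (I := I.prod I') x] with y hy
      using chartField_fieldProd X Y hy)
  rw [fieldD, h3.fderiv]
  rfl

theorem covD_covProd (hη : IsSmoothCov η) (hθ : IsSmoothCov θ) (x : M × M') (v : E × E') :
    covD (covProd η θ) x v = (covD η x.1 v.1).coprod (covD θ x.2 v.2) := by
  have h1 := ((hasFDerivAt_comp_fst (I := I) (I' := I') x (hasFDerivAt_chartCov hη x.1)).clm_comp
    (hasFDerivAt_const (ContinuousLinearMap.fst ℝ E E') _)).add
    ((hasFDerivAt_comp_snd (I := I) (I' := I') x (hasFDerivAt_chartCov hθ x.2)).clm_comp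
    (hasFDerivAt_const (ContinuousLinearMap.snd ℝ E E') _))
  have h3 := h1.congr_of_eventuallyEq (f₁ := chartCov (SasakiProduct.covProd η θ) x) (by
    filter_upwards [extChartAt_target_mem_nhds (I := I.prod I') x] with y hy
    rw [chartCov_covProd η θ hy]
    ext v <;> simp)
  rw [covD, h3.fderiv]
  ext w <;> simp

end ProductFields

section ProductPair

variable {E₁ : Type*} [NormedAddCommGroup E₁] [NormedSpace ℝ E₁] [FiniteDimensional ℝ E₁]
  {S₁ : Type*} [TopologicalSpace S₁] [ChartedSpace E₁ S₁] [IsManifold 𝓘(ℝ, E₁) ∞ S₁] [T2Space S₁]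
  {E₂ : Type*} [NormedAddCommGroup E₂] [NormedSpace ℝ E₂] [FiniteDimensional ℝ E₂]
  {S₂ : Type*} [TopologicalSpace S₂] [ChartedSpace E₂ S₂] [IsManifold 𝓘(ℝ, E₂) ∞ S₂] [T2Space S₂]

/-- The tensor fields on the product of two Sasakian manifolds. -/
def sasakiPair (𝒮₁ : SasakianStructure E₁ S₁) (𝒮₂ : SasakianStructure E₂ S₂) :
    SasakiPair (prodModel E₁ E₂) (S₁ × S₂) where
  X₁ := fieldProd 𝒮₁.reeb 0
  X₂ := fieldProd 0 𝒮₂.reeb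
  η₁ := covProd 𝒮₁.contact 0
  η₂ := covProd 0 𝒮₂.contact
  F₁ := endProd 𝒮₁.phi 0
  F₂ := endProd 0 𝒮₂.phi
  R₁ := endProd (idEnd 𝓘(ℝ, E₁) S₁) 0
  smooth_X₁ := 𝒮₁.isSmoothVec_reeb.fieldProd isSmoothVec_zero
  smooth_X₂ := isSmoothVec_zero.fieldProd 𝒮₂.isSmoothVec_reeb
  smooth_η₁ := 𝒮₁.isSmoothCov_contact.covProd isSmoothCov_zero
  smooth_η₂ := isSmoothCov_zero.covProd 𝒮₂.isSmoothCov_contact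
  smooth_F₁ := 𝒮₁.isSmoothEnd_phi.endProd isSmoothEnd_zero
  smooth_F₂ := isSmoothEnd_zero.endProd 𝒮₂.isSmoothEnd_phi
  smooth_R₁ := isSmoothEnd_idEnd.endProd isSmoothEnd_zero
  η₁_X₁ x := by simp [covAt_covProd, fieldAt_fieldProd, (𝒮₁.algebra x.1).2.2.2, covAt_zero]
  η₂_X₂ x := by simp [covAt_covProd, fieldAt_fieldProd, (𝒮₂.algebra x.2).2.2.2, covAt_zero]
  η₁_X₂ x := by simp [covAt_covProd, fieldAt_fieldProd, covAt_zero, fieldAt_zero]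
  η₂_X₁ x := by simp [covAt_covProd, fieldAt_fieldProd, covAt_zero, fieldAt_zero]
  F₁_X₁ x := by simp [endAt_endProd, fieldAt_fieldProd, (𝒮₁.algebra x.1).2.1, endAt_zero]
  F₁_X₂ x := by simp [endAt_endProd, fieldAt_fieldProd, endAt_zero, fieldAt_zero]
  F₂_X₁ x := by simp [endAt_endProd, fieldAt_fieldProd, endAt_zero, fieldAt_zero]
  F₂_X₂ x := by simp [endAt_endProd, fieldAt_fieldProd, (𝒮₂.algebra x.2).2.1, endAt_zero]
  η₁_F₁ x := by
    ext v <;> simp [endAt_endProd, covAt_covProd, endAt_zero, covAt_zero]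
    exact congrArg (fun L : E₁ →L[ℝ] ℝ => L v) (𝒮₁.algebra x.1).2.2.1
  η₁_F₂ x := by ext v <;> simp [endAt_endProd, covAt_covProd, endAt_zero, covAt_zero]
  η₂_F₁ x := by ext v <;> simp [endAt_endProd, covAt_covProd, endAt_zero, covAt_zero]
  η₂_F₂ x := by
    ext v <;> simp [endAt_endProd, covAt_covProd, endAt_zero, covAt_zero]
    exact congrArg (fun L : E₂ →L[ℝ] ℝ => L v) (𝒮₂.algebra x.2).2.2.1
  F₁_F₂ x := by ext v <;> simp [endAt_endProd, endAt_zero]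
  F₂_F₁ x := by ext v <;> simp [endAt_endProd, endAt_zero]
  R₁_eq x := by
    ext v <;> simp [endAt_endProd, endAt_zero, covAt_covProd, fieldAt_fieldProd, covAt_zero,
      fieldAt_zero, 𝒮₁.phi_phi, endAt_idEnd]
  R₂_eq x := by
    ext v <;> simp [endAt_endProd, endAt_zero, covAt_covProd, fieldAt_fieldProd, covAt_zero,
      fieldAt_zero, 𝒮₂.phi_phi, endAt_idEnd]
  X_comm x := by
    rw [fieldD_fieldProd isSmoothVec_zero 𝒮₂.isSmoothVec_reeb,
      fieldD_fieldProd 𝒮₁.isSmoothVec_reeb isSmoothVec_zero]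
    simp [fieldAt_fieldProd, fieldAt_zero, fieldD_zero]
  L₁_F₁ x := by
    refine ContinuousLinearMap.ext fun v => ?_
    simp [endD_endProd 𝒮₁.isSmoothEnd_phi isSmoothEnd_zero,
      fieldD_fieldProd 𝒮₁.isSmoothVec_reeb isSmoothVec_zero, fieldAt_fieldProd, fieldAt_zero,
      fieldD_zero, endD_zero, endAt_endProd, endAt_zero, 𝒮₁.endD_phi_reeb]
    rfl
  L₁_F₂ x := by
    refine ContinuousLinearMap.ext fun v => ?_
    simp [endD_endProd isSmoothEnd_zero 𝒮₂.isSmoothEnd_phi,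
      fieldD_fieldProd 𝒮₁.isSmoothVec_reeb isSmoothVec_zero, fieldAt_fieldProd, fieldAt_zero,
      fieldD_zero, endD_zero, endAt_endProd, endAt_zero]
    rfl
  L₂_F₁ x := by
    refine ContinuousLinearMap.ext fun v => ?_
    simp [endD_endProd 𝒮₁.isSmoothEnd_phi isSmoothEnd_zero,
      fieldD_fieldProd isSmoothVec_zero 𝒮₂.isSmoothVec_reeb, fieldAt_fieldProd, fieldAt_zero,
      fieldD_zero, endD_zero, endAt_endProd, endAt_zero]
    rfl
  L₂_F₂ x := by
    refine ContinuousLinearMap.ext fun v => ?_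
    simp [endD_endProd isSmoothEnd_zero 𝒮₂.isSmoothEnd_phi,
      fieldD_fieldProd isSmoothVec_zero 𝒮₂.isSmoothVec_reeb, fieldAt_fieldProd, fieldAt_zero,
      fieldD_zero, endD_zero, endAt_endProd, endAt_zero, 𝒮₂.endD_phi_reeb]
    rfl
  L₁_η₁ x w := by
    simp [covD_covProd 𝒮₁.isSmoothCov_contact isSmoothCov_zero,
      fieldD_fieldProd 𝒮₁.isSmoothVec_reeb isSmoothVec_zero, fieldAt_fieldProd, fieldAt_zero,
      fieldD_zero, covD_zero, covAt_covProd, covAt_zero, 𝒮₁.covD_contact_reeb]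
  L₁_η₂ x w := by
    simp [covD_covProd isSmoothCov_zero 𝒮₂.isSmoothCov_contact,
      fieldD_fieldProd 𝒮₁.isSmoothVec_reeb isSmoothVec_zero, fieldAt_fieldProd, fieldAt_zero,
      fieldD_zero, covD_zero, covAt_covProd, covAt_zero]
  L₂_η₁ x w := by
    simp [covD_covProd 𝒮₁.isSmoothCov_contact isSmoothCov_zero,
      fieldD_fieldProd isSmoothVec_zero 𝒮₂.isSmoothVec_reeb, fieldAt_fieldProd, fieldAt_zero,
      fieldD_zero, covD_zero, covAt_covProd, covAt_zero]
  L₂_η₂ x w := by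
    simp [covD_covProd isSmoothCov_zero 𝒮₂.isSmoothCov_contact,
      fieldD_fieldProd isSmoothVec_zero 𝒮₂.isSmoothVec_reeb, fieldAt_fieldProd, fieldAt_zero,
      fieldD_zero, covD_zero, covAt_covProd, covAt_zero, 𝒮₂.covD_contact_reeb]
  dη₁_F₁ x v w := by
    simp [covD_covProd 𝒮₁.isSmoothCov_contact isSmoothCov_zero, covD_zero, endAt_endProd,
      endAt_zero, 𝒮₁.covD_contact_phi]
  dη₂_F₂ x v w := by
    simp [covD_covProd isSmoothCov_zero 𝒮₂.isSmoothCov_contact, covD_zero, endAt_endProd,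
      endAt_zero, 𝒮₂.covD_contact_phi]
  dη₁_F₂ x v w := by
    simp [covD_covProd 𝒮₁.isSmoothCov_contact isSmoothCov_zero, covD_zero, endAt_endProd,
      endAt_zero]
  dη₂_F₁ x v w := by
    simp [covD_covProd isSmoothCov_zero 𝒮₂.isSmoothCov_contact, covD_zero, endAt_endProd,
      endAt_zero]
  dη₁_sq x v w := by
    have h := 𝒮₁.covD_contact_phi_phi x.1 v.1 w.1
    simpa [covD_covProd 𝒮₁.isSmoothCov_contact isSmoothCov_zero, covD_zero, endAt_endProd] using h
  bracket₁₁ x v w := by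
    refine ⟨2 * (covD 𝒮₁.contact x.1 v.1 w.1 - covD 𝒮₁.contact x.1 w.1 v.1), ?_⟩
    rw [fieldAt_fieldProd, Prod.smul_mk, ← 𝒮₁.frolicher_phi, fieldAt_zero, smul_zero]
    ext <;> simp [frolicher, endD_endProd 𝒮₁.isSmoothEnd_phi isSmoothEnd_zero, endD_zero, endAt_endProd,
      endAt_zero]
  bracket₂₂ x v w := by
    refine ⟨2 * (covD 𝒮₂.contact x.2 v.2 w.2 - covD 𝒮₂.contact x.2 w.2 v.2), ?_⟩
    rw [fieldAt_fieldProd, Prod.smul_mk, ← 𝒮₂.frolicher_phi, fieldAt_zero, smul_zero]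
    ext <;> simp [frolicher, endD_endProd isSmoothEnd_zero 𝒮₂.isSmoothEnd_phi, endD_zero, endAt_endProd,
      endAt_zero]
  bracket₁₂ x v w := by
    ext <;> simp [frolicher, endD_endProd isSmoothEnd_zero 𝒮₂.isSmoothEnd_phi,
      endD_endProd 𝒮₁.isSmoothEnd_phi isSmoothEnd_zero, endD_zero, endAt_endProd, endAt_zero]
  bracketR₁ x v w := by
    ext <;> simp [frolicher, endD_endProd isSmoothEnd_idEnd isSmoothEnd_zero,
      endD_endProd 𝒮₁.isSmoothEnd_phi isSmoothEnd_zero, endD_zero, endAt_endProd, endAt_zero,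
      endAt_idEnd, endD_idEnd]
  bracketR₂ x v w := by
    ext <;> simp [frolicher, endD_endProd isSmoothEnd_idEnd isSmoothEnd_zero,
      endD_endProd isSmoothEnd_zero 𝒮₂.isSmoothEnd_phi, endD_zero, endAt_endProd, endAt_zero,
      endAt_idEnd, endD_idEnd]

end ProductPair

/-! ### The derivative of a flow at time zero -/

section LocalFlow

open Set Metric Topology

/-- The local flow of a vector field is differentiable at time zero. Only continuity of the flow in
the initial point enters the proof, since the derivative is taken at time zero. -/
theorem exists_localFlow {E : Type*} [NormedAddCommGroup E] [NormedSpace ℝ E] [CompleteSpace E]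
    {f : E → E} {x₀ : E} (hf : ContDiffAt ℝ 1 f x₀) {U : Set E} (hU : U ∈ 𝓝 x₀) :
    ∃ α : E × ℝ → E, HasFDerivAt α (.fst ℝ E ℝ + (ContinuousLinearMap.snd ℝ E ℝ).smulRight (f x₀))
      (x₀, 0) ∧ ∃ V ∈ 𝓝 x₀, ∃ ε > (0 : ℝ), ∀ x ∈ V, α (x, 0) = x ∧
        ∀ t ∈ Ioo (-ε) ε, α (x, t) ∈ U ∧ HasDerivAt (fun t => α (x, t)) (f (α (x, t))) t := by
  obtain ⟨ε, hε, a, r, L, K, hr, hpl⟩ := IsPicardLindelof.of_contDiffAt_one hf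
  obtain ⟨α, h1, h2⟩ := (hpl 0).exists_forall_mem_closedBall_eq_hasDerivWithinAt_continuousOn
  have hd : ∀ x ∈ closedBall x₀ r, ∀ t ∈ Ioo (-ε) ε,
      HasDerivAt (fun t => α (x, t)) (f (α (x, t))) t := fun x hx t ht =>
    ((h1 x hx).2 t ⟨by linarith [ht.1], by linarith [ht.2]⟩).hasDerivAt
      (Icc_mem_nhds (by linarith [ht.1]) (by linarith [ht.2]))
  have hmem : closedBall x₀ r ×ˢ Icc (0 - ε) (0 + ε) ∈ 𝓝 ((x₀, 0) : E × ℝ) :=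
    prod_mem_nhds (closedBall_mem_nhds x₀ hr) (Icc_mem_nhds (by linarith) (by linarith))
  have hc : ContinuousAt α (x₀, 0) := h2.continuousAt hmem
  have h0 : α (x₀, 0) = x₀ := (h1 x₀ (mem_closedBall_self r.2)).1
  -- a neighbourhood of the initial data on which the flow stays in a prescribed set
  have hbox (W : Set E) (hW : W ∈ 𝓝 x₀) : ∃ δ > (0 : ℝ), δ ≤ ε ∧ δ ≤ r ∧
      ∀ x ∈ ball x₀ δ, ∀ t ∈ Ioo (-δ) δ, α (x, t) ∈ W := by
    have h3 : α ⁻¹' W ∈ 𝓝 ((x₀, 0) : E × ℝ) := hc (by rwa [h0])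
    obtain ⟨δ, hδ, h4⟩ := Metric.mem_nhds_iff.1 h3
    refine ⟨min δ (min ε r), lt_min hδ (lt_min hε hr), (min_le_right _ _).trans (min_le_left _ _),
      (min_le_right _ _).trans (min_le_right _ _), fun x hx t ht => h4 ?_⟩
    rw [← ball_prod_same]
    refine ⟨ball_subset_ball (min_le_left _ _) hx, ?_⟩
    rw [Real.ball_eq_Ioo]
    exact ⟨by linarith [ht.1, min_le_left δ (min ε r)], by linarith [ht.2, min_le_left δ (min ε r)]⟩
  refine ⟨α, ?_, ?_⟩
  · rw [hasFDerivAt_iff_isLittleO_nhds_zero, Asymptotics.isLittleO_iff]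
    intro c hcpos
    have hfc : {y | ‖f y - f x₀‖ ≤ c} ∈ 𝓝 x₀ := by
      have h5 : Filter.Tendsto (fun y => ‖f y - f x₀‖) (𝓝 x₀) (𝓝 ‖f x₀ - f x₀‖) :=
        (hf.continuousAt.sub (continuousAt_const (y := f x₀))).norm
      rw [sub_self, norm_zero] at h5
      exact h5.eventually_le_const hcpos
    obtain ⟨δ, hδ, hδε, hδr, h3⟩ := hbox _ hfc
    filter_upwards [Metric.ball_mem_nhds (0 : E × ℝ) hδ] with z hz
    rw [← Prod.mk_zero_zero, ← ball_prod_same] at hz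
    have hz1 : x₀ + z.1 ∈ ball x₀ δ := by simpa using hz.1
    have hz2 : z.2 ∈ Ioo (-δ) δ := by simpa [Real.ball_eq_Ioo] using hz.2
    have hz1' : x₀ + z.1 ∈ closedBall x₀ r := ball_subset_closedBall (ball_subset_ball hδr hz1)
    have h4 := (convex_Ioo (-δ) δ).norm_image_sub_le_of_norm_hasDerivWithin_le
      (f := fun t => α (x₀ + z.1, t) - t • f x₀) (C := c)
      (fun t ht => (((hd _ hz1' t ⟨by linarith [ht.1], by linarith [ht.2]⟩).sub
        ((hasDerivAt_id t).smul_const (f x₀)))).hasDerivWithinAt)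
      (fun t ht => by simpa using h3 _ hz1 t ht) (x := 0) (y := z.2) ⟨by linarith, hδ⟩ hz2
    have h5 : α (x₀ + z.1, 0) = x₀ + z.1 := (h1 _ hz1').1
    simp only [h5, zero_smul, sub_zero] at h4
    have h6 : α ((x₀, 0) + z) - α (x₀, 0) -
        (ContinuousLinearMap.fst ℝ E ℝ + (ContinuousLinearMap.snd ℝ E ℝ).smulRight (f x₀)) z =
        α (x₀ + z.1, z.2) - z.2 • f x₀ - (x₀ + z.1) := by
      have : ((x₀, 0) : E × ℝ) + z = (x₀ + z.1, z.2) := by ext <;> simp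
      rw [this, h0]
      simp only [add_apply, ContinuousLinearMap.coe_fst', ContinuousLinearMap.smulRight_apply,
        ContinuousLinearMap.coe_snd']
      abel
    rw [h6]
    exact h4.trans (mul_le_mul_of_nonneg_left (norm_snd_le z) hcpos.le)
  · obtain ⟨δ, hδ, hδε, hδr, h3⟩ := hbox U hU
    refine ⟨ball x₀ δ, ball_mem_nhds _ hδ, δ, hδ, fun x hx => ?_⟩
    have hx' : x ∈ closedBall x₀ r := ball_subset_closedBall (ball_subset_ball hδr hx)
    exact ⟨(h1 x hx').1, fun t ht => ⟨h3 x hx t ht, hd x hx' t ⟨by linarith [ht.1],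
      by linarith [ht.2]⟩⟩⟩

end LocalFlow

section Flow

open Set Topology

variable {E : Type*} [NormedAddCommGroup E] [NormedSpace ℝ E]
  {H : Type*} [TopologicalSpace H] {I : ModelWithCorners ℝ E H} [I.Boundaryless]
  {M : Type*} [TopologicalSpace M] [ChartedSpace H M] [IsManifold I ∞ M]

theorem hasMFDerivAt_extChartAt_symm {x₀ : M} {y : E} (hy : y ∈ (extChartAt I x₀).target) :
    HasMFDerivAt 𝓘(ℝ, E) I (extChartAt I x₀).symm y
      (symmD I x₀ y : E →L[ℝ] E) := by
  have := isManifold_one_of_infty I M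
  have h := (mdifferentiableWithinAt_extChartAt_symm hy).hasMFDerivWithinAt
  rw [I.range_eq_univ] at h
  have h2 := hasMFDerivWithinAt_univ.1 h
  have h3 : (symmD I x₀ y : E →L[ℝ] E) = mfderivWithin 𝓘(ℝ, E) I (extChartAt I x₀).symm univ y := by
    rw [← I.range_eq_univ]
    rfl
  rw [h3]
  exact h2

/-- The curves which in a chart solve the differential equation of `X` are integral curves. -/
theorem isMIntegralCurveOn_symm (X : VField I M) {x₀ : M} {β : ℝ → E} {s : Set ℝ}
    (h : ∀ t ∈ s, β t ∈ (extChartAt I x₀).target ∧ HasDerivAt β (chartField X x₀ (β t)) t) :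
    IsMIntegralCurveOn (fun t => (extChartAt I x₀).symm (β t)) X s := by
  intro t ht
  obtain ⟨h1, h2⟩ := h t ht
  have h3 := (hasMFDerivAt_extChartAt_symm h1).comp t h2.hasFDerivAt.hasMFDerivAt
  refine HasMFDerivAt.hasMFDerivWithinAt ?_
  have h4 : (symmD I x₀ (β t)).comp (ContinuousLinearMap.toSpanSingleton ℝ (chartField X x₀ (β t))) =
      (1 : ℝ →L[ℝ] ℝ).smulRight (fieldAt X ((extChartAt I x₀).symm (β t))) := by
    ext
    simp [symmD_chartField X h1]
  exact h4 ▸ h3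

variable [CompleteSpace E]

/-- Near a point, all integral curves of a smooth vector field exist for a uniform time, and are
given by a family which is differentiable at time zero. -/
theorem exists_localFlow_manifold {X : VField I M} (hX : IsSmoothVec X) (p₀ : M) :
    ∃ α : E × ℝ → E, HasFDerivAt α
      (.fst ℝ E ℝ + (ContinuousLinearMap.snd ℝ E ℝ).smulRight (fieldAt X p₀))
      (extChartAt I p₀ p₀, 0) ∧ ∃ V ∈ 𝓝 p₀, ∃ ε > (0 : ℝ), ∀ p ∈ V,
        p ∈ (extChartAt I p₀).source ∧
        (∀ t ∈ Ioo (-ε) ε, α (extChartAt I p₀ p, t) ∈ (extChartAt I p₀).target) ∧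
        (extChartAt I p₀).symm (α (extChartAt I p₀ p, 0)) = p ∧
        IsMIntegralCurveOn (fun t => (extChartAt I p₀).symm (α (extChartAt I p₀ p, t))) X
          (Ioo (-ε) ε) := by
  have h1 : ContDiffAt ℝ 1 (chartField X p₀) (extChartAt I p₀ p₀) :=
    ((hX p₀).contDiffAt (extChartAt_target_mem_nhds p₀)).of_le (by exact_mod_cast le_top)
  obtain ⟨α, hα, V, hV, ε, hε, h2⟩ := exists_localFlow h1 (extChartAt_target_mem_nhds (I := I) p₀)
  rw [← fieldAt_eq_chartField] at hα
  refine ⟨α, hα, extChartAt I p₀ ⁻¹' V ∩ (extChartAt I p₀).source,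
    Filter.inter_mem ((continuousAt_extChartAt p₀) hV) (extChartAt_source_mem_nhds p₀), ε, hε,
    fun p hp => ?_⟩
  obtain ⟨h3, h4⟩ := h2 _ hp.1
  exact ⟨hp.2, fun t ht => (h4 t ht).1, by rw [h3, (extChartAt I p₀).left_inv hp.2],
    isMIntegralCurveOn_symm X h4⟩

variable [T2Space M]

theorem contMDiff_one_of_isSmoothVec {X : VField I M} (hX : IsSmoothVec X) :
    ContMDiff I I.tangent 1 (fun x => (⟨x, X x⟩ : TangentBundle I M)) :=
  (isSmoothField_iff.2 hX).of_le (by exact_mod_cast le_top)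

/-- On a compact manifold the integral curves of a smooth vector field exist for all times. -/
theorem exists_isMIntegralCurve_of_compact [CompactSpace M] {X : VField I M} (hX : IsSmoothVec X)
    (p : M) : ∃ γ : ℝ → M, γ 0 = p ∧ IsMIntegralCurve γ X := by
  have := isManifold_one_of_infty I M
  choose α hα V hV ε hε h using exists_localFlow_manifold hX
  obtain ⟨s, hs⟩ := CompactSpace.elim_nhds_subcover V hV
  rcases s.eq_empty_or_nonempty with rfl | hne
  · have : p ∈ (⊤ : Set M) := trivial
    simp [← hs] at this
  obtain ⟨q, -, hq⟩ := s.exists_min_image ε hne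
  refine exists_isMIntegralCurve_of_isMIntegralCurveOn (contMDiff_one_of_isSmoothVec hX) (hε q)
    (fun x => ?_) p
  have : x ∈ (⊤ : Set M) := trivial
  rw [← hs] at this
  simp only [mem_iUnion] at this
  obtain ⟨r, hr, hxr⟩ := this
  obtain ⟨-, -, h1, h2⟩ := h r x hxr
  exact ⟨_, h1, h2.mono (Ioo_subset_Ioo (neg_le_neg (hq r hr)) (hq r hr))⟩

theorem flow_spec [CompactSpace M] {X : VField I M} (hX : IsSmoothVec X) (p : M) :
    flow X 0 p = p ∧ IsMIntegralCurve (fun t => flow X t p) X := by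
  have h := exists_isMIntegralCurve_of_compact hX p
  have h1 : (fun t => flow X t p) = h.choose := by
    funext t
    rw [flow, dif_pos h]
  rw [h1]
  exact ⟨(congrFun h1 0).trans h.choose_spec.1, h.choose_spec.2⟩

/-- The derivative of the flow of a smooth vector field at time zero. -/
theorem hasMFDerivAt_flow [CompactSpace M] {X : VField I M} (hX : IsSmoothVec X) (p₀ : M) :
    HasMFDerivAt (I.prod 𝓘(ℝ, ℝ)) I (fun z : M × ℝ => flow X z.2 z.1) (p₀, 0)
      (.fst ℝ E ℝ + (ContinuousLinearMap.snd ℝ E ℝ).smulRight (fieldAt X p₀) : E × ℝ →L[ℝ] E) := by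
  have := isManifold_one_of_infty I M
  obtain ⟨α, hα, V, hV, ε, hε, h⟩ := exists_localFlow_manifold hX p₀
  have hfl : ∀ p ∈ V, ∀ t ∈ Ioo (-ε) ε,
      flow X t p = (extChartAt I p₀).symm (α (extChartAt I p₀ p, t)) := by
    intro p hp t ht
    obtain ⟨-, -, h1, h2⟩ := h p hp
    refine isMIntegralCurveOn_Ioo_eqOn_of_contMDiff_boundaryless (t₀ := 0) ⟨by linarith, hε⟩
      (contMDiff_one_of_isSmoothVec hX) ((flow_spec hX p).2.isMIntegralCurveOn _) h2 ?_ ht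
    rw [h1]
    exact (flow_spec hX p).1
  have hmem : V ×ˢ Ioo (-ε) ε ∈ 𝓝 ((p₀, 0) : M × ℝ) :=
    prod_mem_nhds hV (Ioo_mem_nhds (by linarith) hε)
  have hα0 : α (extChartAt I p₀ p₀, 0) = extChartAt I p₀ p₀ := by
    have h1 := h p₀ (mem_of_mem_nhds hV)
    rw [← (extChartAt I p₀).right_inv (h1.2.1 0 ⟨by linarith, hε⟩), h1.2.2.1]
  have h1 : HasMFDerivAt (I.prod 𝓘(ℝ, ℝ)) 𝓘(ℝ, E × ℝ)
      (fun z : M × ℝ => ((extChartAt I p₀ z.1, z.2) : E × ℝ)) (p₀, 0)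
      (.id ℝ (E × ℝ) : E × ℝ →L[ℝ] E × ℝ) := by
    have h2 := (mdifferentiableAt_extChartAt (I := I) (mem_chart_source H p₀)).hasMFDerivAt
    have h3 : (mfderiv I 𝓘(ℝ, E) (extChartAt I p₀) p₀ : E →L[ℝ] E) = .id ℝ E := chartD_self p₀
    rw [h3] at h2
    have h4 := HasMFDerivAt.comp ((p₀, 0) : M × ℝ) h2
      (hasMFDerivAt_fst (I := I) (I' := 𝓘(ℝ, ℝ)) ((p₀, 0) : M × ℝ))
    have h5 := hasMFDerivAt_snd (I := I) (I' := 𝓘(ℝ, ℝ)) ((p₀, 0) : M × ℝ)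
    exact ⟨h4.1.prodMk h5.1, h4.2.prodMk h5.2⟩
  have h2 : HasMFDerivAt (I.prod 𝓘(ℝ, ℝ)) I
      (fun z : M × ℝ => (extChartAt I p₀).symm (α (extChartAt I p₀ z.1, z.2))) (p₀, 0)
      (.fst ℝ E ℝ + (ContinuousLinearMap.snd ℝ E ℝ).smulRight (fieldAt X p₀) : E × ℝ →L[ℝ] E) := by
    have h3 := hasMFDerivAt_extChartAt_symm (mem_extChartAt_target (I := I) p₀)
    rw [symmD_self, ← hα0] at h3
    have h4 := HasMFDerivAt.comp (f := fun z : M × ℝ => α (extChartAt I p₀ z.1, z.2))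
      ((p₀, 0) : M × ℝ) h3 (hα.hasMFDerivAt.comp ((p₀, 0) : M × ℝ) h1)
    exact h4
  exact h2.congr_of_eventuallyEq (by
    filter_upwards [hmem] with z hz using hfl z.1 hz.1 z.2 hz.2)

end Flow

/-! ### The complex structure of the quotient -/

section QuotientStructure

open Set Topology

variable {E₁ : Type*} [NormedAddCommGroup E₁] [NormedSpace ℝ E₁] [FiniteDimensional ℝ E₁]
  {S₁ : Type*} [TopologicalSpace S₁] [ChartedSpace E₁ S₁] [IsManifold 𝓘(ℝ, E₁) ∞ S₁] [T2Space S₁]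
  {E₂ : Type*} [NormedAddCommGroup E₂] [NormedSpace ℝ E₂] [FiniteDimensional ℝ E₂]
  {S₂ : Type*} [TopologicalSpace S₂] [ChartedSpace E₂ S₂] [IsManifold 𝓘(ℝ, E₂) ∞ S₂] [T2Space S₂]
  [CompactSpace S₁] [CompactSpace S₂]

theorem hasMFDerivAt_slice (m : S₁ × S₂) :
    HasMFDerivAt (prodModel E₁ E₂) ((coneModel E₁).prod (coneModel E₂)) slice m
      ((ContinuousLinearMap.inl ℝ E₁ ℝ).prodMap (ContinuousLinearMap.inl ℝ E₂ ℝ) :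
        E₁ × E₂ →L[ℝ] (E₁ × ℝ) × (E₂ × ℝ)) := by
  have h1 := (hasMFDerivAt_fst (I := 𝓘(ℝ, E₁)) (I' := 𝓘(ℝ, E₂)) m).prodMk
    (hasMFDerivAt_const (I := prodModel E₁ E₂) (I' := 𝓘(ℝ, ℝ)) posOne m)
  have h2 := (hasMFDerivAt_snd (I := 𝓘(ℝ, E₁)) (I' := 𝓘(ℝ, E₂)) m).prodMk
    (hasMFDerivAt_const (I := prodModel E₁ E₂) (I' := 𝓘(ℝ, ℝ)) posOne m)
  exact h1.prodMk h2

theorem orbitTime_im (a : ℂ) (t₁ t₂ : ℝ) : (orbitTime a t₁ t₂).im =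
    -(a.re / a.im) * Real.log t₁ + a.im⁻¹ * Real.log t₂ := by
  have h : orbitTime a t₁ t₂ = ((-Real.log t₁ : ℝ) : ℂ) +
      Complex.I * (((-a.re * Real.log t₁ + Real.log t₂) / a.im : ℝ) : ℂ) := by
    rw [orbitTime]
    push_cast
    ring
  rw [h]
  simp only [Complex.add_im, Complex.ofReal_im, Complex.I_mul_im, Complex.ofReal_re, zero_add]
  ring

theorem mul_orbitTime_im {a : ℂ} (ha : a.im ≠ 0) (t₁ t₂ : ℝ) : (a * orbitTime a t₁ t₂).im =
    -((a.re ^ 2 + a.im ^ 2) / a.im) * Real.log t₁ + a.re / a.im * Real.log t₂ := by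
  have h : orbitTime a t₁ t₂ = ((-Real.log t₁ : ℝ) : ℂ) +
      Complex.I * (((-a.re * Real.log t₁ + Real.log t₂) / a.im : ℝ) : ℂ) := by
    rw [orbitTime]
    push_cast
    ring
  rw [Complex.mul_im, orbitTime_im, h]
  simp only [Complex.add_re, Complex.ofReal_re, Complex.I_mul_re, Complex.ofReal_im, neg_zero,
    add_zero]
  field_simp
  ring

/-- The radial coordinates of a point of the product of two cones. -/
def radii (x : Cone S₁ × Cone S₂) : ℝ × ℝ := ((x.1.2 : ℝ), (x.2.2 : ℝ))

theorem hasMFDerivAt_radii (m : S₁ × S₂) :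
    HasMFDerivAt ((coneModel E₁).prod (coneModel E₂)) 𝓘(ℝ, ℝ × ℝ) radii (slice m)
      ((ContinuousLinearMap.snd ℝ E₁ ℝ).prodMap (ContinuousLinearMap.snd ℝ E₂ ℝ) :
        (E₁ × ℝ) × (E₂ × ℝ) →L[ℝ] ℝ × ℝ) := by
  have h0 : HasMFDerivAt 𝓘(ℝ, ℝ) 𝓘(ℝ, ℝ) (fun t : PosReal => (t : ℝ)) posOne (.id ℝ ℝ : ℝ →L[ℝ] ℝ) := by
    have h := (posReal_mdifferentiableAt_val posOne).hasMFDerivAt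
    have h' := posReal_mfderiv_val posOne
    exact h' ▸ h
  have h1 := h0.comp (slice m) (f := fun x : Cone S₁ × Cone S₂ => x.1.2)
    ((hasMFDerivAt_snd (I := 𝓘(ℝ, E₁)) (I' := 𝓘(ℝ, ℝ)) (slice m).1).comp (slice m)
      (hasMFDerivAt_fst (I := coneModel E₁) (I' := coneModel E₂) (slice m)))
  have h2 := h0.comp (slice m) (f := fun x : Cone S₁ × Cone S₂ => x.2.2)
    ((hasMFDerivAt_snd (I := 𝓘(ℝ, E₂)) (I' := 𝓘(ℝ, ℝ)) (slice m).2).comp (slice m)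
      (hasMFDerivAt_snd (I := coneModel E₁) (I' := coneModel E₂) (slice m)))
  exact ⟨h1.1.prodMk h2.1, h1.2.prodMk h2.2⟩

theorem hasFDerivAt_log_add (b c : ℝ) : HasFDerivAt
    (fun t : ℝ × ℝ => b * Real.log t.1 + c * Real.log t.2)
    (b • ContinuousLinearMap.fst ℝ ℝ ℝ + c • ContinuousLinearMap.snd ℝ ℝ ℝ) (1, 1) := by
  have hf : HasFDerivAt (fun t : ℝ × ℝ => t.1) (.fst ℝ ℝ ℝ) (1, 1) := hasFDerivAt_fst
  have hs : HasFDerivAt (fun t : ℝ × ℝ => t.2) (.snd ℝ ℝ ℝ) (1, 1) := hasFDerivAt_snd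
  have h1 := (Real.hasDerivAt_log one_ne_zero).comp_hasFDerivAt_of_eq (f := fun t : ℝ × ℝ => t.1)
    (1, 1) hf rfl
  have h2 := (Real.hasDerivAt_log one_ne_zero).comp_hasFDerivAt_of_eq (f := fun t : ℝ × ℝ => t.2)
    (1, 1) hs rfl
  have h3 := (h1.const_mul b).add (h2.const_mul c)
  simp only [inv_one, one_smul] at h3
  exact h3

variable (𝒮₁ : SasakianStructure E₁ S₁) (𝒮₂ : SasakianStructure E₂ S₂)

theorem hasMFDerivAt_flow_reeb {E : Type*} [NormedAddCommGroup E] [NormedSpace ℝ E]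
    [FiniteDimensional ℝ E] {S : Type*} [TopologicalSpace S] [ChartedSpace E S]
    [IsManifold 𝓘(ℝ, E) ∞ S] [T2Space S] [CompactSpace S] (𝒮 : SasakianStructure E S) (b c : ℝ)
    {f : Cone S₁ × Cone S₂ → S} {m : S₁ × S₂} {L : (E₁ × ℝ) × (E₂ × ℝ) →L[ℝ] E}
    (hf : HasMFDerivAt ((coneModel E₁).prod (coneModel E₂)) 𝓘(ℝ, E) f (slice m) L) :
    HasMFDerivAt ((coneModel E₁).prod (coneModel E₂)) 𝓘(ℝ, E) (fun x => flow 𝒮.reeb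
      (b * Real.log x.1.2 + c * Real.log x.2.2) (f x)) (slice m)
      (L + (b • (.snd ℝ E₁ ℝ ∘L .fst ℝ (E₁ × ℝ) (E₂ × ℝ)) +
        c • (.snd ℝ E₂ ℝ ∘L .snd ℝ (E₁ × ℝ) (E₂ × ℝ))).smulRight (fieldAt 𝒮.reeb (f (slice m))) :
        (E₁ × ℝ) × (E₂ × ℝ) →L[ℝ] E) := by
  have : CompleteSpace E := FiniteDimensional.complete ℝ E
  have h1 (p : S) (s : ℝ) (hs : s = 0) : HasMFDerivAt (𝓘(ℝ, E).prod 𝓘(ℝ, ℝ)) 𝓘(ℝ, E)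
      (fun z : S × ℝ => flow 𝒮.reeb z.2 z.1) (p, s)
      (.fst ℝ E ℝ + (ContinuousLinearMap.snd ℝ E ℝ).smulRight (fieldAt 𝒮.reeb p) :
        E × ℝ →L[ℝ] E) := by
    subst hs
    exact hasMFDerivAt_flow 𝒮.isSmoothVec_reeb p
  have h2 := HasMFDerivAt.comp (slice m) (hasFDerivAt_log_add b c).hasMFDerivAt
    (hasMFDerivAt_radii (E₁ := E₁) (E₂ := E₂) m)
  have h3 := HasMFDerivAt.comp (slice m) (h1 (f (slice m))
    (b * Real.log ((1 : ℝ)) + c * Real.log ((1 : ℝ))) (by simp)) (hf.prodMk h2)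
  exact h3

/-- The derivative of the projection to the quotient, at a point of the slice. -/
def quotProjD (a : ℂ) (m : S₁ × S₂) : (E₁ × ℝ) × (E₂ × ℝ) →L[ℝ] E₁ × E₂ :=
  (.fst ℝ E₁ ℝ ∘L .fst ℝ (E₁ × ℝ) (E₂ × ℝ) +
      (-(a.re / a.im) • (.snd ℝ E₁ ℝ ∘L .fst ℝ (E₁ × ℝ) (E₂ × ℝ)) +
        a.im⁻¹ • (.snd ℝ E₂ ℝ ∘L .snd ℝ (E₁ × ℝ) (E₂ × ℝ))).smulRight (fieldAt 𝒮₁.reeb m.1)).prod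
    (.fst ℝ E₂ ℝ ∘L .snd ℝ (E₁ × ℝ) (E₂ × ℝ) +
      (-((a.re ^ 2 + a.im ^ 2) / a.im) • (.snd ℝ E₁ ℝ ∘L .fst ℝ (E₁ × ℝ) (E₂ × ℝ)) +
        (a.re / a.im) • (.snd ℝ E₂ ℝ ∘L .snd ℝ (E₁ × ℝ) (E₂ × ℝ))).smulRight
          (fieldAt 𝒮₂.reeb m.2))

theorem hasMFDerivAt_quotProj {a : ℂ} (ha : a.im ≠ 0) (m : S₁ × S₂) :
    HasMFDerivAt ((coneModel E₁).prod (coneModel E₂)) (prodModel E₁ E₂) (quotProj 𝒮₁ 𝒮₂ a) (slice m)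
      (quotProjD 𝒮₁ 𝒮₂ a m : (E₁ × ℝ) × (E₂ × ℝ) →L[ℝ] E₁ × E₂) := by
  have h1 := hasMFDerivAt_flow_reeb 𝒮₁ (-(a.re / a.im)) a.im⁻¹ (m := m)
    (f := fun x : Cone S₁ × Cone S₂ => x.1.1)
    (HasMFDerivAt.comp (slice m) (hasMFDerivAt_fst (I := 𝓘(ℝ, E₁)) (I' := 𝓘(ℝ, ℝ)) (slice m).1)
      (hasMFDerivAt_fst (I := coneModel E₁) (I' := coneModel E₂) (slice m)))
  have h2 := hasMFDerivAt_flow_reeb 𝒮₂ (-((a.re ^ 2 + a.im ^ 2) / a.im)) (a.re / a.im) (m := m)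
    (f := fun x : Cone S₁ × Cone S₂ => x.2.1)
    (HasMFDerivAt.comp (slice m) (hasMFDerivAt_fst (I := 𝓘(ℝ, E₂)) (I' := 𝓘(ℝ, ℝ)) (slice m).2)
      (hasMFDerivAt_snd (I := coneModel E₁) (I' := coneModel E₂) (slice m)))
  have h3 : quotProj 𝒮₁ 𝒮₂ a = fun x => (flow 𝒮₁.reeb (-(a.re / a.im) * Real.log x.1.2 +
      a.im⁻¹ * Real.log x.2.2) x.1.1, flow 𝒮₂.reeb (-((a.re ^ 2 + a.im ^ 2) / a.im) *
      Real.log x.1.2 + a.re / a.im * Real.log x.2.2) x.2.1) := by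
    funext x
    rw [quotProj, orbitTime_im, mul_orbitTime_im ha]
  rw [h3]
  exact h1.prodMk h2

/-- The complex structure of the quotient: it is the transverse complex structure of the two factors
together with a complex structure on the span of the Reeb fields. -/
theorem endAt_quotJ {a : ℂ} (ha : a.im ≠ 0) (m : S₁ × S₂) (v : E₁ × E₂) :
    endAt (quotJ 𝒮₁ 𝒮₂ a) m v =
      (endAt 𝒮₁.phi m.1 v.1 + ((a.re * covAt 𝒮₁.contact m.1 v.1 - covAt 𝒮₂.contact m.2 v.2) / a.im) •
          fieldAt 𝒮₁.reeb m.1,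
        endAt 𝒮₂.phi m.2 v.2 + (((a.re ^ 2 + a.im ^ 2) * covAt 𝒮₁.contact m.1 v.1 -
          a.re * covAt 𝒮₂.contact m.2 v.2) / a.im) • fieldAt 𝒮₂.reeb m.2) := by
  have h1 : (mfderiv ((coneModel E₁).prod (coneModel E₂)) (prodModel E₁ E₂) (quotProj 𝒮₁ 𝒮₂ a)
      (slice m) : (E₁ × ℝ) × (E₂ × ℝ) →L[ℝ] E₁ × E₂) = quotProjD 𝒮₁ 𝒮₂ a m :=
    (hasMFDerivAt_quotProj 𝒮₁ 𝒮₂ ha m).mfderiv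
  have h2 : (mfderiv (prodModel E₁ E₂) ((coneModel E₁).prod (coneModel E₂)) slice m :
      E₁ × E₂ →L[ℝ] (E₁ × ℝ) × (E₂ × ℝ)) = (ContinuousLinearMap.inl ℝ E₁ ℝ).prodMap
        (ContinuousLinearMap.inl ℝ E₂ ℝ) := (hasMFDerivAt_slice m).mfderiv
  have h3 : endAt (quotJ 𝒮₁ 𝒮₂ a) m v = (mfderiv ((coneModel E₁).prod (coneModel E₂))
      (prodModel E₁ E₂) (quotProj 𝒮₁ 𝒮₂ a) (slice m) : (E₁ × ℝ) × (E₂ × ℝ) →L[ℝ] E₁ × E₂)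
      ((endAt 𝒮₁.J (m.1, posOne)).prodMap (endAt 𝒮₂.J (m.2, posOne))
        ((mfderiv (prodModel E₁ E₂) ((coneModel E₁).prod (coneModel E₂)) slice m :
          E₁ × E₂ →L[ℝ] (E₁ × ℝ) × (E₂ × ℝ)) v)) := rfl
  rw [h3, h1, h2]
  have h4 := 𝒮₁.endAt_J_one m.1 v.1 0
  have h5 := 𝒮₂.endAt_J_one m.2 v.2 0
  simp only [zero_smul, add_zero] at h4 h5
  change quotProjD 𝒮₁ 𝒮₂ a m
    (endAt 𝒮₁.J (m.1, posOne) (v.1, 0), endAt 𝒮₂.J (m.2, posOne) (v.2, 0)) = _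
  rw [h4, h5]
  refine Prod.ext ?_ ?_
  · simp only [quotProjD, ContinuousLinearMap.prod_apply, add_apply, smul_apply,
      ContinuousLinearMap.comp_apply, ContinuousLinearMap.smulRight_apply,
      ContinuousLinearMap.coe_fst', ContinuousLinearMap.coe_snd', smul_eq_mul]
    congr 2
    ring
  · simp only [quotProjD, ContinuousLinearMap.prod_apply, add_apply, smul_apply,
      ContinuousLinearMap.comp_apply, ContinuousLinearMap.smulRight_apply,
      ContinuousLinearMap.coe_fst', ContinuousLinearMap.coe_snd', smul_eq_mul]
    congr 2
    ring

end QuotientStructure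

/-! ### Types of forms in terms of the operators -/

section Types

open MixAlt

section General

variable {E : Type*} [NormedAddCommGroup E] [NormedSpace ℝ E]
  {H : Type*} [TopologicalSpace H] {I : ModelWithCorners ℝ E H}
  {M : Type*} [TopologicalSpace M] [ChartedSpace H M]

theorem MixAlt.ins_id_apply (b : MixAlt E) (k : ℕ) : ins (.id ℝ E) b k = (k : ℂ) • b k := by
  ext v
  rw [ins_apply]
  simp

theorem hasBideg_iff {J : E →L[ℝ] E} {p q : ℤ} {b : MixAlt E} : HasBideg J p q b ↔
    ins (.id ℝ E) b = ((p : ℂ) + q) • b ∧ ins J b = (Complex.I * (p - q)) • b := by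
  refine and_congr_left fun _ => ⟨fun h => funext fun k => ?_, fun h k hk => ?_⟩
  · rw [ins_id_apply, Pi.smul_apply]
    by_cases hk : (k : ℤ) = p + q
    · congr 1
      exact_mod_cast hk
    · rw [h k hk, csmul_zero, csmul_zero]
  · have h1 := congrFun h k
    rw [ins_id_apply, Pi.smul_apply] at h1
    ext v
    have h2 : (k : ℂ) * b k v = ((p : ℂ) + q) * b k v := congrArg (fun f => f v) h1
    refine (mul_eq_mul_right_iff.1 h2).resolve_left fun h3 => hk ?_
    exact_mod_cast h3

/-- The action of `ℂˣ` in `IsType` can be replaced by its derivative at one. -/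
theorem isType_iff_hasBideg {J : EndField I M} (hJ : ∀ x, endAt J x ∘L endAt J x = -.id ℝ E)
    {p q : ℤ} {β : ExtForm I M ℂ} :
    IsType J p q β ↔ ∀ x, HasBideg (endAt J x) p q (formAt β x) := by
  constructor
  · intro h x
    by_cases hpq : p < 0 ∨ q < 0
    · have h0 := h.eq_zero_of_neg hpq
      subst h0
      refine ⟨fun _ _ => rfl, ?_⟩
      rw [formAt_zero, ins_zero]
      exact funext fun k => (csmul_zero _ k).symm
    · push Not at hpq
      obtain ⟨m, rfl⟩ := Int.eq_ofNat_of_zero_le hpq.1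
      obtain ⟨n, rfl⟩ := Int.eq_ofNat_of_zero_le hpq.2
      refine ⟨fun k hk => congrFun (h.degree k hk) x, ?_⟩
      have h1 := ins_of_pull_cmulAt (J := endAt J x) (p := m) (q := n) (b := formAt β x)
        fun z => by
          have := h.weight z
          rw [zpow_natCast, zpow_natCast] at this
          exact funext fun k => congrFun (congrFun this k) x
      rw [h1]
      simp
  · intro h
    refine ⟨fun hpq => ext_formAt fun x => (h x).eq_zero (hJ x) hpq,
      fun k hk => funext fun x => (h x).1 k hk, fun z => ?_⟩
    exact ext_formAt fun x => (h x).pull_cmulAt (hJ x) z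

theorem isType_iff {J : EndField I M} (hJ : ∀ x, endAt J x ∘L endAt J x = -.id ℝ E)
    {p q : ℤ} {β : ExtForm I M ℂ} : IsType J p q β ↔
      insForm (idEnd I M) β = ((p : ℂ) + q) • β ∧ insForm J β = (Complex.I * (p - q)) • β := by
  rw [isType_iff_hasBideg hJ]
  constructor
  · intro h
    exact ⟨ext_formAt fun x => (hasBideg_iff.1 (h x)).1, ext_formAt fun x => (hasBideg_iff.1 (h x)).2⟩
  · rintro ⟨h1, h2⟩ x
    exact hasBideg_iff.2 ⟨congrArg (formAt · x) h1, congrArg (formAt · x) h2⟩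

theorem typeProj_add (J : EndField I M) (p q : ℤ) (α β : ExtForm I M ℂ) :
    typeProj J p q (α + β) = typeProj J p q α + typeProj J p q β := by
  funext k x
  have h (z : ℂ) : cpull J z (α + β) k x = cpull J z α k x + cpull J z β k x := rfl
  rw [Pi.add_apply, Pi.add_apply, typeProj, typeProj, typeProj]
  split_ifs
  · simp only [h, smul_add, Finset.sum_add_distrib]
  · exact (add_zero _).symm

theorem MixAlt.one_smul (r : ℝ) (θ : E →L[ℝ] ℝ) : one (r • θ) = (r : ℂ) • one θ := by
  refine funext fun k => ?_
  match k with
  | 0 => ext v; simp [one]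
  | 1 => ext v; simp [one]
  | k + 2 => ext v; simp [one]

theorem MixAlt.one_apply_of_ne (θ : E →L[ℝ] ℝ) {k : ℕ} (hk : k ≠ 1) : one θ k = 0 := by
  match k with
  | 0 => rfl
  | 1 => exact absurd rfl hk
  | k + 2 => rfl

theorem MixAlt.ins_add_smulRight (A B : E →L[ℝ] E) (θ θ' : E →L[ℝ] ℝ) (X Y : E) (r s r' s' : ℝ)
    (b : MixAlt E) : ins (A + B + θ.smulRight (r • X + s • Y) + θ'.smulRight (r' • X + s' • Y)) b =
      ins A b + ins B b + MixAlt.wedge (one θ) ((r : ℂ) • ctr X b + (s : ℂ) • ctr Y b) +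
        MixAlt.wedge (one θ') ((r' : ℂ) • ctr X b + (s' : ℂ) • ctr Y b) := by
  rw [ins_add_left, ins_add_left, ins_add_left, ins_smulRight, ins_smulRight, ctr_add_left,
    ctr_add_left, ctr_smul_left, ctr_smul_left, ctr_smul_left, ctr_smul_left]

end General

/-- The difference of the two counting operators is the insertion of the complex structure of the
quotient. -/
theorem SasakiOps.A_sub_B {V : Type*} [AddCommGroup V] [Module ℂ V] (O : SasakiOps V) {a : ℂ}
    (ha : a.im ≠ 0) (x : V) : Complex.I • (O.A a x - O.B a x) = O.N x +
      O.e₁ (((a.re / a.im : ℝ) : ℂ) • O.i₁ x + (((a.re ^ 2 + a.im ^ 2) / a.im : ℝ) : ℂ) • O.i₂ x) +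
      O.e₂ (((-1 / a.im : ℝ) : ℂ) • O.i₁ x + ((-a.re / a.im : ℝ) : ℂ) • O.i₂ x) := by
  have hs : (a.im : ℂ) ≠ 0 := by exact_mod_cast ha
  have h1 := SasakiOps.one_add_ne_zero ha
  have hτ : O.τ a (O.ι' a x) = (starRingEnd ℂ a - a)⁻¹ •
      (starRingEnd ℂ a • O.e₁ (O.i₁ x + a • O.i₂ x) - O.e₂ (O.i₁ x + a • O.i₂ x)) := by
    rw [SasakiOps.τ_apply, SasakiOps.ι'_apply, map_smul, map_smul]
    have : (1 + a) / (starRingEnd ℂ a - a) = (starRingEnd ℂ a - a)⁻¹ * (1 + a) := by ring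
    rw [this, mul_smul, smul_sub (1 + a), smul_comm (1 + a) (starRingEnd ℂ a), smul_smul (1 + a),
      smul_smul (1 + a), mul_inv_cancel₀ h1, _root_.one_smul, _root_.one_smul]
  have hc : starRingEnd ℂ a = a.re - a.im * Complex.I := by
    apply Complex.ext <;> simp
  have hd : a - starRingEnd ℂ a = 2 * a.im * Complex.I := by
    apply Complex.ext <;> simp; ring
  have hi1 : (a - starRingEnd ℂ a)⁻¹ = -Complex.I / (2 * a.im) := by
    rw [hd, mul_inv, Complex.inv_I]; ring
  have hi2 : (starRingEnd ℂ a - a)⁻¹ = Complex.I / (2 * a.im) := by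
    rw [← neg_sub, inv_neg, hi1]; ring
  rw [SasakiOps.A_apply, SasakiOps.B_apply, hτ, SasakiOps.θ_apply, SasakiOps.ι_apply, hi1, hi2]
  simp only [map_add, map_smul, hc]
  have har : a = a.re + a.im * Complex.I := (Complex.re_add_im a).symm
  generalize a.re = r at *
  generalize a.im = s at *
  subst har
  push_cast
  match_scalars <;> field_simp <;> ring_nf <;> simp [Complex.I_sq]

section Quotient

variable {E₁ : Type*} [NormedAddCommGroup E₁] [NormedSpace ℝ E₁] [FiniteDimensional ℝ E₁]
  {S₁ : Type*} [TopologicalSpace S₁] [ChartedSpace E₁ S₁] [IsManifold 𝓘(ℝ, E₁) ∞ S₁]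
  [CompactSpace S₁] [T2Space S₁]
  {E₂ : Type*} [NormedAddCommGroup E₂] [NormedSpace ℝ E₂] [FiniteDimensional ℝ E₂]
  {S₂ : Type*} [TopologicalSpace S₂] [ChartedSpace E₂ S₂] [IsManifold 𝓘(ℝ, E₂) ∞ S₂]
  [CompactSpace S₂] [T2Space S₂]
  (𝒮₁ : SasakianStructure E₁ S₁) (𝒮₂ : SasakianStructure E₂ S₂) {a : ℂ}

theorem endAt_quotJ_comp_self (ha : a.im ≠ 0) (m : S₁ × S₂) :
    endAt (quotJ 𝒮₁ 𝒮₂ a) m ∘L endAt (quotJ 𝒮₁ 𝒮₂ a) m = -.id ℝ (E₁ × E₂) := by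
  refine ContinuousLinearMap.ext fun v => ?_
  obtain ⟨-, h2, h3, h4⟩ := 𝒮₁.algebra m.1
  obtain ⟨-, k2, k3, k4⟩ := 𝒮₂.algebra m.2
  have h3' (w : E₁) : covAt 𝒮₁.contact m.1 (endAt 𝒮₁.phi m.1 w) = 0 :=
    congrArg (fun L : E₁ →L[ℝ] ℝ => L w) h3
  have k3' (w : E₂) : covAt 𝒮₂.contact m.2 (endAt 𝒮₂.phi m.2 w) = 0 :=
    congrArg (fun L : E₂ →L[ℝ] ℝ => L w) k3
  rw [ContinuousLinearMap.comp_apply, endAt_quotJ 𝒮₁ 𝒮₂ ha, endAt_quotJ 𝒮₁ 𝒮₂ ha]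
  simp only [map_add, map_smul, h2, k2, h3', k3', h4, k4, smul_zero, add_zero, zero_add,
    smul_eq_mul, mul_one, 𝒮₁.phi_phi, 𝒮₂.phi_phi]
  refine Prod.ext ?_ ?_
  · change _ = -v.1
    match_scalars <;> field_simp
    ring
  · change _ = -v.2
    match_scalars <;> field_simp
    ring

theorem fieldAt_reebLeft (m : S₁ × S₂) :
    fieldAt (reebLeft 𝒮₁ : VField (prodModel E₁ E₂) (S₁ × S₂)) m = (fieldAt 𝒮₁.reeb m.1, 0) := rfl

theorem fieldAt_reebRight (m : S₁ × S₂) :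
    fieldAt (reebRight 𝒮₂ : VField (prodModel E₁ E₂) (S₁ × S₂)) m = (0, fieldAt 𝒮₂.reeb m.2) := rfl

theorem endAt_quotJ_eq (ha : a.im ≠ 0) (m : S₁ × S₂) : endAt (quotJ 𝒮₁ 𝒮₂ a) m =
    endAt (endProd 𝒮₁.phi (0 : EndField 𝓘(ℝ, E₂) S₂)) m +
      endAt (endProd (0 : EndField 𝓘(ℝ, E₁) S₁) 𝒮₂.phi) m +
      (covAt (covProd 𝒮₁.contact (0 : CovField 𝓘(ℝ, E₂) S₂)) m).smulRight
        ((a.re / a.im) • fieldAt (reebLeft 𝒮₁) m +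
          ((a.re ^ 2 + a.im ^ 2) / a.im) • fieldAt (reebRight 𝒮₂) m) +
      (covAt (covProd (0 : CovField 𝓘(ℝ, E₁) S₁) 𝒮₂.contact) m).smulRight
        ((-1 / a.im) • fieldAt (reebLeft 𝒮₁) m + (-a.re / a.im) • fieldAt (reebRight 𝒮₂) m) := by
  refine ContinuousLinearMap.ext fun v => ?_
  rw [endAt_quotJ 𝒮₁ 𝒮₂ ha]
  refine Prod.ext ?_ ?_
  · simp [endAt_endProd, covAt_covProd, fieldAt_reebLeft, fieldAt_reebRight, endAt_zero, covAt_zero]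
    module
  · simp [endAt_endProd, covAt_covProd, fieldAt_reebLeft, fieldAt_reebRight, endAt_zero, covAt_zero]
    module

/-- The operators on the smooth forms of the product of two Sasakian manifolds. -/
abbrev sasakiOps : SasakiOps (smoothForms (prodModel E₁ E₂) (S₁ × S₂)) := (sasakiPair 𝒮₁ 𝒮₂).ops

section Coercions

variable (β : smoothForms (prodModel E₁ E₂) (S₁ × S₂))

theorem coe_d : ((sasakiOps 𝒮₁ 𝒮₂).d β : ExtForm (prodModel E₁ E₂) (S₁ × S₂) ℂ) = extD β := rfl

theorem coe_i₁ : ((sasakiOps 𝒮₁ 𝒮₂).i₁ β : ExtForm (prodModel E₁ E₂) (S₁ × S₂) ℂ) =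
    contract (reebLeft 𝒮₁) β := rfl

theorem coe_i₂ : ((sasakiOps 𝒮₁ 𝒮₂).i₂ β : ExtForm (prodModel E₁ E₂) (S₁ × S₂) ℂ) =
    contract (reebRight 𝒮₂) β := rfl

theorem coe_e₁ : ((sasakiOps 𝒮₁ 𝒮₂).e₁ β : ExtForm (prodModel E₁ E₂) (S₁ × S₂) ℂ) =
    wedge (covForm (covProd 𝒮₁.contact 0)) β := rfl

theorem coe_e₂ : ((sasakiOps 𝒮₁ 𝒮₂).e₂ β : ExtForm (prodModel E₁ E₂) (S₁ × S₂) ℂ) =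
    wedge (covForm (covProd 0 𝒮₂.contact)) β := rfl

theorem coe_N : ((sasakiOps 𝒮₁ 𝒮₂).N β : ExtForm (prodModel E₁ E₂) (S₁ × S₂) ℂ) =
    insForm (endProd 𝒮₁.phi 0) β + insForm (endProd 0 𝒮₂.phi) β := rfl

theorem coe_D : ((sasakiOps 𝒮₁ 𝒮₂).D β : ExtForm (prodModel E₁ E₂) (S₁ × S₂) ℂ) =
    insForm (idEnd _ _) β := rfl

end Coercions

theorem insForm_quotJ (ha : a.im ≠ 0) (β : smoothForms (prodModel E₁ E₂) (S₁ × S₂)) :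
    insForm (quotJ 𝒮₁ 𝒮₂ a) β = ↑(Complex.I •
      ((sasakiOps 𝒮₁ 𝒮₂).A a β - (sasakiOps 𝒮₁ 𝒮₂).B a β)) := by
  have h (z w : ℂ) : (↑(z • (sasakiOps 𝒮₁ 𝒮₂).i₁ β + w • (sasakiOps 𝒮₁ 𝒮₂).i₂ β) :
      ExtForm (prodModel E₁ E₂) (S₁ × S₂) ℂ) =
        z • contract (reebLeft 𝒮₁) ↑β + w • contract (reebRight 𝒮₂) ↑β := by
    rw [Submodule.coe_add, Submodule.coe_smul, Submodule.coe_smul, coe_i₁, coe_i₂]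
  rw [SasakiOps.A_sub_B _ ha, Submodule.coe_add, Submodule.coe_add, coe_N, coe_e₁, coe_e₂, h, h]
  refine ext_formAt fun m => ?_
  rw [formAt_insForm, endAt_quotJ_eq 𝒮₁ 𝒮₂ ha]
  refine (ins_add_smulRight _ _ _ _ _ _ _ _ _ _ _).trans ?_
  rw [← formAt_covForm, ← formAt_covForm]
  rfl

/-- Being of type `(p, q)` is an eigenvalue condition for the two counting operators. -/
theorem isType_quotJ_iff (ha : a.im ≠ 0) {p q : ℤ}
    (β : smoothForms (prodModel E₁ E₂) (S₁ × S₂)) : IsType (quotJ 𝒮₁ 𝒮₂ a) p q β ↔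
      (sasakiOps 𝒮₁ 𝒮₂).A a β = (p : ℂ) • β ∧ (sasakiOps 𝒮₁ 𝒮₂).B a β = (q : ℂ) • β := by
  have h1 : insForm (idEnd _ _) (β : ExtForm (prodModel E₁ E₂) (S₁ × S₂) ℂ) =
      ↑((sasakiOps 𝒮₁ 𝒮₂).A a β + (sasakiOps 𝒮₁ 𝒮₂).B a β) := by
    rw [SasakiOps.A_add_B, coe_D]
  rw [isType_iff (endAt_quotJ_comp_self 𝒮₁ 𝒮₂ ha), insForm_quotJ 𝒮₁ 𝒮₂ ha, h1,
    ← Submodule.coe_smul, ← Submodule.coe_smul, Subtype.coe_inj, Subtype.coe_inj]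
  constructor
  · rintro ⟨h2, h3⟩
    rw [mul_smul] at h3
    have h4 := smul_right_injective _ Complex.I_ne_zero h3
    constructor
    · linear_combination (norm := module) (1 / 2 : ℂ) • h2 + (1 / 2 : ℂ) • h4
    · linear_combination (norm := module) (1 / 2 : ℂ) • h2 - (1 / 2 : ℂ) • h4
  · rintro ⟨h2, h3⟩
    rw [h2, h3]
    constructor <;> module

theorem isInvariant_iff (β : smoothForms (prodModel E₁ E₂) (S₁ × S₂)) :
    IsInvariant 𝒮₁ 𝒮₂ β ↔ β ∈ (sasakiOps 𝒮₁ 𝒮₂).inv := by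
  rw [SasakiOps.mem_inv, IsInvariant]
  refine and_congr ?_ ?_
  · rw [Subtype.ext_iff, Submodule.coe_add, coe_d, coe_i₁, coe_i₁, coe_d, lieD, Submodule.coe_zero]
  · rw [Subtype.ext_iff, Submodule.coe_add, coe_d, coe_i₂, coe_i₂, coe_d, lieD, Submodule.coe_zero]

theorem isBasic_iff (β : smoothForms (prodModel E₁ E₂) (S₁ × S₂)) :
    IsBasic 𝒮₁ 𝒮₂ β ↔ β ∈ (sasakiOps 𝒮₁ 𝒮₂).bas := by
  rw [SasakiOps.mem_bas_iff]
  constructor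
  · intro h
    have h1 := h (reebLeft 𝒮₁) (isSmoothField_iff.2 (sasakiPair 𝒮₁ 𝒮₂).smooth_X₁)
      fun m => Submodule.subset_span (Or.inl rfl)
    have h2 := h (reebRight 𝒮₂) (isSmoothField_iff.2 (sasakiPair 𝒮₁ 𝒮₂).smooth_X₂)
      fun m => Submodule.subset_span (Or.inr rfl)
    exact ⟨(isInvariant_iff 𝒮₁ 𝒮₂ β).1 ⟨h1.2, h2.2⟩, Subtype.ext h1.1, Subtype.ext h2.1⟩
  · intro h X hX hm
    obtain ⟨⟨h1, h2⟩, h3, h4⟩ := (SasakiOps.mem_bas _).1 ((SasakiOps.mem_bas_iff _).2 h)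
    have hc (γ : smoothForms (prodModel E₁ E₂) (S₁ × S₂)) (hγ₁ : (sasakiOps 𝒮₁ 𝒮₂).i₁ γ = 0)
        (hγ₂ : (sasakiOps 𝒮₁ 𝒮₂).i₂ γ = 0) :
        contract X (γ : ExtForm (prodModel E₁ E₂) (S₁ × S₂) ℂ) = 0 := by
      refine ext_formAt fun m => ?_
      obtain ⟨c, d, hcd⟩ := Submodule.mem_span_pair.1 (hm m)
      have e1 : ctr (fieldAt (reebLeft 𝒮₁) m)
          (formAt (γ : ExtForm (prodModel E₁ E₂) (S₁ × S₂) ℂ) m) = 0 := by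
        rw [← formAt_contract, ← coe_i₁ 𝒮₁ 𝒮₂, hγ₁, Submodule.coe_zero, formAt_zero]
      have e2 : ctr (fieldAt (reebRight 𝒮₂) m)
          (formAt (γ : ExtForm (prodModel E₁ E₂) (S₁ × S₂) ℂ) m) = 0 := by
        rw [← formAt_contract, ← coe_i₂ 𝒮₁ 𝒮₂, hγ₂, Submodule.coe_zero, formAt_zero]
      have e3 : fieldAt X m = c • fieldAt (reebLeft 𝒮₁) m + d • fieldAt (reebRight 𝒮₂) m := hcd.symm
      rw [formAt_contract, e3, ctr_add_left, ctr_smul_left, ctr_smul_left, e1, e2]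
      refine funext fun k => ?_
      rw [Pi.add_apply, Pi.smul_apply, Pi.smul_apply, Pi.zero_apply, csmul_zero, csmul_zero]
      exact add_zero _
    refine ⟨hc β h1 h2, ?_⟩
    have h5 : extD (0 : ExtForm (prodModel E₁ E₂) (S₁ × S₂) ℂ) = 0 := by
      rw [← Submodule.coe_zero (p := smoothForms (prodModel E₁ E₂) (S₁ × S₂)), ← coe_d 𝒮₁ 𝒮₂,
        LinearMap.map_zero]
    rw [lieD, hc β h1 h2, h5, zero_add]
    have h6 := hc _ h3 h4
    rwa [coe_d] at h6

theorem sumContact_eq : sumContact 𝒮₁ 𝒮₂ = covForm (covProd 𝒮₁.contact (0 : CovField 𝓘(ℝ, E₂) S₂)) +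
    covForm (covProd (0 : CovField 𝓘(ℝ, E₁) S₁) 𝒮₂.contact) := by
  refine ext_formAt fun m => ?_
  have h : covAt (covProd 𝒮₁.contact (0 : CovField 𝓘(ℝ, E₂) S₂)) m +
      covAt (covProd (0 : CovField 𝓘(ℝ, E₁) S₁) 𝒮₂.contact) m =
      (covAt 𝒮₁.contact m.1).coprod (covAt 𝒮₂.contact m.2) := by
    ext v <;> simp [covAt_covProd, covAt_zero]
  rw [formAt_add, formAt_covForm, formAt_covForm, ← one_add, h]
  refine funext fun k => ?_
  match k with
  | 0 => rfl
  | 1 => rfl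
  | k + 2 => rfl

/-- The action of the complex structure of the quotient on a combination of the contact forms. -/
theorem ins_quotJ_combination (ha : a.im ≠ 0) (z : ℂ) (m : S₁ × S₂) :
    ins (endAt (quotJ 𝒮₁ 𝒮₂ a) m) (z • one (covAt (covProd 𝒮₁.contact (0 : CovField 𝓘(ℝ, E₂) S₂)) m) -
        one (covAt (covProd (0 : CovField 𝓘(ℝ, E₁) S₁) 𝒮₂.contact) m)) =
      (((z * a.re - (a.re ^ 2 + a.im ^ 2)) / a.im : ℂ)) •
        one (covAt (covProd 𝒮₁.contact (0 : CovField 𝓘(ℝ, E₂) S₂)) m) -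
      (((z - a.re) / a.im : ℂ)) •
        one (covAt (covProd (0 : CovField 𝓘(ℝ, E₁) S₁) 𝒮₂.contact) m) := by
  have h1 : covAt (covProd 𝒮₁.contact (0 : CovField 𝓘(ℝ, E₂) S₂)) m ∘L
      endAt (quotJ 𝒮₁ 𝒮₂ a) m = (a.re / a.im) •
        covAt (covProd 𝒮₁.contact (0 : CovField 𝓘(ℝ, E₂) S₂)) m +
        (-1 / a.im) • covAt (covProd (0 : CovField 𝓘(ℝ, E₁) S₁) 𝒮₂.contact) m := by
    refine ContinuousLinearMap.ext fun v => ?_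
    obtain ⟨-, h2, h3, h4⟩ := 𝒮₁.algebra m.1
    have h3' (w : E₁) : covAt 𝒮₁.contact m.1 (endAt 𝒮₁.phi m.1 w) = 0 :=
      congrArg (fun L : E₁ →L[ℝ] ℝ => L w) h3
    rw [ContinuousLinearMap.comp_apply, endAt_quotJ 𝒮₁ 𝒮₂ ha]
    simp [covAt_covProd, covAt_zero, h3', h4]
    ring
  have h2 : covAt (covProd (0 : CovField 𝓘(ℝ, E₁) S₁) 𝒮₂.contact) m ∘L
      endAt (quotJ 𝒮₁ 𝒮₂ a) m = ((a.re ^ 2 + a.im ^ 2) / a.im) •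
        covAt (covProd 𝒮₁.contact (0 : CovField 𝓘(ℝ, E₂) S₂)) m +
        (-a.re / a.im) • covAt (covProd (0 : CovField 𝓘(ℝ, E₁) S₁) 𝒮₂.contact) m := by
    refine ContinuousLinearMap.ext fun v => ?_
    obtain ⟨-, h2, h3, h4⟩ := 𝒮₂.algebra m.2
    have h3' (w : E₂) : covAt 𝒮₂.contact m.2 (endAt 𝒮₂.phi m.2 w) = 0 :=
      congrArg (fun L : E₂ →L[ℝ] ℝ => L w) h3
    rw [ContinuousLinearMap.comp_apply, endAt_quotJ 𝒮₁ 𝒮₂ ha]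
    simp [covAt_covProd, covAt_zero, h3', h4]
    ring
  rw [ins_sub, ins_smul, ins_one, ins_one, h1, h2, one_add, one_add, MixAlt.one_smul,
    MixAlt.one_smul, MixAlt.one_smul, MixAlt.one_smul]
  push_cast
  module

/-- A combination of the contact forms on which the complex structure of the quotient acts by the
scalar of a given type. -/
theorem isType_combination (ha : a.im ≠ 0) {p q : ℤ} (hpq : p + q = 1) (u z : ℂ)
    (h1 : (z * a.re - (a.re ^ 2 + a.im ^ 2)) / a.im = Complex.I * (p - q) * z)
    (h2 : (z - a.re) / a.im = Complex.I * (p - q)) : IsType (quotJ 𝒮₁ 𝒮₂ a) p q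
      (u • (z • covForm (covProd 𝒮₁.contact (0 : CovField 𝓘(ℝ, E₂) S₂)) -
        covForm (covProd (0 : CovField 𝓘(ℝ, E₁) S₁) 𝒮₂.contact))) := by
  rw [isType_iff_hasBideg (endAt_quotJ_comp_self 𝒮₁ 𝒮₂ ha)]
  intro m
  rw [formAt_smul, formAt_sub, formAt_smul, formAt_covForm, formAt_covForm]
  refine ⟨fun k hk => ?_, ?_⟩
  · have hk' : k ≠ 1 := fun h => hk (by rw [h, hpq]; rfl)
    rw [Pi.smul_apply, Pi.sub_apply, Pi.smul_apply, one_apply_of_ne _ hk', one_apply_of_ne _ hk',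
      csmul_zero, sub_self, csmul_zero]
  · rw [ins_smul, ins_quotJ_combination 𝒮₁ 𝒮₂ ha, h1, h2]
    module

/-- The `(0, 1)`-part of `η₁ + η₂` is a multiple of the conjugate of `θ = a η₁ - η₂`. -/
theorem etaZeroOne_eq (ha : a.im ≠ 0) : etaZeroOne 𝒮₁ 𝒮₂ a =
    ((1 + a) / (starRingEnd ℂ a - a)) • (starRingEnd ℂ a •
      covForm (covProd 𝒮₁.contact (0 : CovField 𝓘(ℝ, E₂) S₂)) -
        covForm (covProd (0 : CovField 𝓘(ℝ, E₁) S₁) 𝒮₂.contact)) := by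
  have hs : (a.im : ℂ) ≠ 0 := by exact_mod_cast ha
  have hd := SasakiOps.conj_sub_ne_zero ha
  have hc : starRingEnd ℂ a = a.re - a.im * Complex.I := by
    apply Complex.ext <;> simp
  have har : a = a.re + a.im * Complex.I := (Complex.re_add_im a).symm
  have h1 := isType_combination 𝒮₁ 𝒮₂ ha (p := 0) (q := 1) rfl
    ((1 + a) / (starRingEnd ℂ a - a)) (starRingEnd ℂ a)
    (by rw [hc]; field_simp; push_cast; linear_combination (-(a.im : ℂ) ^ 2) * Complex.I_sq)
    (by rw [hc]; field_simp; push_cast; ring)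
  have h2 := isType_combination 𝒮₁ 𝒮₂ ha (p := 1) (q := 0) rfl
    (-(1 + starRingEnd ℂ a) / (starRingEnd ℂ a - a)) a
    (by
      have h : a * a.re - (a.re ^ 2 + a.im ^ 2) = a.im * (Complex.I * a) := by
        linear_combination (a.re - Complex.I * a.im) * har - (a.im : ℂ) ^ 2 * Complex.I_sq
      rw [h, mul_div_cancel_left₀ _ hs]
      simp)
    (by
      have h : a - a.re = a.im * Complex.I := by linear_combination har
      rw [h, mul_div_cancel_left₀ _ hs]
      simp)
  -- The form `η₁ + η₂` is a combination of `conj θ` and `θ`.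
  have h3 : sumContact 𝒮₁ 𝒮₂ = ((1 + a) / (starRingEnd ℂ a - a)) • (starRingEnd ℂ a •
      covForm (covProd 𝒮₁.contact (0 : CovField 𝓘(ℝ, E₂) S₂)) -
        covForm (covProd (0 : CovField 𝓘(ℝ, E₁) S₁) 𝒮₂.contact)) +
      (-(1 + starRingEnd ℂ a) / (starRingEnd ℂ a - a)) • (a •
      covForm (covProd 𝒮₁.contact (0 : CovField 𝓘(ℝ, E₂) S₂)) -
        covForm (covProd (0 : CovField 𝓘(ℝ, E₁) S₁) 𝒮₂.contact)) := by
    rw [sumContact_eq]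
    match_scalars <;> field_simp <;> ring
  rw [etaZeroOne, h3, typeProj_add, typeProj_of_isType h1, typeProj_of_isType h2]
  simp

theorem etaZeroOne_wedge (ha : a.im ≠ 0) (β : smoothForms (prodModel E₁ E₂) (S₁ × S₂)) :
    wedge (etaZeroOne 𝒮₁ 𝒮₂ a) β = ↑((sasakiOps 𝒮₁ 𝒮₂).τ a β) := by
  refine ext_formAt fun m => ?_
  rw [SasakiOps.τ_apply, Submodule.coe_smul, AddSubgroupClass.coe_sub, Submodule.coe_smul, coe_e₁,
    coe_e₂, formAt_wedge, etaZeroOne_eq 𝒮₁ 𝒮₂ ha, formAt_smul, formAt_sub, formAt_smul,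
    wedge_smul_left, wedge_sub_left, wedge_smul_left, formAt_smul, formAt_sub, formAt_smul,
    formAt_wedge, formAt_wedge]

/-- On invariant forms `∂̄` is `del`, because `d - del` has type `(p + 1, q)` there. -/
theorem dbar_quotJ (ha : a.im ≠ 0) {p q : ℤ} {β : smoothForms (prodModel E₁ E₂) (S₁ × S₂)}
    (hβ : β ∈ (sasakiOps 𝒮₁ 𝒮₂).invT a p q) :
    dbar (quotJ 𝒮₁ 𝒮₂ a) p q β = ↑((sasakiOps 𝒮₁ 𝒮₂).del a β) := by
  have h1 : extD (β : ExtForm (prodModel E₁ E₂) (S₁ × S₂) ℂ) =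
      ↑((sasakiOps 𝒮₁ 𝒮₂).d β - (sasakiOps 𝒮₁ 𝒮₂).del a β) +
        ↑((sasakiOps 𝒮₁ 𝒮₂).del a β) := by
    rw [← Submodule.coe_add, sub_add_cancel, coe_d]
  have h2 := (isType_quotJ_iff 𝒮₁ 𝒮₂ ha _).2 ((sasakiOps 𝒮₁ 𝒮₂).invT_d_sub_del ha hβ).2
  have h3 := (isType_quotJ_iff 𝒮₁ 𝒮₂ ha _).2 ((sasakiOps 𝒮₁ 𝒮₂).invT_del ha hβ).2
  rw [dbar, h1, typeProj_add, typeProj_of_isType h2, typeProj_of_isType h3]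
  simp

theorem lefschetz_coe (β : smoothForms (prodModel E₁ E₂) (S₁ × S₂)) :
    lefschetz 𝒮₁ 𝒮₂ β = ↑((sasakiOps 𝒮₁ 𝒮₂).lef β) := by
  refine ext_formAt fun m => ?_
  have hη₁ : IsSmoothCov (covProd 𝒮₁.contact (0 : CovField 𝓘(ℝ, E₂) S₂)) :=
    (sasakiPair 𝒮₁ 𝒮₂).smooth_η₁
  have hη₂ : IsSmoothCov (covProd (0 : CovField 𝓘(ℝ, E₁) S₁) 𝒮₂.contact) :=
    (sasakiPair 𝒮₁ 𝒮₂).smooth_η₂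
  have h1 := extD_covForm_wedge hη₁ β.2 m
  have h2 := extD_covForm_wedge hη₂ β.2 m
  rw [← formAt_extD_covForm hη₁] at h1
  rw [← formAt_extD_covForm hη₂] at h2
  rw [lefschetz, omegaZero, sumContact_eq, extD_add (isSmooth_covForm hη₁) (isSmooth_covForm hη₂),
    formAt_wedge, formAt_add, wedge_add_left]
  refine (congrArg₂ (· + ·) h1 h2).symm.trans ?_
  rw [SasakiOps.lef_apply, SasakiOps.w₁_apply, SasakiOps.w₂_apply, Submodule.coe_add,
    Submodule.coe_add, Submodule.coe_add, formAt_add, formAt_add, formAt_add, coe_d, coe_d, coe_e₁,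
    coe_e₂, coe_e₁, coe_e₂, coe_d]

theorem mem_invForms {p q : ℤ} (ha : a.im ≠ 0) {β : ExtForm (prodModel E₁ E₂) (S₁ × S₂) ℂ} :
    β ∈ invForms 𝒮₁ 𝒮₂ a p q ↔ ∃ b ∈ (sasakiOps 𝒮₁ 𝒮₂).invT a p q, ↑b = β := by
  constructor
  · rintro ⟨⟨h1, h2⟩, h3⟩
    exact ⟨⟨β, h1⟩, ⟨(isInvariant_iff 𝒮₁ 𝒮₂ ⟨β, h1⟩).1 h3,
      (isType_quotJ_iff 𝒮₁ 𝒮₂ ha ⟨β, h1⟩).1 h2⟩, rfl⟩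
  · rintro ⟨b, ⟨h1, h2⟩, rfl⟩
    exact ⟨⟨b.2, (isType_quotJ_iff 𝒮₁ 𝒮₂ ha b).2 h2⟩, (isInvariant_iff 𝒮₁ 𝒮₂ b).2 h1⟩

theorem mem_basForms {p q : ℤ} (ha : a.im ≠ 0) {β : ExtForm (prodModel E₁ E₂) (S₁ × S₂) ℂ} :
    β ∈ basForms 𝒮₁ 𝒮₂ a p q ↔ ∃ b ∈ (sasakiOps 𝒮₁ 𝒮₂).basT a p q, ↑b = β := by
  constructor
  · rintro ⟨⟨h1, h2⟩, h3⟩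
    exact ⟨⟨β, h1⟩, (SasakiOps.mem_basT _).2 ⟨(isBasic_iff 𝒮₁ 𝒮₂ ⟨β, h1⟩).1 h3,
      (isType_quotJ_iff 𝒮₁ 𝒮₂ ha ⟨β, h1⟩).1 h2⟩, rfl⟩
  · rintro ⟨b, hb, rfl⟩
    obtain ⟨h1, h2⟩ := (SasakiOps.mem_basT _).1 hb
    exact ⟨⟨b.2, (isType_quotJ_iff 𝒮₁ 𝒮₂ ha b).2 h2⟩, (isBasic_iff 𝒮₁ 𝒮₂ b).2 h1⟩

theorem mem_basEtaForms {p q : ℤ} (ha : a.im ≠ 0) {β : ExtForm (prodModel E₁ E₂) (S₁ × S₂) ℂ} :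
    β ∈ basEtaForms 𝒮₁ 𝒮₂ a p q ↔ ∃ b ∈ (sasakiOps 𝒮₁ 𝒮₂).basET a p q, ↑b = β := by
  constructor
  · rintro ⟨β₀, h0, β₁, h1, rfl⟩
    obtain ⟨b₀, hb₀, rfl⟩ := (mem_basForms 𝒮₁ 𝒮₂ ha).1 h0
    obtain ⟨b₁, hb₁, rfl⟩ := (mem_basForms 𝒮₁ 𝒮₂ ha).1 h1
    refine ⟨_, (SasakiOps.mem_basET _).2 ⟨b₀, hb₀, b₁, hb₁, rfl⟩, ?_⟩
    rw [etaZeroOne_wedge 𝒮₁ 𝒮₂ ha, Submodule.coe_add]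
  · rintro ⟨b, hb, rfl⟩
    obtain ⟨b₀, hb₀, b₁, hb₁, rfl⟩ := (SasakiOps.mem_basET _).1 hb
    refine ⟨b₀, (mem_basForms 𝒮₁ 𝒮₂ ha).2 ⟨b₀, hb₀, rfl⟩, b₁,
      (mem_basForms 𝒮₁ 𝒮₂ ha).2 ⟨b₁, hb₁, rfl⟩, ?_⟩
    rw [etaZeroOne_wedge 𝒮₁ 𝒮₂ ha, Submodule.coe_add]

end Quotient

end Types

/-! ### Complexes of subspaces and mapping cones -/

section Cones

universe u

variable {V : Type u} [AddCommGroup V] [Module ℂ V] {W : Submodule ℂ V}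

/-- The subsets `C i` of `V` with the maps `d i` come from the submodules `T i` of `W` and the
linear endomorphism `δ` of `W`, which restricts to a differential on the `T i`. -/
structure ComesFrom (T : ℤ → Submodule ℂ W) (δ : W →ₗ[ℂ] W) (C : ℤ → Set V) (d : ℤ → V → V) :
    Prop where
  mem_iff : ∀ {i x}, x ∈ C i ↔ ∃ b ∈ T i, (b : V) = x
  coe_map : ∀ {i b}, b ∈ T i → d i b = δ b
  map_mem : ∀ {i b}, b ∈ T i → δ b ∈ T (i + 1)
  map_map : ∀ {i b}, b ∈ T i → δ (δ b) = 0

namespace ComesFrom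

variable {T T₁ T₂ : ℤ → Submodule ℂ W} {δ : W →ₗ[ℂ] W} {C C₁ C₂ : ℤ → Set V}
  {d d₁ d₂ : ℤ → V → V}

theorem isComplex (H : ComesFrom T δ C d) : IsComplex C d where
  zero_mem _ := H.mem_iff.2 ⟨0, Submodule.zero_mem _, rfl⟩
  add_mem i x hx y hy := by
    obtain ⟨b, hb, rfl⟩ := H.mem_iff.1 hx
    obtain ⟨c, hc, rfl⟩ := H.mem_iff.1 hy
    exact H.mem_iff.2 ⟨b + c, Submodule.add_mem _ hb hc, rfl⟩
  smul_mem i z x hx := by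
    obtain ⟨b, hb, rfl⟩ := H.mem_iff.1 hx
    exact H.mem_iff.2 ⟨z • b, Submodule.smul_mem _ z hb, rfl⟩
  map_mem i x hx := by
    obtain ⟨b, hb, rfl⟩ := H.mem_iff.1 hx
    exact H.mem_iff.2 ⟨δ b, H.map_mem hb, (H.coe_map hb).symm⟩
  map_add i x hx y hy := by
    obtain ⟨b, hb, rfl⟩ := H.mem_iff.1 hx
    obtain ⟨c, hc, rfl⟩ := H.mem_iff.1 hy
    rw [← Submodule.coe_add, H.coe_map (Submodule.add_mem _ hb hc), H.coe_map hb, H.coe_map hc,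
      LinearMap.map_add, Submodule.coe_add]
  map_smul i z x hx := by
    obtain ⟨b, hb, rfl⟩ := H.mem_iff.1 hx
    rw [← Submodule.coe_smul, H.coe_map (Submodule.smul_mem _ z hb), H.coe_map hb,
      LinearMap.map_smul, Submodule.coe_smul]
  map_map i x hx := by
    obtain ⟨b, hb, rfl⟩ := H.mem_iff.1 hx
    rw [H.coe_map hb, H.coe_map (H.map_mem hb), H.map_map hb, Submodule.coe_zero]

theorem isComplexMap (H₁ : ComesFrom T₁ δ C₁ d₁) (H₂ : ComesFrom T₂ δ C₂ d₂) {f : V → V}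
    {g : W →ₗ[ℂ] W} (hf : ∀ b : W, f b = g b) (hg : ∀ {i b}, b ∈ T₁ i → g b ∈ T₂ i)
    (hδ : ∀ b, δ (g b) = g (δ b)) : IsComplexMap C₁ d₁ C₂ d₂ f where
  map_mem i x hx := by
    obtain ⟨b, hb, rfl⟩ := H₁.mem_iff.1 hx
    exact H₂.mem_iff.2 ⟨g b, hg hb, (hf b).symm⟩
  map_add i x hx y hy := by
    obtain ⟨b, hb, rfl⟩ := H₁.mem_iff.1 hx
    obtain ⟨c, hc, rfl⟩ := H₁.mem_iff.1 hy
    rw [← Submodule.coe_add, hf, hf, hf, LinearMap.map_add, Submodule.coe_add]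
  map_smul i z x hx := by
    obtain ⟨b, hb, rfl⟩ := H₁.mem_iff.1 hx
    rw [← Submodule.coe_smul, hf, hf, LinearMap.map_smul, Submodule.coe_smul]
  comm i x hx := by
    obtain ⟨b, hb, rfl⟩ := H₁.mem_iff.1 hx
    rw [hf, H₂.coe_map (hg hb), H₁.coe_map hb, hf, hδ]

theorem space_le (H : ComesFrom T δ C d) (h : IsComplex C d) (i : ℤ) : h.space i ≤ W := by
  intro x hx
  obtain ⟨b, -, rfl⟩ := H.mem_iff.1 hx
  exact b.2

/-- The elements of the subspace in degree `i`, as elements of `W`. -/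
def lift (H : ComesFrom T δ C d) (h : IsComplex C d) (i : ℤ) : h.space i →ₗ[ℂ] W :=
  Submodule.inclusion (H.space_le h i)

theorem coe_lift (H : ComesFrom T δ C d) (h : IsComplex C d) (i : ℤ) (x : h.space i) :
    (H.lift h i x : V) = x := rfl

theorem lift_mem (H : ComesFrom T δ C d) (h : IsComplex C d) (i : ℤ) (x : h.space i) :
    H.lift h i x ∈ T i := by
  obtain ⟨b, hb, hbx⟩ := H.mem_iff.1 x.2
  have : H.lift h i x = b := Subtype.ext hbx.symm
  rwa [this]

end ComesFrom

section Differentials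

variable {C C' : ℤ → Set V} {d d' : ℤ → V → V} {f : V → V}

theorem coe_complex_d (h : IsComplex C d) {i j : ℤ} (hij : i + 1 = j) (x : h.space i) :
    ((show h.space j from (h.complex.d i j).hom x) : V) = d i x := by
  subst hij
  simp only [IsComplex.complex, CochainComplex.of_d]
  rfl

theorem coe_coneOf_d_fst (h : IsComplex C d) (h' : IsComplex C' d') (hf : IsComplexMap C d C' d' f)
    {i j : ℤ} (hij : i + 1 = j) (x : h.space (i + 1) × h'.space i) :
    ((show h.space (j + 1) × h'.space j from ((coneOf (hf.hom h h')).d i j).hom x).1 : V) =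
      d (i + 1) x.1 := by
  subst hij
  simp only [coneOf, CochainComplex.of_d]
  exact coe_complex_d h rfl x.1

theorem coe_coneOf_d_snd (h : IsComplex C d) (h' : IsComplex C' d') (hf : IsComplexMap C d C' d' f)
    {i j : ℤ} (hij : i + 1 = j) (x : h.space (i + 1) × h'.space i) :
    ((show h.space (j + 1) × h'.space j from ((coneOf (hf.hom h h')).d i j).hom x).2 : V) =
      f x.1 - d' i x.2 := by
  subst hij
  simp only [coneOf, CochainComplex.of_d]
  exact congrArg (f x.1 - ·) (coe_complex_d h' rfl x.2)

end Differentials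

namespace ComesFrom

variable {T T₁ T₂ : ℤ → Submodule ℂ W} {δ : W →ₗ[ℂ] W} {C C₁ C₂ : ℤ → Set V}
  {d d₁ d₂ : ℤ → V → V} {f : V → V} {g : W →ₗ[ℂ] W}

/-- A map from pairs of elements to `W` which is bijective in each degree and anticommutes with the
differential of the cone identifies the shifted cone with a complex. -/
theorem nonempty_iso_shift_cone (H : ComesFrom T δ C d) (H₁ : ComesFrom T₁ δ C₁ d₁)
    (H₂ : ComesFrom T₂ δ C₂ d₂) (h : IsComplex C d) (h₁ : IsComplex C₁ d₁) (h₂ : IsComplex C₂ d₂)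
    (hf : IsComplexMap C₁ d₁ C₂ d₂ f) (hfg : ∀ b : W, f b = g b) (Ψ : W × W →ₗ[ℂ] W)
    (hΨ : ∀ {k b c}, b ∈ T₁ (k + 1) → c ∈ T₂ k → Ψ (b, c) ∈ T (k + 1))
    (hinj : ∀ {k b c}, b ∈ T₁ (k + 1) → c ∈ T₂ k → Ψ (b, c) = 0 → b = 0 ∧ c = 0)
    (hsurj : ∀ {k x}, x ∈ T (k + 1) → ∃ b ∈ T₁ (k + 1), ∃ c ∈ T₂ k, Ψ (b, c) = x)
    (hδ : ∀ {k b c}, b ∈ T₁ (k + 1) → c ∈ T₂ k → δ (Ψ (b, c)) = Ψ (-δ b, -(g b - δ c))) :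
    Nonempty (h.complex ≅ (coneOf (hf.hom h₁ h₂))⟦(-1 : ℤ)⟧) := by
  have hi (i : ℤ) : i + -1 + 1 = i := by ring
  let L (i : ℤ) : (h₁.space (i + -1 + 1) × h₂.space (i + -1)) →ₗ[ℂ] W :=
    Ψ ∘ₗ (H₁.lift h₁ (i + -1 + 1)).prodMap (H₂.lift h₂ (i + -1))
  have hL (i : ℤ) (x : h₁.space (i + -1 + 1) × h₂.space (i + -1)) : L i x ∈ T i := by
    rw [← congrArg T (hi i)]
    exact hΨ (H₁.lift_mem h₁ _ x.1) (H₂.lift_mem h₂ _ x.2)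
  let F (i : ℤ) : (h₁.space (i + -1 + 1) × h₂.space (i + -1)) →ₗ[ℂ] h.space i :=
    (W.subtype ∘ₗ L i).codRestrict (h.space i) fun x => H.mem_iff.2 ⟨L i x, hL i x, rfl⟩
  have hF (i : ℤ) (x : h₁.space (i + -1 + 1) × h₂.space (i + -1)) : (F i x : V) = L i x := rfl
  have hbij (i : ℤ) : Function.Bijective (F i) := by
    constructor
    · refine (injective_iff_map_eq_zero (F i)).2 fun x hx => ?_
      have h0 : L i x = 0 := Subtype.ext (by rw [← hF, hx]; rfl)
      obtain ⟨k1, k2⟩ := hinj (H₁.lift_mem h₁ _ x.1) (H₂.lift_mem h₂ _ x.2) h0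
      exact Prod.ext (Subtype.ext (by rw [← H₁.coe_lift h₁, k1]; rfl))
        (Subtype.ext (by rw [← H₂.coe_lift h₂, k2]; rfl))
    · intro y
      have hy := H.lift_mem h i y
      rw [← congrArg T (hi i)] at hy
      obtain ⟨b, hb, c, hc, hbc⟩ := hsurj hy
      refine ⟨(⟨b, H₁.mem_iff.2 ⟨b, hb, rfl⟩⟩, ⟨c, H₂.mem_iff.2 ⟨c, hc, rfl⟩⟩), Subtype.ext ?_⟩
      exact congrArg (fun w : W => (w : V)) hbc
  let e (i : ℤ) : ((coneOf (hf.hom h₁ h₂))⟦(-1 : ℤ)⟧).X i ≅ h.complex.X i :=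
    (LinearEquiv.ofBijective (F i) (hbij i)).toModuleIso
  refine ⟨(HomologicalComplex.Hom.isoOfComponents e ?_).symm⟩
  rintro i j hij
  have hij : i + 1 = j := hij
  have hij' : i + -1 + 1 = j + -1 := by omega
  refine ModuleCat.hom_ext (LinearMap.ext fun
    (x : h₁.space (i + -1 + 1) × h₂.space (i + -1)) => Subtype.ext ?_)
  set b := H₁.lift h₁ (i + -1 + 1) x.1 with hb
  set c := H₂.lift h₂ (i + -1) x.2 with hc
  have hbT : b ∈ T₁ (i + -1 + 1) := H₁.lift_mem h₁ _ x.1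
  have hcT : c ∈ T₂ (i + -1) := H₂.lift_mem h₂ _ x.2
  set y : h₁.space (j + -1 + 1) × h₂.space (j + -1) :=
    ((coneOf (hf.hom h₁ h₂)).d (i + -1) (j + -1)).hom x with hy
  have hy₁ : H₁.lift h₁ (j + -1 + 1) y.1 = δ b := Subtype.ext
    ((coe_coneOf_d_fst h₁ h₂ hf hij' x).trans (H₁.coe_map hbT))
  have hy₂ : H₂.lift h₂ (j + -1) y.2 = g b - δ c := Subtype.ext
    ((coe_coneOf_d_snd h₁ h₂ hf hij' x).trans
      (congrArg₂ (· - ·) (hfg b) (H₂.coe_map hcT)))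
  -- The shift by `-1` changes the sign of the differential.
  have hd : (((coneOf (hf.hom h₁ h₂))⟦(-1 : ℤ)⟧).d i j).hom x = -y := by
    rw [CochainComplex.shiftFunctor_obj_d', Int.negOnePow_neg, Int.negOnePow_one, Units.neg_smul, one_smul]
    rfl
  have hl : (h.complex.d i j).hom (F i x) = (F j (-y) : h.space j) := by
    refine Subtype.ext ((coe_complex_d h hij (F i x)).trans ?_)
    rw [hF i x, hF j (-y), H.coe_map (hL i x)]
    refine congrArg Subtype.val ((hδ hbT hcT).trans ?_)
    change _ = Ψ (H₁.lift h₁ (j + -1 + 1) (-y.1), H₂.lift h₂ (j + -1) (-y.2))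
    rw [LinearMap.map_neg, LinearMap.map_neg, hy₁, hy₂]
  refine (congrArg Subtype.val hl).trans ?_
  rw [← hd]
  rfl

theorem succ (H : ComesFrom T δ C d) :
    ComesFrom (fun i => T (i + 1)) δ (fun i => C (i + 1)) (fun i => d (i + 1)) where
  mem_iff := H.mem_iff
  coe_map := H.coe_map
  map_mem := H.map_mem
  map_map := H.map_map

/-- The invariant elements of a realization of the operators are the shifted cone of the Lefschetz
operator. -/
theorem nonempty_iso_shift_cone_lef {O : SasakiOps W} {a : ℂ} (ha : a.im ≠ 0) {p : ℤ}
    (H : ComesFrom (O.invT a p) (O.del a) C d)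
    (H₁ : ComesFrom (O.basET a (p - 1)) (O.del a) C₁ d₁)
    (H₂ : ComesFrom (fun q => O.basET a p (q + 1)) (O.del a) C₂ d₂)
    (h : IsComplex C d) (h₁ : IsComplex C₁ d₁) (h₂ : IsComplex C₂ d₂)
    (hf : IsComplexMap C₁ d₁ C₂ d₂ f) (hfO : ∀ b : W, f b = O.lef b) :
    Nonempty (h.complex ≅ (coneOf (hf.hom h₁ h₂))⟦(-1 : ℤ)⟧) := by
  have hΨ (b c : W) : (O.Φ a ∘ₗ (LinearMap.snd ℂ W W + O.θ a ∘ₗ LinearMap.fst ℂ W W)) (b, c) =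
      O.Ψ a b c := rfl
  refine H.nonempty_iso_shift_cone H₁ H₂ h h₁ h₂ hf hfO
    (O.Φ a ∘ₗ (LinearMap.snd ℂ W W + O.θ a ∘ₗ LinearMap.fst ℂ W W)) ?_ ?_ ?_ ?_ <;>
    simp only [hΨ]
  · exact fun hb hc => O.Ψ_mem ha hb hc
  · exact fun hb hc h => O.Ψ_injective ha hb hc h
  · exact fun hx => O.Ψ_surjective ha hx
  · exact fun hb hc => O.del_Ψ ha hb hc

end ComesFrom

end Cones

section DolbeaultComplexes

variable {E₁ : Type*} [NormedAddCommGroup E₁] [NormedSpace ℝ E₁] [FiniteDimensional ℝ E₁]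
  {S₁ : Type*} [TopologicalSpace S₁] [ChartedSpace E₁ S₁] [IsManifold 𝓘(ℝ, E₁) ∞ S₁]
  [CompactSpace S₁] [T2Space S₁]
  {E₂ : Type*} [NormedAddCommGroup E₂] [NormedSpace ℝ E₂] [FiniteDimensional ℝ E₂]
  {S₂ : Type*} [TopologicalSpace S₂] [ChartedSpace E₂ S₂] [IsManifold 𝓘(ℝ, E₂) ∞ S₂]
  [CompactSpace S₂] [T2Space S₂]
  (𝒮₁ : SasakianStructure E₁ S₁) (𝒮₂ : SasakianStructure E₂ S₂) {a : ℂ}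

theorem comesFrom_invForms (ha : a.im ≠ 0) (p : ℤ) :
    ComesFrom ((sasakiOps 𝒮₁ 𝒮₂).invT a p) ((sasakiOps 𝒮₁ 𝒮₂).del a)
      (fun q => invForms 𝒮₁ 𝒮₂ a p q) (fun q => dbar (quotJ 𝒮₁ 𝒮₂ a) p q) where
  mem_iff := mem_invForms 𝒮₁ 𝒮₂ ha
  coe_map := dbar_quotJ 𝒮₁ 𝒮₂ ha
  map_mem := (sasakiOps 𝒮₁ 𝒮₂).invT_del ha
  map_map hb := (sasakiOps 𝒮₁ 𝒮₂).inv_del_del ha hb.1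

theorem comesFrom_basEtaForms (ha : a.im ≠ 0) (p : ℤ) :
    ComesFrom ((sasakiOps 𝒮₁ 𝒮₂).basET a p) ((sasakiOps 𝒮₁ 𝒮₂).del a)
      (fun q => basEtaForms 𝒮₁ 𝒮₂ a p q) (fun q => dbar (quotJ 𝒮₁ 𝒮₂ a) p q) where
  mem_iff := mem_basEtaForms 𝒮₁ 𝒮₂ ha
  coe_map hb := dbar_quotJ 𝒮₁ 𝒮₂ ha ((sasakiOps 𝒮₁ 𝒮₂).basET_le_invT ha _ _ hb)
  map_mem := (sasakiOps 𝒮₁ 𝒮₂).basET_del ha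
  map_map hb := (sasakiOps 𝒮₁ 𝒮₂).inv_del_del ha
    ((sasakiOps 𝒮₁ 𝒮₂).basET_le_invT ha _ _ hb).1

end DolbeaultComplexes

end SasakiProduct

end

theorem mainTheorem5
    {n₁ n₂ : ℕ}
    {S₁ : Type*} [TopologicalSpace S₁] [ChartedSpace (EuclideanSpace ℝ (Fin (2 * n₁ + 1))) S₁]
    [IsManifold 𝓘(ℝ, EuclideanSpace ℝ (Fin (2 * n₁ + 1))) ∞ S₁] [CompactSpace S₁] [T2Space S₁]
    {S₂ : Type*} [TopologicalSpace S₂] [ChartedSpace (EuclideanSpace ℝ (Fin (2 * n₂ + 1))) S₂]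
    [IsManifold 𝓘(ℝ, EuclideanSpace ℝ (Fin (2 * n₂ + 1))) ∞ S₂] [CompactSpace S₂] [T2Space S₂]
    (𝒮₁ : SasakianStructure (EuclideanSpace ℝ (Fin (2 * n₁ + 1))) S₁)
    (𝒮₂ : SasakianStructure (EuclideanSpace ℝ (Fin (2 * n₂ + 1))) S₂)
    (a : ℂ) (ha : a.im ≠ 0) (p : ℕ) :
    ∃ (hInv : IsComplex (fun q => invForms 𝒮₁ 𝒮₂ a p q)
          (fun q => dbar (quotJ 𝒮₁ 𝒮₂ a) p q))
      (hSrc : IsComplex (fun q => basEtaForms 𝒮₁ 𝒮₂ a (p - 1) q)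
          (fun q => dbar (quotJ 𝒮₁ 𝒮₂ a) (p - 1) q))
      (hTgt : IsComplex (fun q => basEtaForms 𝒮₁ 𝒮₂ a p (q + 1))
          (fun q => dbar (quotJ 𝒮₁ 𝒮₂ a) p (q + 1)))
      (hL : IsComplexMap (fun q => basEtaForms 𝒮₁ 𝒮₂ a (p - 1) q)
          (fun q => dbar (quotJ 𝒮₁ 𝒮₂ a) (p - 1) q)
          (fun q => basEtaForms 𝒮₁ 𝒮₂ a p (q + 1))
          (fun q => dbar (quotJ 𝒮₁ 𝒮₂ a) p (q + 1))
          (lefschetz 𝒮₁ 𝒮₂)),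
      Nonempty (hInv.complex ≅ (coneOf (hL.hom hSrc hTgt))⟦(-1 : ℤ)⟧) := by
  have H := comesFrom_invForms 𝒮₁ 𝒮₂ ha p
  have H₁ := comesFrom_basEtaForms 𝒮₁ 𝒮₂ ha (p - 1)
  have H₂ := (comesFrom_basEtaForms 𝒮₁ 𝒮₂ ha p).succ
  have hL := H₁.isComplexMap H₂ (lefschetz_coe 𝒮₁ 𝒮₂) (sasakiOps 𝒮₁ 𝒮₂).basET_lef
    (sasakiOps 𝒮₁ 𝒮₂).lef_del
  refine ⟨H.isComplex, H₁.isComplex, H₂.isComplex, hL, ?_⟩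
  exact H.nonempty_iso_shift_cone_lef ha H₁ H₂ _ _ _ hL (lefschetz_coe 𝒮₁ 𝒮₂)
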